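/- Let $q\ge 2$ and $d\ge 1$ be integers and let $\mathcal T$ be a complete, deterministic, subsequential transducer with finite state set, input alphabet $\{0,\dots,q-1\}^d$ and output alphabet $\mathbb R$: it has one initial state, for every state and every input letter exactly one transition, which carries a real output label, and every state has a real final output label. Assume that all states are accessible from the initial state. For $\boldsymbol n\in\mathbb N_0^d$ let $\mathcal T(\boldsymbol n)$ be the sum of the outputs of the transitions (together with the final output of the last state) when $\mathcal T$ reads the standard $q$-ary joint expansion of $\boldsymbol n$ from the least significant digit, without leading zeros. For $N\ge1$ let $\boldsymbol n$ be uniformly distributed on $\{0,\dots,N-1\}^d$; $\mathbb P$, $\mathbb E$, $\mathbb V$ refer to this distribution, and asymptotic statements are for $N\to\infty$, with implied constants that may depend on $\mathcal T$. Let $C_1,\dots,C_c$ be the final components, i.e. the strongly connected components of the underlying digraph which no transition leaves, let $p_j$ be the period of $C_j$ (the greatest common divisor of the lengths of its directed cycles) and let $p=\operatorname{lcm}(p_1,\dots,p_c)$. For $t\in\mathbb R$ let $M(t)$ be the matrix, indexed by the states, whose entry at $(s_1,s_2)$ is the sum of $e^{it\delta}$ over all transitions from $s_1$ to $s_2$,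 where $\delta$ is the output label of the transition. For each $j$, let $\mu_j(t)$ be the twice continuously differentiable function near $t=0$ such that $\mu_j(t)$ is an eigenvalue of the submatrix of $M(t)$ with rows and columns in $C_j$ and $\mu_j(0)=q^d$ (it exists and its germ at $0$ is unique). Let $\boldsymbol w_0^\top$ be the image of the indicator row vector of the initial state under the projection onto the left eigenspace of $M(0)$ for the eigenvalue $q^d$ whose kernel is the sum of the generalized left eigenspaces of $M(0)$ for all other eigenvalues. Put $$\lambda_j=\sum_{s\in C_j}(\boldsymbol w_0)_s,\quad a_j=-iq^{-d}\mu_j'(0),\quad b_j=\frac{\mu_j'(0)^2-q^d\mu_j''(0)}{q^{2d}},\quad e_{\mathcal T}=\sum_{j=1}^c\lambda_ja_j,\quad v_{\mathcal T}=\sum_{j=1}^c\lambda_jb_j .$$ Let $\xi\in(0,1]$ be any number such that all eigenvalues of $M(0)$ that are not of maximal modulus have modulus strictly less than $q^{d-\xi}$; such numbers exist. Let $\Phi_{m,\sigma^2}$ be the distribution function of the normal distribution with mean $m$ and variance $\sigma^2>0$. Then $a_j,b_j,\lambda_j$ are real, $b_j\ge0$, $\lambda_j>0$, $\sum_{j=1}^c\lambda_j=1$,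 and the following hold, where $\Psi_1$ and $\Psi_2$ do not depend on $\xi$. (1) There is a $p$-periodic function $\Psi_1:\mathbb R\to\mathbb R$, Hölder continuous of every order $\alpha\in(0,1)$, with $$\mathbb E(\mathcal T(\boldsymbol n))=e_{\mathcal T}\log_qN+\Psi_1(\log_qN)+\mathcal O(N^{-\xi}\log N).$$ (2) If all $b_j$ are positive, then, uniformly in $x\in\mathbb R$ (for $N\ge 2$), $$\mathbb P\Bigl(\frac{\mathcal T(\boldsymbol n)}{\sqrt{\log_qN}}\le x\Bigr)=\sum_{j=1}^c\lambda_j\Phi_{a_j\sqrt{\log_qN},\,b_j}(x)+\mathcal O(\log^{-1/2}N);$$ that is, the distribution function of $\mathcal T(\boldsymbol n)$ is approximated by the mixture of $c$ normal distributions with weights $\lambda_j$, means $a_j\log_qN$ and variances $b_j\log_qN$. (3) If all $a_j$ are equal, then there is a $p$-periodic continuous function $\Psi_2:\mathbb R\to\mathbb R$ with $$\mathbb V(\mathcal T(\boldsymbol n))=v_{\mathcal T}\log_qN-\Psi_1^2(\log_qN)+\Psi_2(\log_qN)+\mathcal O(N^{-\xi}\log^2N).$$ Otherwise $\mathbb V(\mathcal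 T(\boldsymbol n))=\Theta(\log^2N)$. (4) If all $a_j$ are equal, then $(\mathcal T(\boldsymbol n)-\mathbb E(\mathcal T(\boldsymbol n)))/\sqrt{\log_qN}$ converges in distribution to the mixture, with weights $\lambda_j$, of the normal (degenerate if $b_j=0$) distributions with mean $0$ and variance $b_j$. If moreover all $b_j>0$, then, uniformly in $x\in\mathbb R$ (for $N\ge2$), $$\mathbb P\Bigl(\frac{\mathcal T(\boldsymbol n)-\mathbb E(\mathcal T(\boldsymbol n))}{\sqrt{\log_qN}}\le x\Bigr)=\sum_{j=1}^c\lambda_j\Phi_{0,b_j}(x)+\mathcal O(\log^{-1/2}N).$$ (5) If $c=1$ and $v_{\mathcal T}\ne0$, then $\mathcal T(\boldsymbol n)$ is asymptotically normally distributed: $(\mathcal T(\boldsymbol n)-\mathbb E(\mathcal T(\boldsymbol n)))/\sqrt{\mathbb V(\mathcal T(\boldsymbol n))}$ converges in distribution to the standard normal distribution. -/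

import Mathlib

open MeasureTheory ProbabilityTheory Filter Topology

noncomputable section

/-- A complete, deterministic, subsequential transducer with state set `S`, input alphabet
`{0, …, q-1}^d` and output alphabet `ℝ`: an initial state, for every state and every letter exactly
one transition (its target and its output label), and a final output label for every state. -/
structure Transducer (q d : ℕ) (S : Type*) where
  init : S
  next : S → (Fin d → Fin q) → S
  out : S → (Fin d → Fin q) → ℝ
  final : S → ℝ

/-- The standard `q`-ary joint digit representation of `n ∈ ℕ^d`, least significant digit first and
without leading zeros (so its length is the largest length of the expansions of the coordinates, and
`n = 0` has the empty representation). -/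
def jointDigits (q : ℕ) {d : ℕ} [NeZero q] (n : Fin d → ℕ) : List (Fin d → Fin q) :=
  (List.range (Finset.univ.sup fun i => (Nat.digits q (n i)).length)).map
    fun k i => Fin.ofNat q (n i / q ^ k)

/-- The equidistribution on `{0, …, N-1}^d`. -/
def unifBox (d N : ℕ) : Measure (Fin d → ℕ) :=
  uniformOn {n | ∀ i, n i < N}

/-- Convergence in distribution, as `N → ∞`, of random variables `X N` on `{0, …, N-1}^d` to the
law `ν`, in the sense of bounded continuous test functions. -/
def ConvergesInDistribution {d : ℕ} (X : ℕ → (Fin d → ℕ) → ℝ) (ν : Measure ℝ) : Prop :=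
  ∀ f : BoundedContinuousFunction ℝ ℝ,
    Tendsto (fun N => ∫ n, f (X N n) ∂(unifBox d N)) atTop (𝓝 (∫ y, f y ∂ν))

/-- The distribution function of the normal distribution with mean `m` and variance `v`. -/
def normalCDF (m v x : ℝ) : ℝ := cdf (gaussianReal m v.toNNReal) x

namespace Transducer

variable {q d : ℕ} {S : Type*} (T : Transducer q d S)

/-- The state reached from `s` by reading the word `w`. -/
def run (s : S) (w : List (Fin d → Fin q)) : S := w.foldl T.next s

/-- The sum of the outputs of the transitions along the path that starts in `s` and reads `w`,
including the final output of the last state. -/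
def outputSum : S → List (Fin d → Fin q) → ℝ
  | s, [] => T.final s
  | s, ε :: w => T.out s ε + outputSum (T.next s ε) w

/-- The value `T(n)`: the output sum on reading the joint expansion of `n`. -/
def value [NeZero q] (n : Fin d → ℕ) : ℝ := T.outputSum T.init (jointDigits q n)

/-- There is a directed path from `s` to `s'`. -/
def Reach (s s' : S) : Prop := ∃ w, T.run s w = s'

/-- All states are accessible from the initial state. -/
def Accessible : Prop := ∀ s, T.Reach T.init s

/-- `C` is a strongly connected component which no transition leaves. -/
def IsFinalComponent (C : Finset S) : Prop :=
  (∃ s, ∀ s', s' ∈ C ↔ T.Reach s s' ∧ T.Reach s' s) ∧ ∀ s ∈ C, ∀ ε, T.next s ε ∈ C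

open Classical in
/-- The finite set of the final strongly connected components. -/
def finalComponents [Fintype S] : Finset (Finset S) :=
  Finset.univ.filter T.IsFinalComponent

/-- The lengths of the directed closed walks through states of `C`. -/
def cycleLengths (C : Finset S) : Set ℕ :=
  {n | ∃ s ∈ C, ∃ w, w ≠ [] ∧ T.run s w = s ∧ w.length = n}

/-- The period of `C`, the greatest common divisor of its cycle lengths (a closed walk is composed
of simple cycles, so both have the same common divisors). -/
def period (C : Finset S) : ℕ := sSup {g | ∀ n ∈ T.cycleLengths C, g ∣ n}

/-- The final period, the least common multiple of the periods of the final components. -/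
def finalPeriod [Fintype S] : ℕ := T.finalComponents.lcm T.period

section TransitionMatrix

variable [DecidableEq S]

/-- The transition matrix of the letter `ε`. -/
def letterMatrix (ε : Fin d → Fin q) (t : ℝ) : Matrix S S ℂ :=
  Matrix.of fun s₁ s₂ =>
    if T.next s₁ ε = s₂ then Complex.exp (Complex.I * t * T.out s₁ ε) else 0

/-- The transition matrix, the sum of the transition matrices of all letters. -/
def transMatrix (t : ℝ) : Matrix S S ℂ := ∑ ε, T.letterMatrix ε t

/-- `μ` is, near `t = 0`, the eigenvalue of the part of the transition matrix that belongs to the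
component `C` with `μ(0) = q^d`. For a final component `q^d` is a simple eigenvalue at `t = 0`, so
that the germ of `μ` at `0` is unique. -/
def IsEigenvalueBranch (C : Finset S) (μ : ℝ → ℂ) : Prop :=
  ContDiffAt ℝ 2 μ 0 ∧ μ 0 = (q : ℂ) ^ d ∧
    ∀ᶠ t in 𝓝 (0 : ℝ), μ t ∈ spectrum ℂ ((T.transMatrix t).submatrix
      (Subtype.val : {s // s ∈ C} → S) (Subtype.val : {s // s ∈ C} → S))

variable [Fintype S]

/-- `w` is the image of the indicator (row) vector of the initial state under the projection onto
the left eigenspace of the transition matrix at `t = 0` for the eigenvalue `q^d` whose kernel is the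
sum of the generalized left eigenspaces for all other eigenvalues. -/
def IsInitProjection (w : S → ℂ) : Prop :=
  w ∈ Module.End.eigenspace (T.transMatrix 0).vecMulLinear ((q : ℂ) ^ d) ∧
    Pi.single T.init 1 - w ∈
      ⨆ z ∈ {z : ℂ | z ≠ (q : ℂ) ^ d},
        Module.End.maxGenEigenspace (T.transMatrix 0).vecMulLinear z

/-- `ξ ∈ (0, 1]`, and all eigenvalues of the transition matrix at `t = 0` which are not of maximal
modulus have modulus less than `q^(d-ξ)`. -/
def IsErrorExponent (ξ : ℝ) : Prop :=
  0 < ξ ∧ ξ ≤ 1 ∧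
    ∀ z ∈ spectrum ℂ (T.transMatrix 0), (∃ z' ∈ spectrum ℂ (T.transMatrix 0), ‖z‖ < ‖z'‖) →
      ‖z‖ < (q : ℝ) ^ ((d : ℝ) - ξ)

end TransitionMatrix

section Moments

variable [NeZero q]

/-- The expected value of `T(n)` for `n` equidistributed in `{0, …, N-1}^d`. -/
def mean (N : ℕ) : ℝ := ∫ n, T.value n ∂(unifBox d N)

/-- The variance of `T(n)` for `n` equidistributed in `{0, …, N-1}^d`. -/
def var (N : ℕ) : ℝ := variance T.value (unifBox d N)

end Moments

end Transducer

/-- The mixture of the normal (or, for variance `0`, degenerate) distributions with means `0` and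
variances `b j`, weighted by `lam j`, for `j ∈ J`. -/
def centredMixture {ι : Type*} (J : Finset ι) (lam b : ι → ℝ) : Measure ℝ :=
  ∑ j ∈ J, ENNReal.ofReal (lam j) • gaussianReal 0 (b j).toNNReal

end

set_option linter.unusedSectionVars false

noncomputable section

/-! ### Finite random walks driven by uniform letters: maximum principle, Poisson equation,
eigenvalues of modulus one -/

section Chain

open scoped BigOperators

variable {σ A : Type*}

/-! Feeding independent uniform letters to the transducer turns its states into a finite Markov
chain whose averaging operator `P` (`stepAvg`) is `q^(-d) M(0)`. Everything rests on the Poisson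
equation `exists_harmonic_add_coboundary`: as `P` is a contraction in the maximum norm, every
function of the state is a harmonic function plus some `H - P H`. Harmonic functions are
combinations of the absorption probabilities of the final components, whose values at the initial
state are the weights `λ_j`. Applied to the mean output, the equation gives the drifts `a_j` and a
corrector `H` such that the corrected output `centredOut` has mean zero in every state; applied to
the mean square of `centredOut`, it gives the variances `b_j` and a corrector `H₂`. That these
constants are the ones defined by the eigenvalues `μ_j` follows from the implicit function theorem
for a normalized eigenvector, after differentiating the eigenvalue equation twice at `t = 0`.

Mean and variance. Splitting off the least significant digit shows that the centred moments `V(N)`,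
summed over the box of side `N`, satisfy `V(qN) = q^d A V(N)` up to a small error, while `V(N+1) -
V(N)` is `O(N^(d-1) log^β N)`. Here `A` is `P` for the first moment and a block triangular operator
`pairOp` for the first and second moments together. The eigenvalues of modulus one of `A` are `p`-th
roots of unity and are semisimple. On their spectral part `V` is nearly homogeneous under `N ↦ q^p
N`, hence close to an exactly homogeneous function, that is, to `N^d` times a `p`-periodic function
of `log_q N`; on the complementary part `A` contracts, which leaves `O(N^(d-ξ) log^β N)`. This is
`exists_periodic_fluctuation`.

Distribution. Within a final component, `1 - t² H₂ / 2` is an eigenfunction of the averaging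
operator twisted by `exp(i t D)`, with eigenvalue `exp(-b t² / 2)`, up to `O(|t|³)`. Telescoping
compares the characteristic function of the sum along `k` random letters with the normal one. If `b
≠ 0`, there are two paths with the same ends and length but different sums; their interference
yields a decay `exp(-c k t²)`, and Esseen's smoothing inequality, proved here with the Fejér kernel,
gives the Berry–Esseen bound. The passage from random words to uniform arguments is
`exists_transfer_box`: the box is cut into pieces on which the lowest `k` digits are free. The error
on a piece may grow linearly in the number of the other digits, because pieces with few free digits
fill a geometrically small part of the box. The steps before absorption are paid for by the Lyapunov
function of `exists_drift`, in `exists_transfer`.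

If the drifts differ, then at a suitable frequency of order `1 / log N` the characteristic function
tends to a convex combination of points of the unit circle two of which are opposite. Its modulus is
less than `1`, which forces a variance of order `log² N` (`isTheta_var`). -/

theorem foldl_mem_of_closed {nx : σ → A → σ} {K : Set σ} (hK : ∀ s ∈ K, ∀ a, nx s a ∈ K)
    (w : List A) {s : σ} (hs : s ∈ K) : w.foldl nx s ∈ K := by
  induction w generalizing s with
  | nil => exact hs
  | cons a w ih => exact ih (hK s hs a)

theorem eigenfunction_foldl {nx : σ → A → σ} {K : Set σ}
    (hK : ∀ s ∈ K, ∀ a, nx s a ∈ K) {x : σ → ℂ} {z : ℂ}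
    (hx : ∀ s ∈ K, ∀ a, x (nx s a) = z * x s) (w : List A) {s : σ} (hs : s ∈ K) :
    x (w.foldl nx s) = z ^ w.length * x s := by
  induction w generalizing s with
  | nil => simp
  | cons a w ih =>
    rw [List.foldl_cons, ih (hK s hs a), hx s hs, List.length_cons, pow_succ]; ring

variable [Fintype A]

/-- The averaging operator of the random walk which in the state `s` chooses a letter `a` uniformly
at random and moves to `nx s a`. -/
def stepAvg (𝕜 : Type*) [RCLike 𝕜] (nx : σ → A → σ) : (σ → 𝕜) →ₗ[𝕜] (σ → 𝕜) where
  toFun f s := 𝔼 a, f (nx s a)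
  map_add' f g := by
    ext s; simp [Finset.expect_add_distrib]
  map_smul' c f := by
    ext s; simp [Finset.mul_expect]

theorem stepAvg_apply (𝕜 : Type*) [RCLike 𝕜] (nx : σ → A → σ) (f : σ → 𝕜) (s : σ) :
    stepAvg 𝕜 nx f s = 𝔼 a, f (nx s a) := rfl

/-- The maximum principle for subharmonic functions on a closed set of states. -/
theorem le_of_subharmonicOn [Finite σ] {nx : σ → A → σ} {K : Set σ}
    (hK : ∀ s ∈ K, ∀ a, nx s a ∈ K) {y : σ → ℝ} (hy : ∀ s ∈ K, y s ≤ 𝔼 a, y (nx s a))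
    {F : Set σ} {c : ℝ} (hc : ∀ s ∈ F, y s ≤ c)
    (hr : ∀ s ∈ K, ∃ w : List A, w.foldl nx s ∈ F) : ∀ s ∈ K, y s ≤ c := by
  intro s hs
  obtain ⟨s₀, hs₀, hmax⟩ := Set.exists_max_image K y K.toFinite ⟨s, hs⟩
  -- At a maximum the mean over the successors can reach the maximum only if every successor attains
  -- it, so the maximum spreads along all paths.
  have step : ∀ s ∈ K, y s = y s₀ → ∀ a, y (nx s a) = y s₀ := by
    intro s hs h a
    by_contra hne
    have hlt : y (nx s a) < y s₀ := lt_of_le_of_ne (hmax _ (hK s hs a)) hne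
    have := Finset.expect_lt (s := Finset.univ) (f := fun a => y (nx s a)) (a := y s₀)
      (fun b _ => hmax _ (hK s hs b)) ⟨a, Finset.mem_univ _, hlt⟩
    linarith [hy s hs]
  have path : ∀ (w : List A) (s : σ), s ∈ K → y s = y s₀ → y (w.foldl nx s) = y s₀ := by
    intro w
    induction w with
    | nil => intro s _ h; exact h
    | cons a w ih => intro s hs h; exact ih _ (hK s hs a) (step s hs h a)
  obtain ⟨w, hw⟩ := hr s₀ hs₀
  exact (hmax s hs).trans ((path w s₀ hs₀ rfl).symm.le.trans (hc _ hw))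

/-- A harmonic function is constant on a closed set of states on which the walk is irreducible. -/
theorem eq_of_harmonicOn [Finite σ] {nx : σ → A → σ} {K : Set σ}
    (hK : ∀ s ∈ K, ∀ a, nx s a ∈ K) {y : σ → ℝ} (hy : ∀ s ∈ K, y s = 𝔼 a, y (nx s a))
    (hr : ∀ s ∈ K, ∀ s' ∈ K, ∃ w : List A, w.foldl nx s = s') {s s' : σ} (hs : s ∈ K)
    (hs' : s' ∈ K) : y s = y s' := by
  have key : ∀ s ∈ K, ∀ s' ∈ K, y s ≤ y s' := fun s hs s' hs' =>
    le_of_subharmonicOn hK (fun s hs => (hy s hs).le) (F := {s'}) (by simp)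
      (fun s hs => by simpa using hr s hs s' hs') s hs
  exact le_antisymm (key s hs s' hs') (key s' hs' s hs)

variable [Nonempty A]

/-- If `H - P H` is constant on a nonempty closed set of states, then the constant is `0`. -/
theorem eq_zero_of_const_eq_sub [Finite σ] {nx : σ → A → σ} {K : Set σ} (hne : K.Nonempty)
    (hK : ∀ s ∈ K, ∀ a, nx s a ∈ K) {H : σ → ℝ} {c : ℝ}
    (h : ∀ s ∈ K, c = H s - 𝔼 a, H (nx s a)) : c = 0 := by
  obtain ⟨s₁, hs₁, hmax⟩ := Set.exists_max_image K H K.toFinite hne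
  obtain ⟨s₂, hs₂, hmin⟩ := Set.exists_min_image K H K.toFinite hne
  have h1 := Finset.expect_le (s := Finset.univ) Finset.univ_nonempty
    (f := fun a => H (nx s₁ a)) (a := H s₁) (fun a _ => hmax _ (hK s₁ hs₁ a))
  have h2 := Finset.le_expect (s := Finset.univ) Finset.univ_nonempty
    (f := fun a => H (nx s₂ a)) (a := H s₂) (fun a _ => hmin _ (hK s₂ hs₂ a))
  have h3 := h s₁ hs₁
  have h4 := h s₂ hs₂
  linarith

theorem norm_stepAvg_le {𝕜 : Type*} [RCLike 𝕜] [Fintype σ] (nx : σ → A → σ) (f : σ → 𝕜) :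
    ‖stepAvg 𝕜 nx f‖ ≤ ‖f‖ := by
  refine (pi_norm_le_iff_of_nonneg (norm_nonneg _)).2 fun s => ?_
  refine (RCLike.norm_expect_le (K := 𝕜)).trans ?_
  exact Finset.expect_le Finset.univ_nonempty fun a _ => norm_le_pi_norm f _

/-- Bounded powers exclude Jordan blocks at eigenvalues of modulus one; this is the source of the
semisimplicity statements below. -/
theorem norm_stepAvg_pow_le {𝕜 : Type*} [RCLike 𝕜] [Fintype σ] (nx : σ → A → σ) (k : ℕ)
    (f : σ → 𝕜) : ‖(stepAvg 𝕜 nx ^ k) f‖ ≤ ‖f‖ := by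
  induction k with
  | zero => simp
  | succ k ih => rw [pow_succ', Module.End.mul_apply]; exact (norm_stepAvg_le nx _).trans ih

/-- A linear map with bounded orbit of `x` cannot have a Jordan block of size two at `1` there. -/
theorem eq_of_orbit_bounded {𝕜 E : Type*} [RCLike 𝕜] [NormedAddCommGroup E] [NormedSpace 𝕜 E]
    (B : E →ₗ[𝕜] E) (x : E) (M : ℝ) (hM : ∀ k : ℕ, ‖(B ^ k) x‖ ≤ M)
    (h : B (B x - x) = B x - x) : B x = x := by
  -- A Jordan block would make the orbit grow linearly in `k`.
  have hk : ∀ k : ℕ, (B ^ k) x = x + k • (B x - x) := by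
    intro k
    induction k with
    | zero => simp
    | succ k ih =>
      rw [pow_succ', Module.End.mul_apply, ih, map_add, map_nsmul, h, succ_nsmul]
      abel
  have hb : ∀ k : ℕ, k * ‖B x - x‖ ≤ M + ‖x‖ := by
    intro k
    have h1 : k • (B x - x) = (B ^ k) x - x := by rw [hk]; abel
    calc k * ‖B x - x‖ = ‖k • (B x - x)‖ := by
          rw [← Nat.cast_smul_eq_nsmul 𝕜, norm_smul]; simp
      _ ≤ ‖(B ^ k) x‖ + ‖x‖ := by rw [h1]; exact norm_sub_le _ _
      _ ≤ M + ‖x‖ := by gcongr; exact hM k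
  by_contra hne
  have hpos : 0 < ‖B x - x‖ := norm_pos_iff.2 (sub_ne_zero.2 hne)
  obtain ⟨k, hk⟩ := exists_nat_gt ((M + ‖x‖) / ‖B x - x‖)
  rw [div_lt_iff₀ hpos] at hk
  linarith [hb k]

/-- Semisimplicity says that kernel and range meet only in zero; their dimensions add up by
rank-nullity. -/
theorem isCompl_ker_range_of_semisimple {𝕜 E : Type*} [Field 𝕜] [AddCommGroup E] [Module 𝕜 E]
    [FiniteDimensional 𝕜 E] (B : E →ₗ[𝕜] E) (h : ∀ x, B (B x) = 0 → B x = 0) :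
    IsCompl (LinearMap.ker B) (LinearMap.range B) := by
  refine (Submodule.isCompl_iff_disjoint _ _ ?_).2 ?_
  · rw [add_comm, LinearMap.finrank_range_add_finrank_ker]
  · rw [Submodule.disjoint_def]
    rintro _ hx ⟨y, rfl⟩
    exact h y hx

/-- The Poisson equation: every function is the sum of a harmonic function and a coboundary. -/
theorem exists_harmonic_add_coboundary [Fintype σ] (nx : σ → A → σ) (f : σ → ℝ) :
    ∃ u H : σ → ℝ, (∀ s, 𝔼 a, u (nx s a) = u s) ∧ ∀ s, f s = u s + H s - 𝔼 a, H (nx s a) := by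
  have hc := isCompl_ker_range_of_semisimple (stepAvg ℝ nx - 1) fun x hx => by
    simp only [LinearMap.sub_apply, Module.End.one_apply] at hx ⊢
    rw [sub_eq_zero] at hx ⊢
    exact eq_of_orbit_bounded _ x ‖x‖ (fun k => norm_stepAvg_pow_le nx k x) hx
  have hf : f ∈ LinearMap.ker (stepAvg ℝ nx - 1) ⊔ LinearMap.range (stepAvg ℝ nx - 1) := by
    rw [hc.sup_eq_top]; trivial
  obtain ⟨u, hu, _, ⟨H, rfl⟩, rfl⟩ := Submodule.mem_sup.1 hf
  refine ⟨u, -H, fun s => ?_, fun s => ?_⟩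
  · have := congrFun (LinearMap.mem_ker.1 hu) s
    simpa [stepAvg_apply, sub_eq_zero] using this
  · simp [stepAvg_apply, Finset.expect_neg_distrib]
    ring

theorem expect_norm_sub_expect_sq (f : A → ℂ) :
    𝔼 a, ‖f a - 𝔼 a, f a‖ ^ 2 = (𝔼 a, ‖f a‖ ^ 2) - ‖𝔼 a, f a‖ ^ 2 := by
  set c := 𝔼 a, f a with hc
  have h1 : ∀ a, ‖f a - c‖ ^ 2 = ‖f a‖ ^ 2 - 2 * (f a * (starRingEnd ℂ) c).re + ‖c‖ ^ 2 := by
    intro a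
    rw [Complex.sq_norm, Complex.sq_norm, Complex.sq_norm, Complex.normSq_sub]
    ring
  simp_rw [h1]
  rw [Finset.expect_add_distrib, Finset.expect_sub_distrib, ← Finset.mul_expect,
    Finset.expect_const Finset.univ_nonempty]
  have h2 : 𝔼 a, (f a * (starRingEnd ℂ) c).re = ‖c‖ ^ 2 := by
    have : (𝔼 a, f a * (starRingEnd ℂ) c).re = 𝔼 a, (f a * (starRingEnd ℂ) c).re := by
      rw [Fintype.expect_eq_sum_div_card, Fintype.expect_eq_sum_div_card, ← Complex.ofReal_natCast,
        Complex.div_ofReal_re, Complex.re_sum]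
    rw [← this, ← Finset.expect_mul, ← hc, Complex.mul_conj, Complex.ofReal_re,
      Complex.normSq_eq_norm_sq]
  rw [h2]; ring

theorem sq_norm_expect_le (f : A → ℂ) : ‖𝔼 a, f a‖ ^ 2 ≤ 𝔼 a, ‖f a‖ ^ 2 := by
  have h := expect_norm_sub_expect_sq f
  have : 0 ≤ 𝔼 a, ‖f a - 𝔼 a, f a‖ ^ 2 := Finset.expect_nonneg fun a _ => by positivity
  linarith

/-- If the mean square of finitely many complex numbers is at most the square of their mean, all of
them are equal. -/
theorem eq_expect_of_sq_le {f : A → ℂ} (h : 𝔼 a, ‖f a‖ ^ 2 ≤ ‖𝔼 a, f a‖ ^ 2) (a : A) :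
    f a = 𝔼 a, f a := by
  have h0 : 𝔼 a, ‖f a - 𝔼 a, f a‖ ^ 2 = 0 :=
    le_antisymm (by linarith [expect_norm_sub_expect_sq f])
      (Finset.expect_nonneg fun a _ => by positivity)
  have := (Finset.expect_eq_zero_iff_of_nonneg fun a _ => by positivity).1 h0 a (Finset.mem_univ a)
  simpa [sub_eq_zero] using this

/-- A function that is invariant under a power of the averaging operator is constant on the
successors of each state in a closed irreducible set. -/
theorem invariant_step [Finite σ] {nx : σ → A → σ} {K : Set σ}
    (hK : ∀ s ∈ K, ∀ a, nx s a ∈ K) (hr : ∀ s ∈ K, ∀ s' ∈ K, ∃ w : List A, w.foldl nx s = s')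
    {x : σ → ℂ} {p : ℕ} (hp : 0 < p) (hx : (stepAvg ℂ nx ^ p) x = x) :
    ∀ s ∈ K, ∀ a, x (nx s a) = stepAvg ℂ nx x s := by
  set g : ℕ → σ → ℂ := fun i => (stepAvg ℂ nx ^ i) x with hg
  have hgs : ∀ i s, g (i + 1) s = 𝔼 a, g i (nx s a) := fun i s => by
    simp only [hg, pow_succ', Module.End.mul_apply, stepAvg_apply]
  -- Summing over a full period makes `Y` subharmonic: since `g p = g 0`, the shift `i ↦ i + 1` only
  -- permutes the terms, and Jensen's inequality applies to each of them. Hence `Y` is constant on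
  -- `K`, all the Jensen inequalities are equalities, and the term `i = 0` says that `x` takes a
  -- single value on the successors of `s`.
  set Y : σ → ℝ := fun s => ∑ i ∈ Finset.range p, ‖g i s‖ ^ 2 with hY
  have hY' : ∀ s, Y s = ∑ i ∈ Finset.range p, ‖g (i + 1) s‖ ^ 2 := fun s => by
    have h1 := Finset.sum_range_succ (fun i => ‖g i s‖ ^ 2) p
    have h2 := Finset.sum_range_succ' (fun i => ‖g i s‖ ^ 2) p
    have h3 : g p s = g 0 s := by simp only [hg, hx, pow_zero, Module.End.one_apply]
    rw [h3] at h1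
    simp only [hY]
    linarith
  have hterm : ∀ s i, ‖g (i + 1) s‖ ^ 2 ≤ 𝔼 a, ‖g i (nx s a)‖ ^ 2 := fun s i => by
    rw [hgs]; exact sq_norm_expect_le _
  have hsum : ∀ s, 𝔼 a, Y (nx s a) = ∑ i ∈ Finset.range p, 𝔼 a, ‖g i (nx s a)‖ ^ 2 := fun s =>
    Finset.expect_sum_comm _ _ _
  have hsub : ∀ s ∈ K, Y s ≤ 𝔼 a, Y (nx s a) := fun s _ => by
    rw [hY', hsum]
    exact Finset.sum_le_sum fun i _ => hterm s i
  have hle : ∀ s ∈ K, ∀ s' ∈ K, Y s ≤ Y s' := fun s hs s' hs' =>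
    le_of_subharmonicOn hK hsub (F := {s'}) (by simp)
      (fun s hs => by simpa using hr s hs s' hs') s hs
  intro s hs a
  have heq : 𝔼 a, Y (nx s a) ≤ Y s :=
    Finset.expect_le Finset.univ_nonempty fun a _ => hle _ (hK s hs a) _ hs
  rw [hY', hsum] at heq
  have h0 : 𝔼 a, ‖g 0 (nx s a)‖ ^ 2 ≤ ‖g 1 s‖ ^ 2 := by
    by_contra! hlt
    exact absurd heq (not_le.2 (Finset.sum_lt_sum (fun i _ => hterm s i)
      ⟨0, Finset.mem_range.2 hp, by simpa using hlt⟩))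
  have h1 : g 1 s = 𝔼 a, g 0 (nx s a) := hgs 0 s
  rw [h1] at h0
  have := eq_expect_of_sq_le h0 a
  simpa [hg, stepAvg_apply] using this

/-- An eigenfunction of the averaging operator for an eigenvalue of modulus `1` is multiplied by
the eigenvalue in each step, on each closed irreducible set of states. -/
theorem eigenfunction_step [Finite σ] {nx : σ → A → σ} {K : Set σ}
    (hK : ∀ s ∈ K, ∀ a, nx s a ∈ K) (hr : ∀ s ∈ K, ∀ s' ∈ K, ∃ w : List A, w.foldl nx s = s')
    {x : σ → ℂ} {z : ℂ} (hz : ‖z‖ = 1) (hx : ∀ s ∈ K, 𝔼 a, x (nx s a) = z * x s) :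
    ∀ s ∈ K, ∀ a, x (nx s a) = z * x s := by
  have hsub : ∀ s ∈ K, ‖x s‖ ≤ 𝔼 a, ‖x (nx s a)‖ := by
    intro s hs
    calc ‖x s‖ = ‖𝔼 a, x (nx s a)‖ := by rw [hx s hs, norm_mul, hz, one_mul]
      _ ≤ _ := RCLike.norm_expect_le (K := ℂ)
  have hle : ∀ s ∈ K, ∀ s' ∈ K, ‖x s‖ ≤ ‖x s'‖ := fun s hs s' hs' =>
    le_of_subharmonicOn hK hsub (F := {s'}) (by simp)
      (fun s hs => by simpa using hr s hs s' hs') s hs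
  intro s hs a
  rw [← hx s hs]
  refine eq_expect_of_sq_le (f := fun a => x (nx s a)) ?_ a
  rw [hx s hs, norm_mul, hz, one_mul]
  -- The modulus of `x` is subharmonic, hence constant on `K`, and equality in the triangle
  -- inequality makes the successor values agree.
  refine Finset.expect_le Finset.univ_nonempty fun a _ => ?_
  gcongr
  exact hle _ (hK s hs a) _ hs

end Chain

/-! ### Final components, absorption probabilities and the Poisson equation of the transducer -/

namespace Transducer

open scoped BigOperators

variable {q d : ℕ} {S : Type*} (T : Transducer q d S)

theorem Reach.refl (s : S) : T.Reach s s := ⟨[], rfl⟩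

variable {T}

theorem Reach.trans {s₁ s₂ s₃ : S} (h₁ : T.Reach s₁ s₂) (h₂ : T.Reach s₂ s₃) : T.Reach s₁ s₃ := by
  obtain ⟨w₁, rfl⟩ := h₁
  obtain ⟨w₂, rfl⟩ := h₂
  exact ⟨w₁ ++ w₂, by simp [run]⟩

theorem IsFinalComponent.nonempty {C : Finset S} (hC : T.IsFinalComponent C) : C.Nonempty := by
  obtain ⟨⟨s, hs⟩, -⟩ := hC
  exact ⟨s, (hs s).2 ⟨.refl T s, .refl T s⟩⟩

theorem IsFinalComponent.closed {C : Finset S} (hC : T.IsFinalComponent C) :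
    ∀ s ∈ (C : Set S), ∀ ε, T.next s ε ∈ (C : Set S) := fun s hs ε => by
  simpa using hC.2 s (by simpa using hs) ε

theorem IsFinalComponent.reach {C : Finset S} (hC : T.IsFinalComponent C) :
    ∀ s ∈ (C : Set S), ∀ s' ∈ (C : Set S), T.Reach s s' := by
  obtain ⟨⟨s₀, hs⟩, -⟩ := hC
  intro s h s' h'
  exact ((hs s).1 (by simpa using h)).2.trans ((hs s').1 (by simpa using h')).1

theorem IsFinalComponent.mem_of_reach {C : Finset S} (hC : T.IsFinalComponent C) {s s' : S}
    (hs : s ∈ C) (h : T.Reach s s') : s' ∈ C := by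
  obtain ⟨w, rfl⟩ := h
  simpa using! foldl_mem_of_closed hC.closed w (by simpa using hs)

theorem IsFinalComponent.eq_of_mem {C C' : Finset S} (hC : T.IsFinalComponent C)
    (hC' : T.IsFinalComponent C') {s : S} (hs : s ∈ C) (hs' : s ∈ C') : C = C' := by
  ext x
  exact ⟨fun hx => hC'.mem_of_reach hs' (hC.reach s (by simpa using hs) x (by simpa using hx)),
    fun hx => hC.mem_of_reach hs (hC'.reach s (by simpa using hs') x (by simpa using hx))⟩

variable [Fintype S]

theorem mem_finalComponents {C : Finset S} : C ∈ T.finalComponents ↔ T.IsFinalComponent C := by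
  simp [finalComponents]

variable (T)

/-- The set of the states in final components. -/
def finalStates : Set S := {s | ∃ C ∈ T.finalComponents, s ∈ C}

/-- From every state some final component can be reached. -/
theorem exists_reach_finalStates (s : S) : ∃ w : List (Fin d → Fin q),
    w.foldl T.next s ∈ T.finalStates := by
  classical
  let R : S → Finset S := fun x => Finset.univ.filter fun y => T.Reach x y
  -- A state reachable from `s` with the fewest reachable states: everything it reaches must reach
  -- it back, so its reachable set is a final component.
  obtain ⟨x, hx, hmin⟩ := Finset.exists_min_image (R s) (fun x => (R x).card)
    ⟨s, by simpa [R] using Reach.refl T s⟩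
  have hsx : T.Reach s x := by simpa [R] using hx
  have hback : ∀ y, T.Reach x y → T.Reach y x := by
    intro y hy
    have hsub : R y ⊆ R x := fun t ht => by
      simp only [R, Finset.mem_filter, Finset.mem_univ, true_and] at ht ⊢
      exact hy.trans ht
    have heq : R y = R x := Finset.eq_of_subset_of_card_le hsub
      (hmin y (by simpa [R] using hsx.trans hy))
    have : x ∈ R y := by rw [heq]; simpa [R] using Reach.refl T x
    simpa [R] using this
  obtain ⟨w, hw⟩ := hsx
  refine ⟨w, R x, ?_, ?_⟩
  · rw [mem_finalComponents]
    refine ⟨⟨x, fun y => ?_⟩, fun y hy ε => ?_⟩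
    · simp only [R, Finset.mem_filter, Finset.mem_univ, true_and]
      exact ⟨fun h => ⟨h, hback y h⟩, fun h => h.1⟩
    · simp only [R, Finset.mem_filter, Finset.mem_univ, true_and] at hy ⊢
      exact hy.trans ⟨[ε], rfl⟩
  · change T.run s w ∈ R x
    rw [hw]
    simpa [R] using Reach.refl T x

variable [NeZero q]

/-- A function that is subharmonic and nonpositive on the final components is nonpositive. -/
theorem nonpos_of_subharmonic {y : S → ℝ} (hy : ∀ s, y s ≤ 𝔼 ε, y (T.next s ε))
    (hF : ∀ s ∈ T.finalStates, y s ≤ 0) (s : S) : y s ≤ 0 :=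
  le_of_subharmonicOn (K := Set.univ) (fun _ _ _ => trivial) (fun s _ => hy s) hF
    (fun s _ => T.exists_reach_finalStates s) s trivial

theorem eq_zero_of_harmonic {y : S → ℝ} (hy : ∀ s, 𝔼 ε, y (T.next s ε) = y s)
    (hF : ∀ s ∈ T.finalStates, y s = 0) (s : S) : y s = 0 := by
  refine le_antisymm (T.nonpos_of_subharmonic (fun s => (hy s).ge) (fun s h => (hF s h).le) s) ?_
  have := T.nonpos_of_subharmonic (y := fun s => -y s)
    (fun s => by rw [Finset.expect_neg_distrib, hy s]) (fun s h => by simp [hF s h]) s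
  linarith

/-- The probability of being absorbed in the component `C`, as a function of the state: the harmonic
part of the indicator function of `C`. -/
def absorption (C : Finset S) : S → ℝ :=
  (exists_harmonic_add_coboundary T.next (Set.indicator (C : Set S) 1)).choose

theorem absorption_harmonic (C : Finset S) (s : S) :
    𝔼 ε, T.absorption C (T.next s ε) = T.absorption C s :=
  (exists_harmonic_add_coboundary T.next (Set.indicator (C : Set S) 1)).choose_spec.choose_spec.1 s

theorem exists_absorption_add (C : Finset S) : ∃ H : S → ℝ, ∀ s,
    Set.indicator (C : Set S) 1 s = T.absorption C s + H s - 𝔼 ε, H (T.next s ε) :=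
  ⟨_, (exists_harmonic_add_coboundary T.next
    (Set.indicator (C : Set S) 1)).choose_spec.choose_spec.2⟩

variable {T}

theorem IsFinalComponent.harmonic_eq {C : Finset S} (hC : T.IsFinalComponent C) {u : S → ℝ}
    (hu : ∀ s, 𝔼 ε, u (T.next s ε) = u s) {s s' : S} (hs : s ∈ C) (hs' : s' ∈ C) : u s = u s' :=
  eq_of_harmonicOn hC.closed (fun s _ => (hu s).symm) hC.reach (by simpa using hs)
    (by simpa using hs')

/-- On a final component, the constant in a Poisson equation is unique. -/
theorem IsFinalComponent.poisson_unique {C : Finset S} (hC : T.IsFinalComponent C) {f H H' : S → ℝ}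
    {c c' : ℝ} (h : ∀ s ∈ C, f s = c + H s - 𝔼 ε, H (T.next s ε))
    (h' : ∀ s ∈ C, f s = c' + H' s - 𝔼 ε, H' (T.next s ε)) : c = c' := by
  refine sub_eq_zero.1 (eq_zero_of_const_eq_sub (K := (C : Set S)) (by simpa using! hC.nonempty)
    hC.closed (H := fun s => H' s - H s) fun s hs => ?_)
  have h1 := h s (by simpa using hs)
  have h2 := h' s (by simpa using hs)
  rw [Finset.expect_sub_distrib]
  linarith

/-- On `C` the indicator equals `1` and the absorption function is constant, so both are the
constant of a Poisson equation with the same left side, and this constant is unique. The next lemma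
argues in the same way with the left side `0`. -/
theorem absorption_of_mem {C : Finset S} (hC : T.IsFinalComponent C) {s : S} (hs : s ∈ C) :
    T.absorption C s = 1 := by
  obtain ⟨H, hH⟩ := T.exists_absorption_add C
  refine hC.poisson_unique (f := fun _ => 1) (H := H) (H' := 0) (fun x hx => ?_) (by simp)
  rw [← hC.harmonic_eq (T.absorption_harmonic C) hx hs, ← hH x]
  simp [hx]

theorem absorption_of_mem_of_ne {C C' : Finset S} (hC : T.IsFinalComponent C)
    (hC' : T.IsFinalComponent C') (hne : C ≠ C') {s : S} (hs : s ∈ C') :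
    T.absorption C s = 0 := by
  obtain ⟨H, hH⟩ := T.exists_absorption_add C
  refine hC'.poisson_unique (f := fun _ => 0) (H := H) (H' := 0) (fun x hx => ?_) (by simp)
  rw [← hC'.harmonic_eq (T.absorption_harmonic C) hx hs, ← hH x]
  have : x ∉ C := fun h => hne (hC.eq_of_mem hC' h hx)
  simp [this]

theorem absorption_nonneg {C : Finset S} (hC : T.IsFinalComponent C) (s : S) :
    0 ≤ T.absorption C s := by
  have := T.nonpos_of_subharmonic (y := fun s => -T.absorption C s)
    (fun s => by rw [Finset.expect_neg_distrib, T.absorption_harmonic]) (fun s h => ?_) s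
  · linarith
  · obtain ⟨C', hC', hs⟩ := h
    rw [mem_finalComponents] at hC'
    by_cases h : C = C'
    · subst h; simp [absorption_of_mem hC hs]
    · simp [absorption_of_mem_of_ne hC hC' h hs]

/-- Harmonicity carries positivity backwards along a path into `C`, since all the other successors
contribute nonnegative amounts. -/
theorem absorption_pos_of_reach {C : Finset S} (hC : T.IsFinalComponent C) {s s' : S}
    (h : T.Reach s s') (hs' : s' ∈ C) : 0 < T.absorption C s := by
  obtain ⟨w, rfl⟩ := h
  induction w generalizing s with
  | nil => rw [absorption_of_mem hC (by simpa [run] using hs')]; exact one_pos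
  | cons ε w ih =>
    rw [← T.absorption_harmonic]
    exact Finset.expect_pos' (fun ε _ => absorption_nonneg hC _)
      ⟨ε, Finset.mem_univ _, ih (by simpa [run] using hs')⟩

/-- A harmonic function is determined by its values on the final components. -/
theorem harmonic_eq_sum_absorption {u : S → ℝ} (hu : ∀ s, 𝔼 ε, u (T.next s ε) = u s)
    {m : Finset S → ℝ} (hm : ∀ C ∈ T.finalComponents, ∀ s ∈ C, u s = m C) (s : S) :
    u s = ∑ C ∈ T.finalComponents, m C * T.absorption C s := by
  refine sub_eq_zero.1 (T.eq_zero_of_harmonic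
    (y := fun s => u s - ∑ C ∈ T.finalComponents, m C * T.absorption C s) (fun s => ?_)
    (fun s hs => ?_) s)
  · rw [Finset.expect_sub_distrib, hu, Finset.expect_sum_comm]
    simp_rw [← Finset.mul_expect, T.absorption_harmonic]
  · obtain ⟨C, hC, hs⟩ := hs
    rw [Finset.sum_eq_single_of_mem C hC, hm C hC s hs,
      absorption_of_mem (mem_finalComponents.1 hC) hs]
    · simp
    · intro C' hC' hne
      rw [absorption_of_mem_of_ne (mem_finalComponents.1 hC') (mem_finalComponents.1 hC) hne hs,
        mul_zero]

theorem sum_absorption (s : S) : ∑ C ∈ T.finalComponents, T.absorption C s = 1 := by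
  have := harmonic_eq_sum_absorption (T := T) (u := fun _ => 1) (m := fun _ => 1) (by simp)
    (by simp) s
  simpa using this.symm

/-- The function with the value `m C` on each final component `C`, extended harmonically. -/
def harmonicExt (T : Transducer q d S) (m : Finset S → ℝ) (s : S) : ℝ :=
  ∑ C ∈ T.finalComponents, m C * T.absorption C s

theorem harmonicExt_harmonic (m : Finset S → ℝ) (s : S) :
    𝔼 ε, T.harmonicExt m (T.next s ε) = T.harmonicExt m s := by
  simp only [harmonicExt]
  rw [Finset.expect_sum_comm]
  simp_rw [← Finset.mul_expect, T.absorption_harmonic]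

theorem harmonicExt_of_mem {C : Finset S} (hC : C ∈ T.finalComponents) (m : Finset S → ℝ) {s : S}
    (hs : s ∈ C) : T.harmonicExt m s = m C := by
  rw [harmonicExt, Finset.sum_eq_single_of_mem C hC, absorption_of_mem (mem_finalComponents.1 hC) hs,
    mul_one]
  intro C' hC' hne
  rw [absorption_of_mem_of_ne (mem_finalComponents.1 hC') (mem_finalComponents.1 hC) hne hs,
    mul_zero]

theorem harmonicExt_of_const {m : Finset S → ℝ} {c : ℝ} (h : ∀ C ∈ T.finalComponents, m C = c)
    (s : S) : T.harmonicExt m s = c := by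
  rw [harmonicExt, Finset.sum_congr rfl fun C hC => by rw [h C hC], ← Finset.mul_sum,
    sum_absorption, mul_one]

variable (T) in
/-- The Poisson equation, in terms of the means over the final components. -/
theorem exists_poisson (f : S → ℝ) : ∃ (m : Finset S → ℝ) (H : S → ℝ), ∀ s,
    f s = T.harmonicExt m s + H s - 𝔼 ε, H (T.next s ε) := by
  classical
  obtain ⟨u, H, hu, hH⟩ := exists_harmonic_add_coboundary T.next f
  let m : Finset S → ℝ := fun C => if h : C.Nonempty then u h.choose else 0
  refine ⟨m, H, fun s => ?_⟩
  rw [hH s, harmonic_eq_sum_absorption hu (m := m), harmonicExt]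
  intro C hC s hs
  have hC' := mem_finalComponents.1 hC
  have hne : C.Nonempty := hC'.nonempty
  simp only [m, dif_pos hne]
  exact hC'.harmonic_eq hu hs hne.choose_spec

/-- If `f` is given to have the mean `m C` on each final component, the Poisson equation can be
solved with these means. -/
theorem exists_poisson_of_mean (f : S → ℝ) (m : Finset S → ℝ)
    (h : ∀ C ∈ T.finalComponents, ∃ H : S → ℝ, ∀ s ∈ C,
      f s = m C + H s - 𝔼 ε, H (T.next s ε)) :
    ∃ H : S → ℝ, ∀ s, f s = T.harmonicExt m s + H s - 𝔼 ε, H (T.next s ε) := by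
  obtain ⟨m', H', hH'⟩ := T.exists_poisson f
  refine ⟨H', fun s => ?_⟩
  rw [hH' s, harmonicExt, harmonicExt]
  congr 2
  refine Finset.sum_congr rfl fun C hC => ?_
  obtain ⟨H, hH⟩ := h C hC
  rw [(mem_finalComponents.1 hC).poisson_unique (f := f) hH (c' := m' C) (H' := H') fun s hs => ?_]
  rw [hH' s, harmonicExt_of_mem hC _ hs]

variable (T) in
/-- A bounded nonnegative function that decreases by at least `1` on average in each step from a
state outside the final components. -/
theorem exists_drift : ∃ τ : S → ℝ, (∀ s, 0 ≤ τ s) ∧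
    ∀ s ∉ T.finalStates, 1 + 𝔼 ε, τ (T.next s ε) ≤ τ s := by
  classical
  -- The indicator of the transient states vanishes on all final components, so its harmonic part is
  -- zero and it equals `H - P H`. Subtracting a lower bound of `H` gives nonnegativity.
  obtain ⟨H, hH⟩ := exists_poisson_of_mean (T := T)
    (Set.indicator (T.finalStates)ᶜ 1) (fun _ => 0) fun C hC => ⟨0, fun s hs => by
      have : s ∈ T.finalStates := ⟨C, hC, hs⟩
      simp [this]⟩
  obtain ⟨c, hc⟩ : ∃ c, ∀ s, c ≤ H s := by
    obtain ⟨c, hc⟩ := (Set.finite_range H).bddBelow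
    exact ⟨c, fun s => hc ⟨s, rfl⟩⟩
  refine ⟨fun s => H s - c, fun s => by linarith [hc s], fun s hs => ?_⟩
  have := hH s
  rw [harmonicExt_of_const (c := 0) (by simp)] at this
  simp only [Set.indicator_of_mem (show s ∈ (T.finalStates)ᶜ from hs), Pi.one_apply] at this
  rw [Finset.expect_sub_distrib, Finset.expect_const Finset.univ_nonempty]
  linarith

end Transducer

/-! ### Periods, the spectrum of the transition matrix at zero, and the projection of the initial
vector -/

namespace Transducer

open scoped BigOperators

variable {q d : ℕ} {S : Type*} {T : Transducer q d S} [NeZero q]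

theorem IsFinalComponent.exists_cycle {C : Finset S} (hC : T.IsFinalComponent C) :
    ∃ n ∈ T.cycleLengths C, 0 < n := by
  obtain ⟨s, hs⟩ := hC.nonempty
  let ε : Fin d → Fin q := fun _ => 0
  obtain ⟨w, hw⟩ := hC.reach (T.next s ε) (by simpa using! hC.closed s (by simpa using hs) ε) s
    (by simpa using hs)
  exact ⟨_, ⟨s, hs, ε :: w, by simp, by simpa [run] using hw, rfl⟩, by simp⟩

/-- A cycle of positive length bounds the common divisors, so the supremum defining the period is
attained and not a default value. -/
theorem IsFinalComponent.period_mem {C : Finset S} (hC : T.IsFinalComponent C) :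
    BddAbove {g | ∀ n ∈ T.cycleLengths C, g ∣ n} ∧ ∀ n ∈ T.cycleLengths C, T.period C ∣ n := by
  obtain ⟨n₀, hn₀, hpos⟩ := hC.exists_cycle
  have hb : BddAbove {g | ∀ n ∈ T.cycleLengths C, g ∣ n} :=
    ⟨n₀, fun g hg => Nat.le_of_dvd hpos (hg n₀ hn₀)⟩
  exact ⟨hb, Nat.sSup_mem (s := {g | ∀ n ∈ T.cycleLengths C, g ∣ n}) ⟨1, fun n _ => one_dvd n⟩ hb⟩

theorem IsFinalComponent.period_pos {C : Finset S} (hC : T.IsFinalComponent C) :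
    0 < T.period C := by
  obtain ⟨n₀, hn₀, hpos⟩ := hC.exists_cycle
  exact Nat.pos_of_dvd_of_pos (hC.period_mem.2 n₀ hn₀) hpos

/-- The least common multiple of two common divisors is again a common divisor, so it cannot exceed
the greatest one. -/
theorem IsFinalComponent.dvd_period {C : Finset S} (hC : T.IsFinalComponent C) {g : ℕ}
    (hg : ∀ n ∈ T.cycleLengths C, g ∣ n) : g ∣ T.period C := by
  obtain ⟨hb, hmem⟩ := hC.period_mem
  have h1 : g.lcm (T.period C) ≤ T.period C :=
    le_csSup hb fun n hn => Nat.lcm_dvd (hg n hn) (hmem n hn)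
  have h2 : T.period C ∣ g.lcm (T.period C) := Nat.dvd_lcm_right _ _
  have h0 : 0 < g.lcm (T.period C) := Nat.lcm_pos (by
    obtain ⟨n₀, hn₀, hpos⟩ := hC.exists_cycle
    exact Nat.pos_of_dvd_of_pos (hg n₀ hn₀) hpos) hC.period_pos
  rw [← le_antisymm h1 (Nat.le_of_dvd h0 h2)]
  exact Nat.dvd_lcm_left _ _

variable [Fintype S]

theorem finalPeriod_pos : 0 < T.finalPeriod := by
  rw [finalPeriod, Nat.pos_iff_ne_zero, Ne, Finset.lcm_eq_zero_iff]
  rintro ⟨C, hC, h⟩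
  exact (mem_finalComponents.1 hC).period_pos.ne' h

/-- An eigenfunction for an eigenvalue of modulus `1` is determined by its values on the final
components, where it is multiplied by the eigenvalue in each step. -/
theorem eigenfunction_ne_zero {x : S → ℂ} {z : ℂ} (hz : ‖z‖ = 1)
    (hx : ∀ s, 𝔼 ε, x (T.next s ε) = z * x s) (hx0 : x ≠ 0) :
    ∃ C ∈ T.finalComponents, ∃ s ∈ C, x s ≠ 0 := by
  by_contra! hF
  apply hx0
  ext s
  have := T.nonpos_of_subharmonic (y := fun s => ‖x s‖) (fun s => by
    calc ‖x s‖ = ‖𝔼 a, x (T.next s a)‖ := by rw [hx s, norm_mul, hz, one_mul]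
      _ ≤ _ := RCLike.norm_expect_le (K := ℂ))
    (fun s ⟨C, hC, hs⟩ => by simp [hF C hC s hs]) s
  simpa using this

/-- On a final component where `x` does not vanish identically, each step multiplies `x` by `z`, so
`x` vanishes nowhere there and `z^n = 1` for every cycle length `n`. Thus the order of `z` divides
the period of the component. -/
theorem pow_finalPeriod_eq_one {x : S → ℂ} {z : ℂ} (hz : ‖z‖ = 1)
    (hx : ∀ s, 𝔼 ε, x (T.next s ε) = z * x s) (hx0 : x ≠ 0) : z ^ T.finalPeriod = 1 := by
  obtain ⟨C, hC, s₀, hs₀, hne⟩ := eigenfunction_ne_zero hz hx hx0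
  have hC' := mem_finalComponents.1 hC
  have hstep := eigenfunction_step hC'.closed hC'.reach hz (fun s _ => hx s)
  have hnz : ∀ s ∈ C, x s ≠ 0 := by
    intro s hs h0
    obtain ⟨w, hw⟩ := hC'.reach s (by simpa using hs) s₀ (by simpa using hs₀)
    apply hne
    rw [← hw, run, eigenfunction_foldl hC'.closed hstep w (by simpa using hs), h0, mul_zero]
  have hdvd : orderOf z ∣ T.period C := by
    refine hC'.dvd_period ?_
    rintro _ ⟨s, hs, w, -, hw, rfl⟩
    refine orderOf_dvd_of_pow_eq_one (mul_right_cancel₀ (hnz s hs) ?_)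
    rw [← eigenfunction_foldl hC'.closed hstep w (by simpa using hs), one_mul]
    exact congrArg x hw
  exact orderOf_dvd_iff_pow_eq_one.1 (hdvd.trans (Finset.dvd_lcm hC))

variable [DecidableEq S]

/-- Acting on functions of the state, the matrix is averaging up to the number of letters. Left
eigenvectors are reached from here by duality. -/
theorem transMatrix_zero_mulVec (f : S → ℂ) :
    (T.transMatrix 0).mulVec f = (q : ℂ) ^ d • stepAvg ℂ T.next f := by
  ext s
  have hcard : ((Fintype.card (Fin d → Fin q) : ℕ) : ℂ) = (q : ℂ) ^ d := by simp
  rw [Pi.smul_apply, stepAvg_apply, Fintype.expect_eq_sum_div_card, hcard, smul_eq_mul,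
    mul_div_cancel₀]
  · rw [transMatrix, Matrix.sum_mulVec, Finset.sum_apply]
    simp [letterMatrix, Matrix.mulVec, dotProduct]
  · rw [← hcard]; exact_mod_cast Fintype.card_ne_zero

theorem mem_spectrum_transMatrix {z : ℂ} : z ∈ spectrum ℂ (T.transMatrix 0) ↔
    ∃ x : S → ℂ, x ≠ 0 ∧ (q : ℂ) ^ d • stepAvg ℂ T.next x = z • x := by
  rw [← Matrix.spectrum_toLin', ← Module.End.hasEigenvalue_iff_mem_spectrum]
  constructor
  · intro h
    obtain ⟨x, hx⟩ := h.exists_hasEigenvector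
    refine ⟨x, hx.2, ?_⟩
    rw [← transMatrix_zero_mulVec, ← Matrix.toLin'_apply]
    exact hx.apply_eq_smul
  · rintro ⟨x, hx, h⟩
    refine Module.End.hasEigenvalue_of_hasEigenvector (x := x) ⟨?_, hx⟩
    rw [Module.End.mem_eigenspace_iff, Matrix.toLin'_apply, transMatrix_zero_mulVec, h]

theorem pow_ne_zero_complex : ((q : ℂ) ^ d) ≠ 0 := pow_ne_zero _ (by exact_mod_cast NeZero.ne q)

theorem norm_le_of_mem_spectrum {z : ℂ} (hz : z ∈ spectrum ℂ (T.transMatrix 0)) :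
    ‖z‖ ≤ (q : ℝ) ^ d := by
  obtain ⟨x, hx, h⟩ := mem_spectrum_transMatrix.1 hz
  have h1 := congrArg norm h
  rw [norm_smul, norm_smul] at h1
  have h2 := norm_stepAvg_le (𝕜 := ℂ) T.next x
  have h3 : 0 < ‖x‖ := norm_pos_iff.2 hx
  have h4 : ‖(q : ℂ) ^ d‖ = (q : ℝ) ^ d := by simp
  rw [h4] at h1
  refine le_of_mul_le_mul_right ?_ h3
  rw [← h1]
  gcongr

theorem pow_mem_spectrum : (q : ℂ) ^ d ∈ spectrum ℂ (T.transMatrix 0) := by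
  refine mem_spectrum_transMatrix.2 ⟨fun _ => 1, ?_, ?_⟩
  · intro h
    simpa using congrFun h T.init
  · congr 1
    ext s
    simp [stepAvg_apply]

/-- An eigenvalue of `P` that is not a root of unity of order dividing the final period has modulus
below `1`. Since `q^d` belongs to the spectrum of the matrix, the corresponding eigenvalue of the
matrix is then not of maximal modulus, and the condition on `ξ` applies. -/
theorem IsErrorExponent.norm_lt {ξ : ℝ} (hξ : T.IsErrorExponent ξ) {x : S → ℂ} (hx : x ≠ 0)
    {z : ℂ} (h : stepAvg ℂ T.next x = z • x) (hz : z ^ T.finalPeriod ≠ 1) :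
    ‖z‖ < (q : ℝ) ^ (-ξ) := by
  have hq : (0 : ℝ) < q := by exact_mod_cast NeZero.pos q
  have hmem : (q : ℂ) ^ d * z ∈ spectrum ℂ (T.transMatrix 0) :=
    mem_spectrum_transMatrix.2 ⟨x, hx, by rw [h, smul_smul]⟩
  have hnorm : ‖(q : ℂ) ^ d * z‖ = (q : ℝ) ^ d * ‖z‖ := by simp
  have hle := norm_le_of_mem_spectrum hmem
  have hqd : (0 : ℝ) < (q : ℝ) ^ d := by positivity
  have hne : ‖z‖ ≠ 1 := fun h1 => hz (pow_finalPeriod_eq_one h1 (fun s => congrFun h s) hx)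
  have hlt : ‖z‖ < 1 := by
    refine lt_of_le_of_ne ?_ hne
    rw [hnorm] at hle
    exact le_of_mul_le_mul_left (by simpa using hle) hqd
  have := hξ.2.2 _ hmem ⟨_, pow_mem_spectrum, by
    rw [hnorm]
    simpa using mul_lt_mul_of_pos_left hlt hqd⟩
  rw [hnorm, Real.rpow_sub hq, Real.rpow_natCast, div_eq_mul_inv, ← Real.rpow_neg hq.le] at this
  exact lt_of_mul_lt_mul_left this hqd.le

/-- There are finitely many eigenvalues, and `q^(d-ξ)` tends to `q^d` as `ξ` decreases to `0`. -/
theorem exists_isErrorExponent (hq : 2 ≤ q) : ∃ ξ, T.IsErrorExponent ξ := by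
  have hq1 : (1 : ℝ) < q := by exact_mod_cast hq
  have hq0 : (0 : ℝ) < q := by linarith
  have hfin : (spectrum ℂ (T.transMatrix 0)).Finite := by
    rw [← Matrix.spectrum_toLin']
    exact Module.End.finite_spectrum _
  have hev : ∀ᶠ ξ in 𝓝[>] (0 : ℝ), ∀ z ∈ spectrum ℂ (T.transMatrix 0),
      ‖z‖ < (q : ℝ) ^ d → ‖z‖ < (q : ℝ) ^ ((d : ℝ) - ξ) := by
    rw [hfin.eventually_all]
    intro z _
    by_cases h : ‖z‖ < (q : ℝ) ^ d
    · have hc : Tendsto (fun ξ : ℝ => (q : ℝ) ^ ((d : ℝ) - ξ)) (𝓝[>] 0) (𝓝 ((q : ℝ) ^ d)) := by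
        have : ContinuousAt (fun ξ : ℝ => (q : ℝ) ^ ((d : ℝ) - ξ)) 0 := by
          refine ContinuousAt.rpow continuousAt_const (by fun_prop) (Or.inl hq0.ne')
        have h2 := this.tendsto
        simp only [sub_zero, Real.rpow_natCast] at h2
        exact h2.mono_left nhdsWithin_le_nhds
      filter_upwards [hc.eventually (lt_mem_nhds h)] with ξ hξ _ using hξ
    · exact Eventually.of_forall fun _ h' => absurd h' h
  have h1 : ∀ᶠ ξ in 𝓝[>] (0 : ℝ), ξ ≤ 1 :=
    (eventually_le_nhds one_pos).filter_mono nhdsWithin_le_nhds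
  obtain ⟨ξ, ⟨hξ, hle⟩, hpos⟩ := ((hev.and h1).and self_mem_nhdsWithin).exists
  refine ⟨ξ, hpos, hle, fun z hz ⟨z', hz', hlt⟩ => hξ z hz (hlt.trans_le ?_)⟩
  exact norm_le_of_mem_spectrum hz'

theorem vecMul_dotProduct_transMatrix (x f : S → ℂ) :
    dotProduct (Matrix.vecMul x (T.transMatrix 0)) f =
      (q : ℂ) ^ d * dotProduct x (stepAvg ℂ T.next f) := by
  rw [← Matrix.dotProduct_mulVec, transMatrix_zero_mulVec, dotProduct_smul, smul_eq_mul]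

/-- The left eigenvalue `q ^ d` is semisimple. -/
theorem left_semisimple {x : S → ℂ}
    (h : ((T.transMatrix 0).vecMulLinear - algebraMap ℂ (Module.End ℂ (S → ℂ)) ((q : ℂ) ^ d))
      (((T.transMatrix 0).vecMulLinear - algebraMap ℂ (Module.End ℂ (S → ℂ)) ((q : ℂ) ^ d)) x)
        = 0) :
    ((T.transMatrix 0).vecMulLinear - algebraMap ℂ (Module.End ℂ (S → ℂ)) ((q : ℂ) ^ d)) x
      = 0 := by
  set L := (T.transMatrix 0).vecMulLinear - algebraMap ℂ (Module.End ℂ (S → ℂ)) ((q : ℂ) ^ d)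
    with hL
  have hdual : ∀ x f : S → ℂ, dotProduct (L x) f =
      (q : ℂ) ^ d * dotProduct x (stepAvg ℂ T.next f - f) := by
    intro x f
    simp only [hL, LinearMap.sub_apply, Matrix.vecMulLinear_apply, Module.algebraMap_end_apply,
      sub_dotProduct, vecMul_dotProduct_transMatrix, smul_dotProduct, smul_eq_mul, dotProduct_sub]
    ring
  ext s
  -- An entry of `L x` is its pairing with an indicator, which splits into a harmonic `u` and a
  -- coboundary. The pairing with `u` vanishes because the transpose of `L` annihilates harmonic
  -- functions; the pairing with the coboundary is, up to sign and the factor `q^d`, that of `L (L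
  -- x) = 0` with `H`.
  obtain ⟨u, H, hu, hf⟩ := exists_harmonic_add_coboundary T.next (Pi.single s 1)
  have hcast : (Pi.single s 1 : S → ℂ) = (fun s => (u s : ℂ)) -
      (stepAvg ℂ T.next (fun s => (H s : ℂ)) - fun s => (H s : ℂ)) := by
    ext t
    have h1 := congrArg ((↑) : ℝ → ℂ) (hf t)
    have h2 : (((Pi.single s (1 : ℝ) : S → ℝ) t : ℝ) : ℂ) = (Pi.single s (1 : ℂ) : S → ℂ) t := by
      by_cases hst : t = s
      · subst hst; simp
      · simp [hst]
    rw [h2] at h1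
    rw [h1]
    simp only [Complex.ofReal_sub, Complex.ofReal_add, Pi.sub_apply, stepAvg_apply]
    rw [Fintype.expect_eq_sum_div_card, Fintype.expect_eq_sum_div_card]
    push_cast
    ring
  have hharm : stepAvg ℂ T.next (fun s => (u s : ℂ)) = fun s => (u s : ℂ) := by
    ext t
    rw [← hu t, stepAvg_apply, Fintype.expect_eq_sum_div_card, Fintype.expect_eq_sum_div_card]
    push_cast
    rfl
  have h3 : L x s = dotProduct (L x) (Pi.single s 1) := by simp
  have hq := pow_ne_zero_complex (q := q) (d := d)
  have h4 : dotProduct (L x) (stepAvg ℂ T.next (fun s => (H s : ℂ)) - fun s => (H s : ℂ)) = 0 := by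
    have := hdual (L x) (fun s => (H s : ℂ))
    rw [h] at this
    simpa [hq] using this.symm
  rw [h3, hcast, dotProduct_sub, h4, hdual, hharm]
  simp

/-- The projection of the initial indicator vector exists, and the sums of its entries over the final
components are the absorption probabilities. -/
theorem exists_isInitProjection : ∃ w, T.IsInitProjection w ∧
    ∀ C ∈ T.finalComponents, (T.absorption C T.init : ℂ) = ∑ s ∈ C, w s := by
  set L := (T.transMatrix 0).vecMulLinear with hL
  set c := (q : ℂ) ^ d with hc
  have htop : (Pi.single T.init 1 : S → ℂ) ∈ Module.End.maxGenEigenspace L c ⊔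
      ⨆ z ∈ {z : ℂ | z ≠ c}, Module.End.maxGenEigenspace L z := by
    have h1 := Module.End.iSup_maxGenEigenspace_eq_top L
    have h2 : (⨆ z : ℂ, Module.End.maxGenEigenspace L z) ≤ Module.End.maxGenEigenspace L c ⊔
        ⨆ z ∈ {z : ℂ | z ≠ c}, Module.End.maxGenEigenspace L z := by
      refine iSup_le fun z => ?_
      by_cases h : z = c
      · rw [h]; exact le_sup_left
      · exact le_sup_of_le_right (le_iSup₂_of_le z h le_rfl)
    exact h2 (h1 ▸ Submodule.mem_top)
  obtain ⟨w, hw, r, hr, hwr⟩ := Submodule.mem_sup.1 htop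
  -- Semisimplicity lowers the exponent one by one, so the generalized eigenvector `w` is an
  -- eigenvector.
  have heig : ∀ (k : ℕ) (x : S → ℂ), ((L - algebraMap ℂ (Module.End ℂ (S → ℂ)) c) ^ k) x = 0 →
      k ≠ 0 → (L - algebraMap ℂ (Module.End ℂ (S → ℂ)) c) x = 0 := by
    intro k
    induction k with
    | zero => intro x _ h; exact absurd rfl h
    | succ k ih =>
      intro x hx _
      rw [pow_succ, Module.End.mul_apply] at hx
      rcases Nat.eq_zero_or_pos k with rfl | hk
      · simpa using hx
      · exact left_semisimple (ih _ hx hk.ne')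
  have hweig : (L - algebraMap ℂ (Module.End ℂ (S → ℂ)) c) w = 0 := by
    obtain ⟨k, hk⟩ := Module.End.mem_maxGenEigenspace L c w |>.1 hw
    refine heig (k + 1) w ?_ (by simp)
    rw [pow_succ', Module.End.mul_apply]
    have : ((L - algebraMap ℂ (Module.End ℂ (S → ℂ)) c) ^ k) w = 0 := by
      simpa [Algebra.algebraMap_eq_smul_one] using hk
    rw [this, map_zero]
  have hLw : L w = c • w := by
    simpa [sub_eq_zero, Module.algebraMap_end_apply] using hweig
  refine ⟨w, ⟨Module.End.mem_eigenspace_iff.2 hLw, ?_⟩, fun C hC => ?_⟩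
  · rw [← hwr, add_sub_cancel_left]; exact hr
  have hq := pow_ne_zero_complex (q := q) (d := d)
  -- The pairing with a harmonic `h` is multiplied by `q^d` under `L`, hence by `(q^d - z)^k ≠ 0`
  -- under `(L - z)^k`; so it vanishes on the generalized eigenspaces for `z ≠ q^d`.
  have hortho : ∀ h : S → ℂ, stepAvg ℂ T.next h = h → dotProduct r h = 0 := by
    intro h hh
    let φ : (S → ℂ) →ₗ[ℂ] ℂ := Fintype.linearCombination ℂ h
    have hφ : ∀ x, φ x = dotProduct x h := by
      intro x; simp [φ, Fintype.linearCombination_apply, dotProduct]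
    have hφL : ∀ x, φ (L x) = c * φ x := by
      intro x
      rw [hφ, hφ, hL, Matrix.vecMulLinear_apply, vecMul_dotProduct_transMatrix, hh]
    rw [← hφ]
    suffices (⨆ z ∈ {z : ℂ | z ≠ c}, Module.End.maxGenEigenspace L z) ≤ LinearMap.ker φ from
      LinearMap.mem_ker.1 (this hr)
    refine iSup₂_le fun z hz x hx => ?_
    obtain ⟨k, hk⟩ := Module.End.mem_maxGenEigenspace L z x |>.1 hx
    have hpow : ∀ (k : ℕ) (x : S → ℂ), φ (((L - z • (1 : Module.End ℂ (S → ℂ))) ^ k) x) =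
        (c - z) ^ k * φ x := by
      intro k
      induction k with
      | zero => intro x; simp
      | succ k ih =>
        intro x
        rw [pow_succ, Module.End.mul_apply, ih, LinearMap.sub_apply, map_sub, hφL]
        simp
        ring
    have := hpow k x
    rw [hk, map_zero] at this
    rcases mul_eq_zero.1 this.symm with h0 | h0
    · exact absurd (pow_eq_zero_iff (fun h => by simp [h] at h0) |>.1 h0) (sub_ne_zero.2 (Ne.symm hz))
    · exact h0
  obtain ⟨H, hH⟩ := T.exists_absorption_add C
  set h : S → ℂ := fun s => (T.absorption C s : ℂ) with hh
  have hharm : stepAvg ℂ T.next h = h := by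
    ext t
    rw [hh]
    simp only
    rw [← T.absorption_harmonic C t, stepAvg_apply, Fintype.expect_eq_sum_div_card,
      Fintype.expect_eq_sum_div_card]
    push_cast
    rfl
  -- The sum over `C` is the pairing of `w` with the indicator of `C`. The left eigenvector `w`
  -- annihilates coboundaries, and the harmonic part of the indicator is the absorption probability.
  have hind : ∑ s ∈ C, w s = dotProduct w (h + (fun s => (H s : ℂ)) -
      stepAvg ℂ T.next (fun s => (H s : ℂ))) := by
    have : (h + (fun s => (H s : ℂ)) - stepAvg ℂ T.next (fun s => (H s : ℂ))) =
        fun s => if s ∈ C then 1 else 0 := by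
      ext t
      have h1 := congrArg ((↑) : ℝ → ℂ) (hH t)
      have h2 : ((Set.indicator (C : Set S) (1 : S → ℝ) t : ℝ) : ℂ) = if t ∈ C then 1 else 0 := by
        by_cases ht : t ∈ C <;> simp [ht]
      rw [← h2, h1]
      simp only [Complex.ofReal_sub, Complex.ofReal_add, Pi.sub_apply, Pi.add_apply, stepAvg_apply, hh]
      rw [Fintype.expect_eq_sum_div_card, Fintype.expect_eq_sum_div_card]
      push_cast
      ring
    rw [this]
    simp [dotProduct]
  have hwP : ∀ f : S → ℂ, dotProduct w (stepAvg ℂ T.next f) = dotProduct w f := by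
    intro f
    have h1 := vecMul_dotProduct_transMatrix (T := T) w f
    rw [← Matrix.vecMulLinear_apply, ← hL, hLw, smul_dotProduct, smul_eq_mul] at h1
    exact (mul_left_cancel₀ hq h1).symm
  rw [hind, dotProduct_sub, dotProduct_add, hwP, add_sub_cancel_right]
  have h5 : dotProduct (Pi.single T.init 1) h = dotProduct w h + dotProduct r h := by
    rw [← hwr, add_dotProduct]
  rw [hortho h hharm, add_zero] at h5
  rw [← h5]
  simp [hh]

end Transducer

/-! ### Nearly homogeneous sequences and their homogeneous limits -/

section Scaling

/-- The order of magnitude `x ^ (d - 1) * log x ^ β`, made positive and monotone for `0 ≤ x`. -/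
def growth (d β : ℕ) (x : ℝ) : ℝ := (x + 1) ^ (d - 1) * (1 + Real.log (x + 1)) ^ β

theorem one_le_one_add_log {x : ℝ} (hx : 0 ≤ x) : 1 ≤ 1 + Real.log (x + 1) := by
  linarith [Real.log_nonneg (by linarith : 1 ≤ x + 1)]

theorem one_le_growth (d β : ℕ) {x : ℝ} (hx : 0 ≤ x) : 1 ≤ growth d β x :=
  one_le_mul_of_one_le_of_one_le (one_le_pow₀ (by linarith)) (one_le_pow₀ (one_le_one_add_log hx))

theorem growth_mono (d β : ℕ) {x y : ℝ} (hx : 0 ≤ x) (hxy : x ≤ y) :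
    growth d β x ≤ growth d β y := by
  have h1 := one_le_one_add_log hx
  have h2 : Real.log (x + 1) ≤ Real.log (y + 1) := Real.log_le_log (by linarith) (by linarith)
  have h3 : 0 ≤ y := hx.trans hxy
  unfold growth
  gcongr

theorem growth_mul_le (d β : ℕ) {c x : ℝ} (hc : 1 ≤ c) (hx : 0 ≤ x) :
    growth d β (c * x) ≤ c ^ (d - 1) * (1 + Real.log c) ^ β * growth d β x := by
  have h0 : 0 ≤ c * x := by positivity
  have h1 : c * x + 1 ≤ c * (x + 1) := by linarith
  have hlc := Real.log_nonneg hc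
  have hlx := Real.log_nonneg (by linarith : 1 ≤ x + 1)
  have h2 : 1 + Real.log (c * x + 1) ≤ (1 + Real.log c) * (1 + Real.log (x + 1)) := by
    have : Real.log (c * x + 1) ≤ Real.log c + Real.log (x + 1) := by
      rw [← Real.log_mul (by linarith) (by linarith)]
      exact Real.log_le_log (by linarith) h1
    nlinarith
  have h3 := one_le_one_add_log h0
  calc growth d β (c * x) ≤ (c * (x + 1)) ^ (d - 1) *
        ((1 + Real.log c) * (1 + Real.log (x + 1))) ^ β := by
        unfold growth; gcongr
    _ = _ := by unfold growth; rw [mul_pow, mul_pow]; ring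

theorem exists_one_add_log_pow_le (β : ℕ) {ε : ℝ} (hε : 0 < ε) :
    ∃ K, 0 ≤ K ∧ ∀ y : ℝ, 1 ≤ y → (1 + Real.log y) ^ β ≤ K * y ^ ε := by
  -- With `β + 1` the quotient is meaningful for `β = 0` too, and `δ β ≤ ε`.
  set δ := ε / (β + 1) with hδ
  have hδ0 : 0 < δ := by positivity
  refine ⟨(1 + 1 / δ) ^ β, by positivity, fun y hy => ?_⟩
  have h1 : 1 + Real.log y ≤ (1 + 1 / δ) * y ^ δ := by
    have h2 := Real.log_le_rpow_div (by linarith : 0 ≤ y) hδ0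
    have h3 : 1 ≤ y ^ δ := Real.one_le_rpow hy hδ0.le
    calc 1 + Real.log y ≤ y ^ δ + y ^ δ / δ := by linarith
      _ = _ := by ring
  calc (1 + Real.log y) ^ β ≤ ((1 + 1 / δ) * y ^ δ) ^ β := by
        have := Real.log_nonneg hy
        gcongr
    _ = (1 + 1 / δ) ^ β * y ^ (δ * β) := by
        rw [mul_pow, ← Real.rpow_mul_natCast (by linarith)]
    _ ≤ (1 + 1 / δ) ^ β * y ^ ε := by
        gcongr
        rw [hδ, div_mul_eq_mul_div, div_le_iff₀ (by positivity)]
        nlinarith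

theorem exists_growth_le_rpow {d : ℕ} (hd : 1 ≤ d) (β : ℕ) {α : ℝ} (hα : α < 1) :
    ∃ K, 0 ≤ K ∧ ∀ x : ℝ, 0 ≤ x → growth d β x ≤ K * (x + 1) ^ ((d : ℝ) - α) := by
  obtain ⟨K, hK, h⟩ := exists_one_add_log_pow_le β (sub_pos.2 hα)
  refine ⟨K, hK, fun x hx => ?_⟩
  calc growth d β x ≤ (x + 1) ^ (d - 1) * (K * (x + 1) ^ (1 - α)) := by
        unfold growth
        gcongr
        exact h _ (by linarith)
    _ = K * ((x + 1) ^ ((d - 1 : ℕ) : ℝ) * (x + 1) ^ (1 - α)) := by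
        rw [Real.rpow_natCast]; ring
    _ = K * (x + 1) ^ ((d : ℝ) - α) := by
        rw [← Real.rpow_add (by linarith)]
        congr 2
        push_cast [hd]
        ring

variable {E : Type*} [NormedAddCommGroup E]

theorem norm_sub_le_of_increments {U : ℕ → E} {g : ℕ → ℝ} (hg : Monotone g)
    (hU : ∀ N, ‖U (N + 1) - U N‖ ≤ g N) (a r : ℕ) : ‖U (a + r) - U a‖ ≤ r * g (a + r) := by
  induction r with
  | zero => simp
  | succ r ih =>
    calc ‖U (a + (r + 1)) - U a‖ ≤ ‖U (a + r + 1) - U (a + r)‖ + ‖U (a + r) - U a‖ := by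
          rw [← add_assoc]; exact norm_sub_le_norm_sub_add_norm_sub _ _ _
      _ ≤ g (a + r) + r * g (a + r) := add_le_add (hU _) ih
      _ = (r + 1 : ℝ) * g (a + r) := by ring
      _ ≤ ((r + 1 : ℕ) : ℝ) * g (a + (r + 1)) := by
          push_cast
          gcongr
          exact hg (by omega)

theorem norm_sub_le_of_increments' {U : ℕ → E} {g : ℕ → ℝ} (hg : Monotone g)
    (hU : ∀ N, ‖U (N + 1) - U N‖ ≤ g N) {a b r c : ℕ} (h1 : a ≤ b + r) (h2 : b ≤ a + r)
    (ha : a ≤ c) (hb : b ≤ c) : ‖U a - U b‖ ≤ r * g c := by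
  have h0 : ∀ N, 0 ≤ g N := fun N => (norm_nonneg _).trans (hU N)
  rcases le_total a b with h | h
  · obtain ⟨k, rfl⟩ := Nat.exists_eq_add_of_le h
    rw [norm_sub_rev]
    refine (norm_sub_le_of_increments hg hU a k).trans ?_
    exact mul_le_mul (by exact_mod_cast (by omega : k ≤ r)) (hg hb) (h0 _) (by positivity)
  · obtain ⟨k, rfl⟩ := Nat.exists_eq_add_of_le h
    refine (norm_sub_le_of_increments hg hU b k).trans ?_
    exact mul_le_mul (by exact_mod_cast (by omega : k ≤ r)) (hg ha) (h0 _) (by positivity)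

variable [NormedSpace ℝ E]

/-- The rescaled sequence whose limit is the homogeneous function attached to `U`. -/
def rescale (Q d : ℕ) (U : ℕ → E) (k : ℕ) (x : ℝ) : E :=
  (((Q : ℝ) ^ d) ^ k)⁻¹ • U ⌊(Q : ℝ) ^ k * x⌋₊

/-- The floor at level `k + 1` differs from `Q` times the floor at level `k` by at most `Q`
increments, and the rest is the defect of homogeneity. Both are `O((Q^k (x+1))^(d-α))`, as `α < 1`
leaves room for the logarithms, and dividing by `Q^(d(k+1))` makes the series geometric. -/
theorem exists_rescale_step {Q d : ℕ} (hQ : 2 ≤ Q) (hd : 1 ≤ d) (β : ℕ) {U : ℕ → E} {K : ℝ}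
    (hU1 : ∀ N : ℕ, ‖U (Q * N) - (Q : ℝ) ^ d • U N‖ ≤ K * growth d β N)
    (hU2 : ∀ N : ℕ, ‖U (N + 1) - U N‖ ≤ K * growth d β N) {α : ℝ} (hα : 0 < α) (hα1 : α < 1) :
    ∃ C, 0 ≤ C ∧ ∀ (k : ℕ) (x : ℝ), 0 ≤ x →
      ‖rescale Q d U k x - rescale Q d U (k + 1) x‖ ≤
        C * (x + 1) ^ ((d : ℝ) - α) * ((Q : ℝ) ^ (-α)) ^ k := by
  have hK : 0 ≤ K := nonneg_of_mul_nonneg_left ((norm_nonneg _).trans (hU2 0))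
    (by linarith [one_le_growth d β (le_refl ((0 : ℕ) : ℝ)|>.trans_eq' (by simp))])
  obtain ⟨C₀, hC₀, hgr⟩ := exists_growth_le_rpow hd β hα1
  have hQ0 : (0 : ℝ) < Q := by exact_mod_cast (by omega : 0 < Q)
  have hQ1 : (1 : ℝ) ≤ Q := by exact_mod_cast (by omega : 1 ≤ Q)
  have hda : 0 ≤ (d : ℝ) - α := by
    have : (1 : ℝ) ≤ d := by exact_mod_cast hd
    linarith
  refine ⟨K * C₀ * (1 + Q * (Q : ℝ) ^ ((d : ℝ) - α)), by positivity, fun k x hx => ?_⟩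
  have hgm : Monotone fun N : ℕ => K * growth d β N := fun a b hab => by
    have := growth_mono d β (Nat.cast_nonneg (α := ℝ) a) (by exact_mod_cast hab : (a : ℝ) ≤ b)
    dsimp only
    gcongr
  set N := ⌊(Q : ℝ) ^ k * x⌋₊ with hN
  set M := ⌊(Q : ℝ) ^ (k + 1) * x⌋₊ with hM
  have hy : 0 ≤ (Q : ℝ) ^ k * x := by positivity
  have hNle : (N : ℝ) ≤ (Q : ℝ) ^ k * x := Nat.floor_le hy
  have hMle : (M : ℝ) ≤ (Q : ℝ) ^ (k + 1) * x := Nat.floor_le (by positivity)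
  have hlo : Q * N ≤ M := by
    refine Nat.le_floor ?_
    push_cast
    rw [pow_succ']
    nlinarith
  have hhi : M ≤ Q * N + Q := by
    have h1 : (Q : ℝ) ^ k * x < N + 1 := Nat.lt_floor_add_one _
    have h2 : (M : ℝ) < Q * N + Q := by
      calc (M : ℝ) ≤ Q * ((Q : ℝ) ^ k * x) := by rw [pow_succ'] at hMle; linarith
        _ < Q * (N + 1) := by gcongr
        _ = _ := by ring
    exact_mod_cast h2.le
  have e1 : ‖U M - U (Q * N)‖ ≤ Q * (K * growth d β M) :=
    norm_sub_le_of_increments' hgm hU2 hhi (by omega) le_rfl hlo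
  have hqk : (1 : ℝ) ≤ (Q : ℝ) ^ k := one_le_pow₀ hQ1
  have e2 : growth d β N ≤ C₀ * ((Q : ℝ) ^ k * (x + 1)) ^ ((d : ℝ) - α) := by
    refine (hgr _ (Nat.cast_nonneg _)).trans ?_
    gcongr
    nlinarith
  have e3 : growth d β M ≤ C₀ * ((Q : ℝ) ^ ((d : ℝ) - α) *
      ((Q : ℝ) ^ k * (x + 1)) ^ ((d : ℝ) - α)) := by
    refine (hgr _ (Nat.cast_nonneg _)).trans ?_
    rw [← Real.mul_rpow hQ0.le (by positivity)]
    gcongr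
    rw [pow_succ'] at hMle
    nlinarith [mul_le_mul hQ1 hqk zero_le_one hQ0.le]
  have e4 : ‖U M - (Q : ℝ) ^ d • U N‖ ≤ K * C₀ * (1 + Q * (Q : ℝ) ^ ((d : ℝ) - α)) *
      ((Q : ℝ) ^ k * (x + 1)) ^ ((d : ℝ) - α) := by
    calc ‖U M - (Q : ℝ) ^ d • U N‖ ≤ ‖U M - U (Q * N)‖ + ‖U (Q * N) - (Q : ℝ) ^ d • U N‖ :=
          norm_sub_le_norm_sub_add_norm_sub _ _ _
      _ ≤ Q * (K * (C₀ * ((Q : ℝ) ^ ((d : ℝ) - α) *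
            ((Q : ℝ) ^ k * (x + 1)) ^ ((d : ℝ) - α)))) +
          K * (C₀ * ((Q : ℝ) ^ k * (x + 1)) ^ ((d : ℝ) - α)) := by
          refine add_le_add (e1.trans (by gcongr)) ((hU1 N).trans (by gcongr))
      _ = _ := by ring
  have e5 : rescale Q d U k x - rescale Q d U (k + 1) x =
      -((((Q : ℝ) ^ d) ^ (k + 1))⁻¹ • (U M - (Q : ℝ) ^ d • U N)) := by
    simp only [rescale, ← hN, ← hM]
    rw [smul_sub, smul_smul, pow_succ, mul_inv_rev, mul_assoc, mul_comm _ ((Q : ℝ) ^ d),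
      ← mul_assoc, inv_mul_cancel₀ (by positivity), one_mul]
    abel
  rw [e5, norm_neg, norm_smul, Real.norm_of_nonneg (by positivity)]
  have e6 : (((Q : ℝ) ^ d) ^ (k + 1))⁻¹ ≤ (((Q : ℝ) ^ d) ^ k)⁻¹ := by
    gcongr
    · exact one_le_pow₀ hQ1
    · omega
  have e7 : (((Q : ℝ) ^ d) ^ k)⁻¹ * ((Q : ℝ) ^ k * (x + 1)) ^ ((d : ℝ) - α) =
      (x + 1) ^ ((d : ℝ) - α) * ((Q : ℝ) ^ (-α)) ^ k := by
    rw [Real.mul_rpow (by positivity) (by positivity), Real.rpow_sub (by positivity),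
      Real.rpow_natCast, ← pow_mul, ← pow_mul, mul_comm d k, Real.rpow_neg hQ0.le, inv_pow,
      ← Real.rpow_natCast (_ ^ α) k, ← Real.rpow_natCast _ k, ← Real.rpow_mul hQ0.le,
      ← Real.rpow_mul hQ0.le, mul_comm α]
    field_simp
  calc _ ≤ (((Q : ℝ) ^ d) ^ k)⁻¹ * (K * C₀ * (1 + Q * (Q : ℝ) ^ ((d : ℝ) - α)) *
      ((Q : ℝ) ^ k * (x + 1)) ^ ((d : ℝ) - α)) := by gcongr
    _ = K * C₀ * (1 + Q * (Q : ℝ) ^ ((d : ℝ) - α)) * ((((Q : ℝ) ^ d) ^ k)⁻¹ *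
      ((Q : ℝ) ^ k * (x + 1)) ^ ((d : ℝ) - α)) := by ring
    _ = _ := by rw [e7]; ring

end Scaling

section Scaling

variable {E : Type*} [NormedAddCommGroup E] [NormedSpace ℝ E] [CompleteSpace E]

/-- At integers the floors are exact, so only the defect of homogeneity enters, and the bound keeps
`growth d β N` instead of a power with exponent above `d - 1`. This is what makes the case `ξ = 1`
accessible. The exponent `1/2` is an arbitrary choice in `(0, 1)`. -/
theorem exists_rescale_int_step {Q d : ℕ} (hQ : 2 ≤ Q) (hd : 1 ≤ d) (β : ℕ) {U : ℕ → E} {K : ℝ}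
    (hK : 0 ≤ K) (hU1 : ∀ N : ℕ, ‖U (Q * N) - (Q : ℝ) ^ d • U N‖ ≤ K * growth d β N) :
    ∃ C, 0 ≤ C ∧ ∀ (k N : ℕ), ‖rescale Q d U k N - rescale Q d U (k + 1) N‖ ≤
        C * growth d β N * ((Q : ℝ) ^ (-(1 / 2 : ℝ))) ^ k := by
  have hQ0 : (0 : ℝ) < Q := by exact_mod_cast (by omega : 0 < Q)
  have hQ1 : (1 : ℝ) ≤ Q := by exact_mod_cast (by omega : 1 ≤ Q)
  obtain ⟨C₀, hC₀, hlog⟩ := exists_one_add_log_pow_le β (by norm_num : (0 : ℝ) < 1 / 2)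
  refine ⟨K * C₀, by positivity, fun k N => ?_⟩
  have hfl : ∀ k : ℕ, ⌊(Q : ℝ) ^ k * (N : ℝ)⌋₊ = Q ^ k * N := fun k => by
    rw [← Nat.cast_pow, ← Nat.cast_mul, Nat.floor_natCast]
  have hqk : (1 : ℝ) ≤ (Q : ℝ) ^ k := one_le_pow₀ hQ1
  have hg0 : 0 ≤ growth d β N := zero_le_one.trans (one_le_growth d β (Nat.cast_nonneg _))
  have e5 : rescale Q d U k N - rescale Q d U (k + 1) N =
      -((((Q : ℝ) ^ d) ^ (k + 1))⁻¹ • (U (Q * (Q ^ k * N)) - (Q : ℝ) ^ d • U (Q ^ k * N))) := by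
    simp only [rescale, hfl]
    have h1 : (((Q : ℝ) ^ d) ^ (k + 1))⁻¹ * (Q : ℝ) ^ d = (((Q : ℝ) ^ d) ^ k)⁻¹ := by
      rw [pow_succ]
      field_simp
    rw [smul_sub, smul_smul, h1, ← mul_assoc Q, ← pow_succ']
    abel
  rw [e5, norm_neg, norm_smul, Real.norm_of_nonneg (by positivity)]
  have e1 : growth d β ((Q ^ k * N : ℕ) : ℝ) ≤
      ((Q : ℝ) ^ k) ^ (d - 1) * (C₀ * ((Q : ℝ) ^ k) ^ (1 / 2 : ℝ)) * growth d β N := by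
    push_cast
    refine (growth_mul_le d β hqk (Nat.cast_nonneg _)).trans ?_
    gcongr
    exact hlog _ hqk
  have e6 : (((Q : ℝ) ^ d) ^ (k + 1))⁻¹ ≤ (((Q : ℝ) ^ d) ^ k)⁻¹ := by
    gcongr
    · exact one_le_pow₀ hQ1
    · omega
  have e7 : (((Q : ℝ) ^ d) ^ k)⁻¹ * (((Q : ℝ) ^ k) ^ (d - 1) * ((Q : ℝ) ^ k) ^ (1 / 2 : ℝ)) =
      ((Q : ℝ) ^ (-(1 / 2 : ℝ))) ^ k := by
    obtain ⟨d', rfl⟩ : ∃ d', d = d' + 1 := ⟨d - 1, by omega⟩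
    have h1 : ((Q : ℝ) ^ k) ^ (1 / 2 : ℝ) * ((Q : ℝ) ^ k) ^ (1 / 2 : ℝ) = (Q : ℝ) ^ k := by
      rw [← Real.rpow_add (by positivity)]; norm_num
    have h2 : ((Q : ℝ) ^ (-(1 / 2 : ℝ))) ^ k = (((Q : ℝ) ^ k) ^ (1 / 2 : ℝ))⁻¹ := by
      rw [Real.rpow_neg hQ0.le, inv_pow, ← Real.rpow_natCast, ← Real.rpow_mul hQ0.le, mul_comm,
        Real.rpow_mul hQ0.le, Real.rpow_natCast]
    rw [h2, ← pow_mul, mul_comm, add_tsub_cancel_right]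
    have h3 : (0 : ℝ) < ((Q : ℝ) ^ k) ^ (1 / 2 : ℝ) := by positivity
    field_simp
    rw [pow_two, h1]
    ring
  calc _ ≤ (((Q : ℝ) ^ d) ^ k)⁻¹ * (K * (((Q : ℝ) ^ k) ^ (d - 1) *
        (C₀ * ((Q : ℝ) ^ k) ^ (1 / 2 : ℝ)) * growth d β N)) := by
        gcongr
        exact (hU1 _).trans (by gcongr)
    _ = K * C₀ * growth d β N * ((((Q : ℝ) ^ d) ^ k)⁻¹ * (((Q : ℝ) ^ k) ^ (d - 1) *
        ((Q : ℝ) ^ k) ^ (1 / 2 : ℝ))) := by ring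
    _ = _ := by rw [e7]

theorem rpow_neg_lt_one {Q : ℕ} (hQ : 2 ≤ Q) {α : ℝ} (hα : 0 < α) : (Q : ℝ) ^ (-α) < 1 :=
  Real.rpow_lt_one_of_one_lt_of_neg (by exact_mod_cast hQ) (by linarith)

/-- A nearly homogeneous sequence is close to a homogeneous function, which is Hölder continuous
on compact intervals. -/
theorem exists_homogeneous_limit {Q d : ℕ} (hQ : 2 ≤ Q) (hd : 1 ≤ d) (β : ℕ) {U : ℕ → E} {K : ℝ}
    (hU1 : ∀ N : ℕ, ‖U (Q * N) - (Q : ℝ) ^ d • U N‖ ≤ K * growth d β N)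
    (hU2 : ∀ N : ℕ, ‖U (N + 1) - U N‖ ≤ K * growth d β N) :
    ∃ G : ℝ → E, (∀ x, 0 ≤ x → G (Q * x) = (Q : ℝ) ^ d • G x) ∧
      (∃ C, ∀ N : ℕ, ‖U N - G N‖ ≤ C * growth d β N) ∧
      ∀ α : ℝ, 0 < α → α < 1 → ∀ X : ℝ, 0 ≤ X → ∃ C, 0 ≤ C ∧ ∀ x y : ℝ, 0 ≤ x → x ≤ X → 0 ≤ y →
        y ≤ X → ‖G x - G y‖ ≤ C * |x - y| ^ α := by
  have hK : 0 ≤ K := nonneg_of_mul_nonneg_left ((norm_nonneg _).trans (hU2 0))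
    (by linarith [one_le_growth d β (le_refl ((0 : ℕ) : ℝ)|>.trans_eq' (by simp))])
  have hQ0 : (0 : ℝ) < Q := by exact_mod_cast (by omega : 0 < Q)
  have hQ1 : (1 : ℝ) < Q := by exact_mod_cast (by omega : 1 < Q)
  have hlim : ∀ x : ℝ, 0 ≤ x → ∃ y, Tendsto (fun k => rescale Q d U k x) atTop (𝓝 y) := by
    intro x hx
    obtain ⟨C, hC, h⟩ := exists_rescale_step hQ hd β hU1 hU2 (α := 1 / 2) (by norm_num)
      (by norm_num)
    exact cauchySeq_tendsto_of_complete (cauchySeq_of_le_geometric _ _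
      (rpow_neg_lt_one hQ one_half_pos) fun k => by rw [dist_eq_norm]; exact h k x hx)
  choose! G hG using hlim
  refine ⟨G, fun x hx => ?_, ?_, ?_⟩
  · refine tendsto_nhds_unique (hG _ (by positivity)) ?_
    have h1 := ((hG x hx).comp (tendsto_add_atTop_nat 1)).const_smul ((Q : ℝ) ^ d)
    refine h1.congr fun k => ?_
    simp only [rescale, Function.comp]
    rw [smul_smul, pow_succ (((Q : ℝ) ^ d)), mul_inv_rev, ← mul_assoc,
      mul_inv_cancel₀ (by positivity), one_mul, pow_succ, mul_assoc]
  · obtain ⟨C, hC, h⟩ := exists_rescale_int_step hQ hd β hK hU1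
    refine ⟨C / (1 - (Q : ℝ) ^ (-(1 / 2 : ℝ))), fun N => ?_⟩
    have := dist_le_of_le_geometric_of_tendsto _ _ (rpow_neg_lt_one hQ one_half_pos)
      (fun k => by rw [dist_eq_norm]; exact h k N) (hG N (Nat.cast_nonneg _)) 0
    rw [dist_eq_norm] at this
    simp only [rescale, pow_zero, inv_one, one_mul, Nat.floor_natCast, one_smul, mul_one] at this
    refine this.trans (le_of_eq (by ring))
  · intro α hα hα1 X hX
    obtain ⟨C, hC, h⟩ := exists_rescale_step hQ hd β hU1 hU2 hα hα1
    obtain ⟨C₀, hC₀, hgr⟩ := exists_growth_le_rpow hd β hα1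
    set r := (Q : ℝ) ^ (-α) with hr
    have hr0 : 0 < r := by positivity
    have hr1 : r < 1 := rpow_neg_lt_one hQ hα
    have hda : 0 ≤ (d : ℝ) - α := by
      have : (1 : ℝ) ≤ d := by exact_mod_cast hd
      linarith
    set Z := (X + 1) ^ ((d : ℝ) - α) with hZ
    have hZ0 : 0 ≤ Z := by positivity
    have happ : ∀ (k : ℕ) (x : ℝ), 0 ≤ x → x ≤ X →
        ‖rescale Q d U k x - G x‖ ≤ C * Z / (1 - r) * r ^ k := by
      intro k x hx hxX
      have := dist_le_of_le_geometric_of_tendsto _ _ hr1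
        (fun k => by rw [dist_eq_norm]; exact h k x hx) (hG x hx) k
      rw [dist_eq_norm] at this
      refine this.trans ?_
      have h1 : (x + 1) ^ ((d : ℝ) - α) ≤ Z := by rw [hZ]; gcongr
      have h2 : 0 < 1 - r := by linarith
      calc C * (x + 1) ^ ((d : ℝ) - α) * r ^ k / (1 - r) ≤ C * Z * r ^ k / (1 - r) := by gcongr
        _ = _ := by ring
    have h1r : 0 < 1 - r := by linarith
    set B := ∑ i ∈ Finset.range (⌊X⌋₊ + 1), ‖U i‖ with hB
    have hB0 : 0 ≤ B := Finset.sum_nonneg fun _ _ => norm_nonneg _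
    have hbd : ∀ x : ℝ, 0 ≤ x → x ≤ X → ‖G x‖ ≤ B + C * Z / (1 - r) := by
      intro x hx hxX
      have h1 := happ 0 x hx hxX
      have h2 : ‖rescale Q d U 0 x‖ ≤ B := by
        simp only [rescale, pow_zero, inv_one, one_mul, one_smul]
        exact Finset.single_le_sum (f := fun i => ‖U i‖) (fun _ _ => norm_nonneg _)
          (Finset.mem_range.2 (Nat.lt_succ_of_le (Nat.floor_le_floor hxX)))
      rw [pow_zero, mul_one] at h1
      calc ‖G x‖ = ‖rescale Q d U 0 x - (rescale Q d U 0 x - G x)‖ := by congr 1; abel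
        _ ≤ _ := (norm_sub_le _ _).trans (add_le_add h2 h1)
    set D := 2 * (C * Z / (1 - r)) + 2 * (K * C₀ * Z) with hD
    have hD0 : 0 ≤ D := by positivity
    refine ⟨2 * (B + C * Z / (1 - r)) + D * (Q : ℝ) ^ α, by positivity,
      fun x y hx hxX hy hyX => ?_⟩
    set δ := |x - y| with hδ
    -- For points further apart than `1` the boundedness of `G` on `[0, X]` suffices.
    rcases le_or_gt δ 1 with hδ1 | hδ1
    swap
    · have h1 : ‖G x - G y‖ ≤ 2 * (B + C * Z / (1 - r)) :=
        (norm_sub_le _ _).trans (by linarith [hbd x hx hxX, hbd y hy hyX])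
      have h2 : 1 ≤ δ ^ α := Real.one_le_rpow hδ1.le hα.le
      calc ‖G x - G y‖ ≤ 2 * (B + C * Z / (1 - r)) + D * (Q : ℝ) ^ α := by
            have : 0 ≤ D * (Q : ℝ) ^ α := by positivity
            linarith
        _ ≤ _ := le_mul_of_one_le_right (by positivity) h2
    rcases eq_or_lt_of_le (abs_nonneg (x - y)) with h0 | h0
    · have : x = y := by
        rw [← sub_eq_zero]; exact abs_eq_zero.1 h0.symm
      subst this
      simp only [sub_self, norm_zero]
      positivity
    -- The scale is chosen with `Q^(-k-1) < |x - y| ≤ Q^(-k)`. There the two floors differ by at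
    -- most `2`, and both the resulting difference and the distance to the limit are of order `Q^(-α
    -- k)`, which is comparable to `|x - y|^α`.
    obtain ⟨k, hk1, hk2⟩ := exists_nat_pow_near_of_lt_one h0 hδ1 (inv_pos.2 hQ0)
      (inv_lt_one_of_one_lt₀ hQ1)
    rw [← hδ] at hk1 hk2
    have hqk : (0 : ℝ) < (Q : ℝ) ^ k := by positivity
    have hqk1 : (1 : ℝ) ≤ (Q : ℝ) ^ k := one_le_pow₀ hQ1.le
    have hQδ : (Q : ℝ) ^ k * δ ≤ 1 := by
      rw [inv_pow] at hk2
      calc (Q : ℝ) ^ k * δ ≤ (Q : ℝ) ^ k * ((Q : ℝ) ^ k)⁻¹ := by gcongr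
        _ = 1 := mul_inv_cancel₀ hqk.ne'
    have hgm : Monotone fun N : ℕ => K * growth d β N := fun a b hab => by
      have := growth_mono d β (Nat.cast_nonneg (α := ℝ) a) (by exact_mod_cast hab : (a : ℝ) ≤ b)
      dsimp only
      gcongr
    have hfl : ∀ x y : ℝ, 0 ≤ x → 0 ≤ y → |x - y| = δ →
        ⌊(Q : ℝ) ^ k * x⌋₊ ≤ ⌊(Q : ℝ) ^ k * y⌋₊ + 2 := by
      intro x y hx hy hxy
      have h1 : (⌊(Q : ℝ) ^ k * x⌋₊ : ℝ) ≤ (Q : ℝ) ^ k * x := Nat.floor_le (by positivity)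
      have h2 : (Q : ℝ) ^ k * y < ⌊(Q : ℝ) ^ k * y⌋₊ + 1 := Nat.lt_floor_add_one _
      have h3 : (Q : ℝ) ^ k * x - (Q : ℝ) ^ k * y ≤ (Q : ℝ) ^ k * δ := by
        rw [← mul_sub]
        gcongr
        rw [← hxy]; exact le_abs_self _
      have : (⌊(Q : ℝ) ^ k * x⌋₊ : ℝ) ≤ ((⌊(Q : ℝ) ^ k * y⌋₊ + 2 : ℕ) : ℝ) := by
        push_cast; linarith
      exact_mod_cast this
    have hstep : ‖rescale Q d U k x - rescale Q d U k y‖ ≤ 2 * (K * C₀ * Z) * r ^ k := by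
      simp only [rescale]
      rw [← smul_sub, norm_smul, Real.norm_of_nonneg (by positivity)]
      have h1 := norm_sub_le_of_increments' hgm hU2 (c := ⌊(Q : ℝ) ^ k * X⌋₊)
        (hfl x y hx hy rfl) (hfl y x hy hx (by rw [abs_sub_comm]))
        (Nat.floor_le_floor (by gcongr)) (Nat.floor_le_floor (by gcongr))
      have h2 : growth d β ⌊(Q : ℝ) ^ k * X⌋₊ ≤ C₀ * ((Q : ℝ) ^ k * (X + 1)) ^ ((d : ℝ) - α) := by
        refine (hgr _ (Nat.cast_nonneg _)).trans ?_
        have : (⌊(Q : ℝ) ^ k * X⌋₊ : ℝ) ≤ (Q : ℝ) ^ k * X := Nat.floor_le (by positivity)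
        gcongr
        linarith
      have e7 : (((Q : ℝ) ^ d) ^ k)⁻¹ * ((Q : ℝ) ^ k * (X + 1)) ^ ((d : ℝ) - α) = Z * r ^ k := by
        rw [Real.mul_rpow (by positivity) (by positivity), Real.rpow_sub (by positivity),
          Real.rpow_natCast, ← pow_mul, ← pow_mul, mul_comm d k, hr, Real.rpow_neg hQ0.le, inv_pow,
          ← Real.rpow_natCast (_ ^ α) k, ← Real.rpow_natCast _ k, ← Real.rpow_mul hQ0.le,
          ← Real.rpow_mul hQ0.le, mul_comm α]
        field_simp
        ring
      calc _ ≤ (((Q : ℝ) ^ d) ^ k)⁻¹ * ((2 : ℕ) * (K * (C₀ *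
            ((Q : ℝ) ^ k * (X + 1)) ^ ((d : ℝ) - α)))) := by
            gcongr
            exact h1.trans (by gcongr)
        _ = 2 * (K * C₀) * ((((Q : ℝ) ^ d) ^ k)⁻¹ *
            ((Q : ℝ) ^ k * (X + 1)) ^ ((d : ℝ) - α)) := by push_cast; ring
        _ = _ := by rw [e7]; ring
    have hrk : r ^ k ≤ (Q : ℝ) ^ α * δ ^ α := by
      rw [← Real.mul_rpow hQ0.le (abs_nonneg _)]
      have h1 : ((Q : ℝ)⁻¹) ^ k ≤ Q * δ := by
        rw [pow_succ'] at hk1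
        calc ((Q : ℝ)⁻¹) ^ k = Q * ((Q : ℝ)⁻¹ * (Q : ℝ)⁻¹ ^ k) := by
              rw [← mul_assoc, mul_inv_cancel₀ hQ0.ne', one_mul]
          _ ≤ Q * δ := by gcongr
      calc r ^ k = (((Q : ℝ)⁻¹) ^ k) ^ α := by
            rw [hr, Real.rpow_neg hQ0.le, ← Real.inv_rpow hQ0.le, ← Real.rpow_natCast,
              ← Real.rpow_natCast, ← Real.rpow_mul (by positivity), ← Real.rpow_mul (by positivity),
              mul_comm]
        _ ≤ _ := by gcongr
    calc ‖G x - G y‖ = ‖(rescale Q d U k x - rescale Q d U k y) - (rescale Q d U k x - G x) +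
          (rescale Q d U k y - G y)‖ := by congr 1; abel
      _ ≤ 2 * (K * C₀ * Z) * r ^ k + C * Z / (1 - r) * r ^ k + C * Z / (1 - r) * r ^ k :=
          (norm_add_le _ _).trans (add_le_add ((norm_sub_le _ _).trans
            (add_le_add hstep (happ k x hx hxX))) (happ k y hy hyX))
      _ = D * r ^ k := by rw [hD]; ring
      _ ≤ D * ((Q : ℝ) ^ α * δ ^ α) := by gcongr
      _ ≤ _ := by
          have : 0 ≤ 2 * (B + C * Z / (1 - r)) * δ ^ α := by positivity
          linarith [add_mul (2 * (B + C * Z / (1 - r))) (D * (Q : ℝ) ^ α) (δ ^ α),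
            mul_assoc D ((Q : ℝ) ^ α) (δ ^ α)]

end Scaling

/-! ### Spectral projection, adapted norm and the contracted part -/

section Scaling

variable {E : Type*} [NormedAddCommGroup E] [NormedSpace ℂ E] [FiniteDimensional ℂ E]

theorem exists_eigenvector_of_mem_spectrum {R : E →L[ℂ] E} {z : ℂ} (hz : z ∈ spectrum ℂ R) :
    ∃ x, x ≠ 0 ∧ R x = z • x := by
  have : CompleteSpace E := FiniteDimensional.complete ℂ E
  by_contra! h
  refine hz (ContinuousLinearMap.isUnit_iff_bijective.2 ?_)
  have hinj : Function.Injective (algebraMap ℂ (E →L[ℂ] E) z - R) := by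
    refine (injective_iff_map_eq_zero _).2 fun x hx => ?_
    by_contra hx0
    refine h x hx0 ?_
    rw [sub_apply, sub_eq_zero] at hx
    rw [← hx]
    simp [Algebra.algebraMap_eq_smul_one]
  exact ⟨hinj, (LinearMap.injective_iff_surjective
    (f := ((algebraMap ℂ (E →L[ℂ] E) z - R : E →L[ℂ] E) : E →ₗ[ℂ] E))).1 hinj⟩

/-- If all eigenvalues have modulus less than `ρ`, some power of the operator has norm less than the
corresponding power of a smaller number. -/
theorem exists_norm_pow_le [Nontrivial E] {R : E →L[ℂ] E} {ρ : ℝ}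
    (h : ∀ (z : ℂ) (x : E), x ≠ 0 → R x = z • x → ‖z‖ < ρ) :
    ∃ θ, 0 < θ ∧ θ < ρ ∧ ∃ n : ℕ, 0 < n ∧ ‖R ^ n‖ ≤ θ ^ n := by
  have : CompleteSpace E := FiniteDimensional.complete ℂ E
  have hne : (spectrum ℂ R).Nonempty := spectrum.nonempty R
  have hρ : 0 < ρ := by
    obtain ⟨z, hz⟩ := hne
    obtain ⟨x, hx, hxz⟩ := exists_eigenvector_of_mem_spectrum hz
    exact (norm_nonneg z).trans_lt (h z x hx hxz)
  have hlt : spectralRadius ℂ R < (ρ.toNNReal : ENNReal) := by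
    refine spectrum.spectralRadius_lt_of_forall_lt_of_nonempty hne fun z hz => ?_
    obtain ⟨x, hx, hxz⟩ := exists_eigenvector_of_mem_spectrum hz
    rw [← NNReal.coe_lt_coe, Real.coe_toNNReal _ hρ.le]
    exact h z x hx hxz
  -- By Gelfand's formula, `‖R^n‖^(1/n)` eventually falls below any number above the spectral
  -- radius.
  obtain ⟨t, ht1, ht2⟩ := ENNReal.lt_iff_exists_nnreal_btwn.1 hlt
  have hev := (spectrum.pow_nnnorm_pow_one_div_tendsto_nhds_spectralRadius R).eventually
    (gt_mem_nhds ht1)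
  obtain ⟨n, hn, hpos⟩ := (hev.and (eventually_gt_atTop 0)).exists
  have ht0 : 0 < t := by
    rw [← ENNReal.coe_pos]; exact (zero_le).trans_lt ht1
  refine ⟨t, by exact_mod_cast ht0, ?_, n, hpos, ?_⟩
  · rw [← Real.coe_toNNReal _ hρ.le]; exact_mod_cast ht2
  · have h1 : (‖R ^ n‖₊ : ENNReal) ≤ (t : ENNReal) ^ n := by
      have h2 := ENNReal.rpow_le_rpow hn.le (Nat.cast_nonneg n)
      rwa [← ENNReal.rpow_mul, one_div_mul_cancel (by exact_mod_cast hpos.ne'), ENNReal.rpow_one,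
        ENNReal.rpow_natCast] at h2
    exact_mod_cast h1

/-- A norm-like function that is contracted by `R`. -/
theorem exists_adapted_norm [Nontrivial E] {R : E →L[ℂ] E} {ρ : ℝ}
    (h : ∀ (z : ℂ) (x : E), x ≠ 0 → R x = z • x → ‖z‖ < ρ) :
    ∃ (θ : ℝ) (ν : E → ℝ) (C : ℝ), 0 < θ ∧ θ < ρ ∧ 0 ≤ C ∧ (∀ x, ‖x‖ ≤ ν x) ∧
      (∀ x, ν x ≤ C * ‖x‖) ∧ (∀ x y, ν (x + y) ≤ ν x + ν y) ∧
      (∀ (c : ℝ) x, 0 ≤ c → ν (c • x) = c * ν x) ∧ ∀ x, ν (R x) ≤ θ * ν x := by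
  obtain ⟨θ, hθ, hθρ, n, hn, hR⟩ := exists_norm_pow_le h
  -- Passing from `x` to `R x` shifts the weighted sum and produces a factor `θ`; the new term `j =
  -- n` is at most the lost term `j = 0`, because `‖R^n‖ ≤ θ^n`.
  refine ⟨θ, fun x => ∑ j ∈ Finset.range n, (θ ^ j)⁻¹ * ‖(R ^ j) x‖,
    ∑ j ∈ Finset.range n, (θ ^ j)⁻¹ * ‖R ^ j‖, hθ, hθρ, by positivity, fun x => ?_, fun x => ?_,
    fun x y => ?_, fun c x hc => ?_, fun x => ?_⟩
  · have := Finset.single_le_sum (f := fun j => (θ ^ j)⁻¹ * ‖(R ^ j) x‖)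
      (fun j _ => by positivity) (Finset.mem_range.2 hn)
    simpa using this
  · rw [Finset.sum_mul]
    refine Finset.sum_le_sum fun j _ => ?_
    rw [mul_assoc]
    gcongr
    exact (R ^ j).le_opNorm x
  · rw [← Finset.sum_add_distrib]
    refine Finset.sum_le_sum fun j _ => ?_
    rw [← mul_add, map_add]
    gcongr
    exact norm_add_le _ _
  · rw [Finset.mul_sum]
    refine Finset.sum_congr rfl fun j _ => ?_
    have : (R ^ j) (c • x) = c • (R ^ j) x := by
      rw [← Complex.coe_smul, map_smul, Complex.coe_smul]
    rw [this, norm_smul, Real.norm_of_nonneg hc]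
    ring
  · have hpow : ∀ j : ℕ, (R ^ j) (R x) = (R ^ (j + 1)) x := fun j => by
      rw [pow_succ]; rfl
    have hshift : ∑ j ∈ Finset.range n, (θ ^ j)⁻¹ * ‖(R ^ j) (R x)‖ =
        θ * ∑ j ∈ Finset.range n, (θ ^ (j + 1))⁻¹ * ‖(R ^ (j + 1)) x‖ := by
      rw [Finset.mul_sum]
      refine Finset.sum_congr rfl fun j _ => ?_
      rw [hpow, pow_succ' θ, mul_inv, ← mul_assoc, ← mul_assoc, mul_inv_cancel₀ hθ.ne', one_mul]
    beta_reduce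
    rw [hshift]
    refine mul_le_mul_of_nonneg_left ?_ hθ.le
    have h1 := Finset.sum_range_succ (fun j => (θ ^ j)⁻¹ * ‖(R ^ j) x‖) n
    have h2 := Finset.sum_range_succ' (fun j => (θ ^ j)⁻¹ * ‖(R ^ j) x‖) n
    have h3 : (θ ^ n)⁻¹ * ‖(R ^ n) x‖ ≤ ‖x‖ := by
      rw [inv_mul_le_iff₀ (by positivity)]
      exact ((R ^ n).le_opNorm x).trans (by gcongr)
    simp only [pow_zero, inv_one, one_mul, one_apply_eq_self] at h2
    linarith

/-- The spectral projection of a semisimple eigenvalue. -/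
theorem exists_spectral_projection (A : E →L[ℂ] E) (p : ℕ)
    (hss : ∀ x, (A ^ p - 1) ((A ^ p - 1) x) = 0 → (A ^ p - 1) x = 0) :
    ∃ P : E →L[ℂ] E, (∀ x, (A ^ p) (P x) = P x) ∧ (∀ x, (A ^ p) x = x → P x = x) ∧
      (∀ x, P (P x) = P x) ∧ ∀ x, P (A x) = A (P x) := by
  have hc := isCompl_ker_range_of_semisimple ((A ^ p - 1 : E →L[ℂ] E) : E →ₗ[ℂ] E) hss
  set B : E →ₗ[ℂ] E := ((A ^ p - 1 : E →L[ℂ] E) : E →ₗ[ℂ] E) with hB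
  have hBapp : ∀ x, B x = (A ^ p) x - x := fun x => rfl
  have hcomm : ∀ x, B (A x) = A (B x) := fun x => by
    rw [hBapp, hBapp, map_sub]
    congr 1
    change (A ^ p * A) x = (A * A ^ p) x
    rw [pow_mul_comm']
  set P := Submodule.projection _ _ hc with hP
  have hmem : ∀ x, B (P x) = 0 := fun x =>
    LinearMap.mem_ker.1 (Submodule.projection_apply_mem hc x)
  have hself : ∀ x, B x = 0 → P x = x := fun x hx =>
    (Submodule.projection_eq_self_iff hc x).2 hx
  refine ⟨LinearMap.toContinuousLinearMap P, fun x => ?_, fun x hx => ?_, fun x => ?_,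
    fun x => ?_⟩
  · have := hmem x
    rw [hBapp, sub_eq_zero] at this
    exact this
  · exact hself x (by rw [hBapp, hx, sub_self])
  · exact hself _ (hmem x)
  · change P (A x) = A (P x)
    have h1 : P (A (P x)) = A (P x) := hself _ (by rw [hcomm, hmem, map_zero])
    have h2 : P (A (x - P x)) = 0 := by
      rw [hP, Submodule.projection_apply_eq_zero_iff]
      obtain ⟨y, hy⟩ := Submodule.sub_projection_mem hc x
      exact ⟨A y, by rw [hcomm, hy]⟩
    rw [map_sub, map_sub, sub_eq_zero, h1] at h2
    exact h2

theorem growth_le_rpow_mul {d : ℕ} (hd : 1 ≤ d) (β : ℕ) {ξ : ℝ} (hξ : ξ ≤ 1) {N : ℕ}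
    (hN : 1 ≤ N) : growth d β N ≤ 2 ^ (d - 1) * 2 ^ β * ((N : ℝ) ^ ((d : ℝ) - ξ) *
      (1 + Real.log N) ^ β) := by
  have hN1 : (1 : ℝ) ≤ N := by exact_mod_cast hN
  have hlog := Real.log_nonneg hN1
  have h1 : Real.log ((N : ℝ) + 1) ≤ 1 + Real.log N := by
    calc Real.log ((N : ℝ) + 1) ≤ Real.log (2 * N) := Real.log_le_log (by linarith) (by linarith)
      _ = Real.log 2 + Real.log N := Real.log_mul (by norm_num) (by linarith)
      _ ≤ _ := by linarith [Real.log_two_lt_d9]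
  have h3 : ((N : ℝ)) ^ (d - 1) ≤ (N : ℝ) ^ ((d : ℝ) - ξ) := by
    rw [← Real.rpow_natCast]
    refine Real.rpow_le_rpow_of_exponent_le hN1 ?_
    push_cast [hd]
    linarith
  have h4 := one_le_one_add_log (Nat.cast_nonneg (α := ℝ) N)
  calc growth d β N ≤ (2 * (N : ℝ)) ^ (d - 1) * (2 * (1 + Real.log N)) ^ β := by
        unfold growth
        gcongr
        · linarith
        · linarith
    _ = 2 ^ (d - 1) * 2 ^ β * ((N : ℝ) ^ (d - 1) * (1 + Real.log N) ^ β) := by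
        rw [mul_pow, mul_pow]; ring
    _ ≤ _ := by gcongr

/-- The part of a nearly homogeneous sequence that belongs to the small eigenvalues is small. -/
theorem exists_le_of_contracted [Nontrivial E] {q d : ℕ} (hq : 2 ≤ q) (hd : 1 ≤ d) (β : ℕ)
    {R : E →L[ℂ] E} {ξ : ℝ} (hξ1 : ξ ≤ 1)
    (h : ∀ (z : ℂ) (x : E), x ≠ 0 → R x = z • x → ‖z‖ < (q : ℝ) ^ (-ξ)) {X : ℕ → E} {K : ℝ}
    (hK : 0 ≤ K) (hX : ∀ N : ℕ, ‖X N - (q : ℝ) ^ d • R (X (N / q))‖ ≤ K * growth d β N) :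
    ∃ C, ∀ N : ℕ, 1 ≤ N → ‖X N‖ ≤ C * ((N : ℝ) ^ ((d : ℝ) - ξ) * (1 + Real.log N) ^ β) := by
  obtain ⟨θ, ν, C₁, hθ, hθρ, hC₁, hν1, hν2, hν3, hν4, hν5⟩ := exists_adapted_norm h
  have hq0 : (0 : ℝ) < q := by exact_mod_cast (by omega : 0 < q)
  have hq1 : (1 : ℝ) ≤ q := by exact_mod_cast (by omega : 1 ≤ q)
  -- The factor gained in passing from `N / q` to `N`, measured against the weight `N^(d-ξ)`.
  set ρ := θ * (q : ℝ) ^ ξ with hρ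
  have hρ1 : ρ < 1 := by
    rw [hρ]
    calc θ * (q : ℝ) ^ ξ < (q : ℝ) ^ (-ξ) * (q : ℝ) ^ ξ := by gcongr
      _ = 1 := by rw [← Real.rpow_add hq0]; simp
  have hρ0 : 0 < ρ := by positivity
  set K' := C₁ * K * (2 ^ (d - 1) * 2 ^ β) with hK'
  have hK'0 : 0 ≤ K' := by positivity
  set B := ∑ i ∈ Finset.range q, ν (X i) with hB
  have hνn : ∀ x, 0 ≤ ν x := fun x => (norm_nonneg x).trans (hν1 x)
  have hB0 : 0 ≤ B := Finset.sum_nonneg fun i _ => hνn _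
  have hd1 : (1 : ℝ) ≤ d := by exact_mod_cast hd
  -- `B` covers the initial values `N < q`, and the constant is stable under the recursion: `ρ C +
  -- K' ≤ C`.
  refine ⟨B + K' / (1 - ρ), fun N hN => (hν1 _).trans ?_⟩
  set C := B + K' / (1 - ρ) with hC
  have h1ρ : 0 < 1 - ρ := by linarith
  have hC0 : 0 ≤ C := by positivity
  induction N using Nat.strong_induction_on with
  | _ N ih =>
    have hN1 : (1 : ℝ) ≤ N := by exact_mod_cast hN
    have hlog := Real.log_nonneg hN1
    have hf1 : 1 ≤ (N : ℝ) ^ ((d : ℝ) - ξ) * (1 + Real.log N) ^ β :=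
      one_le_mul_of_one_le_of_one_le (Real.one_le_rpow hN1 (by linarith))
        (one_le_pow₀ (by linarith))
    rcases lt_or_ge N q with hlt | hge
    · have h1 : ν (X N) ≤ B := Finset.single_le_sum (f := fun i => ν (X i)) (fun i _ => hνn _)
        (Finset.mem_range.2 hlt)
      calc ν (X N) ≤ C := by
            have : 0 ≤ K' / (1 - ρ) := by positivity
            linarith
        _ ≤ _ := le_mul_of_one_le_right hC0 hf1
    · set M := N / q with hM
      have hM1 : 1 ≤ M := (Nat.one_le_div_iff (by omega)).2 hge
      have hMN : M < N := Nat.div_lt_self (by omega) hq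
      have hM1' : (1 : ℝ) ≤ M := by exact_mod_cast hM1
      have hMle : (M : ℝ) ≤ N / q := Nat.cast_div_le
      have hMN' : (M : ℝ) ≤ N := by exact_mod_cast hMN.le
      have e1 : ν (X N) ≤ (q : ℝ) ^ d * (θ * ν (X M)) + C₁ * (K * growth d β N) := by
        calc ν (X N) = ν ((q : ℝ) ^ d • R (X M) + (X N - (q : ℝ) ^ d • R (X M))) := by
              congr 1; abel
          _ ≤ ν ((q : ℝ) ^ d • R (X M)) + ν (X N - (q : ℝ) ^ d • R (X M)) := hν3 _ _
          _ ≤ _ := by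
              rw [hν4 _ _ (by positivity)]
              gcongr
              · exact hν5 _
              · exact (hν2 _).trans (by gcongr; exact hX N)
      have e2 : ν (X M) ≤ C * (((q : ℝ) ^ ((d : ℝ) - ξ))⁻¹ * (N : ℝ) ^ ((d : ℝ) - ξ) *
          (1 + Real.log N) ^ β) := by
        refine (ih M hMN hM1).trans ?_
        gcongr ?_ * (?_ * ?_)
        · calc (M : ℝ) ^ ((d : ℝ) - ξ) ≤ (N / q : ℝ) ^ ((d : ℝ) - ξ) :=
                Real.rpow_le_rpow (by positivity) hMle (by linarith)
            _ = _ := by rw [Real.div_rpow (by positivity) hq0.le]; ring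
        · have := Real.log_nonneg hM1'
          gcongr
      have e3 := growth_le_rpow_mul hd β hξ1 hN
      have e4 : (q : ℝ) ^ d * θ * ((q : ℝ) ^ ((d : ℝ) - ξ))⁻¹ = ρ := by
        rw [Real.rpow_sub hq0, Real.rpow_natCast, hρ]
        field_simp
      set f := (N : ℝ) ^ ((d : ℝ) - ξ) * (1 + Real.log N) ^ β with hf
      calc ν (X N) ≤ (q : ℝ) ^ d * (θ * (C * (((q : ℝ) ^ ((d : ℝ) - ξ))⁻¹ *
            (N : ℝ) ^ ((d : ℝ) - ξ) * (1 + Real.log N) ^ β))) +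
            C₁ * (K * (2 ^ (d - 1) * 2 ^ β * f)) := by
            refine e1.trans ?_
            gcongr
        _ = (((q : ℝ) ^ d * θ * ((q : ℝ) ^ ((d : ℝ) - ξ))⁻¹) * C + K') * f := by
            rw [hK', hf]; ring
        _ ≤ C * f := by
            rw [e4]
            gcongr
            have : K' = (1 - ρ) * (K' / (1 - ρ)) := by field_simp
            rw [hC]
            nlinarith

end Scaling

/-! ### The periodic fluctuation -/

section Scaling

/-- A periodic function that is Hölder continuous on two periods is Hölder continuous. -/
theorem holderWith_of_periodic {E : Type*} [NormedAddCommGroup E] {f : ℝ → E} {p : ℝ} (hp : 0 < p)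
    (hf : Function.Periodic f p) {C : ℝ} (hC : 0 ≤ C) {α : NNReal}
    (h : ∀ x y, 0 ≤ x → x ≤ 2 * p → 0 ≤ y → y ≤ 2 * p → ‖f x - f y‖ ≤ C * |x - y| ^ (α : ℝ)) :
    HolderWith C.toNNReal α f := by
  have key : ∀ x y, x ≤ y → ‖f x - f y‖ ≤ C * |x - y| ^ (α : ℝ) := by
    intro x y hxy
    -- The point `x` and the gap `y - x` are reduced modulo `p` separately: both points then lie
    -- within two periods, and the gap has not grown.
    set x' := toIcoMod hp 0 x with hx'
    set r := toIcoMod hp 0 (y - x) with hr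
    have h1 := toIcoMod_mem_Ico hp 0 x
    have h2 := toIcoMod_mem_Ico hp 0 (y - x)
    rw [zero_add, Set.mem_Ico, ← hx'] at h1
    rw [zero_add, Set.mem_Ico, ← hr] at h2
    have hrle : r ≤ y - x := by
      rw [hr, toIcoMod]
      have : 0 ≤ toIcoDiv hp 0 (y - x) := by
        by_contra! hneg
        have h3 : (toIcoDiv hp 0 (y - x) : ℝ) ≤ -1 := by exact_mod_cast Int.le_sub_one_of_lt hneg
        have h4 : r = y - x - toIcoDiv hp 0 (y - x) * p := by rw [hr, toIcoMod, zsmul_eq_mul]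
        nlinarith
      rw [zsmul_eq_mul]
      have : (0 : ℝ) ≤ toIcoDiv hp 0 (y - x) := by exact_mod_cast this
      nlinarith
    have e1 : f x = f x' := by
      rw [hx', toIcoMod, hf.sub_zsmul_eq]
    have e2 : f y = f (x' + r) := by
      have : x' + r = y - (toIcoDiv hp 0 x + toIcoDiv hp 0 (y - x)) • p := by
        rw [hx', hr, toIcoMod, toIcoMod, add_smul]; ring
      rw [this, hf.sub_zsmul_eq]
    rw [e1, e2]
    refine (h x' (x' + r) h1.1 (by linarith) (by linarith) (by linarith)).trans ?_
    refine mul_le_mul_of_nonneg_left (Real.rpow_le_rpow (abs_nonneg _) ?_ α.coe_nonneg) hC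
    rw [show x' - (x' + r) = -r by ring, abs_neg, abs_of_nonneg h2.1, abs_sub_comm,
      abs_of_nonneg (by linarith)]
    exact hrle
  intro x y
  have hxy : ‖f x - f y‖ ≤ C * |x - y| ^ (α : ℝ) := by
    rcases le_total x y with hle | hle
    · exact key x y hle
    · rw [norm_sub_rev, abs_sub_comm]; exact key y x hle
  rw [edist_dist, edist_dist, dist_eq_norm, Real.dist_eq, ENNReal.ofReal_rpow_of_nonneg
    (abs_nonneg _) α.coe_nonneg, ← ENNReal.ofReal_coe_nnreal, Real.coe_toNNReal _ hC,
    ← ENNReal.ofReal_mul hC]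
  exact ENNReal.ofReal_le_ofReal hxy

theorem abs_exp_sub_exp_le (c : ℝ) {X x y : ℝ} (hx : 0 ≤ x) (hxX : x ≤ X) (hy : 0 ≤ y)
    (hyX : y ≤ X) : |Real.exp (c * x) - Real.exp (c * y)| ≤
      |c| * Real.exp (|c| * X) * |x - y| := by
  have := Convex.norm_image_sub_le_of_norm_hasDerivWithin_le (𝕜 := ℝ) (s := Set.Icc 0 X)
    (f := fun x => Real.exp (c * x)) (f' := fun x => Real.exp (c * x) * c)
    (C := |c| * Real.exp (|c| * X)) (x := y) (y := x)
    (fun t _ => by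
      have h1 : HasDerivAt (fun x : ℝ => c * x) c t := by
        simpa using (hasDerivAt_id t).const_mul c
      exact h1.exp.hasDerivWithinAt)
    (fun t ht => by
      rw [norm_mul, Real.norm_eq_abs, Real.norm_eq_abs, Real.abs_exp, mul_comm]
      refine mul_le_mul_of_nonneg_left (Real.exp_le_exp.2 ?_) (abs_nonneg c)
      calc c * t ≤ |c| * t := mul_le_mul_of_nonneg_right (le_abs_self c) ht.1
        _ ≤ |c| * X := mul_le_mul_of_nonneg_left ht.2 (abs_nonneg c))
    (convex_Icc 0 X) ⟨hy, hyX⟩ ⟨hx, hxX⟩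
  simpa [Real.norm_eq_abs] using this

variable {E : Type*} [NormedAddCommGroup E] [NormedSpace ℂ E] [FiniteDimensional ℂ E]

/-- The sequence is nearly homogeneous with respect to `A`; an honest scaling relation appears only
for the power `A^p`, hence the iteration. -/
theorem exists_iterate_bound {q d : ℕ} (hq : 2 ≤ q) (β : ℕ) (A : E →L[ℂ] E) {V : ℕ → E} {K : ℝ}
    (hV1 : ∀ N : ℕ, ‖V (q * N) - (q : ℝ) ^ d • A (V N)‖ ≤ K * growth d β N) (j : ℕ) :
    ∃ C, 0 ≤ C ∧ ∀ N : ℕ, ‖V (q ^ j * N) - ((q : ℝ) ^ d) ^ j • (A ^ j) (V N)‖ ≤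
      C * growth d β N := by
  have hq1 : (1 : ℝ) ≤ q := by exact_mod_cast (by omega : 1 ≤ q)
  have hK : 0 ≤ K := nonneg_of_mul_nonneg_left ((norm_nonneg _).trans (hV1 0))
    (by linarith [one_le_growth d β (le_refl ((0 : ℕ) : ℝ)|>.trans_eq' (by simp))])
  induction j with
  | zero => exact ⟨0, le_rfl, fun N => by simp⟩
  | succ j ih =>
    obtain ⟨C, hC, h⟩ := ih
    have hqj : (1 : ℝ) ≤ (q : ℝ) ^ j := one_le_pow₀ hq1
    have hl := Real.log_nonneg hqj
    refine ⟨K * (((q : ℝ) ^ j) ^ (d - 1) * (1 + Real.log ((q : ℝ) ^ j)) ^ β) +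
      (q : ℝ) ^ d * (‖A‖ * C), by positivity, fun N => ?_⟩
    have hg0 : 0 ≤ growth d β N := zero_le_one.trans (one_le_growth d β (Nat.cast_nonneg _))
    have e1 := hV1 (q ^ j * N)
    have e2 : growth d β ((q ^ j * N : ℕ) : ℝ) ≤ ((q : ℝ) ^ j) ^ (d - 1) *
        (1 + Real.log ((q : ℝ) ^ j)) ^ β * growth d β N := by
      push_cast
      exact growth_mul_le d β hqj (Nat.cast_nonneg _)
    have e3 : V (q ^ (j + 1) * N) - ((q : ℝ) ^ d) ^ (j + 1) • (A ^ (j + 1)) (V N) =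
        (V (q * (q ^ j * N)) - (q : ℝ) ^ d • A (V (q ^ j * N))) + (q : ℝ) ^ d •
          A (V (q ^ j * N) - ((q : ℝ) ^ d) ^ j • (A ^ j) (V N)) := by
      have h4 : A (((q : ℝ) ^ d) ^ j • (A ^ j) (V N)) =
          ((q : ℝ) ^ d) ^ j • (A ^ (j + 1)) (V N) := by
        rw [pow_succ' A, ← Complex.coe_smul, map_smul, Complex.coe_smul]; rfl
      rw [map_sub, smul_sub, h4, smul_smul, pow_succ' ((q : ℝ) ^ d), pow_succ' q, mul_assoc q]
      abel
    rw [e3]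
    refine (norm_add_le _ _).trans ?_
    rw [norm_smul, Real.norm_of_nonneg (by positivity : (0 : ℝ) ≤ (q : ℝ) ^ d)]
    calc _ ≤ K * (((q : ℝ) ^ j) ^ (d - 1) * (1 + Real.log ((q : ℝ) ^ j)) ^ β * growth d β N) +
          (q : ℝ) ^ d * (‖A‖ * (C * growth d β N)) := by
          gcongr
          · exact e1.trans (by gcongr)
          · exact (A.le_opNorm _).trans (by gcongr; exact h N)
      _ = _ := by ring

/-- The asymptotic behaviour of a sequence which is nearly homogeneous with respect to an operator
whose eigenvalues of maximal modulus are semisimple `p`-th roots of unity. -/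
theorem exists_periodic_fluctuation [Nontrivial E] {q d p : ℕ} (hq : 2 ≤ q) (hd : 1 ≤ d)
    (hp : 0 < p) (β : ℕ) (A : E →L[ℂ] E)
    (hss : ∀ x, (A ^ p - 1) ((A ^ p - 1) x) = 0 → (A ^ p - 1) x = 0) {V : ℕ → E} {K : ℝ}
    (hV1 : ∀ N : ℕ, ‖V (q * N) - (q : ℝ) ^ d • A (V N)‖ ≤ K * growth d β N)
    (hV2 : ∀ N : ℕ, ‖V (N + 1) - V N‖ ≤ K * growth d β N) :
    ∃ Ψ : ℝ → E, Function.Periodic Ψ p ∧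
      (∀ α : NNReal, 0 < α → α < 1 → ∃ C : NNReal, HolderWith C α Ψ) ∧
      ∀ ξ : ℝ, ξ ≤ 1 → (∀ (z : ℂ) (x : E), x ≠ 0 → A x = z • x → z ^ p ≠ 1 →
          ‖z‖ < (q : ℝ) ^ (-ξ)) →
        ∃ C, ∀ N : ℕ, 1 ≤ N → ‖V N - (N : ℝ) ^ d • Ψ (Real.logb q N)‖ ≤
          C * ((N : ℝ) ^ ((d : ℝ) - ξ) * (1 + Real.log N) ^ β) := by
  have : CompleteSpace E := FiniteDimensional.complete ℂ E
  have hK : 0 ≤ K := nonneg_of_mul_nonneg_left ((norm_nonneg _).trans (hV2 0))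
    (by linarith [one_le_growth d β (le_refl ((0 : ℕ) : ℝ)|>.trans_eq' (by simp))])
  have hq0 : (0 : ℝ) < q := by exact_mod_cast (by omega : 0 < q)
  have hq1 : (1 : ℝ) < q := by exact_mod_cast (by omega : 1 < q)
  have hg0 : ∀ N : ℕ, 0 ≤ growth d β N := fun N =>
    zero_le_one.trans (one_le_growth d β (Nat.cast_nonneg _))
  obtain ⟨P, hP1, hP2, hP3, hP4⟩ := exists_spectral_projection A p hss
  have hreal : ∀ (B : E →L[ℂ] E) (c : ℝ) x, B (c • x) = c • B x := fun B c x => by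
    rw [← Complex.coe_smul, map_smul, Complex.coe_smul]
  have hPpow : ∀ (j : ℕ) x, P ((A ^ j) x) = (A ^ j) (P x) := by
    intro j
    induction j with
    | zero => intro x; rfl
    | succ j ih =>
      intro x
      rw [pow_succ']
      change P (A ((A ^ j) x)) = A ((A ^ j) (P x))
      rw [hP4, ih]
  -- On the range of `P` the power `A^p` is the identity, so `P (V N)` is nearly homogeneous under
  -- multiplication of `N` by `q^p`. This is where the period `p` comes from.
  set Q := q ^ p with hQ
  have hQ2 : 2 ≤ Q := hq.trans (Nat.le_self_pow hp.ne' q)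
  have hQq : (Q : ℝ) = (q : ℝ) ^ p := by rw [hQ]; push_cast; rfl
  obtain ⟨K₁, hK₁, hit⟩ := exists_iterate_bound hq β A hV1 p
  obtain ⟨G, hG1, ⟨C₂, hG2⟩, hG3⟩ := exists_homogeneous_limit (U := fun N => P (V N))
    (K := ‖P‖ * (K + K₁)) hQ2 hd β
    (fun N => by
      have h1 : P (V (Q * N)) - (Q : ℝ) ^ d • P (V N) =
          P (V (q ^ p * N) - ((q : ℝ) ^ d) ^ p • (A ^ p) (V N)) := by
        rw [map_sub, hreal, hPpow, hP1, hQq, ← pow_mul, ← pow_mul, mul_comm p d]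
      rw [h1]
      refine (P.le_opNorm _).trans ?_
      rw [mul_assoc]
      gcongr
      refine (hit N).trans ?_
      have := hg0 N
      gcongr
      linarith)
    (fun N => by
      rw [← map_sub]
      refine (P.le_opNorm _).trans ?_
      rw [mul_assoc]
      gcongr
      refine (hV2 N).trans ?_
      have := hg0 N
      gcongr
      linarith)
  set Ψ : ℝ → E := fun y => (((q : ℝ) ^ y) ^ d)⁻¹ • G ((q : ℝ) ^ y) with hΨ
  have hper : Function.Periodic Ψ p := by
    intro y
    simp only [hΨ]
    rw [Real.rpow_add hq0, Real.rpow_natCast, mul_comm, ← hQq, hG1 _ (by positivity), smul_smul,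
      mul_pow, mul_inv, mul_comm (((Q : ℝ) ^ d)⁻¹), mul_assoc, inv_mul_cancel₀, mul_one]
    have : (0 : ℝ) < Q := by exact_mod_cast (by omega : 0 < Q)
    positivity
  refine ⟨Ψ, hper, fun α hα hα1 => ?_, fun ξ hξ1 hev => ?_⟩
  · have hp' : (0 : ℝ) < p := by exact_mod_cast hp
    set c := Real.log q with hc
    have hc0 : 0 < c := Real.log_pos hq1
    set X := Real.exp (c * (2 * p)) with hX
    obtain ⟨C, hC, hhold⟩ := hG3 α (by exact_mod_cast hα) (by exact_mod_cast hα1) X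
      (Real.exp_nonneg _)
    have hα0 : (0 : ℝ) < α := by exact_mod_cast hα
    have hα1' : (α : ℝ) < 1 := by exact_mod_cast hα1
    set B := ‖G 0‖ + C * X ^ (α : ℝ) with hB
    have hGb : ∀ x, 0 ≤ x → x ≤ X → ‖G x‖ ≤ B := by
      intro x hx hxX
      have h1 := hhold x 0 hx hxX le_rfl (Real.exp_nonneg _)
      rw [sub_zero, abs_of_nonneg hx] at h1
      have h2 : C * x ^ (α : ℝ) ≤ C * X ^ (α : ℝ) := by gcongr
      calc ‖G x‖ = ‖G 0 + (G x - G 0)‖ := by congr 1; abel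
        _ ≤ _ := (norm_add_le _ _).trans (by rw [hB]; linarith)
    have hexp : ∀ y, (q : ℝ) ^ y = Real.exp (c * y) := fun y => Real.rpow_def_of_pos hq0 y
    have hexp' : ∀ y, (((q : ℝ) ^ y) ^ d)⁻¹ = Real.exp (-(d * c) * y) := fun y => by
      rw [hexp, ← Real.exp_nat_mul, ← Real.exp_neg]; congr 1; ring
    set L₁ := |c| * Real.exp (|c| * (2 * p)) with hL₁
    set L₂ := |-(d * c)| * Real.exp (|-(d * c)| * (2 * p)) with hL₂
    have hB0 : 0 ≤ B := by positivity
    refine ⟨_, holderWith_of_periodic hp' hper (C := C * L₁ ^ (α : ℝ) +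
      L₂ * (2 * p) ^ (1 - (α : ℝ)) * B) (by positivity) fun x y hx hxp hy hyp => ?_⟩
    have hqx : ∀ y : ℝ, 0 ≤ y → y ≤ 2 * p → (q : ℝ) ^ y ≤ X := fun y hy hyp => by
      rw [hexp]; exact Real.exp_le_exp.2 (by gcongr)
    have e1 : ‖G ((q : ℝ) ^ x) - G ((q : ℝ) ^ y)‖ ≤ C * (L₁ * |x - y|) ^ (α : ℝ) := by
      refine (hhold _ _ (by positivity) (hqx x hx hxp) (by positivity) (hqx y hy hyp)).trans ?_
      gcongr
      rw [hexp, hexp]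
      exact abs_exp_sub_exp_le c hx hxp hy hyp
    have e2 : |(((q : ℝ) ^ x) ^ d)⁻¹ - (((q : ℝ) ^ y) ^ d)⁻¹| ≤ L₂ * |x - y| := by
      rw [hexp', hexp']
      exact abs_exp_sub_exp_le _ hx hxp hy hyp
    have e3 : (((q : ℝ) ^ x) ^ d)⁻¹ ≤ 1 :=
      inv_le_one_of_one_le₀ (one_le_pow₀ (Real.one_le_rpow hq1.le hx))
    have e4 : |x - y| ≤ (2 * p) ^ (1 - (α : ℝ)) * |x - y| ^ (α : ℝ) := by
      rcases eq_or_lt_of_le (abs_nonneg (x - y)) with h0 | h0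
      · rw [← h0]; positivity
      · calc |x - y| = |x - y| ^ (1 - (α : ℝ)) * |x - y| ^ (α : ℝ) := by
              rw [← Real.rpow_add h0]; simp
          _ ≤ _ := by
              have : |x - y| ≤ 2 * p := abs_sub_le_iff.2 ⟨by linarith, by linarith⟩
              gcongr
    have e5 : Ψ x - Ψ y = (((q : ℝ) ^ x) ^ d)⁻¹ • (G ((q : ℝ) ^ x) - G ((q : ℝ) ^ y)) +
        ((((q : ℝ) ^ x) ^ d)⁻¹ - (((q : ℝ) ^ y) ^ d)⁻¹) • G ((q : ℝ) ^ y) := by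
      simp only [hΨ, smul_sub, sub_smul]; abel
    rw [e5]
    calc _ ≤ (((q : ℝ) ^ x) ^ d)⁻¹ * ‖G ((q : ℝ) ^ x) - G ((q : ℝ) ^ y)‖ +
          |(((q : ℝ) ^ x) ^ d)⁻¹ - (((q : ℝ) ^ y) ^ d)⁻¹| * ‖G ((q : ℝ) ^ y)‖ := by
          refine (norm_add_le _ _).trans (le_of_eq ?_)
          rw [norm_smul, norm_smul, Real.norm_of_nonneg (by positivity), Real.norm_eq_abs]
      _ ≤ 1 * (C * (L₁ * |x - y|) ^ (α : ℝ)) +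
          (L₂ * ((2 * p) ^ (1 - (α : ℝ)) * |x - y| ^ (α : ℝ))) * B := by
          refine add_le_add (mul_le_mul e3 e1 (norm_nonneg _) zero_le_one) (mul_le_mul
            (e2.trans (by gcongr)) (hGb _ (by positivity) (hqx y hy hyp)) (norm_nonneg _)
            (by positivity))
      _ = _ := by
          rw [Real.mul_rpow (by positivity) (abs_nonneg _)]; ring
  -- `R` is `A` on the kernel of `P` and zero on its range. An eigenvector of `R` for `z ≠ 0` lies
  -- in the kernel of `P`, while `z^p = 1` would put it into the range; so only the small
  -- eigenvalues remain.
  · set R : E →L[ℂ] E := A ∘L (1 - P) with hR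
    have hRapp : ∀ x, R x = A (x - P x) := fun x => rfl
    obtain ⟨C, hC⟩ := exists_le_of_contracted (R := R) (X := fun N => V N - P (V N))
      (K := ‖(1 - P : E →L[ℂ] E)‖ * ((q + 1) * K)) hq hd β hξ1
      (fun z x hx hz => by
        have hq' : (0 : ℝ) < (q : ℝ) ^ (-ξ) := by positivity
        by_cases hz0 : z = 0
        · rw [hz0, norm_zero]; exact hq'
        have hPx : P x = 0 := by
          have h1 : z • P x = 0 := by
            rw [← map_smul, ← hz, hRapp, hP4, map_sub, hP3, sub_self, map_zero]
          exact (smul_eq_zero.1 h1).resolve_left hz0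
        rw [hRapp, hPx, sub_zero] at hz
        refine hev z x hx hz fun hzp => hx ?_
        have h2 : ∀ j : ℕ, (A ^ j) x = z ^ j • x := by
          intro j
          induction j with
          | zero => simp
          | succ j ih =>
            rw [pow_succ']
            change A ((A ^ j) x) = _
            rw [ih, map_smul, hz, smul_smul, pow_succ]
        rw [← hP2 x (by rw [h2, hzp, one_smul]), hPx])
      (by positivity)
      (fun N => by
        have hdiv : q * (N / q) ≤ N := Nat.mul_div_le N q
        have hgm : Monotone fun N : ℕ => K * growth d β N := fun a b hab => by
          have := growth_mono d β (Nat.cast_nonneg (α := ℝ) a)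
            (by exact_mod_cast hab : (a : ℝ) ≤ b)
          dsimp only
          gcongr
        have h1 : ‖V N - V (q * (N / q))‖ ≤ q * (K * growth d β N) := by
          refine norm_sub_le_of_increments' hgm hV2 ?_ (by omega) le_rfl hdiv
          have := Nat.mod_lt N (by omega : 0 < q)
          have := Nat.div_add_mod N q
          omega
        have h2 : ‖V (q * (N / q)) - (q : ℝ) ^ d • A (V (N / q))‖ ≤ K * growth d β N :=
          (hV1 _).trans (hgm (Nat.div_le_self N q))
        have h3 : V N - P (V N) - (q : ℝ) ^ d • R (V (N / q) - P (V (N / q))) =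
            (1 - P : E →L[ℂ] E) (V N - (q : ℝ) ^ d • A (V (N / q))) := by
          have h4 : ∀ x, (1 - P : E →L[ℂ] E) x = x - P x := fun x => rfl
          rw [h4, hRapp, map_sub P, map_sub P, hP3, sub_self, sub_zero, hreal, hP4, map_sub A,
            smul_sub]
          abel
        rw [h3]
        refine ((1 - P : E →L[ℂ] E).le_opNorm _).trans ?_
        rw [mul_assoc]
        gcongr
        calc _ ≤ ‖V N - V (q * (N / q))‖ + ‖V (q * (N / q)) - (q : ℝ) ^ d • A (V (N / q))‖ :=
              norm_sub_le_norm_sub_add_norm_sub _ _ _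
          _ ≤ (q + 1) * K * growth d β N := by linarith)
    refine ⟨C + |C₂| * (2 ^ (d - 1) * 2 ^ β), fun N hN => ?_⟩
    have hN0 : (0 : ℝ) < N := by exact_mod_cast hN
    have e1 : (N : ℝ) ^ d • Ψ (Real.logb q N) = G N := by
      simp only [hΨ]
      rw [Real.rpow_logb hq0 hq1.ne' hN0, smul_smul, mul_inv_cancel₀ (by positivity), one_smul]
    have e2 := (hG2 N).trans (mul_le_mul_of_nonneg_right (le_abs_self C₂) (hg0 N))
    have e3 := growth_le_rpow_mul hd β hξ1 hN
    have e4 := hC N hN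
    rw [e1]
    calc ‖V N - G N‖ = ‖(V N - P (V N)) + (P (V N) - G N)‖ := by congr 1; abel
      _ ≤ _ := norm_add_le _ _
      _ ≤ C * ((N : ℝ) ^ ((d : ℝ) - ξ) * (1 + Real.log N) ^ β) + |C₂| * (2 ^ (d - 1) * 2 ^ β *
          ((N : ℝ) ^ ((d : ℝ) - ξ) * (1 + Real.log N) ^ β)) :=
          add_le_add e4 (e2.trans (by gcongr))
      _ = _ := by ring

end Scaling

/-! ### Boxes, uniform arguments and joint digit expansions -/

section Box

/-- The box `{0, …, N-1}^d`. -/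
def box (d N : ℕ) : Finset (Fin d → ℕ) := Fintype.piFinset fun _ => Finset.range N

variable {q d : ℕ}

theorem mem_box {N : ℕ} {n : Fin d → ℕ} : n ∈ box d N ↔ ∀ i, n i < N := by
  simp [box]

theorem card_box (N : ℕ) : (box d N).card = N ^ d := by simp [box]

theorem box_mono {M N : ℕ} (h : M ≤ N) : box d M ⊆ box d N := fun _ hn =>
  mem_box.2 fun i => (mem_box.1 hn i).trans_le h

theorem coe_box (N : ℕ) : (box d N : Set (Fin d → ℕ)) = {n | ∀ i, n i < N} := by
  ext n; simp [mem_box]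

theorem integral_unifBox {E : Type*} [NormedAddCommGroup E] [NormedSpace ℝ E] [CompleteSpace E]
    (N : ℕ) (f : (Fin d → ℕ) → E) : ∫ n, f n ∂(unifBox d N) = ((N : ℝ) ^ d)⁻¹ • ∑ n ∈ box d N, f n := by
  rw [unifBox, ← coe_box, uniformOn, ProbabilityTheory.cond, integral_smul_measure,
    setIntegral_finset, Measure.count_apply_finset, card_box]
  · simp
  · rw [← (box d N : Set (Fin d → ℕ)).biUnion_of_singleton]
    simp only [SetLike.mem_coe, integrableOn_finset_iUnion]
    simp

theorem unifBox_real {N : ℕ} (p : (Fin d → ℕ) → Prop) [DecidablePred p] :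
    (unifBox d N).real {n | p n} = ((N : ℝ) ^ d)⁻¹ * ∑ n ∈ box d N, if p n then 1 else 0 := by
  have hm : MeasurableSet {n | p n} := (Set.to_countable _).measurableSet
  have h1 := integral_unifBox N (Set.indicator {n | p n} (1 : (Fin d → ℕ) → ℝ))
  rw [integral_indicator_one hm] at h1
  rw [h1, smul_eq_mul]
  congr 1
  refine Finset.sum_congr rfl fun n _ => ?_
  simp [Set.indicator_apply]

theorem isProbabilityMeasure_unifBox {N : ℕ} (hN : 0 < N) :
    IsProbabilityMeasure (unifBox d N) := by
  refine isProbabilityMeasure_uniformOn ?_ ⟨0, fun _ => hN⟩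
  rw [← coe_box]
  exact Finset.finite_toSet _

/-- The vector `q * m + ε`. -/
def digitCons [NeZero q] (ε : Fin d → Fin q) (m : Fin d → ℕ) : Fin d → ℕ :=
  fun i => q * m i + ε i

variable [NeZero q]

theorem sum_box_mul {M : Type*} [AddCommMonoid M] (N : ℕ) (f : (Fin d → ℕ) → M) :
    ∑ n ∈ box d (q * N), f n = ∑ m ∈ box d N, ∑ ε : Fin d → Fin q, f (digitCons ε m) := by
  have hq := NeZero.pos q
  rw [← Finset.sum_product']
  refine Finset.sum_nbij' (fun n => (fun i => n i / q, fun i => Fin.ofNat q (n i)))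
    (fun x => digitCons x.2 x.1) ?_ ?_ ?_ ?_ ?_
  · intro n hn
    simp only [Finset.mem_product, Finset.mem_univ, and_true, mem_box]
    exact fun i => Nat.div_lt_of_lt_mul (mem_box.1 hn i)
  · rintro ⟨m, ε⟩ hx
    simp only [Finset.mem_product, Finset.mem_univ, and_true, mem_box] at hx
    refine mem_box.2 fun i => ?_
    have h1 := hx i
    have h2 := (ε i).2
    calc q * m i + ε i < q * m i + q := by omega
      _ = q * (m i + 1) := by ring
      _ ≤ q * N := Nat.mul_le_mul_left q h1
  · intro n _
    ext i
    simp [digitCons, Nat.div_add_mod]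
  · rintro ⟨m, ε⟩ _
    ext i
    · simp [digitCons, Nat.mul_add_div hq, Nat.div_eq_of_lt (ε i).2]
    · simp [digitCons, Nat.mod_eq_of_lt (ε i).2]
  · intro n _
    congr 1
    ext i
    simp [digitCons, Nat.div_add_mod]

/-- Zero is the only vector for which prepending a digit does not prolong the expansion, as leading
zeros are not written. -/
theorem digitCons_eq_zero {ε : Fin d → Fin q} {m : Fin d → ℕ} :
    digitCons ε m = 0 ↔ ε = 0 ∧ m = 0 := by
  have hq := NeZero.ne q
  simp only [funext_iff, digitCons, Pi.zero_apply, Nat.add_eq_zero_iff, mul_eq_zero, hq, false_or,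
    Fin.val_eq_zero_iff, forall_and]
  tauto

/-- The length of the joint expansion. -/
def jointLength (q : ℕ) (n : Fin d → ℕ) : ℕ := Finset.univ.sup fun i => (Nat.digits q (n i)).length

/-- A coordinate that is zero keeps the length zero, so the recursion may fail for single
coordinates, yet not for the maximum: either all expansions of `m` are empty and some nonzero
coordinate gets one digit, or a longest coordinate of `m` stays nonzero. -/
theorem jointLength_digitCons (hq : 2 ≤ q) {ε : Fin d → Fin q} {m : Fin d → ℕ}
    (h : digitCons ε m ≠ 0) : jointLength q (digitCons ε m) = jointLength q m + 1 := by
  have hlen : ∀ i, digitCons ε m i ≠ 0 → (Nat.digits q (digitCons ε m i)).length =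
      (Nat.digits q (m i)).length + 1 := by
    intro i hi
    rw [Nat.digits_def' (by omega) (Nat.pos_of_ne_zero hi), List.length_cons]
    congr 3
    simp [digitCons, Nat.mul_add_div (by omega : 0 < q), Nat.div_eq_of_lt (ε i).2]
  refine le_antisymm (Finset.sup_le fun i _ => ?_) ?_
  · by_cases hi : digitCons ε m i = 0
    · simp [hi]
    · rw [hlen i hi]
      exact Nat.succ_le_succ (Finset.le_sup (f := fun i => (Nat.digits q (m i)).length)
        (Finset.mem_univ i))
  · obtain ⟨i₁, hi₁⟩ := Function.ne_iff.1 h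
    obtain ⟨i₀, -, hi₀⟩ := Finset.exists_mem_eq_sup Finset.univ ⟨i₁, Finset.mem_univ i₁⟩
      (fun i => (Nat.digits q (m i)).length)
    rcases Nat.eq_zero_or_pos (jointLength q m) with h0 | hpos
    · rw [h0, zero_add]
      refine le_trans ?_ (Finset.le_sup (f := fun i => (Nat.digits q (digitCons ε m i)).length)
        (Finset.mem_univ i₁))
      rw [hlen i₁ hi₁]
      omega
    · have hne : digitCons ε m i₀ ≠ 0 := by
        intro h0
        have : m i₀ = 0 := by
          simp only [digitCons, Nat.add_eq_zero_iff, mul_eq_zero] at h0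
          omega
        rw [jointLength, hi₀, this] at hpos
        simp at hpos
      refine le_trans ?_ (Finset.le_sup (f := fun i => (Nat.digits q (digitCons ε m i)).length)
        (Finset.mem_univ i₀))
      rw [hlen i₀ hne, jointLength, hi₀]

theorem jointDigits_digitCons (hq : 2 ≤ q) {ε : Fin d → Fin q} {m : Fin d → ℕ}
    (h : digitCons ε m ≠ 0) : jointDigits q (digitCons ε m) = ε :: jointDigits q m := by
  have h1 := jointLength_digitCons hq h
  simp only [jointLength] at h1
  simp only [jointDigits]
  rw [h1, List.range_succ_eq_map, List.map_cons, List.map_map]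
  congr 1
  · ext i
    simp [digitCons, Nat.mod_eq_of_lt (ε i).2]
  · refine List.map_congr_left fun k _ => ?_
    ext i
    simp only [Function.comp, digitCons, Nat.succ_eq_add_one, pow_succ']
    rw [← Nat.div_div_eq_div_mul, Nat.mul_add_div (by omega : 0 < q), Nat.div_eq_of_lt (ε i).2,
      add_zero]

theorem length_jointDigits (n : Fin d → ℕ) : (jointDigits q n).length = jointLength q n := by
  simp [jointDigits, jointLength]

theorem jointLength_le (hq : 2 ≤ q) {N k : ℕ} {n : Fin d → ℕ} (hn : n ∈ box d N) (hN : N ≤ q ^ k) :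
    jointLength q n ≤ k :=
  Finset.sup_le fun i _ => (Nat.digits_length_le_iff (by omega) _).2 ((mem_box.1 hn i).trans_le hN)

end Box

/-! ### Output sums from arbitrary states, logarithmic bounds, and formulas for mean and variance -/

namespace Transducer

variable {q d : ℕ} {S : Type*} (T : Transducer q d S) [NeZero q]

/-- The output sum when the joint expansion of `n` is read from the state `s`. -/
def valueFrom (s : S) (n : Fin d → ℕ) : ℝ := T.outputSum s (jointDigits q n)

theorem value_eq_valueFrom (n : Fin d → ℕ) : T.value n = T.valueFrom T.init n := rfl

variable {T}

theorem valueFrom_digitCons (hq : 2 ≤ q) {ε : Fin d → Fin q} {m : Fin d → ℕ}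
    (h : digitCons ε m ≠ 0) (s : S) :
    T.valueFrom s (digitCons ε m) = T.out s ε + T.valueFrom (T.next s ε) m := by
  rw [valueFrom, jointDigits_digitCons hq h, outputSum, valueFrom]

variable [Fintype S]

variable (T) in
/-- A bound for all output labels. -/
def outBound : ℝ := (∑ s, ∑ ε, |T.out s ε|) + ∑ s, |T.final s|

theorem outBound_nonneg : 0 ≤ T.outBound := by
  unfold outBound; positivity

theorem abs_out_le (s : S) (ε : Fin d → Fin q) : |T.out s ε| ≤ T.outBound := by
  have h1 := Finset.single_le_sum (f := fun ε => |T.out s ε|) (fun _ _ => abs_nonneg _)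
    (Finset.mem_univ ε)
  have h2 := Finset.single_le_sum (f := fun s => ∑ ε, |T.out s ε|)
    (fun _ _ => Finset.sum_nonneg fun _ _ => abs_nonneg _) (Finset.mem_univ s)
  have h3 : 0 ≤ ∑ s, |T.final s| := by positivity
  simp only [outBound] at *
  linarith

theorem abs_final_le (s : S) : |T.final s| ≤ T.outBound := by
  have h2 := Finset.single_le_sum (f := fun s => |T.final s|) (fun _ _ => abs_nonneg _)
    (Finset.mem_univ s)
  have h3 : 0 ≤ ∑ s, ∑ ε, |T.out s ε| := by positivity
  simp only [outBound] at *
  linarith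

theorem abs_outputSum_le (w : List (Fin d → Fin q)) (s : S) :
    |T.outputSum s w| ≤ T.outBound * (w.length + 1) := by
  induction w generalizing s with
  | nil => simpa [outputSum] using abs_final_le s
  | cons ε w ih =>
    rw [outputSum, List.length_cons]
    push_cast
    calc |T.out s ε + T.outputSum (T.next s ε) w| ≤ T.outBound + T.outBound * (w.length + 1) :=
          (abs_add_le _ _).trans (add_le_add (abs_out_le s ε) (ih _))
      _ = _ := by ring

theorem abs_valueFrom_le (s : S) (n : Fin d → ℕ) :
    |T.valueFrom s n| ≤ T.outBound * (jointLength q n + 1) := by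
  rw [← length_jointDigits]; exact abs_outputSum_le _ s

/-- The box has side `N + 1` so that the bound is meaningful from `N = 0` on. -/
theorem abs_valueFrom_le_log (hq : 2 ≤ q) (s : S) {N : ℕ} {n : Fin d → ℕ}
    (hn : n ∈ box d (N + 1)) :
    |T.valueFrom s n| ≤ 4 * T.outBound * (1 + Real.log (N + 1)) := by
  have hlen : jointLength q n ≤ Nat.log q (N + 1) + 1 :=
    jointLength_le hq hn (Nat.lt_pow_succ_log_self (by omega) _).le
  have h1 : (Nat.log q (N + 1) : ℝ) ≤ 2 * Real.log (N + 1) := by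
    have h2 : (q : ℝ) ^ Nat.log q (N + 1) ≤ N + 1 := by
      exact_mod_cast Nat.pow_log_le_self q (by omega)
    have hq2 : Real.log 2 ≤ Real.log q := Real.log_le_log (by norm_num) (by exact_mod_cast hq)
    have h3 : (Nat.log q (N + 1) : ℝ) * Real.log q ≤ Real.log (N + 1) := by
      rw [← Real.log_pow]
      refine Real.log_le_log ?_ h2
      have : (0 : ℝ) < q := by exact_mod_cast (by omega : 0 < q)
      positivity
    have := Real.log_two_gt_d9
    nlinarith [Nat.cast_nonneg (α := ℝ) (Nat.log q (N + 1))]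
  have hlog : 0 ≤ Real.log ((N : ℝ) + 1) := Real.log_nonneg (by simp)
  have hB := T.outBound_nonneg
  have hlen' : (jointLength q n : ℝ) ≤ Nat.log q (N + 1) + 1 := by exact_mod_cast hlen
  refine (abs_valueFrom_le s n).trans ?_
  calc T.outBound * (jointLength q n + 1) ≤ T.outBound * (4 * (1 + Real.log (N + 1))) := by
        gcongr; linarith
    _ = _ := by ring

theorem mean_eq (N : ℕ) : T.mean N = ((N : ℝ) ^ d)⁻¹ * ∑ n ∈ box d N, T.valueFrom T.init n := by
  rw [mean, integral_unifBox, smul_eq_mul]; rfl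

theorem var_eq (N : ℕ) : T.var N = ((N : ℝ) ^ d)⁻¹ *
    ∑ n ∈ box d N, (T.valueFrom T.init n - T.mean N) ^ 2 := by
  rw [var, variance_eq_integral (measurable_of_countable _).aemeasurable, integral_unifBox,
    smul_eq_mul]
  rfl

/-- The variance in terms of the second moment about an arbitrary point. -/
theorem var_eq_sub {N : ℕ} (hN : 0 < N) (c : ℝ) : T.var N = ((N : ℝ) ^ d)⁻¹ *
    ∑ n ∈ box d N, (T.valueFrom T.init n - c) ^ 2 - (T.mean N - c) ^ 2 := by
  have hNd : ((N : ℝ) ^ d) ≠ 0 := by positivity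
  have h1 : ∑ n ∈ box d N, (T.valueFrom T.init n - T.mean N) ^ 2 =
      ∑ n ∈ box d N, (T.valueFrom T.init n - c) ^ 2 -
        2 * (T.mean N - c) * (∑ n ∈ box d N, T.valueFrom T.init n) +
        (T.mean N ^ 2 - c ^ 2) * (N : ℝ) ^ d := by
    have h2 : ((N : ℝ) ^ d) = ∑ n ∈ box d N, (1 : ℝ) := by
      rw [Finset.sum_const, card_box]; simp
    rw [h2, Finset.mul_sum, Finset.mul_sum, ← Finset.sum_sub_distrib, ← Finset.sum_add_distrib]
    refine Finset.sum_congr rfl fun n _ => by ring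
  have h3 : ∑ n ∈ box d N, T.valueFrom T.init n = (N : ℝ) ^ d * T.mean N := by
    rw [mean_eq, ← mul_assoc, mul_inv_cancel₀ hNd, one_mul]
  rw [var_eq, h1, h3]
  field_simp
  ring

end Transducer

/-! ### Changes of the logarithm and of box sums from `N` to `N + 1` -/

section Increments

theorem abs_logb_succ_sub_le {q : ℕ} (hq : 2 ≤ q) (N : ℕ) :
    |Real.logb q ((N + 1 : ℕ) : ℝ) - Real.logb q N| ≤ 4 / (N + 1) := by
  -- For `N = 0` both logarithms are zero, the second by convention. For `N ≥ 1` the constant comes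
  -- from `1 / N ≤ 2 / (N + 1)` and `log q ≥ 1/2`.
  rcases Nat.eq_zero_or_pos N with rfl | hN
  · simp
  have hN0 : (0 : ℝ) < N := by exact_mod_cast hN
  have hN1 : (1 : ℝ) ≤ N := by exact_mod_cast hN
  have hq2 : Real.log 2 ≤ Real.log q := Real.log_le_log (by norm_num) (by exact_mod_cast hq)
  have hl : (1 / 2 : ℝ) ≤ Real.log q := by linarith [Real.log_two_gt_d9]
  have h1 : Real.log ((N + 1 : ℕ) : ℝ) - Real.log N ≤ 1 / N := by
    rw [← Real.log_div (by positivity) hN0.ne']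
    refine (Real.log_le_sub_one_of_pos (by positivity)).trans (le_of_eq ?_)
    push_cast
    field_simp
    ring
  have h0 : 0 ≤ Real.log ((N + 1 : ℕ) : ℝ) - Real.log N :=
    sub_nonneg.2 (Real.log_le_log hN0 (by push_cast; linarith))
  rw [Real.logb, Real.logb, ← sub_div, abs_of_nonneg (by positivity), div_le_iff₀ (by linarith)]
  refine h1.trans ?_
  calc 1 / (N : ℝ) ≤ 2 / (N + 1) := by
        rw [div_le_div_iff₀ hN0 (by positivity)]; linarith
    _ = 4 / (N + 1) * (1 / 2) := by ring
    _ ≤ _ := by gcongr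

theorem abs_logb_le {q : ℕ} (hq : 2 ≤ q) (N : ℕ) :
    |Real.logb q N| ≤ 2 * (1 + Real.log (N + 1)) := by
  have hq2 : Real.log 2 ≤ Real.log q := Real.log_le_log (by norm_num) (by exact_mod_cast hq)
  have hl : (1 / 2 : ℝ) ≤ Real.log q := by linarith [Real.log_two_gt_d9]
  have h0 : 0 ≤ Real.log N := Real.log_natCast_nonneg N
  have h1 : Real.log N ≤ Real.log (N + 1) := by
    rcases Nat.eq_zero_or_pos N with rfl | hN
    · simp
    · exact Real.log_le_log (by exact_mod_cast hN) (by linarith)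
  rw [Real.logb, abs_of_nonneg (by positivity), div_le_iff₀ (by linarith)]
  nlinarith

theorem succ_pow_sub_pow_le {d : ℕ} (N : ℕ) :
    ((N : ℝ) + 1) ^ d - (N : ℝ) ^ d ≤ d * ((N : ℝ) + 1) ^ (d - 1) := by
  induction d with
  | zero => simp
  | succ d ih =>
    rcases Nat.eq_zero_or_pos d with rfl | hd
    · simp
    have h1 : ((N : ℝ) + 1) ^ d = ((N : ℝ) + 1) * ((N : ℝ) + 1) ^ (d - 1) := by
      rw [← pow_succ']; congr 1; omega
    have h2 : (N : ℝ) ^ d ≤ ((N : ℝ) + 1) ^ d := by gcongr; linarith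
    have h3 : (0 : ℝ) ≤ ((N : ℝ) + 1) ^ (d - 1) := by positivity
    have hN : (0 : ℝ) ≤ N := Nat.cast_nonneg N
    rw [pow_succ, pow_succ, add_tsub_cancel_right]
    push_cast
    have h4 := mul_le_mul_of_nonneg_left ih hN
    have h5 : (N : ℝ) * (d * ((N : ℝ) + 1) ^ (d - 1)) ≤ d * ((N : ℝ) + 1) ^ d := by
      rw [h1]
      nlinarith [mul_nonneg (Nat.cast_nonneg (α := ℝ) d) h3]
    nlinarith

/-- Sums over consecutive boxes of slowly varying functions differ only slightly. -/
theorem abs_sum_box_succ_sub_le {d : ℕ} {f : ℕ → (Fin d → ℕ) → ℝ} {N : ℕ} {a b : ℝ}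
    (ha : ∀ n ∈ box d (N + 1), |f (N + 1) n| ≤ a)
    (hb : ∀ n ∈ box d N, |f (N + 1) n - f N n| ≤ b) :
    |∑ n ∈ box d (N + 1), f (N + 1) n - ∑ n ∈ box d N, f N n| ≤
      d * ((N : ℝ) + 1) ^ (d - 1) * a + (N : ℝ) ^ d * b := by
  have hsub : box d N ⊆ box d (N + 1) := box_mono (Nat.le_succ N)
  have ha0 : 0 ≤ a := (abs_nonneg _).trans (ha 0 (mem_box.2 fun _ => Nat.succ_pos N))
  rw [← Finset.sum_sdiff hsub, add_sub_assoc, ← Finset.sum_sub_distrib]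
  refine (abs_add_le _ _).trans (add_le_add ?_ ?_)
  · refine (Finset.abs_sum_le_sum_abs _ _).trans ((Finset.sum_le_card_nsmul _ _ a fun n hn =>
      ha n (Finset.mem_sdiff.1 hn).1).trans ?_)
    rw [nsmul_eq_mul]
    refine mul_le_mul_of_nonneg_right ?_ ha0
    rw [Finset.card_sdiff_of_subset hsub, card_box, card_box,
      Nat.cast_sub (Nat.pow_le_pow_left (Nat.le_succ N) d)]
    push_cast
    exact succ_pow_sub_pow_le N
  · refine (Finset.abs_sum_le_sum_abs _ _).trans ((Finset.sum_le_card_nsmul _ _ b hb).trans ?_)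
    rw [nsmul_eq_mul, card_box]
    push_cast
    exact le_rfl

/-- The `O(N^(d-1))` new points count with the full size of the summand; the `N^d` old points count
only with its change, which is smaller by a factor `N + 1`. -/
theorem abs_sum_box_succ_sub_le_growth {d : ℕ} (hd : 1 ≤ d) {β : ℕ} {f : ℕ → (Fin d → ℕ) → ℝ}
    {N : ℕ} {C : ℝ} (ha : ∀ n ∈ box d (N + 1), |f (N + 1) n| ≤ C * (1 + Real.log (N + 1)) ^ β)
    (hb : ∀ n ∈ box d N, |f (N + 1) n - f N n| ≤ C * (1 + Real.log (N + 1)) ^ β / (N + 1)) :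
    |∑ n ∈ box d (N + 1), f (N + 1) n - ∑ n ∈ box d N, f N n| ≤
      (d + 1) * C * growth d β N := by
  refine (abs_sum_box_succ_sub_le ha hb).trans ?_
  have h0 : 0 ≤ C * (1 + Real.log (N + 1)) ^ β :=
    (abs_nonneg _).trans (ha 0 (mem_box.2 fun _ => Nat.succ_pos N))
  have h1 : (N : ℝ) ^ d ≤ ((N : ℝ) + 1) ^ (d - 1) * (N + 1) := by
    rw [← pow_succ, Nat.sub_add_cancel hd]; gcongr; linarith
  have h2 : (N : ℝ) ^ d * (C * (1 + Real.log (N + 1)) ^ β / (N + 1)) ≤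
      ((N : ℝ) + 1) ^ (d - 1) * (C * (1 + Real.log (N + 1)) ^ β) := by
    rw [mul_div_assoc', div_le_iff₀ (by positivity)]
    calc (N : ℝ) ^ d * (C * (1 + Real.log (N + 1)) ^ β) ≤
        ((N : ℝ) + 1) ^ (d - 1) * (N + 1) * (C * (1 + Real.log (N + 1)) ^ β) := by gcongr
      _ = _ := by ring
  unfold growth
  nlinarith

end Increments

/-! ### First moments and the expected value -/

namespace Transducer

open scoped BigOperators

variable {q d : ℕ} {S : Type*} {T : Transducer q d S} [NeZero q]

/-- The sum of a function of the values over a box, in terms of the values after one step; the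
summand for `0` needs a correction, as there are no leading zeros. -/
theorem sum_box_mul_valueFrom {E : Type*} [AddCommGroup E] (hq : 2 ≤ q) {N : ℕ} (hN : 1 ≤ N) (s : S)
    (F : ℝ → E) :
    ∑ n ∈ box d (q * N), F (T.valueFrom s n) =
      (∑ m ∈ box d N, ∑ ε, F (T.out s ε + T.valueFrom (T.next s ε) m)) +
        (F (T.valueFrom s 0) - F (T.out s 0 + T.valueFrom (T.next s 0) 0)) := by
  rw [sum_box_mul, ← sub_eq_iff_eq_add', ← Finset.sum_sub_distrib]
  have h0 : (0 : Fin d → ℕ) ∈ box d N := mem_box.2 fun _ => hN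
  have hz : digitCons (0 : Fin d → Fin q) (0 : Fin d → ℕ) = 0 := digitCons_eq_zero.2 ⟨rfl, rfl⟩
  -- The digit recursion fails only if both the digit vector and the remaining vector vanish, so a
  -- single term survives in the difference.
  rw [Finset.sum_eq_single_of_mem 0 h0, ← Finset.sum_sub_distrib,
    Finset.sum_eq_single_of_mem 0 (Finset.mem_univ _), hz]
  · intro ε _ hε
    rw [valueFrom_digitCons hq (fun h => hε (digitCons_eq_zero.1 h).1), sub_self]
  · intro m _ hm
    rw [← Finset.sum_sub_distrib]
    refine Finset.sum_eq_zero fun ε _ => ?_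
    rw [valueFrom_digitCons hq (fun h => hm (digitCons_eq_zero.1 h).2), sub_self]

theorem valueFrom_zero_bound [Fintype S] (s : S) : |T.valueFrom s 0| ≤ T.outBound := by
  have h : jointLength q (0 : Fin d → ℕ) = 0 := by
    simp [jointLength]
  have := abs_valueFrom_le (T := T) s 0
  rw [h] at this
  simpa using this

theorem sum_eq_expect (f : (Fin d → Fin q) → ℝ) : ∑ ε, f ε = (q : ℝ) ^ d * 𝔼 ε, f ε := by
  rw [Fintype.expect_eq_sum_div_card]
  have : ((Fintype.card (Fin d → Fin q) : ℕ) : ℝ) = (q : ℝ) ^ d := by simp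
  have hq : (q : ℝ) ≠ 0 := by exact_mod_cast NeZero.ne q
  rw [this]
  field_simp

variable [Fintype S]

/-- The first moments of the values, centred. -/
def moment₁ (T : Transducer q d S) (u H : S → ℝ) (N : ℕ) (s : S) : ℝ :=
  ∑ n ∈ box d N, (T.valueFrom s n - H s - u s * Real.logb q N)

theorem logb_mul_self (hq : 2 ≤ q) {N : ℕ} (hN : 1 ≤ N) :
    Real.logb q ((q * N : ℕ) : ℝ) = Real.logb q N + 1 := by
  have hq1 : (1 : ℝ) < q := by exact_mod_cast hq
  have hN0 : (N : ℝ) ≠ 0 := by exact_mod_cast (by omega : N ≠ 0)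
  push_cast
  rw [Real.logb_mul (by linarith) hN0, Real.logb_self_eq_one hq1, add_comm]

theorem moment₁_zero (hd : 1 ≤ d) (u H : S → ℝ) (s : S) : T.moment₁ u H 0 s = 0 := by
  have : box d 0 = ∅ := by
    rw [← Finset.card_eq_zero, card_box]; exact zero_pow (by omega)
  simp [moment₁, this]

/-- One more digit raises `log_q N` by one, which absorbs the drift `u`, while `H` absorbs the
coboundary in the mean output. The recursion is therefore exact except for the correction at `n =
0`. -/
theorem moment₁_mul (hq : 2 ≤ q) {u H : S → ℝ} (hu : ∀ s, 𝔼 ε, u (T.next s ε) = u s)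
    (hH : ∀ s, 𝔼 ε, T.out s ε = u s + H s - 𝔼 ε, H (T.next s ε)) {N : ℕ} (hN : 1 ≤ N) (s : S) :
    T.moment₁ u H (q * N) s = (q : ℝ) ^ d * (𝔼 ε, T.moment₁ u H N (T.next s ε)) +
      (T.valueFrom s 0 - (T.out s 0 + T.valueFrom (T.next s 0) 0)) := by
  have h1 := sum_box_mul_valueFrom (T := T) hq hN s
    (fun x => x - H s - u s * Real.logb q ((q * N : ℕ) : ℝ))
  rw [moment₁, h1, logb_mul_self hq hN, ← sum_eq_expect]
  simp only [moment₁]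
  congr 1
  swap
  · ring
  rw [Finset.sum_comm, ← sub_eq_zero, ← Finset.sum_sub_distrib]
  simp_rw [← Finset.sum_sub_distrib]
  set l := Real.logb q (N : ℝ)
  have h2 : ∀ (ε : Fin d → Fin q) (m : Fin d → ℕ),
      T.out s ε + T.valueFrom (T.next s ε) m - H s - u s * (l + 1) -
        (T.valueFrom (T.next s ε) m - H (T.next s ε) - u (T.next s ε) * l) =
      (T.out s ε + H (T.next s ε) + u (T.next s ε) * l) - (H s + u s * (l + 1)) := by
    intro ε m; ring
  simp_rw [h2]
  rw [Finset.sum_comm]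
  refine Finset.sum_eq_zero fun m _ => ?_
  rw [sum_eq_expect, Finset.expect_sub_distrib, Finset.expect_add_distrib,
    Finset.expect_add_distrib, ← Finset.expect_mul, hu, hH, Finset.expect_const
    Finset.univ_nonempty]
  ring

theorem exists_abs_le (f : S → ℝ) : ∃ C, 0 ≤ C ∧ ∀ s, |f s| ≤ C :=
  ⟨∑ s, |f s|, by positivity, fun s => Finset.single_le_sum (f := fun s => |f s|)
    (fun _ _ => abs_nonneg _) (Finset.mem_univ s)⟩

theorem exists_centred_bound (hq : 2 ≤ q) (u H : S → ℝ) : ∃ C, 0 ≤ C ∧ ∀ (N : ℕ) (s : S),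
    ∀ n ∈ box d (N + 1), |T.valueFrom s n - H s - u s * Real.logb q ((N + 1 : ℕ) : ℝ)| ≤
      C * (1 + Real.log (N + 1)) ∧
    |T.valueFrom s n - H s - u s * Real.logb q (N : ℝ)| ≤ C * (1 + Real.log (N + 1)) := by
  obtain ⟨Cu, hCu, hu⟩ := exists_abs_le u
  obtain ⟨CH, hCH, hH⟩ := exists_abs_le H
  have hB := T.outBound_nonneg
  refine ⟨4 * T.outBound + CH + Cu * 4, by positivity, fun N s n hn => ?_⟩
  have hlog := one_le_one_add_log (Nat.cast_nonneg (α := ℝ) N)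
  have h1 := abs_valueFrom_le_log hq s hn (T := T)
  have h2 := abs_logb_le hq N
  have h3 : |Real.logb q ((N + 1 : ℕ) : ℝ)| ≤ 4 * (1 + Real.log (N + 1)) := by
    refine (abs_logb_le hq (N + 1)).trans ?_
    have : Real.log (((N + 1 : ℕ) : ℝ) + 1) ≤ Real.log (N + 1) + 1 := by
      calc Real.log (((N + 1 : ℕ) : ℝ) + 1) ≤ Real.log (2 * (N + 1)) := by
            refine Real.log_le_log (by positivity) ?_
            push_cast; linarith [Nat.cast_nonneg (α := ℝ) N]
        _ = Real.log 2 + Real.log (N + 1) := Real.log_mul (by norm_num) (by positivity)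
        _ ≤ _ := by linarith [Real.log_two_lt_d9]
    linarith
  have key : ∀ l : ℝ, |l| ≤ 4 * (1 + Real.log (N + 1)) →
      |T.valueFrom s n - H s - u s * l| ≤ (4 * T.outBound + CH + Cu * 4) * (1 + Real.log (N + 1)) := by
    intro l hl
    calc |T.valueFrom s n - H s - u s * l| ≤ |T.valueFrom s n| + |H s| + |u s| * |l| := by
          rw [← abs_mul]
          exact (abs_sub _ _).trans (add_le_add_left (abs_sub _ _) _)
      _ ≤ 4 * T.outBound * (1 + Real.log (N + 1)) + CH * (1 + Real.log (N + 1)) +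
          Cu * (4 * (1 + Real.log (N + 1))) := by
          gcongr
          · exact (hH s).trans (le_mul_of_one_le_right hCH hlog)
          · exact hu s
      _ = _ := by ring
  exact ⟨key _ h3, key _ (h2.trans (by linarith))⟩

theorem exists_moment₁_increment (hq : 2 ≤ q) (hd : 1 ≤ d) (u H : S → ℝ) : ∃ C, 0 ≤ C ∧
    ∀ (N : ℕ) (s : S), |T.moment₁ u H (N + 1) s - T.moment₁ u H N s| ≤ C * growth d 1 N := by
  obtain ⟨Cu, hCu, hu⟩ := exists_abs_le u
  obtain ⟨C, hC, h⟩ := exists_centred_bound (T := T) hq u H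
  refine ⟨(d + 1) * (C + Cu * 4), by positivity, fun N s => ?_⟩
  have hlog := one_le_one_add_log (Nat.cast_nonneg (α := ℝ) N)
  refine abs_sum_box_succ_sub_le_growth hd (f := fun N n =>
    T.valueFrom s n - H s - u s * Real.logb q N) (fun n hn => ?_) fun n hn => ?_
  · rw [pow_one]
    refine (h N s n hn).1.trans ?_
    gcongr
    have : 0 ≤ Cu * 4 := by positivity
    linarith
  · rw [pow_one]
    have h1 : T.valueFrom s n - H s - u s * Real.logb q ((N + 1 : ℕ) : ℝ) -
        (T.valueFrom s n - H s - u s * Real.logb q N) =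
        -(u s * (Real.logb q ((N + 1 : ℕ) : ℝ) - Real.logb q N)) := by ring
    rw [h1, abs_neg, abs_mul]
    calc |u s| * |Real.logb q ((N + 1 : ℕ) : ℝ) - Real.logb q N| ≤ Cu * (4 / (N + 1)) := by
          gcongr
          · exact hu s
          · exact abs_logb_succ_sub_le hq N
      _ = Cu * 4 * 1 / (N + 1) := by ring
      _ ≤ (C + Cu * 4) * (1 + Real.log (N + 1)) / (N + 1) := by
          gcongr
          linarith

end Transducer

namespace Transducer

open scoped BigOperators

variable {q d : ℕ} {S : Type*} {T : Transducer q d S} [NeZero q] [Fintype S]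

theorem stepAvg_ofReal (f : S → ℝ) (s : S) :
    stepAvg ℂ T.next (fun s => (f s : ℂ)) s = ((𝔼 ε, f (T.next s ε) : ℝ) : ℂ) := by
  rw [stepAvg_apply, Fintype.expect_eq_sum_div_card, Fintype.expect_eq_sum_div_card]
  push_cast
  rfl

variable (T) in
/-- The averaging operator of the transducer. -/
def avgOp : (S → ℂ) →L[ℂ] (S → ℂ) := LinearMap.toContinuousLinearMap (stepAvg ℂ T.next)

theorem avgOp_apply (f : S → ℂ) : T.avgOp f = stepAvg ℂ T.next f := rfl

theorem avgOp_pow_apply (k : ℕ) (f : S → ℂ) : (T.avgOp ^ k) f = (stepAvg ℂ T.next ^ k) f := by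
  induction k with
  | zero => rfl
  | succ k ih =>
    rw [pow_succ', pow_succ']
    change T.avgOp ((T.avgOp ^ k) f) = stepAvg ℂ T.next ((stepAvg ℂ T.next ^ k) f)
    rw [ih, avgOp_apply]

/-- The powers of `P` are contractions, so `1` is a semisimple eigenvalue of each power of `P`. -/
theorem avgOp_pow_eq_self {p : ℕ} {x : S → ℂ}
    (h : (T.avgOp ^ p - 1) ((T.avgOp ^ p - 1) x) = 0) : (T.avgOp ^ p - 1) x = 0 := by
  have happ : ∀ y, (T.avgOp ^ p - 1) y = (stepAvg ℂ T.next ^ p) y - y := fun y => by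
    rw [← avgOp_pow_apply]; rfl
  rw [happ, happ, sub_eq_zero] at h
  rw [happ, sub_eq_zero]
  refine eq_of_orbit_bounded _ x ‖x‖ (fun k => ?_) h
  rw [← pow_mul]
  exact norm_stepAvg_pow_le T.next _ x

theorem norm_le_of_forall_abs_le {f : S → ℝ} {C : ℝ} (hC : 0 ≤ C) (h : ∀ s, |f s| ≤ C) :
    ‖(fun s => (f s : ℂ))‖ ≤ C :=
  (pi_norm_le_iff_of_nonneg hC).2 fun s => by simpa using h s

end Transducer

theorem isBigO_of_le_rpow_mul {d : ℕ} {ξ C : ℝ} {β : ℕ} {f : ℕ → ℝ}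
    (h : ∀ N : ℕ, 1 ≤ N → |(N : ℝ) ^ d * f N| ≤
      C * ((N : ℝ) ^ ((d : ℝ) - ξ) * (1 + Real.log N) ^ β)) :
    f =O[atTop] fun N : ℕ => (N : ℝ) ^ (-ξ) * Real.log N ^ β := by
  refine Asymptotics.IsBigO.of_bound (|C| * 2 ^ β) ?_
  filter_upwards [eventually_ge_atTop 3] with N hN
  have hN0 : (0 : ℝ) < N := by exact_mod_cast (by omega : 0 < N)
  have hlog : 1 ≤ Real.log N := by
    rw [← Real.log_exp 1]
    refine Real.log_le_log (Real.exp_pos 1) ?_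
    have : (3 : ℝ) ≤ N := by exact_mod_cast hN
    linarith [Real.exp_one_lt_d9]
  have h1 := h N (by omega)
  rw [abs_mul, abs_of_pos (by positivity : (0 : ℝ) < (N : ℝ) ^ d)] at h1
  have h2 : (N : ℝ) ^ ((d : ℝ) - ξ) = (N : ℝ) ^ d * (N : ℝ) ^ (-ξ) := by
    rw [sub_eq_add_neg, Real.rpow_add hN0, Real.rpow_natCast]
  rw [h2] at h1
  have h3 : |f N| ≤ C * ((N : ℝ) ^ (-ξ) * (1 + Real.log N) ^ β) := by
    refine le_of_mul_le_mul_left (h1.trans (le_of_eq ?_)) (by positivity : (0 : ℝ) < (N : ℝ) ^ d)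
    ring
  rw [Real.norm_eq_abs, Real.norm_of_nonneg (by positivity)]
  calc |f N| ≤ |C| * ((N : ℝ) ^ (-ξ) * (2 * Real.log N) ^ β) := by
        refine h3.trans ?_
        gcongr
        · exact le_abs_self C
        · linarith
    _ = _ := by rw [mul_pow]; ring

namespace Transducer

open scoped BigOperators

variable {q d : ℕ} {S : Type*} {T : Transducer q d S} [NeZero q] [Fintype S]

theorem exists_moment₁_mul_bound (hq : 2 ≤ q) (hd : 1 ≤ d) {u H : S → ℝ}
    (hu : ∀ s, 𝔼 ε, u (T.next s ε) = u s)
    (hH : ∀ s, 𝔼 ε, T.out s ε = u s + H s - 𝔼 ε, H (T.next s ε)) (N : ℕ) (s : S) :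
    |T.moment₁ u H (q * N) s - (q : ℝ) ^ d * 𝔼 ε, T.moment₁ u H N (T.next s ε)| ≤
      3 * T.outBound := by
  rcases Nat.eq_zero_or_pos N with rfl | hN
  · rw [mul_zero, moment₁_zero hd]
    simp only [moment₁_zero hd, Finset.expect_const_zero]
    simpa using T.outBound_nonneg
  · rw [moment₁_mul hq hu hH hN, add_sub_cancel_left]
    have h1 := valueFrom_zero_bound (T := T) s
    have h2 := valueFrom_zero_bound (T := T) (T.next s 0)
    have h3 := abs_out_le (T := T) s 0
    rw [abs_le] at *
    constructor <;> linarith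

/-- The expected value, with its periodic fluctuation. -/
theorem exists_mean_asymptotics [DecidableEq S] (hq : 2 ≤ q) (hd : 1 ≤ d) {u H : S → ℝ}
    (hu : ∀ s, 𝔼 ε, u (T.next s ε) = u s)
    (hH : ∀ s, 𝔼 ε, T.out s ε = u s + H s - 𝔼 ε, H (T.next s ε)) :
    ∃ Ψ₁ : ℝ → ℝ, Function.Periodic Ψ₁ (T.finalPeriod : ℝ) ∧
      (∀ α : NNReal, 0 < α → α < 1 → ∃ K : NNReal, HolderWith K α Ψ₁) ∧
      ∀ ξ, T.IsErrorExponent ξ →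
        (fun N : ℕ => T.mean N - (u T.init * Real.logb q N + Ψ₁ (Real.logb q N)))
          =O[atTop] fun N : ℕ => (N : ℝ) ^ (-ξ) * Real.log N := by
  have hnt : Nontrivial (S → ℂ) := have : Nonempty S := ⟨T.init⟩; inferInstance
  obtain ⟨C, hC, hinc⟩ := exists_moment₁_increment (T := T) hq hd u H
  have hB := T.outBound_nonneg
  have hg : ∀ N : ℕ, 1 ≤ growth d 1 N := fun N => one_le_growth d 1 (Nat.cast_nonneg _)
  obtain ⟨Ψ, hper, hhold, hasymp⟩ := exists_periodic_fluctuation (E := S → ℂ) (K := C + 3 * T.outBound)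
    (V := fun N s => (T.moment₁ u H N s : ℂ)) hq hd (finalPeriod_pos (T := T)) 1 T.avgOp
    (fun x hx => avgOp_pow_eq_self hx)
    (fun N => by
      have h1 : ((fun s => (T.moment₁ u H (q * N) s : ℂ)) - (q : ℝ) ^ d •
          T.avgOp (fun s => (T.moment₁ u H N s : ℂ))) = fun s =>
          ((T.moment₁ u H (q * N) s - (q : ℝ) ^ d * 𝔼 ε, T.moment₁ u H N (T.next s ε) : ℝ) : ℂ) := by
        ext s
        rw [avgOp_apply, Pi.sub_apply, Pi.smul_apply, stepAvg_ofReal]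
        simp
      rw [h1]
      have := hg N
      refine norm_le_of_forall_abs_le (by positivity) fun s =>
        (exists_moment₁_mul_bound hq hd hu hH N s).trans ?_
      nlinarith)
    (fun N => by
      have h1 : ((fun s => (T.moment₁ u H (N + 1) s : ℂ)) - fun s => (T.moment₁ u H N s : ℂ)) =
          fun s => ((T.moment₁ u H (N + 1) s - T.moment₁ u H N s : ℝ) : ℂ) := by
        ext s; simp
      rw [h1]
      have := hg N
      refine norm_le_of_forall_abs_le (by positivity) fun s => (hinc N s).trans ?_
      gcongr
      linarith)
  -- The centring in `moment₁` has subtracted `H`, whose value at the initial state is added back as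
  -- a constant.
  refine ⟨fun y => (Ψ y T.init).re + H T.init, fun y => by simp only [hper y], fun α hα hα1 => ?_,
    fun ξ hξ => ?_⟩
  · obtain ⟨K, hK⟩ := hhold α hα hα1
    refine ⟨K, fun x y => le_trans ?_ (hK x y)⟩
    rw [edist_add_right, edist_dist, edist_dist]
    refine ENNReal.ofReal_le_ofReal ?_
    rw [Real.dist_eq, ← Complex.sub_re]
    refine (Complex.abs_re_le_norm _).trans ?_
    rw [← dist_eq_norm]
    exact dist_le_pi_dist (Ψ x) (Ψ y) T.init
  · obtain ⟨C', hC'⟩ := hasymp ξ hξ.2.1 fun z x hx hz hzp => hξ.norm_lt hx hz hzp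
    have := isBigO_of_le_rpow_mul (d := d) (ξ := ξ) (C := C') (β := 1)
      (f := fun N : ℕ => T.mean N -
        (u T.init * Real.logb q N + ((Ψ (Real.logb q N) T.init).re + H T.init))) fun N hN => ?_
    · simpa only [pow_one] using this
    have hNd : ((N : ℝ) ^ d) ≠ 0 := by
      have : (N : ℝ) ≠ 0 := by exact_mod_cast (by omega : N ≠ 0)
      positivity
    have h1 := (norm_le_pi_norm _ T.init).trans (hC' N hN)
    refine (le_trans (le_of_eq ?_) (Complex.abs_re_le_norm _)).trans h1
    congr 1
    simp only [Pi.sub_apply, Pi.smul_apply, Complex.sub_re, Complex.ofReal_re, Complex.smul_re,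
      smul_eq_mul, moment₁]
    rw [mean_eq, Finset.sum_sub_distrib, Finset.sum_sub_distrib, Finset.sum_const, Finset.sum_const,
      card_box, nsmul_eq_mul, nsmul_eq_mul]
    push_cast
    field_simp
    ring

end Transducer

/-! ### Second moments and the variance -/

namespace Transducer

open scoped BigOperators

variable {q d : ℕ} {S : Type*} {T : Transducer q d S} [NeZero q] [Fintype S]

variable (T) in
/-- The averaging operator weighted by a function on the transitions. -/
def weightedAvg (D : S → (Fin d → Fin q) → ℝ) : (S → ℂ) →ₗ[ℂ] (S → ℂ) where
  toFun f s := 𝔼 ε, (D s ε : ℂ) * f (T.next s ε)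
  map_add' f g := by
    ext s; simp [mul_add, Finset.expect_add_distrib]
  map_smul' c f := by
    ext s
    simp only [Pi.smul_apply, smul_eq_mul, RingHom.id_apply, Finset.mul_expect]
    exact Finset.expect_congr rfl fun _ _ => by ring

theorem weightedAvg_apply (D : S → (Fin d → Fin q) → ℝ) (f : S → ℂ) (s : S) :
    T.weightedAvg D f s = 𝔼 ε, (D s ε : ℂ) * f (T.next s ε) := rfl

variable (T) in
/-- The operator which governs the joint growth of the first and the second moments. -/
def pairOp (D : S → (Fin d → Fin q) → ℝ) : ((S → ℂ) × (S → ℂ)) →L[ℂ] ((S → ℂ) × (S → ℂ)) :=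
  LinearMap.toContinuousLinearMap
    (((stepAvg ℂ T.next).comp (LinearMap.fst ℂ _ _)).prod
      ((stepAvg ℂ T.next).comp (LinearMap.snd ℂ _ _) +
        (2 : ℂ) • (T.weightedAvg D).comp (LinearMap.fst ℂ _ _)))

theorem pairOp_apply (D : S → (Fin d → Fin q) → ℝ) (x : (S → ℂ) × (S → ℂ)) :
    T.pairOp D x = (stepAvg ℂ T.next x.1, stepAvg ℂ T.next x.2 + (2 : ℂ) • T.weightedAvg D x.1) :=
  rfl

theorem pairOp_pow_succ (D : S → (Fin d → Fin q) → ℝ) (k : ℕ) (x : (S → ℂ) × (S → ℂ)) :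
    (T.pairOp D ^ (k + 1)) x = T.pairOp D ((T.pairOp D ^ k) x) := by
  rw [pow_succ']; rfl

theorem pairOp_pow_fst (D : S → (Fin d → Fin q) → ℝ) (k : ℕ) (x : (S → ℂ) × (S → ℂ)) :
    ((T.pairOp D ^ k) x).1 = (stepAvg ℂ T.next ^ k) x.1 := by
  induction k with
  | zero => rfl
  | succ k ih => rw [pairOp_pow_succ, pairOp_apply, ih, pow_succ']; rfl

theorem pairOp_pow_of_fst_eq_zero (D : S → (Fin d → Fin q) → ℝ) (k : ℕ) (z : S → ℂ) :
    (T.pairOp D ^ k) (0, z) = (0, (stepAvg ℂ T.next ^ k) z) := by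
  induction k with
  | zero => rfl
  | succ k ih =>
    rw [pairOp_pow_succ, pairOp_apply, ih, pow_succ']
    simp

theorem next_mem_finalStates {s : S} (hs : s ∈ T.finalStates) (ε : Fin d → Fin q) :
    T.next s ε ∈ T.finalStates := by
  obtain ⟨C, hC, hsC⟩ := hs
  exact ⟨C, hC, (mem_finalComponents.1 hC).2 s hsC ε⟩

/-- On a final component a function fixed by a power of `P` is constant on the successors of each
state. It factors out of the average, and what remains is the mean of `D`, which is zero. -/
theorem weightedAvg_eq_zero {D : S → (Fin d → Fin q) → ℝ} (hD : ∀ s, 𝔼 ε, D s ε = 0) {p : ℕ}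
    (hp : 0 < p) {y : S → ℂ} (hy : (stepAvg ℂ T.next ^ p) y = y) {s : S}
    (hs : s ∈ T.finalStates) : T.weightedAvg D y s = 0 := by
  obtain ⟨C, hC, hsC⟩ := hs
  have hC := mem_finalComponents.1 hC
  have h := invariant_step hC.closed hC.reach hp hy s (by simpa using hsC)
  rw [weightedAvg_apply]
  simp_rw [h]
  rw [← Finset.expect_mul]
  have : (𝔼 ε, (D s ε : ℂ)) = ((𝔼 ε, D s ε : ℝ) : ℂ) := by
    rw [Fintype.expect_eq_sum_div_card, Fintype.expect_eq_sum_div_card]; push_cast; rfl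
  rw [this, hD s]; simp

/-- The sum of the moduli over one period of the orbit is subharmonic and vanishes on the final
components, so it is zero. -/
theorem eq_zero_of_pow_invariant {p : ℕ} {x : S → ℂ} (hx : (stepAvg ℂ T.next ^ p) x = x)
    (h0 : ∀ s ∈ T.finalStates, x s = 0) (hp : 0 < p) : x = 0 := by
  set g : ℕ → S → ℂ := fun i => (stepAvg ℂ T.next ^ i) x with hg
  have hgs : ∀ i s, g (i + 1) s = 𝔼 ε, g i (T.next s ε) := fun i s => by
    simp only [hg, pow_succ', Module.End.mul_apply, stepAvg_apply]
  have hgF : ∀ i, ∀ s ∈ T.finalStates, g i s = 0 := by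
    intro i
    induction i with
    | zero => exact h0
    | succ i ih =>
      intro s hs
      rw [hgs]
      exact Finset.expect_eq_zero fun ε _ => ih _ (next_mem_finalStates hs ε)
  have hsum : ∀ s, ∑ i ∈ Finset.range p, ‖g i s‖ = ∑ i ∈ Finset.range p, ‖g (i + 1) s‖ := by
    intro s
    have h1 := Finset.sum_range_succ (fun i => ‖g i s‖) p
    have h2 := Finset.sum_range_succ' (fun i => ‖g i s‖) p
    have h3 : g p s = g 0 s := by
      simp only [hg, hx, pow_zero]; rfl
    rw [h3] at h1
    linarith
  ext s
  have h1 := T.nonpos_of_subharmonic (y := fun s => ∑ i ∈ Finset.range p, ‖g i s‖)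
    (fun s => by
      rw [hsum, Finset.expect_sum_comm]
      refine Finset.sum_le_sum fun i _ => ?_
      rw [hgs]
      exact RCLike.norm_expect_le (K := ℂ))
    (fun s hs => le_of_eq (Finset.sum_eq_zero fun i _ => by rw [hgF i s hs, norm_zero])) s
  have h2 := Finset.single_le_sum (f := fun i => ‖g i s‖) (fun _ _ => norm_nonneg _)
    (Finset.mem_range.2 hp)
  have : ‖x s‖ ≤ 0 := h2.trans h1
  simpa using this

/-- The coupling block could create a Jordan block even though the diagonal blocks have none. The
assumption forces `B^p (y, z) = (y, z) + (0, x)` for `B = pairOp D`, with `x` fixed by `P^p`, so the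
second component of the orbit is `z + k x`. On the final states the coupling vanishes and this
component is `P^(p k) z`, which is bounded; hence `x = 0` there, and then everywhere. -/
theorem pairOp_pow_eq_self {D : S → (Fin d → Fin q) → ℝ} (hD : ∀ s, 𝔼 ε, D s ε = 0) {p : ℕ}
    (hp : 0 < p) {x : (S → ℂ) × (S → ℂ)}
    (h : (T.pairOp D ^ p - 1) ((T.pairOp D ^ p - 1) x) = 0) : (T.pairOp D ^ p - 1) x = 0 := by
  obtain ⟨y, z⟩ := x
  have happ : ∀ y, (T.pairOp D ^ p - 1) y = (T.pairOp D ^ p) y - y := fun y => rfl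
  have hy : (stepAvg ℂ T.next ^ p) y = y := by
    have h1 := congrArg Prod.fst h
    have h2 : (T.avgOp ^ p - 1) ((T.avgOp ^ p - 1) y) = 0 := by
      refine Eq.trans ?_ h1
      change (T.avgOp ^ p) ((T.avgOp ^ p) y - y) - ((T.avgOp ^ p) y - y) = _
      rw [happ, Prod.fst_sub, pairOp_pow_fst, happ, Prod.fst_sub, pairOp_pow_fst, avgOp_pow_apply,
        avgOp_pow_apply]
    have h3 := avgOp_pow_eq_self h2
    rw [← avgOp_pow_apply]
    exact sub_eq_zero.1 h3
  set x := ((T.pairOp D ^ p) (y, z)).2 - z with hx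
  have hB : (T.pairOp D ^ p) (y, z) = (y, z) + (0, x) := by
    refine Prod.ext ?_ ?_
    · rw [pairOp_pow_fst, hy]; simp
    · simp [hx]
  rw [happ, happ, hB, add_sub_cancel_left, pairOp_pow_of_fst_eq_zero, Prod.mk_sub_mk, sub_zero] at h
  have hPx : (stepAvg ℂ T.next ^ p) x = x := sub_eq_zero.1 (congrArg Prod.snd h)
  rw [happ, hB, add_sub_cancel_left]
  suffices x = 0 by rw [this]; rfl
  refine eq_zero_of_pow_invariant hPx (fun s hs => ?_) hp
  have horb : ∀ k : ℕ, (T.pairOp D ^ (p * k)) (y, z) = (y, z + (k : ℂ) • x) := by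
    intro k
    induction k with
    | zero => simp
    | succ k ih =>
      have : (T.pairOp D ^ (p * (k + 1))) (y, z) =
          (T.pairOp D ^ p) ((T.pairOp D ^ (p * k)) (y, z)) := by
        rw [mul_add, mul_one, add_comm, pow_add]; rfl
      have h2 : ((y, z + (k : ℂ) • x) : (S → ℂ) × (S → ℂ)) = (y, z) + (k : ℂ) • (0, x) := by
        simp
      rw [this, ih, h2, map_add, map_smul, hB, pairOp_pow_of_fst_eq_zero, hPx]
      simp only [Prod.mk_add_mk, Prod.smul_mk, smul_zero, add_zero]
      push_cast
      rw [add_smul, one_smul]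
      congr 1
      abel
  have hF : ∀ k : ℕ, ∀ s ∈ T.finalStates,
      ((T.pairOp D ^ k) (y, z)).2 s = (stepAvg ℂ T.next ^ k) z s := by
    intro k
    induction k with
    | zero => intro s _; rfl
    | succ k ih =>
      intro s hs
      rw [pairOp_pow_succ, pairOp_apply, pow_succ', pairOp_pow_fst]
      simp only [Pi.add_apply, Pi.smul_apply, Module.End.mul_apply, stepAvg_apply]
      rw [weightedAvg_eq_zero hD hp _ hs, smul_zero, add_zero]
      · exact Finset.expect_congr rfl fun ε _ => ih _ (next_mem_finalStates hs ε)
      · rw [← Module.End.mul_apply, ← pow_add, add_comm, pow_add, Module.End.mul_apply, hy]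
  have hbd : ∀ k : ℕ, ‖z s + (k : ℂ) * x s‖ ≤ ‖z‖ := fun k => by
    have h1 := hF (p * k) s hs
    rw [horb] at h1
    have h2 : z s + (k : ℂ) * x s = (stepAvg ℂ T.next ^ (p * k)) z s := h1
    rw [h2]
    exact (norm_le_pi_norm _ s).trans (norm_stepAvg_pow_le T.next _ z)
  by_contra hne
  have hpos : 0 < ‖x s‖ := norm_pos_iff.2 hne
  obtain ⟨k, hk⟩ := exists_nat_gt (2 * ‖z‖ / ‖x s‖)
  rw [div_lt_iff₀ hpos] at hk
  have h1 : ‖(k : ℂ) * x s‖ ≤ ‖z s + (k : ℂ) * x s‖ + ‖z s‖ := by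
    simpa using norm_sub_le (z s + (k : ℂ) * x s) (z s)
  rw [norm_mul, Complex.norm_natCast] at h1
  linarith [hbd k, norm_le_pi_norm z s]

/-- The operator is block triangular with both diagonal blocks equal to `P`, so it has no new
eigenvalues. -/
theorem exists_eigenvector_of_pairOp {D : S → (Fin d → Fin q) → ℝ} {z : ℂ}
    {x : (S → ℂ) × (S → ℂ)} (hx : x ≠ 0) (h : T.pairOp D x = z • x) :
    ∃ y : S → ℂ, y ≠ 0 ∧ stepAvg ℂ T.next y = z • y := by
  have h1 := congrArg Prod.fst h
  have h2 := congrArg Prod.snd h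
  simp only [pairOp_apply, Prod.smul_fst, Prod.smul_snd] at h1 h2
  by_cases hx1 : x.1 = 0
  · refine ⟨x.2, fun hx2 => hx (Prod.ext hx1 hx2), ?_⟩
    rw [hx1, map_zero, smul_zero, add_zero] at h2
    exact h2
  · exact ⟨x.1, hx1, h1⟩

/-- The centred output of a transition. -/
def centredOut (T : Transducer q d S) (u H : S → ℝ) (s : S) (ε : Fin d → Fin q) : ℝ :=
  T.out s ε + H (T.next s ε) - H s - u s

theorem expect_centredOut {u H : S → ℝ}
    (hH : ∀ s, 𝔼 ε, T.out s ε = u s + H s - 𝔼 ε, H (T.next s ε)) (s : S) :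
    𝔼 ε, T.centredOut u H s ε = 0 := by
  simp only [centredOut]
  rw [Finset.expect_sub_distrib, Finset.expect_sub_distrib, Finset.expect_add_distrib, hH,
    Finset.expect_const Finset.univ_nonempty, Finset.expect_const Finset.univ_nonempty]
  ring

/-- The second moments of the values, centred. -/
def moment₂ (T : Transducer q d S) (a : ℝ) (H w H₂ : S → ℝ) (N : ℕ) (s : S) : ℝ :=
  ∑ n ∈ box d N, ((T.valueFrom s n - H s - a * Real.logb q N) ^ 2 - w s * Real.logb q N - H₂ s)

theorem moment₂_zero (hd : 1 ≤ d) (a : ℝ) (H w H₂ : S → ℝ) (s : S) :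
    T.moment₂ a H w H₂ 0 s = 0 := by
  have : box d 0 = ∅ := by
    rw [← Finset.card_eq_zero, card_box]; exact zero_pow (by omega)
  simp [moment₂, this]

/-- The centred value after one digit is the centred increment plus the centred value of the rest.
In its square, the mean square of the increment is absorbed by `w` and `H₂`, and the mixed term is
the coupling with the first moments. A drift that is the same constant in all states is essential,
as otherwise the increment would contain a multiple of `log_q N`. -/
theorem moment₂_mul (hq : 2 ≤ q) {a : ℝ} {H w H₂ : S → ℝ}
    (hw : ∀ s, 𝔼 ε, w (T.next s ε) = w s)
    (hH₂ : ∀ s, 𝔼 ε, T.centredOut (fun _ => a) H s ε ^ 2 = w s + H₂ s - 𝔼 ε, H₂ (T.next s ε))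
    {N : ℕ} (hN : 1 ≤ N) (s : S) :
    T.moment₂ a H w H₂ (q * N) s = (q : ℝ) ^ d * ((𝔼 ε, T.moment₂ a H w H₂ N (T.next s ε)) +
        2 * 𝔼 ε, T.centredOut (fun _ => a) H s ε * T.moment₁ (fun _ => a) H N (T.next s ε)) +
      ((T.valueFrom s 0 - H s - a * (Real.logb q N + 1)) ^ 2 -
        (T.out s 0 + T.valueFrom (T.next s 0) 0 - H s - a * (Real.logb q N + 1)) ^ 2) := by
  have h1 := sum_box_mul_valueFrom (T := T) hq hN s
    (fun x => (x - H s - a * Real.logb q ((q * N : ℕ) : ℝ)) ^ 2 -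
      w s * Real.logb q ((q * N : ℕ) : ℝ) - H₂ s)
  rw [moment₂, h1, logb_mul_self hq hN, Finset.mul_expect, ← Finset.expect_add_distrib,
    ← sum_eq_expect]
  simp only [moment₂, moment₁]
  congr 1
  swap
  · ring
  set l := Real.logb q (N : ℝ)
  simp_rw [Finset.mul_sum, ← Finset.sum_add_distrib]
  rw [Finset.sum_comm, ← sub_eq_zero, ← Finset.sum_sub_distrib]
  simp_rw [← Finset.sum_sub_distrib]
  rw [Finset.sum_comm]
  refine Finset.sum_eq_zero fun m _ => ?_
  have h2 : ∀ ε : Fin d → Fin q,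
      (T.out s ε + T.valueFrom (T.next s ε) m - H s - a * (l + 1)) ^ 2 - w s * (l + 1) - H₂ s -
        ((T.valueFrom (T.next s ε) m - H (T.next s ε) - a * l) ^ 2 - w (T.next s ε) * l -
          H₂ (T.next s ε) + 2 * (T.centredOut (fun _ => a) H s ε *
            (T.valueFrom (T.next s ε) m - H (T.next s ε) - a * l))) =
      (T.centredOut (fun _ => a) H s ε ^ 2 + w (T.next s ε) * l + H₂ (T.next s ε)) -
        (w s * (l + 1) + H₂ s) := by
    intro ε; simp only [centredOut]; ring
  simp_rw [h2]
  rw [sum_eq_expect, Finset.expect_sub_distrib, Finset.expect_add_distrib,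
    Finset.expect_add_distrib, ← Finset.expect_mul, hw, hH₂, Finset.expect_const
    Finset.univ_nonempty]
  ring

/-- The correction at `n = 0` is a difference of two squares of size `O(log² N)` whose bases differ
by a bounded amount, so it is only `O(log N)`. -/
theorem exists_moment₂_mul_bound (hq : 2 ≤ q) (hd : 1 ≤ d) {a : ℝ} {H w H₂ : S → ℝ}
    (hw : ∀ s, 𝔼 ε, w (T.next s ε) = w s)
    (hH₂ : ∀ s, 𝔼 ε, T.centredOut (fun _ => a) H s ε ^ 2 = w s + H₂ s - 𝔼 ε, H₂ (T.next s ε)) :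
    ∃ C, 0 ≤ C ∧ ∀ (N : ℕ) (s : S), |T.moment₂ a H w H₂ (q * N) s -
      (q : ℝ) ^ d * ((𝔼 ε, T.moment₂ a H w H₂ N (T.next s ε)) +
        2 * 𝔼 ε, T.centredOut (fun _ => a) H s ε * T.moment₁ (fun _ => a) H N (T.next s ε))| ≤
      C * growth d 2 N := by
  obtain ⟨CH, hCH, hH⟩ := exists_abs_le H
  have hB := T.outBound_nonneg
  refine ⟨3 * T.outBound * (2 * (2 * T.outBound + CH + |a| * 3)), by positivity, fun N s => ?_⟩
  have hg : (1 + Real.log (N + 1)) ≤ growth d 2 N := by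
    have hlog := one_le_one_add_log (Nat.cast_nonneg (α := ℝ) N)
    have : (1 : ℝ) ≤ ((N : ℝ) + 1) ^ (d - 1) := one_le_pow₀ (by linarith [Nat.cast_nonneg (α := ℝ) N])
    unfold growth
    nlinarith [mul_le_mul this (le_refl ((1 + Real.log (N + 1)) ^ 2)) (by positivity) (by positivity)]
  have hg0 : 0 ≤ growth d 2 N := (by linarith [one_le_growth d 2 (Nat.cast_nonneg (α := ℝ) N)])
  rcases Nat.eq_zero_or_pos N with rfl | hN
  · rw [mul_zero, moment₂_zero hd]
    simp only [moment₂_zero hd, moment₁_zero hd, mul_zero, Finset.expect_const_zero]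
    simp only [add_zero, mul_zero, sub_zero, abs_zero]
    positivity
  · rw [moment₂_mul hq hw hH₂ hN, add_sub_cancel_left]
    have h1 := valueFrom_zero_bound (T := T) s
    have h2 := valueFrom_zero_bound (T := T) (T.next s 0)
    have h3 := abs_out_le (T := T) s 0
    have hlog := one_le_one_add_log (Nat.cast_nonneg (α := ℝ) N)
    have hl : |Real.logb q N + 1| ≤ 3 * (1 + Real.log (N + 1)) := by
      refine (abs_add_le _ _).trans ?_
      rw [abs_one]
      linarith [abs_logb_le hq N]
    have hal : |a * (Real.logb q N + 1)| ≤ |a| * 3 * (1 + Real.log (N + 1)) := by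
      rw [abs_mul, mul_assoc]; gcongr
    have hHs := (hH s).trans (le_mul_of_one_le_right hCH hlog)
    have hB' := le_mul_of_one_le_right hB hlog
    set L := 1 + Real.log ((N : ℝ) + 1)
    rw [sq_sub_sq, abs_mul, mul_comm]
    have e1 : |T.valueFrom s 0 - H s - a * (Real.logb q N + 1) -
        (T.out s 0 + T.valueFrom (T.next s 0) 0 - H s - a * (Real.logb q N + 1))| ≤
        3 * T.outBound := by
      rw [abs_le] at *
      constructor <;> linarith
    have e2 : |T.valueFrom s 0 - H s - a * (Real.logb q N + 1) +
        (T.out s 0 + T.valueFrom (T.next s 0) 0 - H s - a * (Real.logb q N + 1))| ≤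
        2 * (2 * T.outBound + CH + |a| * 3) * L := by
      rw [abs_le] at *
      constructor <;> nlinarith
    refine (mul_le_mul e1 e2 (abs_nonneg _) (by positivity)).trans ?_
    rw [← mul_assoc]
    gcongr

theorem exists_moment₂_increment (hq : 2 ≤ q) (hd : 1 ≤ d) (a : ℝ) (H w H₂ : S → ℝ) :
    ∃ C, 0 ≤ C ∧ ∀ (N : ℕ) (s : S),
      |T.moment₂ a H w H₂ (N + 1) s - T.moment₂ a H w H₂ N s| ≤ C * growth d 2 N := by
  obtain ⟨Cw, hCw, hw⟩ := exists_abs_le w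
  obtain ⟨C₂, hC₂, hH₂⟩ := exists_abs_le H₂
  obtain ⟨C, hC, h⟩ := exists_centred_bound (T := T) hq (fun _ => a) H
  have hK : 0 ≤ |a| * 4 * (2 * C) := by positivity
  refine ⟨(d + 1) * (C ^ 2 + |a| * 4 * (2 * C) + Cw * 4 + C₂), by positivity, fun N s => ?_⟩
  have hlog := one_le_one_add_log (Nat.cast_nonneg (α := ℝ) N)
  have hLL : 1 + Real.log ((N : ℝ) + 1) ≤ (1 + Real.log ((N : ℝ) + 1)) ^ 2 := by nlinarith
  refine abs_sum_box_succ_sub_le_growth hd (f := fun N n =>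
    (T.valueFrom s n - H s - a * Real.logb q N) ^ 2 - w s * Real.logb q N - H₂ s)
    (fun n hn => ?_) fun n hn => ?_
  · have h1 := (h N s n hn).1
    have h3 : |Real.logb q ((N + 1 : ℕ) : ℝ)| ≤ 4 * (1 + Real.log (N + 1)) := by
      have e1 := abs_logb_succ_sub_le hq N
      have e2 := abs_logb_le hq N
      have e3 : (4 : ℝ) / (N + 1) ≤ 4 := div_le_self (by norm_num) (by linarith [Nat.cast_nonneg (α := ℝ) N])
      have e4 := abs_logb_le hq (N + 1)
      have : Real.log (((N + 1 : ℕ) : ℝ) + 1) ≤ Real.log (N + 1) + 1 := by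
        calc Real.log (((N + 1 : ℕ) : ℝ) + 1) ≤ Real.log (2 * (N + 1)) := by
              refine Real.log_le_log (by positivity) ?_
              push_cast; linarith [Nat.cast_nonneg (α := ℝ) N]
          _ = Real.log 2 + Real.log (N + 1) := Real.log_mul (by norm_num) (by positivity)
          _ ≤ _ := by linarith [Real.log_two_lt_d9]
      linarith
    calc _ ≤ |T.valueFrom s n - H s - a * Real.logb q ((N + 1 : ℕ) : ℝ)| ^ 2 +
          |w s| * |Real.logb q ((N + 1 : ℕ) : ℝ)| + |H₂ s| := by
          rw [← abs_mul, ← abs_pow]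
          exact (abs_sub _ _).trans (add_le_add_left (abs_sub _ _) _)
      _ ≤ (C * (1 + Real.log (N + 1))) ^ 2 + Cw * (4 * (1 + Real.log (N + 1))) + C₂ := by
          gcongr
          · exact hw s
          · exact hH₂ s
      _ ≤ (C * (1 + Real.log (N + 1))) ^ 2 + Cw * (4 * (1 + Real.log (N + 1)) ^ 2) +
          C₂ * (1 + Real.log (N + 1)) ^ 2 + |a| * 4 * (2 * C) * (1 + Real.log (N + 1)) ^ 2 := by
          have e1 : 0 ≤ |a| * 4 * (2 * C) * (1 + Real.log ((N : ℝ) + 1)) ^ 2 := by positivity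
          have e2 : C₂ ≤ C₂ * (1 + Real.log ((N : ℝ) + 1)) ^ 2 :=
            le_mul_of_one_le_right hC₂ (by linarith)
          have e3 := mul_le_mul_of_nonneg_left hLL hCw
          linarith
      _ = _ := by ring
  · have hn' := box_mono (Nat.le_succ N) hn
    have h1 := (h N s n hn').1
    have h2 := (h N s n hn').2
    have hl := abs_logb_succ_sub_le hq N
    set x := T.valueFrom s n - H s - a * Real.logb q ((N + 1 : ℕ) : ℝ) with hx
    set y := T.valueFrom s n - H s - a * Real.logb q (N : ℝ) with hy
    set L := 1 + Real.log ((N : ℝ) + 1)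
    have e0 : x ^ 2 - w s * Real.logb q ((N + 1 : ℕ) : ℝ) - H₂ s -
        (y ^ 2 - w s * Real.logb q N - H₂ s) =
        -(a * (Real.logb q ((N + 1 : ℕ) : ℝ) - Real.logb q N)) * (x + y) -
          w s * (Real.logb q ((N + 1 : ℕ) : ℝ) - Real.logb q N) := by
      rw [hx, hy]; ring
    rw [e0]
    calc _ ≤ |a| * |Real.logb q ((N + 1 : ℕ) : ℝ) - Real.logb q N| * (|x| + |y|) +
          |w s| * |Real.logb q ((N + 1 : ℕ) : ℝ) - Real.logb q N| := by
          refine (abs_sub _ _).trans ?_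
          rw [abs_mul, abs_neg, abs_mul, abs_mul]
          gcongr
          exact abs_add_le _ _
      _ ≤ |a| * (4 / (N + 1)) * (C * L + C * L) + Cw * (4 / (N + 1)) := by
          gcongr
          exact hw s
      _ = (|a| * 4 * (2 * C) * L + Cw * 4) / (N + 1) := by ring
      _ ≤ (C ^ 2 + |a| * 4 * (2 * C) + Cw * 4 + C₂) * L ^ 2 / (N + 1) := by
          gcongr
          have e1 := mul_le_mul_of_nonneg_left hLL hK
          have e2 : Cw * 4 ≤ Cw * 4 * L ^ 2 := le_mul_of_one_le_right (by positivity) (by linarith)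
          have e3 : 0 ≤ C ^ 2 * L ^ 2 := by positivity
          have e4 : 0 ≤ C₂ * L ^ 2 := by positivity
          linarith

theorem growth_le_growth_succ (d β N : ℕ) : growth d β N ≤ growth d (β + 1) N := by
  have hlog := one_le_one_add_log (Nat.cast_nonneg (α := ℝ) N)
  unfold growth
  have h := pow_le_pow_right₀ hlog (Nat.le_succ β)
  gcongr

theorem exists_abs_le_of_periodic {f : ℝ → ℝ} (hf : Continuous f) {c : ℝ} (hc : c ≠ 0)
    (hp : Function.Periodic f c) : ∃ C, ∀ x, |f x| ≤ C := by
  have hcomp := hp.compact_of_continuous hc hf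
  obtain ⟨C, hC⟩ := hcomp.isBounded.exists_norm_le
  exact ⟨C, fun x => hC _ ⟨x, rfl⟩⟩

/-- The second moments, with their periodic fluctuation. -/
theorem exists_moment₂_asymptotics [DecidableEq S] (hq : 2 ≤ q) (hd : 1 ≤ d) {a : ℝ}
    {H w H₂ : S → ℝ}
    (hH : ∀ s, 𝔼 ε, T.out s ε = a + H s - 𝔼 ε, H (T.next s ε))
    (hw : ∀ s, 𝔼 ε, w (T.next s ε) = w s)
    (hH₂ : ∀ s, 𝔼 ε, T.centredOut (fun _ => a) H s ε ^ 2 = w s + H₂ s - 𝔼 ε, H₂ (T.next s ε)) :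
    ∃ Ψ : ℝ → ℝ, Function.Periodic Ψ (T.finalPeriod : ℝ) ∧ Continuous Ψ ∧
      ∀ ξ, T.IsErrorExponent ξ → ∃ C, ∀ N : ℕ, 1 ≤ N →
        |T.moment₂ a H w H₂ N T.init - (N : ℝ) ^ d * Ψ (Real.logb q N)| ≤
          C * ((N : ℝ) ^ ((d : ℝ) - ξ) * (1 + Real.log N) ^ 2) := by
  have hnt : Nontrivial (S → ℂ) := have : Nonempty S := ⟨T.init⟩; inferInstance
  obtain ⟨C₁, hC₁, hinc₁⟩ := exists_moment₁_increment (T := T) hq hd (fun _ => a) H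
  obtain ⟨C₂, hC₂, hinc₂⟩ := exists_moment₂_increment (T := T) hq hd a H w H₂
  obtain ⟨C₃, hC₃, hmul⟩ := exists_moment₂_mul_bound (T := T) hq hd hw hH₂
  have hB := T.outBound_nonneg
  have hg : ∀ N : ℕ, 1 ≤ growth d 2 N := fun N => one_le_growth d 2 (Nat.cast_nonneg _)
  have hg' : ∀ N : ℕ, growth d 1 N ≤ growth d 2 N := growth_le_growth_succ d 1
  set K := C₁ + C₂ + C₃ + 3 * T.outBound
  set D := T.centredOut (fun _ => a) H
  obtain ⟨Ψ, hper, hhold, hasymp⟩ := exists_periodic_fluctuation (E := (S → ℂ) × (S → ℂ)) (K := K)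
    (V := fun N => (fun s => (T.moment₁ (fun _ => a) H N s : ℂ),
      fun s => (T.moment₂ a H w H₂ N s : ℂ))) hq hd (finalPeriod_pos (T := T)) 2 (T.pairOp D)
    (fun x hx => pairOp_pow_eq_self (expect_centredOut hH) finalPeriod_pos hx)
    (fun N => by
      have h1 : (((fun s => (T.moment₁ (fun _ => a) H (q * N) s : ℂ)),
          (fun s => (T.moment₂ a H w H₂ (q * N) s : ℂ))) : (S → ℂ) × (S → ℂ)) - (q : ℝ) ^ d •
          T.pairOp D (fun s => (T.moment₁ (fun _ => a) H N s : ℂ),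
            fun s => (T.moment₂ a H w H₂ N s : ℂ)) =
          (fun s => ((T.moment₁ (fun _ => a) H (q * N) s -
            (q : ℝ) ^ d * 𝔼 ε, T.moment₁ (fun _ => a) H N (T.next s ε) : ℝ) : ℂ),
          fun s => ((T.moment₂ a H w H₂ (q * N) s -
            (q : ℝ) ^ d * ((𝔼 ε, T.moment₂ a H w H₂ N (T.next s ε)) +
              2 * 𝔼 ε, D s ε * T.moment₁ (fun _ => a) H N (T.next s ε)) : ℝ) : ℂ)) := by
        rw [pairOp_apply]
        have hwt : ∀ s, T.weightedAvg D (fun s => (T.moment₁ (fun _ => a) H N s : ℂ)) s =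
            ((𝔼 ε, D s ε * T.moment₁ (fun _ => a) H N (T.next s ε) : ℝ) : ℂ) := fun s => by
          rw [weightedAvg_apply, Fintype.expect_eq_sum_div_card, Fintype.expect_eq_sum_div_card]
          push_cast; rfl
        refine Prod.ext ?_ ?_
        · ext s
          simp only [Prod.fst_sub, Prod.smul_fst, Pi.sub_apply, Pi.smul_apply, stepAvg_ofReal]
          simp
        · ext s
          simp only [Prod.snd_sub, Prod.smul_snd, Pi.sub_apply, Pi.smul_apply, Pi.add_apply,
            stepAvg_ofReal, hwt]
          simp [mul_add]
      rw [h1]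
      have h2 := hg N
      rw [Prod.norm_def]
      refine max_le (norm_le_of_forall_abs_le (by positivity) fun s =>
        (exists_moment₁_mul_bound hq hd (fun s => by simp) hH N s).trans ?_)
        (norm_le_of_forall_abs_le (by positivity) fun s => (hmul N s).trans ?_)
      · simp only [K]; nlinarith
      · gcongr; simp only [K]; linarith)
    (fun N => by
      have h1 : (((fun s => (T.moment₁ (fun _ => a) H (N + 1) s : ℂ)),
          (fun s => (T.moment₂ a H w H₂ (N + 1) s : ℂ))) : (S → ℂ) × (S → ℂ)) -
          (fun s => (T.moment₁ (fun _ => a) H N s : ℂ), fun s => (T.moment₂ a H w H₂ N s : ℂ)) =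
          (fun s => ((T.moment₁ (fun _ => a) H (N + 1) s - T.moment₁ (fun _ => a) H N s : ℝ) : ℂ),
          fun s => ((T.moment₂ a H w H₂ (N + 1) s - T.moment₂ a H w H₂ N s : ℝ) : ℂ)) := by
        refine Prod.ext ?_ ?_ <;> ext s <;> simp
      rw [h1]
      have h2 := hg N
      have h3 := hg' N
      rw [Prod.norm_def]
      refine max_le (norm_le_of_forall_abs_le (by positivity) fun s => (hinc₁ N s).trans ?_)
        (norm_le_of_forall_abs_le (by positivity) fun s => (hinc₂ N s).trans ?_)
      · have h4 : C₁ ≤ K := by simp only [K]; linarith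
        gcongr
        exact zero_le_one.trans (one_le_growth d 1 (Nat.cast_nonneg _))
      · gcongr; simp only [K]; linarith)
  refine ⟨fun y => ((Ψ y).2 T.init).re, fun y => by simp only [hper y], ?_, fun ξ hξ => ?_⟩
  · obtain ⟨K', hK'⟩ := hhold (1 / 2) (by positivity) (by
      rw [← NNReal.coe_lt_coe]; push_cast; norm_num)
    have hc : Continuous Ψ := hK'.continuous (by positivity)
    fun_prop
  · obtain ⟨C', hC'⟩ := hasymp ξ hξ.2.1 fun z x hx hz hzp => by
      obtain ⟨y, hy, hyz⟩ := exists_eigenvector_of_pairOp hx hz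
      exact hξ.norm_lt hy hyz hzp
    refine ⟨C', fun N hN => ?_⟩
    have h1 := ((norm_le_pi_norm _ T.init).trans (norm_snd_le _)).trans (hC' N hN)
    refine (le_trans (le_of_eq ?_) (Complex.abs_re_le_norm _)).trans h1
    congr 1
    simp only [Prod.snd_sub, Prod.smul_snd, Pi.sub_apply, Pi.smul_apply, Complex.sub_re,
      Complex.ofReal_re, Complex.smul_re, smul_eq_mul]

/-- The variance, with its periodic fluctuation, if all final components have the same mean. -/
theorem exists_var_asymptotics [DecidableEq S] (hq : 2 ≤ q) (hd : 1 ≤ d) {a : ℝ}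
    {H w H₂ : S → ℝ}
    (hH : ∀ s, 𝔼 ε, T.out s ε = a + H s - 𝔼 ε, H (T.next s ε))
    (hw : ∀ s, 𝔼 ε, w (T.next s ε) = w s)
    (hH₂ : ∀ s, 𝔼 ε, T.centredOut (fun _ => a) H s ε ^ 2 = w s + H₂ s - 𝔼 ε, H₂ (T.next s ε))
    {Ψ₁ : ℝ → ℝ} (hc : Continuous Ψ₁) (hp : Function.Periodic Ψ₁ (T.finalPeriod : ℝ))
    (hΨ₁ : ∀ ξ, T.IsErrorExponent ξ →
        (fun N : ℕ => T.mean N - (a * Real.logb q N + Ψ₁ (Real.logb q N)))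
          =O[atTop] fun N : ℕ => (N : ℝ) ^ (-ξ) * Real.log N) :
    ∃ Ψ₂ : ℝ → ℝ, Continuous Ψ₂ ∧ Function.Periodic Ψ₂ (T.finalPeriod : ℝ) ∧
      ∀ ξ, T.IsErrorExponent ξ →
        (fun N : ℕ => T.var N -
          (w T.init * Real.logb q N - Ψ₁ (Real.logb q N) ^ 2 + Ψ₂ (Real.logb q N)))
          =O[atTop] fun N : ℕ => (N : ℝ) ^ (-ξ) * Real.log N ^ 2 := by
  obtain ⟨Ψ, hper, hcont, hasymp⟩ := exists_moment₂_asymptotics (T := T) hq hd hH hw hH₂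
  set h := H T.init
  -- The variance is the second moment about `h + a log_q N` minus the squared distance of the mean
  -- from that point. The latter is `(Ψ₁ - h)²` up to the error of the mean; expanding it leaves
  -- `-Ψ₁²` apart, and the other terms go into `Ψ₂`.
  refine ⟨fun y => Ψ y + H₂ T.init + 2 * h * Ψ₁ y - h ^ 2, by fun_prop, fun y => by
    simp only [hper y, hp y], fun ξ hξ => ?_⟩
  obtain ⟨C, hC⟩ := hasymp ξ hξ
  have hmean := hΨ₁ ξ hξ
  obtain ⟨B, hB⟩ := exists_abs_le_of_periodic hc
    (by exact_mod_cast (finalPeriod_pos (T := T)).ne') hp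
  set g := fun N : ℕ => (N : ℝ) ^ (-ξ) * Real.log N
  have hgg : g =O[atTop] fun N : ℕ => (N : ℝ) ^ (-ξ) * Real.log N ^ 2 := by
    refine Asymptotics.IsBigO.of_bound 1 ?_
    filter_upwards [eventually_ge_atTop 3] with N hN
    have hlog : 1 ≤ Real.log N := by
      rw [← Real.log_exp 1]
      refine Real.log_le_log (Real.exp_pos 1) ?_
      have : (3 : ℝ) ≤ N := by exact_mod_cast hN
      linarith [Real.exp_one_lt_d9]
    have : (0 : ℝ) ≤ (N : ℝ) ^ (-ξ) := by positivity
    rw [Real.norm_of_nonneg (by positivity), Real.norm_of_nonneg (by positivity), one_mul]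
    simp only [g]
    gcongr
    nlinarith
  have hg1 : g =O[atTop] fun _ : ℕ => (1 : ℝ) := by
    have h1 : Tendsto (fun x : ℝ => Real.log x / x ^ ξ) atTop (𝓝 0) :=
      (isLittleO_log_rpow_atTop hξ.1).tendsto_div_nhds_zero
    have h2 : Tendsto g atTop (𝓝 0) := by
      refine (h1.comp tendsto_natCast_atTop_atTop).congr fun N => ?_
      simp only [Function.comp, g]
      rw [Real.rpow_neg (Nat.cast_nonneg _)]
      ring
    exact h2.isBigO_one ℝ
  have hδ : (fun N : ℕ => (T.mean N - (a * Real.logb q N + Ψ₁ (Real.logb q N))) ^ 2 +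
      2 * (Ψ₁ (Real.logb q N) - h) * (T.mean N - (a * Real.logb q N + Ψ₁ (Real.logb q N))))
      =O[atTop] fun N : ℕ => (N : ℝ) ^ (-ξ) * Real.log N ^ 2 := by
    refine Asymptotics.IsBigO.trans ?_ hgg
    have e1 : (fun N : ℕ => 2 * (Ψ₁ (Real.logb q N) - h)) =O[atTop] fun _ : ℕ => (1 : ℝ) := by
      refine Asymptotics.IsBigO.of_bound (2 * (B + |h|)) (Eventually.of_forall fun N => ?_)
      rw [norm_one, mul_one, Real.norm_eq_abs, abs_mul, abs_two]
      gcongr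
      exact (abs_sub _ _).trans (by gcongr; exact hB _)
    have e2 := e1.mul hmean
    have e3 := hmean.mul (hmean.trans hg1)
    simp only [one_mul] at e2
    simp only [mul_one] at e3
    refine Asymptotics.IsBigO.add ?_ e2
    simpa only [pow_two] using e3
  have hM := isBigO_of_le_rpow_mul (d := d) (ξ := ξ) (C := C) (β := 2)
    (f := fun N : ℕ => ((N : ℝ) ^ d)⁻¹ * T.moment₂ a H w H₂ N T.init - Ψ (Real.logb q N))
    fun N hN => by
      have hNd : ((N : ℝ) ^ d) ≠ 0 := by
        have : (N : ℝ) ≠ 0 := by exact_mod_cast (by omega : N ≠ 0)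
        positivity
      rw [mul_sub, mul_inv_cancel_left₀ hNd]
      exact hC N hN
  refine (hM.sub hδ).congr' ?_ EventuallyEq.rfl
  filter_upwards [eventually_gt_atTop 0] with N hN
  have hNd : ((N : ℝ) ^ d) ≠ 0 := by positivity
  rw [var_eq_sub hN (h + a * Real.logb q N), moment₂, Finset.sum_sub_distrib,
    Finset.sum_sub_distrib, Finset.sum_const, Finset.sum_const, card_box, nsmul_eq_mul,
    nsmul_eq_mul]
  simp only [sub_sub _ h, h]
  push_cast
  field_simp
  ring

end Transducer

/-! ### The walk with a counter, and estimates for cutting boxes into pieces -/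

section SkewAverage

open scoped BigOperators

variable {σ A : Type*} [Fintype A]

/-- The averaging operator of the random walk which in the state `s` chooses a letter `a` uniformly
at random, moves to `nx s a` and adds `D s a` to a counter. -/
def skewAvg (𝕜 : Type*) [RCLike 𝕜] (nx : σ → A → σ) (D : σ → A → ℝ) :
    Module.End 𝕜 (ℝ → σ → 𝕜) where
  toFun f x s := 𝔼 a, f (x + D s a) (nx s a)
  map_add' f g := by
    ext x s; simp [Finset.expect_add_distrib]
  map_smul' c f := by
    ext x s; simp [Finset.mul_expect]

variable {𝕜 : Type*} [RCLike 𝕜] (nx : σ → A → σ) (D : σ → A → ℝ)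

theorem skewAvg_apply (f : ℝ → σ → 𝕜) (x : ℝ) (s : σ) :
    skewAvg 𝕜 nx D f x s = 𝔼 a, f (x + D s a) (nx s a) := rfl

theorem skewAvg_pow_succ (k : ℕ) (f : ℝ → σ → 𝕜) (x : ℝ) (s : σ) :
    (skewAvg 𝕜 nx D ^ (k + 1)) f x s = 𝔼 a, (skewAvg 𝕜 nx D ^ k) f (x + D s a) (nx s a) := by
  rw [pow_succ', Module.End.mul_apply, skewAvg_apply]

theorem skewAvg_pow_translate (k : ℕ) (f : ℝ → σ → 𝕜) (x y : ℝ) (s : σ) :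
    (skewAvg 𝕜 nx D ^ k) f (x + y) s = (skewAvg 𝕜 nx D ^ k) (fun z s => f (z + y) s) x s := by
  induction k generalizing x s with
  | zero => rfl
  | succ k ih =>
    rw [skewAvg_pow_succ, skewAvg_pow_succ]
    refine Finset.expect_congr rfl fun a _ => ?_
    rw [← ih, add_right_comm]

variable [Nonempty A]

/-- Replacing the increments by cohomologous ones. -/
theorem skewAvg_pow_cohomologous {K : Set σ} (hK : ∀ s ∈ K, ∀ a, nx s a ∈ K) {D' : σ → A → ℝ}
    {H : σ → ℝ} {c : ℝ} (hD : ∀ s ∈ K, ∀ a, D s a = D' s a + c + H s - H (nx s a)) (k : ℕ)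
    (f : ℝ → σ → 𝕜) (x : ℝ) {s : σ} (hs : s ∈ K) :
    (skewAvg 𝕜 nx D ^ k) f x s =
      (skewAvg 𝕜 nx D' ^ k) (fun y s => f (y + c * k - H s) s) (x + H s) s := by
  induction k generalizing x s with
  | zero => simp
  | succ k ih =>
    rw [skewAvg_pow_succ, skewAvg_pow_succ]
    refine Finset.expect_congr rfl fun a _ => ?_
    rw [ih _ (hK s hs a), hD s hs]
    have h1 : x + (D' s a + c + H s - H (nx s a)) + H (nx s a) = x + H s + D' s a + c := by ring
    rw [h1, skewAvg_pow_translate]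
    refine congrFun (congrFun (congrArg _ ?_) _) _
    funext y s'
    congr 1
    push_cast
    ring

end SkewAverage

theorem pow_sub_pow_le_mul {x y : ℝ} (hy : 0 ≤ y) (hxy : y ≤ x) (d : ℕ) :
    x ^ d - y ^ d ≤ d * x ^ (d - 1) * (x - y) := by
  induction d with
  | zero => simp
  | succ d ih =>
    rcases Nat.eq_zero_or_pos d with rfl | hd
    · simp
    have hx : 0 ≤ x := hy.trans hxy
    have h1 : x ^ d = x * x ^ (d - 1) := by rw [← pow_succ']; congr 1; omega
    have h2 : y ^ d ≤ x ^ d := by gcongr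
    rw [add_tsub_cancel_right, pow_succ, pow_succ]
    push_cast
    have h3 := mul_le_mul_of_nonneg_left ih hx
    have h4 := mul_le_mul_of_nonneg_right h2 (sub_nonneg.2 hxy)
    have h5 : x * (d * x ^ (d - 1) * (x - y)) = d * x ^ d * (x - y) := by rw [h1]; ring
    nlinarith

theorem one_add_log_succ_le_sqrt {N : ℕ} (hN : 1 ≤ N) : 1 + Real.log ((N : ℝ) + 1) ≤ 3 * √N := by
  have hN1 : (1 : ℝ) ≤ N := by exact_mod_cast hN
  have h1 : Real.log ((N : ℝ) + 1) ≤ Real.log (2 * N) :=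
    Real.log_le_log (by positivity) (by linarith)
  have h2 : Real.log (2 * N) = Real.log 2 + 2 * Real.log √N := by
    rw [Real.log_mul (by norm_num) (by positivity), Real.log_sqrt (by positivity)]; ring
  have h3 := Real.log_le_sub_one_of_pos (Real.sqrt_pos.2 (by positivity : (0 : ℝ) < N))
  have h4 : 1 ≤ √(N : ℝ) := Real.one_le_sqrt.2 hN1
  linarith [Real.log_two_lt_d9]

/-- In the application `N` is the integer part of `N₀ / q^k`, and the left side is the number of
digits beyond the `k` free ones. -/
theorem logb_sub_le {q N₀ N k : ℕ} (hq : 2 ≤ q) (hN₀ : 1 ≤ N₀) (h : N₀ < q ^ k * (N + 1)) :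
    Real.logb q N₀ - k ≤ 2 * (1 + Real.log (N + 1)) := by
  have hN₀0 : (0 : ℝ) < N₀ := by exact_mod_cast hN₀
  have hq1 : (1 : ℝ) < q := by exact_mod_cast (by omega : 1 < q)
  have hlog2 : Real.log 2 ≤ Real.log q := Real.log_le_log (by norm_num) (by exact_mod_cast hq)
  have hl : (1 / 2 : ℝ) ≤ Real.log q := by linarith [Real.log_two_gt_d9]
  have e1 : Real.logb q N₀ ≤ k + Real.logb q ((N : ℝ) + 1) := by
    have : (N₀ : ℝ) ≤ (q : ℝ) ^ k * ((N : ℝ) + 1) := by exact_mod_cast h.le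
    refine (Real.logb_le_logb_of_le hq1 hN₀0 this).trans (le_of_eq ?_)
    rw [Real.logb_mul (by positivity) (by positivity), Real.logb_pow,
      Real.logb_self_eq_one hq1, mul_one]
  have e2 : Real.logb q ((N : ℝ) + 1) ≤ 2 * (1 + Real.log (N + 1)) := by
    have e3 : 0 ≤ Real.log ((N : ℝ) + 1) :=
      Real.log_nonneg (by linarith [Nat.cast_nonneg (α := ℝ) N])
    rw [Real.logb, div_le_iff₀ (by linarith)]
    nlinarith
  linarith

theorem inv_sqrt_le_of_lt {q N₀ N k : ℕ} (hN₀ : 1 ≤ N₀) (hN : 1 ≤ N) (h : N₀ < q ^ k * (N + 1)) :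
    (√(N : ℝ))⁻¹ ≤ 2 * √((q : ℝ) ^ k / N₀) := by
  have hN₀0 : (0 : ℝ) < N₀ := by exact_mod_cast hN₀
  have hN1 : (1 : ℝ) ≤ N := by exact_mod_cast hN
  have h1 : ((N : ℝ))⁻¹ ≤ 2 ^ 2 * ((q : ℝ) ^ k / N₀) := by
    rw [inv_le_iff_one_le_mul₀ (by linarith), ← mul_div_assoc, div_mul_eq_mul_div, le_div_iff₀ hN₀0]
    have : (N₀ : ℝ) ≤ (q : ℝ) ^ k * ((N : ℝ) + 1) := by exact_mod_cast h.le
    have h2 : (0 : ℝ) ≤ (q : ℝ) ^ k := by positivity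
    nlinarith
  rw [← Real.sqrt_inv]
  refine (Real.sqrt_le_sqrt h1).trans (le_of_eq ?_)
  rw [Real.sqrt_mul (by norm_num), Real.sqrt_sq (by norm_num)]

/-- The left side counts the points of the box that are lost by rounding its side down to a multiple
of `q`; the summand `2` accounts for the two correction terms at `n = 0`. -/
theorem shell_card_le {q d N : ℕ} (hq : 0 < q) (hN : 1 ≤ N) :
    (N : ℝ) ^ d - ((q * (N / q) : ℕ) : ℝ) ^ d + 2 ≤ (d * q + 2) * (N : ℝ) ^ (d - 1) := by
  have hN1 : (1 : ℝ) ≤ N := by exact_mod_cast hN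
  have h1 := pow_sub_pow_le_mul (x := (N : ℝ)) (y := ((q * (N / q) : ℕ) : ℝ)) (by positivity)
    (by exact_mod_cast Nat.mul_div_le N q) d
  have h2 : (N : ℝ) - ((q * (N / q) : ℕ) : ℝ) ≤ q := by
    rw [sub_le_iff_le_add]
    have := Nat.lt_mul_div_succ N hq
    have : N ≤ q + q * (N / q) := by rw [mul_add, mul_one] at this; omega
    exact_mod_cast this
  have h3 : (1 : ℝ) ≤ (N : ℝ) ^ (d - 1) := one_le_pow₀ hN1
  have h4 : (d : ℝ) * (N : ℝ) ^ (d - 1) * ((N : ℝ) - ((q * (N / q) : ℕ) : ℝ)) ≤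
      d * (N : ℝ) ^ (d - 1) * q := by gcongr
  nlinarith

/-! ### From random words to uniformly distributed arguments -/

namespace Transducer

open scoped BigOperators

variable {q d : ℕ} {S : Type*} {T : Transducer q d S} [NeZero q] {𝕜 : Type*} [RCLike 𝕜]

/-- The sum of a function of the values over a box, as a function of the starting point of the
counter and of the initial state. -/
def boxSum (T : Transducer q d S) (φ : ℝ → 𝕜) (N : ℕ) (x : ℝ) (s : S) : 𝕜 :=
  ∑ n ∈ box d N, φ (x + T.valueFrom s n)

theorem sum_eq_expect_rclike (f : (Fin d → Fin q) → 𝕜) :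
    ∑ ε, f ε = (q : 𝕜) ^ d * 𝔼 ε, f ε := by
  rw [Fintype.expect_eq_sum_div_card]
  have : ((Fintype.card (Fin d → Fin q) : ℕ) : 𝕜) = (q : 𝕜) ^ d := by simp
  have hq : (q : 𝕜) ≠ 0 := by exact_mod_cast NeZero.ne q
  rw [this]
  field_simp

theorem boxSum_zero (hd : 1 ≤ d) (φ : ℝ → 𝕜) : T.boxSum φ 0 = 0 := by
  have : box d 0 = ∅ := by
    rw [← Finset.card_eq_zero, card_box]; exact zero_pow (by omega)
  ext x s
  simp [boxSum, this]

/-- Rounding the side down to a multiple of `q` allows the lowest digit to be averaged; the shell is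
kept as it is. If `N < q` the inner box is empty, and there is no correction at zero. -/
theorem boxSum_eq (hq : 2 ≤ q) (hd : 1 ≤ d) (φ : ℝ → 𝕜) (N : ℕ) :
    T.boxSum φ N = (q : 𝕜) ^ d • skewAvg 𝕜 T.next T.out (T.boxSum φ (N / q)) +
      ((∑ n ∈ box d N \ box d (q * (N / q)), fun x s => φ (x + T.valueFrom s n)) +
        if N / q = 0 then 0 else (fun x s => φ (x + T.valueFrom s 0)) -
          fun x s => φ (x + (T.out s 0 + T.valueFrom (T.next s 0) 0))) := by
  ext x s
  have hsub : box d (q * (N / q)) ⊆ box d N := box_mono (Nat.mul_div_le N q)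
  simp only [Pi.add_apply, Pi.smul_apply, Finset.sum_apply, smul_eq_mul]
  rw [skewAvg_apply, boxSum, ← Finset.sum_sdiff hsub, ← sum_eq_expect_rclike]
  by_cases h0 : N / q = 0
  · rw [if_pos h0, h0, boxSum_zero hd]
    have : box d (q * 0) = ∅ := by
      rw [← Finset.card_eq_zero, card_box, mul_zero, zero_pow (by omega)]
    rw [this]
    simp
  · rw [if_neg h0, sum_box_mul_valueFrom hq (Nat.pos_of_ne_zero h0) s (fun y => φ (x + y)),
      Finset.sum_comm]
    simp only [boxSum, Pi.sub_apply, ← add_assoc]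
    ring

variable [Fintype S]

set_option maxHeartbeats 600000 in
/-- From the random walk of the digits to uniformly distributed arguments. -/
theorem exists_transfer_box (hq : 2 ≤ q) (hd : 1 ≤ d) (T : Transducer q d S) : ∃ K : ℝ, 0 ≤ K ∧
    ∀ (N : ℕ), 1 ≤ N → ∀ (φ : ℝ → 𝕜) (τ : 𝕜) (η : ℝ), 0 ≤ η →
      (∀ (k : ℕ) (g : S → ℝ) (G : ℝ), q ^ k ≤ N → (∀ s, |g s| ≤ G) →
        ‖(skewAvg 𝕜 T.next T.out ^ k) (fun x s => φ (x + g s)) 0 T.init - τ‖ ≤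
          η * (1 + G + (Real.logb q N - k))) →
      ‖((N : 𝕜) ^ d)⁻¹ * ∑ n ∈ box d N, φ (T.valueFrom T.init n) - τ‖ ≤ K * η := by
  have hB := T.outBound_nonneg
  have hq0 : (0 : ℝ) < q := by exact_mod_cast (by omega : 0 < q)
  have hq1 : (1 : ℝ) < q := by exact_mod_cast (by omega : 1 < q)
  have hsq : 1 < √(q : ℝ) := by rw [← Real.sqrt_one]; exact Real.sqrt_lt_sqrt (by norm_num) hq1
  have hq𝕜 : (q : 𝕜) ≠ 0 := by exact_mod_cast NeZero.ne q
  set C₁ : ℝ := (d * q + 2) * (3 * (3 + 4 * T.outBound)) * 2 with hC₁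
  have hC₁0 : 0 ≤ C₁ := by positivity
  -- The solution of `C₂ = C₁ + C₂ / √q`: the contributions of the levels form a geometric series
  -- with ratio `√q`.
  set C₂ : ℝ := C₁ * √q / (√q - 1) with hC₂
  have hC₂0 : 0 ≤ C₂ := by
    have : 0 < √(q : ℝ) - 1 := by linarith
    positivity
  have hC₁₂ : C₁ = C₂ * (1 - (√(q : ℝ))⁻¹) := by
    have : √(q : ℝ) - 1 ≠ 0 := by linarith
    have : √(q : ℝ) ≠ 0 := by linarith
    rw [hC₂]; field_simp
  refine ⟨C₂, hC₂0, fun N₀ hN₀ φ τ η hη h => ?_⟩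
  have hN₀0 : (0 : ℝ) < N₀ := by exact_mod_cast hN₀
  set A : ℕ → ℕ → 𝕜 := fun k N => (skewAvg 𝕜 T.next T.out ^ k) (T.boxSum φ N) 0 T.init with hA
  -- `N` is the integer part of `N₀ / q^k`, and in `A k N` the lowest `k` digits are already free.
  -- The shell split off at level `k` has `O(N^(d-1))` points with errors `O(η √N)` each, a share
  -- `O(η √(q^k / N₀))` of `N₀^d`. The subtracted term leaves room for the levels below `k`, and the
  -- condition `q^k ≤ q N₀` keeps the bound nonnegative when `N` has reached `0`.
  have claim : ∀ N k : ℕ, q ^ k * N ≤ N₀ → N₀ < q ^ k * (N + 1) → q ^ k ≤ q * N₀ →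
      ((q : ℝ) ^ d) ^ k * ‖A k N - (N : 𝕜) ^ d * τ‖ ≤
        C₂ * η * (N₀ : ℝ) ^ d * (1 - (√q)⁻¹ * √((q : ℝ) ^ k / N₀)) := by
    intro N
    induction N using Nat.strong_induction_on with
    | _ N ih =>
      intro k hk1 hk2 hk3
      rcases Nat.eq_zero_or_pos N with rfl | hN
      · have h1 : A k 0 = 0 := by simp [hA, boxSum_zero hd]
        rw [h1, Nat.cast_zero, zero_pow (by omega), zero_mul, sub_zero, norm_zero, mul_zero]
        have h2 : √((q : ℝ) ^ k / N₀) ≤ √q := by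
          refine Real.sqrt_le_sqrt ?_
          rw [div_le_iff₀ hN₀0]
          exact_mod_cast hk3
        have h3 : (√(q : ℝ))⁻¹ * √((q : ℝ) ^ k / N₀) ≤ 1 := by
          rw [inv_mul_le_iff₀ (by linarith), mul_one]; exact h2
        have : 0 ≤ 1 - (√(q : ℝ))⁻¹ * √((q : ℝ) ^ k / N₀) := by linarith
        positivity
      have hN1 : (1 : ℝ) ≤ N := by exact_mod_cast hN
      set M := N / q with hM
      have hqM : q * M ≤ N := Nat.mul_div_le N q
      have hNM : N < q * (M + 1) := Nat.lt_mul_div_succ N (by omega)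
      have hqk : q ^ k ≤ N₀ := (Nat.le_mul_of_pos_right _ hN).trans hk1
      have hih := ih M (Nat.div_lt_self hN (by omega)) (k + 1)
        (by rw [pow_succ, mul_assoc]; exact (Nat.mul_le_mul_left _ hqM).trans hk1)
        (by rw [pow_succ, mul_assoc]; exact hk2.trans_le (Nat.mul_le_mul_left _ hNM))
        (by rw [pow_succ, mul_comm]; exact Nat.mul_le_mul_left _ hqk)
      set E : ℝ := 1 + 4 * T.outBound * (1 + Real.log N) + (Real.logb q N₀ - k) with hE
      have hlogN : 0 ≤ Real.log N := Real.log_natCast_nonneg N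
      have hlk : (k : ℝ) ≤ Real.logb q N₀ := by
        rw [Real.le_logb_iff_rpow_le hq1 hN₀0, Real.rpow_natCast]
        exact_mod_cast hqk
      have hE0 : 0 ≤ E := by
        have : 0 ≤ Real.logb q N₀ - k := by linarith
        positivity
      have hval : ∀ n ∈ box d N, ∀ s, |T.valueFrom s n| ≤ 4 * T.outBound * (1 + Real.log N) := by
        intro n hn s
        obtain ⟨N', rfl⟩ : ∃ N', N = N' + 1 := ⟨N - 1, by omega⟩
        have := abs_valueFrom_le_log (T := T) hq s hn
        push_cast
        exact this
      have hterm : ∀ g : S → ℝ, (∀ s, |g s| ≤ 4 * T.outBound * (1 + Real.log N)) →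
          ‖(skewAvg 𝕜 T.next T.out ^ k) (fun x s => φ (x + g s)) 0 T.init - τ‖ ≤ η * E :=
        fun g hg => h k g _ hqk hg
      set R : ℝ → S → 𝕜 := ((∑ n ∈ box d N \ box d (q * M), fun x s => φ (x + T.valueFrom s n)) +
        if M = 0 then 0 else (fun x s => φ (x + T.valueFrom s 0)) -
          fun x s => φ (x + (T.out s 0 + T.valueFrom (T.next s 0) 0))) with hR
      have hrec : A k N = (q : 𝕜) ^ d * A (k + 1) M + (skewAvg 𝕜 T.next T.out ^ k) R 0 T.init := by
        simp only [hA]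
        rw [boxSum_eq hq hd φ N, map_add, map_smul, pow_succ, Module.End.mul_apply]
        rfl
      have hcard : ((box d N \ box d (q * M)).card : ℝ) = (N : ℝ) ^ d - ((q * M : ℕ) : ℝ) ^ d := by
        rw [Finset.card_sdiff_of_subset (box_mono hqM), card_box, card_box,
          Nat.cast_sub (Nat.pow_le_pow_left hqM d)]
        push_cast; rfl
      have hshell : ((box d N \ box d (q * M)).card : ℝ) + 2 ≤ (d * q + 2) * (N : ℝ) ^ (d - 1) := by
        rw [hcard]
        exact shell_card_le (by omega) hN
      have hRτ : ‖(skewAvg 𝕜 T.next T.out ^ k) R 0 T.init -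
          ((N : 𝕜) ^ d - (((q * M : ℕ) : 𝕜)) ^ d) * τ‖ ≤
          (((box d N \ box d (q * M)).card : ℝ) + 2) * (η * E) := by
        have hcard' : (N : 𝕜) ^ d - (((q * M : ℕ) : 𝕜)) ^ d =
            ((box d N \ box d (q * M)).card : 𝕜) := by
          have := congrArg (fun r : ℝ => (r : 𝕜)) hcard
          push_cast at this ⊢
          rw [this]
        rw [hcard', hR, map_add, map_sum, add_mul]
        simp only [Pi.add_apply, Finset.sum_apply]
        rw [add_sub_right_comm, ← nsmul_eq_mul, ← Finset.sum_const, ← Finset.sum_sub_distrib]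
        refine (norm_add_le _ _).trans (add_le_add ?_ ?_)
        · refine (norm_sum_le _ _).trans ?_
          rw [← nsmul_eq_mul]
          refine Finset.sum_le_card_nsmul _ _ _ fun n hn => hterm _ fun s => ?_
          exact hval n (Finset.mem_sdiff.1 hn).1 s
        · split_ifs with hM0
          · simp only [map_zero, Pi.zero_apply, norm_zero]; positivity
          · rw [map_sub, Pi.sub_apply, Pi.sub_apply, two_mul]
            have e1 := hterm (fun s => T.valueFrom s 0) (hval 0 (mem_box.2 fun _ => hN))
            have e2 := hterm (fun s => T.out s 0 + T.valueFrom (T.next s 0) 0) fun s => by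
              refine (abs_add_le _ _).trans ((add_le_add (abs_out_le s 0)
                (valueFrom_zero_bound _)).trans ?_)
              nlinarith
            calc _ = ‖((skewAvg 𝕜 T.next T.out ^ k) (fun x s => φ (x + T.valueFrom s 0)) 0 T.init - τ) -
                  ((skewAvg 𝕜 T.next T.out ^ k) (fun x s => φ (x + (T.out s 0 +
                    T.valueFrom (T.next s 0) 0))) 0 T.init - τ)‖ := by congr 1; ring
              _ ≤ _ := (norm_sub_le _ _).trans (add_le_add e1 e2)
      have hsplit : A k N - (N : 𝕜) ^ d * τ = (q : 𝕜) ^ d * (A (k + 1) M - (M : 𝕜) ^ d * τ) +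
          ((skewAvg 𝕜 T.next T.out ^ k) R 0 T.init -
          ((N : 𝕜) ^ d - (((q * M : ℕ) : 𝕜)) ^ d) * τ) := by
        rw [hrec]; push_cast; rw [mul_pow]; ring
      set r := √((q : ℝ) ^ k / N₀) with hr
      have hr' : √((q : ℝ) ^ (k + 1) / N₀) = √q * r := by
        rw [hr, ← Real.sqrt_mul (by positivity), pow_succ]; congr 1; ring
      rw [hr'] at hih
      have hEN : E ≤ 3 * (3 + 4 * T.outBound) * √N := by
        have h1 := one_add_log_succ_le_sqrt hN
        have h2 := logb_sub_le hq hN₀ hk2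
        have h3 : Real.log N ≤ Real.log (N + 1) := Real.log_le_log (by linarith) (by linarith)
        have h4 : 4 * T.outBound * (1 + Real.log N) ≤ 4 * T.outBound * (3 * √N) := by
          gcongr; linarith
        have h5 : 0 ≤ Real.log ((N : ℝ) + 1) := Real.log_nonneg (by linarith)
        rw [hE]
        linarith
      have hrN : (√(N : ℝ))⁻¹ ≤ 2 * r := inv_sqrt_le_of_lt hN₀ hN hk2
      have hqN : ((q : ℝ) ^ d) ^ k * (N : ℝ) ^ d ≤ (N₀ : ℝ) ^ d := by
        rw [← pow_mul, mul_comm d k, pow_mul, ← mul_pow]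
        gcongr
        exact_mod_cast hk1
      have hrem : ((q : ℝ) ^ d) ^ k * ((((box d N \ box d (q * M)).card : ℝ) + 2) * (η * E)) ≤
          C₁ * η * (N₀ : ℝ) ^ d * r := by
        calc _ ≤ ((q : ℝ) ^ d) ^ k * (((d * q + 2) * (N : ℝ) ^ (d - 1)) *
              (η * (3 * (3 + 4 * T.outBound) * √N))) := by gcongr
          _ = (d * q + 2) * (3 * (3 + 4 * T.outBound)) * η * (((q : ℝ) ^ d) ^ k * (N : ℝ) ^ d) *
              (√(N : ℝ))⁻¹ := by
              have e1 : (N : ℝ) ^ d = (N : ℝ) ^ (d - 1) * (√N * √N) := by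
                rw [Real.mul_self_sqrt (by linarith), ← pow_succ, Nat.sub_add_cancel hd]
              have e2 : √(N : ℝ) ≠ 0 := (Real.sqrt_pos.2 (by linarith)).ne'
              rw [e1]; field_simp
          _ ≤ (d * q + 2) * (3 * (3 + 4 * T.outBound)) * η * (N₀ : ℝ) ^ d * (2 * r) := by gcongr
          _ = _ := by rw [hC₁]; ring
      have hnq : ‖(q : 𝕜) ^ d‖ = (q : ℝ) ^ d := by simp
      calc ((q : ℝ) ^ d) ^ k * ‖A k N - (N : 𝕜) ^ d * τ‖ ≤ ((q : ℝ) ^ d) ^ k *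
            ((q : ℝ) ^ d * ‖A (k + 1) M - (M : 𝕜) ^ d * τ‖ +
              (((box d N \ box d (q * M)).card : ℝ) + 2) * (η * E)) := by
            gcongr
            rw [hsplit]
            refine (norm_add_le _ _).trans (add_le_add ?_ hRτ)
            rw [norm_mul, hnq]
        _ = ((q : ℝ) ^ d) ^ (k + 1) * ‖A (k + 1) M - (M : 𝕜) ^ d * τ‖ +
            ((q : ℝ) ^ d) ^ k * ((((box d N \ box d (q * M)).card : ℝ) + 2) * (η * E)) := by
            rw [pow_succ]; ring
        _ ≤ C₂ * η * (N₀ : ℝ) ^ d * (1 - (√q)⁻¹ * (√q * r)) + C₁ * η * (N₀ : ℝ) ^ d * r :=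
            add_le_add hih hrem
        _ = C₂ * η * (N₀ : ℝ) ^ d * (1 - (√q)⁻¹ * r) := by
            have : √(q : ℝ) ≠ 0 := by linarith
            rw [hC₁₂]; field_simp; ring
  have hfin := claim N₀ 0 (by simp) (by simp) (by simpa using Nat.le_mul_of_pos_left N₀ (by omega) |>.trans' hN₀)
  have hA0 : A 0 N₀ = ∑ n ∈ box d N₀, φ (T.valueFrom T.init n) := by
    simp [hA, boxSum]
  rw [hA0, pow_zero, one_mul] at hfin
  have hN𝕜 : ((N₀ : 𝕜) ^ d) ≠ 0 := by
    have : (N₀ : 𝕜) ≠ 0 := by exact_mod_cast (by omega : N₀ ≠ 0)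
    positivity
  have h1 : ((N₀ : 𝕜) ^ d)⁻¹ * ∑ n ∈ box d N₀, φ (T.valueFrom T.init n) - τ =
      ((N₀ : 𝕜) ^ d)⁻¹ * (∑ n ∈ box d N₀, φ (T.valueFrom T.init n) - (N₀ : 𝕜) ^ d * τ) := by
    field_simp
  rw [h1, norm_mul, norm_inv, norm_pow, RCLike.norm_natCast, inv_mul_le_iff₀ (by positivity)]
  refine hfin.trans ?_
  have : 0 ≤ C₂ * η * (N₀ : ℝ) ^ d := by positivity
  have h2 : 0 ≤ (√(q : ℝ))⁻¹ * √((q : ℝ) ^ 0 / N₀) := by positivity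
  nlinarith

/-- From the random walks within the final components to uniformly distributed arguments. -/
theorem exists_transfer (hq : 2 ≤ q) (hd : 1 ≤ d) (T : Transducer q d S) : ∃ K : ℝ, 0 ≤ K ∧
    ∀ (N : ℕ), 1 ≤ N → ∀ (φ : ℝ → 𝕜) (τ : Finset S → 𝕜) (η : ℝ), 0 ≤ η →
      2 ≤ η * (1 + Real.logb q N) → (∀ x, ‖φ x‖ ≤ 1) → (∀ C ∈ T.finalComponents, ‖τ C‖ ≤ 1) →
      (∀ C ∈ T.finalComponents, ∀ s ∈ C, ∀ (k : ℕ) (g : S → ℝ) (G x : ℝ), k ≤ Real.logb q N →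
        (∀ s, |g s| ≤ G) →
        ‖(skewAvg 𝕜 T.next T.out ^ k) (fun x s => φ (x + g s)) x s - τ C‖ ≤
          η * (1 + |x| + G + (Real.logb q N - k))) →
      ‖((N : 𝕜) ^ d)⁻¹ * ∑ n ∈ box d N, φ (T.valueFrom T.init n) -
        ∑ C ∈ T.finalComponents, (T.absorption C T.init : 𝕜) * τ C‖ ≤ K * η := by
  obtain ⟨K, hK, h⟩ := exists_transfer_box (𝕜 := 𝕜) hq hd T
  obtain ⟨t, ht0, ht⟩ := T.exists_drift
  have hB := T.outBound_nonneg
  set c := 1 + T.outBound with hc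
  refine ⟨K * (1 + c * t T.init), mul_nonneg hK (by have := ht0 T.init; positivity),
    fun N hN φ τ η hη hη2 hφ hτ hcomp => ?_⟩
  have hq1 : (1 : ℝ) < q := by exact_mod_cast (by omega : 1 < q)
  set l := Real.logb q N with hl
  -- The harmonic extension of `τ` is the expected target of the walk before its component is known.
  set τ' : S → 𝕜 := fun s => ∑ C ∈ T.finalComponents, (T.absorption C s : 𝕜) * τ C with hτ'
  have hτharm : ∀ s, 𝔼 ε, τ' (T.next s ε) = τ' s := by
    intro s
    simp only [hτ']
    rw [Finset.expect_sum_comm]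
    refine Finset.sum_congr rfl fun C _ => ?_
    rw [← Finset.expect_mul, ← T.absorption_harmonic C s]
    congr 1
    rw [Fintype.expect_eq_sum_div_card, Fintype.expect_eq_sum_div_card]
    push_cast
    rfl
  have hτ1 : ∀ s, ‖τ' s‖ ≤ 1 := by
    intro s
    refine (norm_sum_le _ _).trans ?_
    rw [← T.sum_absorption s]
    refine Finset.sum_le_sum fun C hC => ?_
    have h0 := absorption_nonneg (mem_finalComponents.1 hC) s
    rw [norm_mul, RCLike.norm_ofReal, abs_of_nonneg h0]
    exact mul_le_of_le_one_right h0 (hτ C hC)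
  have hτC : ∀ C ∈ T.finalComponents, ∀ s ∈ C, τ' s = τ C := by
    intro C hC s hs
    simp only [hτ']
    rw [Finset.sum_eq_single_of_mem C hC fun C' hC' hne => by
      rw [absorption_of_mem_of_ne (mem_finalComponents.1 hC') (mem_finalComponents.1 hC) hne hs]
      simp, absorption_of_mem (mem_finalComponents.1 hC) hs]
    simp
  -- A step outside the final components moves the counter by at most `T.outBound` and uses up one
  -- letter, which costs `c = 1 + T.outBound` in the bound; the mean decrease of `c * t` by at least
  -- `c` pays for it.
  have main : ∀ (k : ℕ) (g : S → ℝ) (G : ℝ), k ≤ l → (∀ s, |g s| ≤ G) → ∀ (x : ℝ) (s : S),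
      ‖(skewAvg 𝕜 T.next T.out ^ k) (fun x s => φ (x + g s)) x s - τ' s‖ ≤
        η * (1 + |x| + G + (l - k) + c * t s) := by
    intro k g G hk hg
    induction k with
    | zero =>
      intro x s
      have hG : 0 ≤ G := (abs_nonneg _).trans (hg s)
      -- With no letters left nothing is known, but then `l - k = l` and the trivial bound `2` is
      -- covered by `hη2`.
      have h1 : ‖(skewAvg 𝕜 T.next T.out ^ 0) (fun x s => φ (x + g s)) x s - τ' s‖ ≤ 2 := by
        refine (norm_sub_le _ _).trans ?_
        have := hφ (x + g s)
        have := hτ1 s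
        simp only [pow_zero, Module.End.one_apply]
        linarith
      refine h1.trans (hη2.trans ?_)
      have h2 := ht0 s
      have h3 : 0 ≤ c * t s := by positivity
      refine mul_le_mul_of_nonneg_left ?_ hη
      push_cast
      linarith [abs_nonneg x]
    | succ k ih =>
      intro x s
      by_cases hs : s ∈ T.finalStates
      · obtain ⟨C, hC, hsC⟩ := hs
        rw [hτC C hC s hsC]
        refine (hcomp C hC s hsC (k + 1) g G x hk hg).trans ?_
        refine mul_le_mul_of_nonneg_left ?_ hη
        have h2 := ht0 s
        have h3 : 0 ≤ c * t s := by positivity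
        linarith
      · rw [skewAvg_pow_succ, ← hτharm s, ← Finset.expect_sub_distrib]
        have hk' : (k : ℝ) ≤ l := by push_cast at hk; linarith
        refine (RCLike.norm_expect_le (K := 𝕜)).trans ?_
        calc (𝔼 ε, ‖(skewAvg 𝕜 T.next T.out ^ k) (fun x s => φ (x + g s)) (x + T.out s ε)
              (T.next s ε) - τ' (T.next s ε)‖) ≤
              𝔼 ε, (η * (1 + |x| + T.outBound + G + (l - k)) + η * c * t (T.next s ε)) := by
              refine Finset.expect_le_expect fun ε _ => (ih hk' _ _).trans ?_
              rw [mul_assoc η c, ← mul_add]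
              refine mul_le_mul_of_nonneg_left ?_ hη
              have := (abs_add_le x (T.out s ε)).trans (add_le_add_right (abs_out_le s ε) _)
              linarith
          _ = η * (1 + |x| + T.outBound + G + (l - k)) + η * c * 𝔼 ε, t (T.next s ε) := by
              rw [Finset.expect_add_distrib, Finset.expect_const Finset.univ_nonempty,
                Finset.mul_expect]
          _ ≤ η * (1 + |x| + T.outBound + G + (l - k)) + η * c * (t s - 1) := by
              have := ht s hs
              have hc0 : 0 ≤ c := by positivity
              gcongr
              linarith
          _ = _ := by push_cast; rw [hc]; ring
  have h1 := h N hN φ (τ' T.init) (η * (1 + c * t T.init))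
    (mul_nonneg hη (by have := ht0 T.init; positivity)) fun k g G hk hg => ?_
  · rw [mul_assoc, mul_comm _ η]; exact h1
  · have hk' : (k : ℝ) ≤ l := by
      rw [hl, Real.le_logb_iff_rpow_le hq1 (by exact_mod_cast hN), Real.rpow_natCast]
      exact_mod_cast hk
    refine (main k g G hk' hg 0 T.init).trans ?_
    have h2 : 0 ≤ c * t T.init := by have := ht0 T.init; positivity
    have hG : 0 ≤ G := (abs_nonneg _).trans (hg T.init)
    rw [abs_zero, add_zero, mul_assoc]
    gcongr
    nlinarith [mul_nonneg h2 (add_nonneg hG (sub_nonneg.2 hk'))]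

end Transducer

/-! ### Twisted averages and almost eigenfunctions -/

section TwistAverage

open scoped BigOperators

variable {σ A : Type*} [Fintype A]

/-- The averaging operator twisted by the characters `exp (i t D)` of the increments. -/
def twistAvg (nx : σ → A → σ) (D : σ → A → ℝ) (t : ℝ) : Module.End ℂ (σ → ℂ) where
  toFun f s := 𝔼 a, Complex.exp (t * D s a * Complex.I) * f (nx s a)
  map_add' f g := by
    ext s; simp [mul_add, Finset.expect_add_distrib]
  map_smul' c f := by
    ext s
    simp only [Pi.smul_apply, smul_eq_mul, RingHom.id_apply, Finset.mul_expect]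
    exact Finset.expect_congr rfl fun _ _ => by ring

variable {nx : σ → A → σ} {D : σ → A → ℝ}

theorem twistAvg_apply (t : ℝ) (f : σ → ℂ) (s : σ) :
    twistAvg nx D t f s = 𝔼 a, Complex.exp (t * D s a * Complex.I) * f (nx s a) := rfl

/-- A character in the counter turns translations into factors, so the walk with a counter reduces
to an operator on functions of the state. -/
theorem skewAvg_pow_exp (t : ℝ) (k : ℕ) (f : σ → ℂ) (x : ℝ) (s : σ) :
    (skewAvg ℂ nx D ^ k) (fun x s => Complex.exp (t * x * Complex.I) * f s) x s =
      Complex.exp (t * x * Complex.I) * (twistAvg nx D t ^ k) f s := by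
  induction k generalizing x s with
  | zero => rfl
  | succ k ih =>
    rw [skewAvg_pow_succ, pow_succ', Module.End.mul_apply, twistAvg_apply, Finset.mul_expect]
    refine Finset.expect_congr rfl fun a _ => ?_
    rw [ih, ← mul_assoc, ← Complex.exp_add]
    push_cast
    congr 2
    ring

theorem norm_exp_mul_mul_I (t x : ℝ) : ‖Complex.exp (t * x * Complex.I)‖ = 1 := by
  have := Complex.norm_exp_ofReal_mul_I (t * x)
  push_cast at this
  exact this

theorem norm_exp_sub_exp_le (x y : ℝ) :
    ‖Complex.exp (x * Complex.I) - Complex.exp (y * Complex.I)‖ ≤ |x - y| := by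
  have h : Complex.exp (x * Complex.I) - Complex.exp (y * Complex.I) =
      Complex.exp (y * Complex.I) * (Complex.exp (Complex.I * ((x - y : ℝ) : ℂ)) - 1) := by
    rw [mul_sub, mul_one, ← Complex.exp_add]
    congr 2
    push_cast
    ring
  rw [h, norm_mul, Complex.norm_exp_ofReal_mul_I, one_mul]
  exact Real.norm_exp_I_mul_ofReal_sub_one_le

variable [Nonempty A] {K : Set σ}

theorem norm_twistAvg_le (hK : ∀ s ∈ K, ∀ a, nx s a ∈ K) (t : ℝ) {f : σ → ℂ} {c : ℝ}
    (hf : ∀ s ∈ K, ‖f s‖ ≤ c) : ∀ s ∈ K, ‖twistAvg nx D t f s‖ ≤ c := by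
  intro s hs
  rw [twistAvg_apply]
  refine (RCLike.norm_expect_le (K := ℂ)).trans
    (Finset.expect_le Finset.univ_nonempty fun a _ => ?_)
  rw [norm_mul, norm_exp_mul_mul_I, one_mul]
  exact hf _ (hK s hs a)

theorem norm_twistAvg_pow_le (hK : ∀ s ∈ K, ∀ a, nx s a ∈ K) (t : ℝ) (k : ℕ) {f : σ → ℂ} {c : ℝ}
    (hf : ∀ s ∈ K, ‖f s‖ ≤ c) : ∀ s ∈ K, ‖(twistAvg nx D t ^ k) f s‖ ≤ c := by
  induction k with
  | zero => exact hf
  | succ k ih =>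
    rw [pow_succ', Module.End.mul_apply]
    exact norm_twistAvg_le hK t ih

theorem exists_le_of_finite {ι : Type*} [Finite ι] (f : ι → ℝ) : ∃ C, 0 ≤ C ∧ ∀ i, |f i| ≤ C := by
  have := Fintype.ofFinite ι
  exact ⟨∑ i, |f i|, by positivity, fun i => Finset.single_le_sum (f := fun i => |f i|)
    (fun _ _ => abs_nonneg _) (Finset.mem_univ i)⟩

theorem norm_exp_sub_taylor_le (x : ℂ) {r : ℝ} (h : ‖x‖ ≤ r) :
    ‖Complex.exp x - (1 + x + x ^ 2 / 2)‖ ≤ ‖x‖ ^ 3 * Real.exp r := by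
  have h1 := Complex.norm_exp_sub_sum_le_norm_mul_exp x 3
  have h2 : ∑ m ∈ Finset.range 3, x ^ m / (m.factorial : ℂ) = 1 + x + x ^ 2 / 2 := by
    simp [Finset.sum_range_succ]
  rw [h2] at h1
  refine h1.trans ?_
  gcongr

theorem norm_exp_sub_one_sub_le (x : ℂ) {r : ℝ} (h : ‖x‖ ≤ r) :
    ‖Complex.exp x - (1 + x)‖ ≤ ‖x‖ ^ 2 * Real.exp r := by
  have h1 := Complex.norm_exp_sub_sum_le_norm_mul_exp x 2
  have h2 : ∑ m ∈ Finset.range 2, x ^ m / (m.factorial : ℂ) = 1 + x := by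
    simp [Finset.sum_range_succ]
  rw [h2] at h1
  refine h1.trans ?_
  gcongr

theorem expect_ofReal {ι : Type*} [Fintype ι] (f : ι → ℝ) : (𝔼 i, (f i : ℂ)) = ((𝔼 i, f i : ℝ) : ℂ) := by
  rw [Fintype.expect_eq_sum_div_card, Fintype.expect_eq_sum_div_card]
  push_cast
  rfl

/-- A function which is almost an eigenfunction of the twisted averaging operator. -/
def almostEigen (H₂ : σ → ℝ) (t : ℝ) (s : σ) : ℂ := 1 - t ^ 2 / 2 * H₂ s

/-- Both sides agree to second order in `t`: the linear term averages to zero, and the quadratic one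
is `-t²/2` times the mean of `D²` plus `P H₂`, which the Poisson equation turns into `b + H₂`. The
rest is `O(|t|³)`. -/
theorem exists_norm_twistAvg_almostEigen_sub_le [Finite σ] {b : ℝ} (hb : 0 ≤ b) {H₂ : σ → ℝ}
    (hD : ∀ s ∈ K, 𝔼 a, D s a = 0)
    (hD₂ : ∀ s ∈ K, 𝔼 a, D s a ^ 2 = b + H₂ s - 𝔼 a, H₂ (nx s a)) (t₀ : ℝ) :
    ∃ C, 0 ≤ C ∧ ∀ t : ℝ, |t| ≤ t₀ → ∀ s ∈ K,
      ‖twistAvg nx D t (almostEigen H₂ t) s - Complex.exp (-(b * t ^ 2 / 2 : ℝ)) *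
        almostEigen H₂ t s‖ ≤ C * |t| ^ 3 := by
  rcases lt_or_ge t₀ 0 with ht₀ | ht₀
  · exact ⟨0, le_rfl, fun t ht => absurd (ht.trans_lt ht₀) (not_lt.2 (abs_nonneg t))⟩
  obtain ⟨M, hM, hDM⟩ := exists_le_of_finite fun x : σ × A => D x.1 x.2
  obtain ⟨M₂, hM₂, hHM⟩ := exists_le_of_finite H₂
  have hHn : ∀ s, ‖(H₂ s : ℂ)‖ ≤ M₂ := fun s => by rw [Complex.norm_real]; exact hHM s
  set C₁ := M ^ 3 * Real.exp (t₀ * M) * (1 + t₀ ^ 2 / 2 * M₂) + M₂ / 2 * (M + t₀ * M ^ 2 / 2) with hC₁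
  set C₂ := t₀ * (b / 2) ^ 2 * Real.exp (b * t₀ ^ 2 / 2) * (1 + t₀ ^ 2 / 2 * M₂) +
    t₀ * (b / 2 * (M₂ / 2)) with hC₂
  refine ⟨C₁ + C₂, by positivity, fun t ht s hs => ?_⟩
  have ht2 : t ^ 2 ≤ t₀ ^ 2 := by rw [← sq_abs t]; gcongr
  have hnt : ‖(t : ℂ)‖ = |t| := by simp
  have hf : ∀ s, ‖almostEigen H₂ t s‖ ≤ 1 + t₀ ^ 2 / 2 * M₂ := fun s => by
    refine (norm_sub_le _ _).trans ?_
    rw [norm_one, norm_mul, norm_div, norm_pow, hnt, sq_abs]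
    have := hHn s
    have h2 : ‖(2 : ℂ)‖ = 2 := by simp
    rw [h2]
    gcongr
  have hX : ∀ a, ‖Complex.exp (t * D s a * Complex.I) * almostEigen H₂ t (nx s a) -
      (1 + t * D s a * Complex.I - t ^ 2 / 2 * ((D s a) ^ 2 + H₂ (nx s a)))‖ ≤ C₁ * |t| ^ 3 := by
    intro a
    have hDa := hDM (s, a)
    simp only at hDa
    have hn : ‖(t * D s a * Complex.I : ℂ)‖ = |t| * |D s a| := by simp
    have h1 := norm_exp_sub_taylor_le (t * D s a * Complex.I) (r := t₀ * M)
      (by rw [hn]; gcongr)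
    rw [hn] at h1
    have h2 : Complex.exp (t * D s a * Complex.I) * almostEigen H₂ t (nx s a) -
      (1 + t * D s a * Complex.I - t ^ 2 / 2 * ((D s a) ^ 2 + H₂ (nx s a))) =
      (Complex.exp (t * D s a * Complex.I) - (1 + t * D s a * Complex.I +
        (t * D s a * Complex.I) ^ 2 / 2)) * almostEigen H₂ t (nx s a) -
      t ^ 2 / 2 * H₂ (nx s a) * (t * D s a * Complex.I - t ^ 2 * D s a ^ 2 / 2) := by
      have : (Complex.I) ^ 2 = -1 := Complex.I_sq
      simp only [almostEigen, mul_pow, this]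
      ring
    rw [h2]
    refine (norm_sub_le _ _).trans ?_
    rw [norm_mul]
    have h3 : ‖(t ^ 2 / 2 * H₂ (nx s a) * (t * D s a * Complex.I - t ^ 2 * D s a ^ 2 / 2) : ℂ)‖ ≤
        |t| ^ 2 / 2 * M₂ * (|t| * M + |t| * t₀ * M ^ 2 / 2) := by
      rw [norm_mul, norm_mul, norm_div, norm_pow, hnt]
      have h2 : ‖(2 : ℂ)‖ = 2 := by simp
      rw [h2]
      gcongr
      · exact hHn _
      · refine (norm_sub_le _ _).trans ?_
        rw [hn, norm_div, norm_mul, norm_pow, norm_pow, hnt, h2, Complex.norm_real,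
          Real.norm_eq_abs]
        have : |t| ^ 2 ≤ |t| * t₀ := by rw [pow_two]; gcongr
        gcongr
    calc _ ≤ (|t| * M) ^ 3 * Real.exp (t₀ * M) * (1 + t₀ ^ 2 / 2 * M₂) +
          |t| ^ 2 / 2 * M₂ * (|t| * M + |t| * t₀ * M ^ 2 / 2) := by
          gcongr
          · refine h1.trans ?_
            gcongr
          · exact hf _
      _ = C₁ * |t| ^ 3 := by rw [hC₁]; ring
  have hY : ‖Complex.exp (-(b * t ^ 2 / 2 : ℝ)) * almostEigen H₂ t s -
      (1 - t ^ 2 / 2 * (b + H₂ s))‖ ≤ C₂ * |t| ^ 3 := by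
    have hn : ‖(-(b * t ^ 2 / 2 : ℝ) : ℂ)‖ = b * t ^ 2 / 2 := by
      rw [norm_neg, Complex.norm_real, Real.norm_of_nonneg (by positivity)]
    have h1 := norm_exp_sub_one_sub_le (-(b * t ^ 2 / 2 : ℝ)) (r := b * t₀ ^ 2 / 2)
      (by rw [hn]; gcongr)
    rw [hn] at h1
    have h2 : Complex.exp (-(b * t ^ 2 / 2 : ℝ)) * almostEigen H₂ t s -
      (1 - t ^ 2 / 2 * (b + H₂ s)) = (Complex.exp (-(b * t ^ 2 / 2 : ℝ)) -
        (1 + (-(b * t ^ 2 / 2 : ℝ)))) * almostEigen H₂ t s +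
        ((b * t ^ 2 / 2 * (t ^ 2 / 2 * H₂ s) : ℝ) : ℂ) := by
      simp only [almostEigen]; push_cast; ring
    rw [h2]
    refine (norm_add_le _ _).trans ?_
    rw [norm_mul, Complex.norm_real, Real.norm_eq_abs, abs_mul, abs_mul,
      abs_of_nonneg (by positivity : 0 ≤ b * t ^ 2 / 2), abs_of_nonneg (by positivity : 0 ≤ t ^ 2 / 2)]
    have h4 : t ^ 2 * t ^ 2 ≤ |t| ^ 3 * t₀ := by
      rw [← sq_abs]
      calc |t| ^ 2 * |t| ^ 2 = |t| ^ 3 * |t| := by ring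
        _ ≤ _ := by gcongr
    calc _ ≤ (b * t ^ 2 / 2) ^ 2 * Real.exp (b * t₀ ^ 2 / 2) * (1 + t₀ ^ 2 / 2 * M₂) +
          b * t ^ 2 / 2 * (t ^ 2 / 2 * M₂) := by
          gcongr
          · exact hf s
          · exact hHM s
      _ = (t ^ 2 * t ^ 2) * ((b / 2) ^ 2 * Real.exp (b * t₀ ^ 2 / 2) * (1 + t₀ ^ 2 / 2 * M₂) +
          b / 2 * (M₂ / 2)) := by ring
      _ ≤ (|t| ^ 3 * t₀) * ((b / 2) ^ 2 * Real.exp (b * t₀ ^ 2 / 2) * (1 + t₀ ^ 2 / 2 * M₂) +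
          b / 2 * (M₂ / 2)) := by gcongr
      _ = C₂ * |t| ^ 3 := by rw [hC₂]; ring
  have hmid : (𝔼 a, (1 + t * D s a * Complex.I - t ^ 2 / 2 * ((D s a) ^ 2 + H₂ (nx s a)) : ℂ)) =
      1 - t ^ 2 / 2 * (b + H₂ s) := by
    have e1 : (𝔼 a, (t * D s a * Complex.I : ℂ)) = 0 := by
      rw [← Finset.expect_mul, ← Finset.mul_expect, expect_ofReal, hD s hs]; simp
    have e2 : (𝔼 a, ((D s a : ℂ) ^ 2 + H₂ (nx s a))) = b + H₂ s := by
      have := expect_ofReal fun a => D s a ^ 2 + H₂ (nx s a)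
      refine (Finset.expect_congr rfl fun a _ => by push_cast; rfl).trans (this.trans ?_)
      rw [Finset.expect_add_distrib, hD₂ s hs]
      push_cast
      ring
    rw [Finset.expect_sub_distrib, Finset.expect_add_distrib, e1, ← Finset.mul_expect, e2,
      Finset.expect_const Finset.univ_nonempty, add_zero]
  have hfinal : twistAvg nx D t (almostEigen H₂ t) s - Complex.exp (-(b * t ^ 2 / 2 : ℝ)) *
        almostEigen H₂ t s = (𝔼 a, (Complex.exp (t * D s a * Complex.I) * almostEigen H₂ t (nx s a) -
      (1 + t * D s a * Complex.I - t ^ 2 / 2 * ((D s a) ^ 2 + H₂ (nx s a))))) -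
      (Complex.exp (-(b * t ^ 2 / 2 : ℝ)) * almostEigen H₂ t s - (1 - t ^ 2 / 2 * (b + H₂ s))) := by
    rw [Finset.expect_sub_distrib, hmid, twistAvg_apply]; ring
  rw [hfinal, add_mul]
  refine (norm_sub_le _ _).trans (add_le_add ?_ hY)
  exact (RCLike.norm_expect_le (K := ℂ)).trans (Finset.expect_le Finset.univ_nonempty fun a _ => hX a)

/-- The characteristic function of the sum of the increments, compared with that of a normal
distribution. -/
theorem exists_norm_twistAvg_pow_sub_le [Finite σ] {b : ℝ} (hb : 0 ≤ b) {H₂ : σ → ℝ}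
    (hD : ∀ s ∈ K, 𝔼 a, D s a = 0)
    (hD₂ : ∀ s ∈ K, 𝔼 a, D s a ^ 2 = b + H₂ s - 𝔼 a, H₂ (nx s a)) {t₀ c B : ℝ} (hc : 0 ≤ c)
    (hcb : c ≤ b / 2) (hB : 1 ≤ B)
    (hL : ∀ t : ℝ, |t| ≤ t₀ → ∀ (k : ℕ) (f : σ → ℂ) (m : ℝ), (∀ s ∈ K, ‖f s‖ ≤ m) →
      ∀ s ∈ K, ‖(twistAvg nx D t ^ k) f s‖ ≤ B * Real.exp (-(c * k * t ^ 2)) * m) :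
    ∃ C, 0 ≤ C ∧ ∀ t : ℝ, |t| ≤ t₀ → ∀ (k : ℕ), ∀ s ∈ K,
      ‖(twistAvg nx D t ^ k) 1 s - Complex.exp (-(b * k * t ^ 2 / 2 : ℝ))‖ ≤
        C * (t ^ 2 + k * |t| ^ 3) * Real.exp (-(c * k * t ^ 2)) := by
  obtain ⟨C, hC, hstep⟩ := exists_norm_twistAvg_almostEigen_sub_le (nx := nx) hb hD hD₂ t₀
  obtain ⟨M₂, hM₂, hHM⟩ := exists_le_of_finite H₂
  refine ⟨B * M₂ + C * B * Real.exp (c * t₀ ^ 2), by positivity, fun t ht k s hs => ?_⟩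
  set f := almostEigen H₂ t with hf
  have hf1 : ∀ s, ‖(1 : σ → ℂ) s - f s‖ ≤ t ^ 2 / 2 * M₂ := fun s => by
    have : (1 : σ → ℂ) s - f s = ((t ^ 2 / 2 * H₂ s : ℝ) : ℂ) := by
      simp [hf, almostEigen]
    rw [this, Complex.norm_real, Real.norm_eq_abs, abs_mul, abs_of_nonneg (by positivity)]
    gcongr
    exact hHM s
  have hct : Real.exp (c * t ^ 2) ≤ Real.exp (c * t₀ ^ 2) := by
    have : t ^ 2 ≤ t₀ ^ 2 := by rw [← sq_abs t]; gcongr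
    gcongr
  have hne : ∀ r : ℝ, ‖Complex.exp (-(r : ℝ))‖ = Real.exp (-r) := fun r => by
    rw [← Complex.ofReal_neg, ← Complex.ofReal_exp, Complex.norm_real,
      Real.norm_of_nonneg (Real.exp_pos _).le]
  have hkk : ∀ k : ℕ, Real.exp (-(b * k * t ^ 2 / 2)) ≤ Real.exp (-(c * k * t ^ 2)) := fun k => by
    have : 0 ≤ (k : ℝ) * t ^ 2 := by positivity
    gcongr
    nlinarith
  -- Replacing one application of the operator by its almost eigenvalue costs `O(|t|³)`. This error
  -- is damped by the remaining applications through `hL`, the earlier ones by `c ≤ b / 2`; the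
  -- factor `exp (c t₀²)` makes up for the one undamped step.
  have main : ∀ k : ℕ, ∀ s ∈ K, ‖(twistAvg nx D t ^ k) f s -
      Complex.exp (-(b * k * t ^ 2 / 2 : ℝ)) * f s‖ ≤
      C * B * Real.exp (c * t₀ ^ 2) * (k * |t| ^ 3) * Real.exp (-(c * k * t ^ 2)) := by
    intro k
    induction k with
    | zero => intro s _; simp
    | succ k ih =>
      intro s hs
      have h1 : (twistAvg nx D t ^ (k + 1)) f = (twistAvg nx D t ^ k)
          (Complex.exp (-(b * t ^ 2 / 2 : ℝ)) • f) + (twistAvg nx D t ^ k)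
          (twistAvg nx D t f - Complex.exp (-(b * t ^ 2 / 2 : ℝ)) • f) := by
        rw [← map_add, add_sub_cancel, pow_succ, Module.End.mul_apply]
      have h2 : Complex.exp (-(b * (k + 1 : ℕ) * t ^ 2 / 2 : ℝ)) =
          Complex.exp (-(b * t ^ 2 / 2 : ℝ)) * Complex.exp (-(b * k * t ^ 2 / 2 : ℝ)) := by
        rw [← Complex.exp_add]; congr 1; push_cast; ring
      have h3 : (twistAvg nx D t ^ (k + 1)) f s - Complex.exp (-(b * (k + 1 : ℕ) * t ^ 2 / 2 : ℝ)) *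
          f s = Complex.exp (-(b * t ^ 2 / 2 : ℝ)) * ((twistAvg nx D t ^ k) f s -
          Complex.exp (-(b * k * t ^ 2 / 2 : ℝ)) * f s) + (twistAvg nx D t ^ k)
          (twistAvg nx D t f - Complex.exp (-(b * t ^ 2 / 2 : ℝ)) • f) s := by
        rw [h1, h2, map_smul, Pi.add_apply, Pi.smul_apply, smul_eq_mul]; ring
      rw [h3]
      refine (norm_add_le _ _).trans ?_
      rw [norm_mul, hne]
      have h4 := hL t ht k _ (C * |t| ^ 3) (hstep t ht) s hs
      have h5 := ih s hs
      have h6 : Real.exp (-(b * t ^ 2 / 2)) ≤ Real.exp (-(c * t ^ 2)) := by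
        simpa using hkk 1
      have h7 : Real.exp (-(c * (k + 1 : ℕ) * t ^ 2)) =
          Real.exp (-(c * t ^ 2)) * Real.exp (-(c * k * t ^ 2)) := by
        rw [← Real.exp_add]; congr 1; push_cast; ring
      have h8 : (1 : ℝ) ≤ Real.exp (c * t₀ ^ 2) * Real.exp (-(c * t ^ 2)) := by
        rw [← Real.exp_add, Real.one_le_exp_iff]
        have : t ^ 2 ≤ t₀ ^ 2 := by rw [← sq_abs t]; gcongr
        nlinarith
      calc _ ≤ Real.exp (-(c * t ^ 2)) * (C * B * Real.exp (c * t₀ ^ 2) * (k * |t| ^ 3) *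
            Real.exp (-(c * k * t ^ 2))) + B * Real.exp (-(c * k * t ^ 2)) * (C * |t| ^ 3) * 1 := by
            rw [mul_one]; gcongr
            exact h4
        _ ≤ Real.exp (-(c * t ^ 2)) * (C * B * Real.exp (c * t₀ ^ 2) * (k * |t| ^ 3) *
            Real.exp (-(c * k * t ^ 2))) + B * Real.exp (-(c * k * t ^ 2)) * (C * |t| ^ 3) *
              (Real.exp (c * t₀ ^ 2) * Real.exp (-(c * t ^ 2))) := by gcongr
        _ = _ := by rw [h7]; push_cast; ring
  have h1 : (twistAvg nx D t ^ k) 1 s - Complex.exp (-(b * k * t ^ 2 / 2 : ℝ)) =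
      (twistAvg nx D t ^ k) (1 - f) s + ((twistAvg nx D t ^ k) f s -
      Complex.exp (-(b * k * t ^ 2 / 2 : ℝ)) * f s) -
      Complex.exp (-(b * k * t ^ 2 / 2 : ℝ)) * ((1 : σ → ℂ) s - f s) := by
    rw [map_sub, Pi.sub_apply, Pi.one_apply]; ring
  rw [h1]
  refine (norm_sub_le _ _).trans ((add_le_add_left (norm_add_le _ _) _).trans ?_)
  rw [norm_mul, hne]
  have h2 := hL t ht k (1 - f) _ (fun s _ => hf1 s) s hs
  have h3 := main k s hs
  have h4 := hf1 s
  have h5 := hkk k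
  set E := Real.exp (-(c * k * t ^ 2))
  have hE : 0 ≤ E := (Real.exp_pos _).le
  calc _ ≤ B * E * (t ^ 2 / 2 * M₂) + C * B * Real.exp (c * t₀ ^ 2) * (k * |t| ^ 3) * E +
        E * (t ^ 2 / 2 * M₂) := by gcongr
    _ ≤ B * E * (t ^ 2 / 2 * M₂) + C * B * Real.exp (c * t₀ ^ 2) * (k * |t| ^ 3) * E +
        B * E * (t ^ 2 / 2 * M₂) := by
        gcongr
        exact le_mul_of_one_le_left hE hB
    _ = (B * M₂ * t ^ 2 + C * B * Real.exp (c * t₀ ^ 2) * (k * |t| ^ 3)) * E := by ring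
    _ ≤ _ := by
        gcongr
        have e1 : 0 ≤ C * B * Real.exp (c * t₀ ^ 2) * t ^ 2 := by positivity
        have e2 : 0 ≤ B * M₂ * (k * |t| ^ 3) := by positivity
        nlinarith

end TwistAverage

/-! ### Characteristic functions of the values -/

namespace Transducer

open scoped BigOperators

variable {q d : ℕ} {S : Type*} {T : Transducer q d S} [NeZero q] [Fintype S]

theorem out_eq_centredOut {C : Finset S} (hC : T.IsFinalComponent C) {a : Finset S → ℝ} {H : S → ℝ} :
    ∀ s ∈ (C : Set S), ∀ ε, T.out s ε =
      T.centredOut (T.harmonicExt a) H s ε + a C + H s - H (T.next s ε) := by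
  intro s hs ε
  rw [centredOut, harmonicExt_of_mem (mem_finalComponents.2 hC) _ (by simpa using hs)]
  ring

/-- For `|t| ≤ Θ / √l` no decay of the twisted averages is needed: contraction alone (`c = 0`, `B =
1`) suffices, since `t²` and `k |t|³` are already `O(l^(-1/2))`. Degenerate variances are therefore
allowed. The starting point, the function `g`, the corrector `H` and the missing `l - k` letters
change the result by `O(|t|)` or `O(t²)` each. -/
theorem IsFinalComponent.exists_charFun_bound {C : Finset S} (hC : T.IsFinalComponent C)
    {a b : Finset S → ℝ} {H H₂ : S → ℝ} (hb : 0 ≤ b C)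
    (hH : ∀ s, 𝔼 ε, T.out s ε = T.harmonicExt a s + H s - 𝔼 ε, H (T.next s ε))
    (hH₂ : ∀ s, 𝔼 ε, T.centredOut (T.harmonicExt a) H s ε ^ 2 =
      T.harmonicExt b s + H₂ s - 𝔼 ε, H₂ (T.next s ε)) {Θ : ℝ} (hΘ : 0 ≤ Θ) :
    ∃ B, 0 ≤ B ∧ ∀ l : ℝ, 1 ≤ l → ∀ t : ℝ, |t| ≤ Θ / √l → ∀ s ∈ C, ∀ (k : ℕ) (g : S → ℝ) (G x : ℝ),
      k ≤ l → (∀ s, |g s| ≤ G) →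
      ‖(skewAvg ℂ T.next T.out ^ k) (fun x s => Complex.exp (t * (x + g s : ℝ) * Complex.I)) x s -
        Complex.exp (t * (a C * l : ℝ) * Complex.I) * Complex.exp (-(b C * l * t ^ 2 / 2 : ℝ))‖ ≤
        B / √l * (1 + |x| + G + (l - k)) := by
  set D := T.centredOut (T.harmonicExt a) H with hD
  obtain ⟨C₁, hC₁, h1⟩ := exists_norm_twistAvg_pow_sub_le (nx := T.next) (D := D) (K := (C : Set S))
    (b := b C) (H₂ := H₂) (t₀ := Θ) (c := 0) (B := 1) hb (fun s _ => expect_centredOut hH s)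
    (fun s hs => by rw [hH₂ s, harmonicExt_of_mem (mem_finalComponents.2 hC) _ (by simpa using hs)]) le_rfl (by linarith) le_rfl
    (fun t _ k f m hf s hs => by
      simpa using norm_twistAvg_pow_le hC.closed t k hf s hs)
  obtain ⟨CH, hCH, hHb⟩ := exists_abs_le H
  set B := Θ * (1 + 2 * CH + |a C|) + C₁ * (Θ ^ 2 + Θ ^ 3) + b C / 2 * Θ ^ 2 with hB
  refine ⟨B, by positivity, fun l hl t ht s hs k g G x hk hg => ?_⟩
  have hl0 : 0 < l := by linarith
  have hsl : 1 ≤ √l := Real.one_le_sqrt.2 hl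
  have hsl0 : 0 < √l := by linarith
  have hG : 0 ≤ G := (abs_nonneg _).trans (hg s)
  have hkl : 0 ≤ l - k := by linarith
  have htΘ : |t| ≤ Θ := ht.trans (div_le_self hΘ hsl)
  have ht2 : t ^ 2 ≤ Θ ^ 2 / √l := by
    calc t ^ 2 = |t| ^ 2 := (sq_abs t).symm
      _ ≤ (Θ / √l) ^ 2 := by gcongr
      _ = Θ ^ 2 / √l / √l := by rw [div_pow, div_div, pow_two (√l)]
      _ ≤ Θ ^ 2 / √l := div_le_self (by positivity) hsl
  have ht3 : k * |t| ^ 3 ≤ Θ ^ 3 / √l := by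
    calc k * |t| ^ 3 ≤ l * (Θ / √l) ^ 3 := by gcongr
      _ = Θ ^ 3 / √l := by
        have : l = √l * √l := (Real.mul_self_sqrt hl0.le).symm
        rw [div_pow]; nth_rewrite 1 [this]; field_simp
  set f : S → ℂ := fun s => Complex.exp (t * (g s - H s : ℝ) * Complex.I) with hf
  have e0 : (skewAvg ℂ T.next T.out ^ k) (fun x s => Complex.exp (t * (x + g s : ℝ) * Complex.I)) x s =
      Complex.exp (t * (x + H s + a C * k : ℝ) * Complex.I) * (twistAvg T.next D t ^ k) f s := by
    rw [skewAvg_pow_cohomologous T.next T.out hC.closed (out_eq_centredOut hC (a := a) (H := H)) k _ x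
      (by simpa using hs)]
    have : (fun (y : ℝ) (s : S) => Complex.exp (t * (y + a C * k - H s + g s : ℝ) * Complex.I)) =
        Complex.exp (t * (a C * k : ℝ) * Complex.I) •
          fun (y : ℝ) (s : S) => Complex.exp (t * y * Complex.I) * f s := by
      ext y s
      simp only [Pi.smul_apply, smul_eq_mul, hf]
      rw [← Complex.exp_add, ← Complex.exp_add]
      congr 1
      push_cast
      ring
    rw [this, map_smul, Pi.smul_apply, Pi.smul_apply, skewAvg_pow_exp, smul_eq_mul, ← mul_assoc,
      ← Complex.exp_add]
    congr 2
    push_cast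
    ring
  have e1 : ‖(twistAvg T.next D t ^ k) f s - (twistAvg T.next D t ^ k) 1 s‖ ≤ |t| * (G + CH) := by
    rw [← Pi.sub_apply, ← map_sub]
    refine norm_twistAvg_pow_le hC.closed t k (fun s _ => ?_) s (by simpa using hs)
    have := norm_exp_sub_exp_le (t * (g s - H s)) 0
    rw [sub_zero, abs_mul] at this
    simp only [Pi.sub_apply, Pi.one_apply, hf]
    push_cast at this ⊢
    rw [zero_mul, Complex.exp_zero] at this
    refine this.trans ?_
    gcongr
    exact (abs_sub _ _).trans (add_le_add (hg s) (hHb s))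
  have e2 : ‖(twistAvg T.next D t ^ k) 1 s - Complex.exp (-(b C * k * t ^ 2 / 2 : ℝ))‖ ≤
      C₁ * (Θ ^ 2 / √l + Θ ^ 3 / √l) := by
    refine (h1 t htΘ k s (by simpa using hs)).trans ?_
    rw [zero_mul, zero_mul, neg_zero, Real.exp_zero, mul_one]
    gcongr
  have e3 : ‖Complex.exp (-(b C * k * t ^ 2 / 2 : ℝ)) - Complex.exp (-(b C * l * t ^ 2 / 2 : ℝ))‖ ≤
      b C / 2 * (Θ ^ 2 / √l) * (l - k) := by
    rw [← Complex.ofReal_neg, ← Complex.ofReal_neg, ← Complex.ofReal_exp, ← Complex.ofReal_exp,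
      ← Complex.ofReal_sub, Complex.norm_real, Real.norm_eq_abs]
    have hle : b C * k * t ^ 2 / 2 ≤ b C * l * t ^ 2 / 2 := by gcongr
    rw [abs_of_nonneg (sub_nonneg.2 (Real.exp_le_exp.2 (by linarith)))]
    have h2 := Real.one_sub_le_exp_neg (b C * l * t ^ 2 / 2 - b C * k * t ^ 2 / 2)
    have h3 : Real.exp (-(b C * l * t ^ 2 / 2)) = Real.exp (-(b C * k * t ^ 2 / 2)) *
        Real.exp (-(b C * l * t ^ 2 / 2 - b C * k * t ^ 2 / 2)) := by
      rw [← Real.exp_add]; congr 1; ring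
    have h4 : Real.exp (-(b C * k * t ^ 2 / 2)) ≤ 1 := Real.exp_le_one_iff.2 (by
      have : 0 ≤ b C * k * t ^ 2 / 2 := by positivity
      linarith)
    calc _ ≤ b C * l * t ^ 2 / 2 - b C * k * t ^ 2 / 2 := by
          rw [h3]
          nlinarith [Real.exp_pos (-(b C * k * t ^ 2 / 2))]
      _ = b C / 2 * t ^ 2 * (l - k) := by ring
      _ ≤ _ := by gcongr
  have e4 : ‖Complex.exp (t * (x + H s + a C * k : ℝ) * Complex.I) -
      Complex.exp (t * (a C * l : ℝ) * Complex.I)‖ ≤ |t| * (|x| + CH + |a C| * (l - k)) := by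
    have := norm_exp_sub_exp_le (t * (x + H s + a C * k)) (t * (a C * l))
    rw [← mul_sub, abs_mul] at this
    push_cast at this ⊢
    refine this.trans ?_
    gcongr
    have e : x + H s + a C * k - a C * l = x + H s + a C * -(l - k) := by ring
    rw [e]
    refine (abs_add_le _ _).trans (add_le_add ((abs_add_le _ _).trans (add_le_add le_rfl (hHb s))) ?_)
    rw [abs_mul, abs_neg, abs_of_nonneg hkl]
  rw [e0]
  have hn2 : ‖Complex.exp (-(b C * l * t ^ 2 / 2 : ℝ))‖ ≤ 1 := by
    rw [← Complex.ofReal_neg, ← Complex.ofReal_exp, Complex.norm_real,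
      Real.norm_of_nonneg (Real.exp_pos _).le, Real.exp_le_one_iff]
    have : 0 ≤ b C * l * t ^ 2 / 2 := by positivity
    linarith
  set P := Complex.exp (t * (x + H s + a C * k : ℝ) * Complex.I) with hP
  set Q := Complex.exp (t * (a C * l : ℝ) * Complex.I)
  set E := Complex.exp (-(b C * k * t ^ 2 / 2 : ℝ))
  set F := Complex.exp (-(b C * l * t ^ 2 / 2 : ℝ))
  have hPn : ‖P‖ = 1 := norm_exp_mul_mul_I _ _
  have hsplit : P * (twistAvg T.next D t ^ k) f s - Q * F =
      P * (((twistAvg T.next D t ^ k) f s - (twistAvg T.next D t ^ k) 1 s) +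
        ((twistAvg T.next D t ^ k) 1 s - E) + (E - F)) + (P - Q) * F := by ring
  rw [hsplit]
  calc _ ≤ 1 * (|t| * (G + CH) + C₁ * (Θ ^ 2 / √l + Θ ^ 3 / √l) +
        b C / 2 * (Θ ^ 2 / √l) * (l - k)) + |t| * (|x| + CH + |a C| * (l - k)) * 1 := by
        refine (norm_add_le _ _).trans ?_
        rw [norm_mul, norm_mul, hPn]
        gcongr
        exact (norm_add_le _ _).trans (add_le_add ((norm_add_le _ _).trans (add_le_add e1 e2)) e3)
    _ ≤ 1 * (Θ / √l * (G + CH) + C₁ * (Θ ^ 2 / √l + Θ ^ 3 / √l) +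
        b C / 2 * (Θ ^ 2 / √l) * (l - k)) + Θ / √l * (|x| + CH + |a C| * (l - k)) * 1 := by
        gcongr
    _ = (Θ * ((G + |x|) * 1 + 2 * CH + |a C| * (l - k)) + C₁ * (Θ ^ 2 + Θ ^ 3) +
        b C / 2 * Θ ^ 2 * (l - k)) / √l := by field_simp; ring
    _ ≤ B * (1 + |x| + G + (l - k)) / √l := by
        gcongr
        set L := 1 + |x| + G + (l - k) with hL
        have hL1 : 1 ≤ L := by linarith [abs_nonneg x]
        have hLk : l - k ≤ L := by linarith [abs_nonneg x]
        have hLx : G + |x| ≤ L := by linarith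
        have f1 : 2 * CH ≤ 2 * CH * L := le_mul_of_one_le_right (by positivity) hL1
        have f2 : C₁ * (Θ ^ 2 + Θ ^ 3) ≤ C₁ * (Θ ^ 2 + Θ ^ 3) * L :=
          le_mul_of_one_le_right (by positivity) hL1
        have f3 : |a C| * (l - k) ≤ |a C| * L := by gcongr
        have f4 : b C / 2 * Θ ^ 2 * (l - k) ≤ b C / 2 * Θ ^ 2 * L := by gcongr
        have f5 : Θ * ((G + |x|) * 1 + 2 * CH + |a C| * (l - k)) ≤
            Θ * (L + 2 * CH * L + |a C| * L) :=
          mul_le_mul_of_nonneg_left (by linarith) hΘ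
        calc _ ≤ Θ * (L + 2 * CH * L + |a C| * L) + C₁ * (Θ ^ 2 + Θ ^ 3) * L +
              b C / 2 * Θ ^ 2 * L := add_le_add (add_le_add f5 f2) f4
          _ = B * L := by rw [hB]; ring
    _ = _ := by ring

theorem exists_uniform_bound {ι : Type*} (J : Finset ι) {P : ι → ℝ → Prop}
    (hmono : ∀ i B B', B ≤ B' → P i B → P i B') (h : ∀ i ∈ J, ∃ B, 0 ≤ B ∧ P i B) :
    ∃ B, 0 ≤ B ∧ ∀ i ∈ J, P i B := by
  choose! B hB0 hB using h
  exact ⟨∑ i ∈ J, B i, Finset.sum_nonneg hB0, fun i hi =>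
    hmono i _ _ (Finset.single_le_sum (f := B) hB0 hi) (hB i hi)⟩

/-- Supplies the hypothesis of `exists_transfer` that makes its trivial bound admissible. -/
theorem two_le_div_sqrt_mul {B l : ℝ} (hB : 2 ≤ B) (hl : 1 ≤ l) : 2 ≤ B / √l * (1 + l) := by
  have hsl : 1 ≤ √l := Real.one_le_sqrt.2 hl
  rw [div_mul_eq_mul_div, le_div_iff₀ (by linarith)]
  have : √l * √l = l := Real.mul_self_sqrt (by linarith)
  nlinarith

theorem one_le_logb {N : ℕ} (hq : 2 ≤ q) (hN : q ≤ N) : 1 ≤ Real.logb q N := by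
  have hq1 : (1 : ℝ) < q := by exact_mod_cast (by omega : 1 < q)
  have hN0 : (0 : ℝ) < N := by exact_mod_cast (by omega : 0 < N)
  rw [Real.le_logb_iff_rpow_le hq1 hN0, Real.rpow_one]
  exact_mod_cast hN

/-- The characteristic function of the values for uniformly distributed arguments. -/
theorem exists_charFun_value_bound (hq : 2 ≤ q) (hd : 1 ≤ d) {a b : Finset S → ℝ} {H H₂ : S → ℝ}
    (hb : ∀ C ∈ T.finalComponents, 0 ≤ b C)
    (hH : ∀ s, 𝔼 ε, T.out s ε = T.harmonicExt a s + H s - 𝔼 ε, H (T.next s ε))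
    (hH₂ : ∀ s, 𝔼 ε, T.centredOut (T.harmonicExt a) H s ε ^ 2 =
      T.harmonicExt b s + H₂ s - 𝔼 ε, H₂ (T.next s ε)) {Θ : ℝ} (hΘ : 0 ≤ Θ) :
    ∃ B, ∀ N : ℕ, q ≤ N → ∀ t : ℝ, |t| ≤ Θ / √(Real.logb q N) →
      ‖((N : ℂ) ^ d)⁻¹ * ∑ n ∈ box d N, Complex.exp (t * T.valueFrom T.init n * Complex.I) -
        ∑ C ∈ T.finalComponents, (T.absorption C T.init : ℂ) *
          (Complex.exp (t * (a C * Real.logb q N : ℝ) * Complex.I) *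
            Complex.exp (-(b C * Real.logb q N * t ^ 2 / 2 : ℝ)))‖ ≤ B / √(Real.logb q N) := by
  obtain ⟨K, hK, htr⟩ := exists_transfer (𝕜 := ℂ) hq hd T
  obtain ⟨B, hB, h⟩ := exists_uniform_bound T.finalComponents (P := fun C B =>
    ∀ l : ℝ, 1 ≤ l → ∀ t : ℝ, |t| ≤ Θ / √l → ∀ s ∈ C, ∀ (k : ℕ) (g : S → ℝ) (G x : ℝ),
      k ≤ l → (∀ s, |g s| ≤ G) →
      ‖(skewAvg ℂ T.next T.out ^ k) (fun x s => Complex.exp (t * (x + g s : ℝ) * Complex.I)) x s -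
        Complex.exp (t * (a C * l : ℝ) * Complex.I) * Complex.exp (-(b C * l * t ^ 2 / 2 : ℝ))‖ ≤
        B / √l * (1 + |x| + G + (l - k)))
    (fun C B B' hBB' hP l hl t ht s hs k g G x hk hg => (hP l hl t ht s hs k g G x hk hg).trans (by
      have : 0 ≤ 1 + |x| + G + (l - k) := by
        have hG : 0 ≤ G := (abs_nonneg _).trans (hg s)
        have : 0 ≤ l - k := by linarith
        positivity
      gcongr))
    (fun C hC => (mem_finalComponents.1 hC).exists_charFun_bound (hb C hC) hH hH₂ hΘ)
  refine ⟨K * (B + 2), fun N hN t ht => ?_⟩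
  have hl := one_le_logb hq hN
  set l := Real.logb q N
  have hsl : 0 < √l := Real.sqrt_pos.2 (by linarith)
  rw [mul_div_assoc]
  refine htr N (by omega) (fun x => Complex.exp (t * x * Complex.I)) _ ((B + 2) / √l) (by positivity)
    (two_le_div_sqrt_mul (by linarith) hl) (fun x => (norm_exp_mul_mul_I t x).le) (fun C hC => ?_)
    fun C hC s hs k g G x hk hg => ?_
  · rw [norm_mul, norm_exp_mul_mul_I, one_mul, ← Complex.ofReal_neg, ← Complex.ofReal_exp,
      Complex.norm_real, Real.norm_of_nonneg (Real.exp_pos _).le, Real.exp_le_one_iff]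
    have := hb C hC
    have : 0 ≤ b C * l * t ^ 2 / 2 := by positivity
    linarith
  · refine (h C hC l hl t ht s hs k g G x hk hg).trans ?_
    have : 0 ≤ 1 + |x| + G + (l - k) := by
      have hG : 0 ≤ G := (abs_nonneg _).trans (hg s)
      have : 0 ≤ l - k := by linarith
      positivity
    gcongr
    linarith

end Transducer

/-! ### The Fejér kernel and Esseen's smoothing inequality -/

section Smoothing

/-- The Fejér kernel. -/
def fejer (u : ℝ) : ℝ := if u = 0 then 1 else 2 * (1 - Real.cos u) / u ^ 2

theorem fejer_nonneg (u : ℝ) : 0 ≤ fejer u := by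
  unfold fejer
  split_ifs
  · exact zero_le_one
  · have := Real.cos_le_one u
    have : 0 ≤ 1 - Real.cos u := by linarith
    positivity

theorem fejer_neg (u : ℝ) : fejer (-u) = fejer u := by
  simp [fejer]

theorem fejer_le_one (u : ℝ) : fejer u ≤ 1 := by
  unfold fejer
  split_ifs with h
  · exact le_rfl
  · have := Real.one_sub_sq_div_two_le_cos (x := u)
    rw [div_le_one (by positivity)]
    linarith

theorem fejer_le (u : ℝ) : fejer u ≤ 8 * (1 + u ^ 2)⁻¹ := by
  rcases le_total (u ^ 2) 1 with h | h
  · refine (fejer_le_one u).trans ?_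
    rw [← div_eq_mul_inv, le_div_iff₀ (by positivity)]
    linarith
  · have hu : u ≠ 0 := by rintro rfl; norm_num at h
    rw [fejer, if_neg hu, ← div_eq_mul_inv, div_le_div_iff₀ (by positivity) (by positivity)]
    have := Real.neg_one_le_cos u
    nlinarith

theorem measurable_fejer : Measurable fejer := by
  unfold fejer
  refine Measurable.ite (measurableSet_singleton 0) measurable_const ?_
  fun_prop

theorem integrable_fejer : Integrable fejer := by
  refine (integrable_inv_one_add_sq.const_mul 8).mono' measurable_fejer.aestronglyMeasurable
    (Eventually.of_forall fun u => ?_)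
  rw [Real.norm_of_nonneg (fejer_nonneg u)]
  exact fejer_le u

theorem integral_fejer_pos : 0 < ∫ u, fejer u := by
  rw [integral_pos_iff_support_of_nonneg fejer_nonneg integrable_fejer]
  have h : Set.Ioo (0 : ℝ) 1 ⊆ Function.support fejer := by
    intro u hu
    have hu0 : u ≠ 0 := hu.1.ne'
    rw [Function.mem_support, fejer, if_neg hu0]
    have : Real.cos u < 1 := by
      rw [← Real.cos_zero]
      exact Real.cos_lt_cos_of_nonneg_of_le_pi le_rfl (by linarith [hu.2, Real.pi_gt_three]) hu.1
    have : 0 < 1 - Real.cos u := by linarith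
    positivity
  refine lt_of_lt_of_le ?_ (measure_mono h)
  simp

theorem exists_integral_fejer_Icc : ∃ A : ℝ, 0 ≤ A ∧
    3 / 4 * ∫ u, fejer u ≤ ∫ u in Set.Icc (-A) A, fejer u := by
  have h := (aecover_Icc (μ := volume) (tendsto_neg_atTop_atBot (G := ℝ)) tendsto_id
    ).integral_tendsto_of_countably_generated integrable_fejer
  have hc := integral_fejer_pos
  have h2 := (h.eventually (eventually_ge_nhds (by linarith : 3 / 4 * ∫ u, fejer u < ∫ u, fejer u))).and
    (eventually_ge_atTop (0 : ℝ))
  obtain ⟨A, hA, hA0⟩ := h2.exists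
  exact ⟨A, hA0, hA⟩

theorem integral_one_sub_mul_cos {u : ℝ} (hu : u ≠ 0) :
    ∫ t in (0 : ℝ)..1, (1 - t) * Real.cos (t * u) = (1 - Real.cos u) / u ^ 2 := by
  have hd : ∀ t ∈ Set.uIcc (0 : ℝ) 1, HasDerivAt
      (fun t => (1 - t) * Real.sin (t * u) / u - Real.cos (t * u) / u ^ 2)
      ((1 - t) * Real.cos (t * u)) t := by
    intro t _
    have h1 : HasDerivAt (fun t : ℝ => t * u) u t := by simpa using (hasDerivAt_id t).mul_const u
    have h2 := (((hasDerivAt_id t).const_sub 1).mul h1.sin).div_const u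
    have h3 := h1.cos.div_const (u ^ 2)
    refine (h2.sub h3).congr_deriv ?_
    simp only [id]
    field_simp
    ring
  rw [intervalIntegral.integral_eq_sub_of_hasDerivAt hd
    (by apply Continuous.intervalIntegrable; fun_prop)]
  simp
  ring

/-- The Fejér kernel is the Fourier transform of a triangle function. -/
theorem integral_triangle_mul_exp (u : ℝ) :
    ∫ t in (-1 : ℝ)..1, ((1 - |t| : ℝ) : ℂ) * Complex.exp (t * u * Complex.I) = fejer u := by
  have hint : ∀ a b : ℝ, IntervalIntegrable
      (fun t : ℝ => ((1 - |t| : ℝ) : ℂ) * Complex.exp (t * u * Complex.I)) volume a b := fun a b => by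
    apply Continuous.intervalIntegrable
    fun_prop
  rw [← intervalIntegral.integral_add_adjacent_intervals (hint (-1) 0) (hint 0 1)]
  have h1 : ∫ t in (-1 : ℝ)..0, ((1 - |t| : ℝ) : ℂ) * Complex.exp (t * u * Complex.I) =
      ∫ t in (0 : ℝ)..1, ((1 - |t| : ℝ) : ℂ) * Complex.exp (-(t * u * Complex.I)) := by
    have := intervalIntegral.integral_comp_neg (a := 0) (b := 1)
      fun t : ℝ => ((1 - |t| : ℝ) : ℂ) * Complex.exp (t * u * Complex.I)
    rw [neg_zero] at this
    rw [← this]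
    simp
  have hint' : IntervalIntegrable
      (fun t : ℝ => ((1 - |t| : ℝ) : ℂ) * Complex.exp (-(t * u * Complex.I))) volume 0 1 := by
    apply Continuous.intervalIntegrable
    fun_prop
  rw [h1, ← intervalIntegral.integral_add hint' (hint 0 1)]
  have h2 : ∀ t ∈ Set.uIcc (0 : ℝ) 1, ((1 - |t| : ℝ) : ℂ) * Complex.exp (-(t * u * Complex.I)) +
      ((1 - |t| : ℝ) : ℂ) * Complex.exp (t * u * Complex.I) =
      ((2 * ((1 - t) * Real.cos (t * u)) : ℝ) : ℂ) := by
    intro t ht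
    rw [Set.uIcc_of_le zero_le_one] at ht
    rw [abs_of_nonneg ht.1]
    push_cast
    rw [Complex.cos]
    ring_nf
  rw [intervalIntegral.integral_congr h2, intervalIntegral.integral_ofReal,
    intervalIntegral.integral_const_mul]
  congr 1
  unfold fejer
  split_ifs with h
  · subst h
    simp only [mul_zero, Real.cos_zero, mul_one]
    rw [intervalIntegral.integral_sub (by simp) (by simp)]
    simp
    norm_num
  · rw [integral_one_sub_mul_cos h]; ring

theorem norm_exp_sub_exp_div_le (x x' t : ℝ) :
    ‖(Complex.exp (t * x' * Complex.I) - Complex.exp (t * x * Complex.I)) / (t * Complex.I)‖ ≤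
      |x' - x| := by
  rcases eq_or_ne t 0 with rfl | ht
  · simp
  · have h := norm_exp_sub_exp_le (t * x') (t * x)
    push_cast at h
    rw [norm_div, norm_mul, Complex.norm_I, mul_one, Complex.norm_real, Real.norm_eq_abs,
      div_le_iff₀ (abs_pos.2 ht)]
    refine h.trans (le_of_eq ?_)
    rw [← mul_sub, abs_mul, mul_comm]

theorem norm_exp_sub_exp_div_le_two (x x' t : ℝ) :
    ‖(Complex.exp (t * x' * Complex.I) - Complex.exp (t * x * Complex.I)) / (t * Complex.I)‖ ≤
      2 / |t| := by
  rw [norm_div, norm_mul, Complex.norm_I, mul_one, Complex.norm_real, Real.norm_eq_abs]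
  gcongr
  refine (norm_sub_le _ _).trans ?_
  rw [norm_exp_mul_mul_I, norm_exp_mul_mul_I]
  norm_num

theorem integral_exp_mul_I (x x' t : ℝ) (ht : t ≠ 0) :
    ∫ v in x..x', Complex.exp (t * v * Complex.I) =
      (Complex.exp (t * x' * Complex.I) - Complex.exp (t * x * Complex.I)) / (t * Complex.I) := by
  have h := integral_exp_mul_complex (a := x) (b := x') (c := t * Complex.I)
    (mul_ne_zero (by exact_mod_cast ht) Complex.I_ne_zero)
  rw [mul_right_comm (t : ℂ) Complex.I, mul_right_comm (t : ℂ) Complex.I] at h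
  rw [← h]
  congr 1
  ext v
  congr 1
  ring

/-- The Fourier representation of the kernel is integrated over `v` under the integral sign; the
point `t = 0`, where the quotient is a division by zero, is a null set. -/
theorem integral_fejer_eq (x x' : ℝ) :
    ((∫ v in x..x', fejer v : ℝ) : ℂ) = ∫ t in (-1 : ℝ)..1, ((1 - |t| : ℝ) : ℂ) *
      ((Complex.exp (t * x' * Complex.I) - Complex.exp (t * x * Complex.I)) / (t * Complex.I)) := by
  rw [← intervalIntegral.integral_ofReal]
  simp_rw [← integral_triangle_mul_exp]
  rw [intervalIntegral_intervalIntegral_swap]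
  · refine intervalIntegral.integral_congr_ae ?_
    have : ∀ᵐ t : ℝ, t ≠ 0 := by simp [ae_iff]
    filter_upwards [this] with t ht _
    rw [← integral_exp_mul_I x x' t ht, intervalIntegral.integral_const_mul]
  · have hc : Continuous (Function.uncurry fun (v t : ℝ) =>
        ((1 - |t| : ℝ) : ℂ) * Complex.exp (t * v * Complex.I)) := by
      simp only [Function.uncurry_def]; fun_prop
    refine (hc.continuousOn.integrableOn_compact
      (K := Set.uIcc x x' ×ˢ Set.uIcc (-1) 1) (isCompact_uIcc.prod isCompact_uIcc)).mono_set ?_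
    exact Set.prod_mono Set.uIoc_subset_uIcc Set.uIoc_subset_uIcc

/-- By Fubini both sides integrate the kernel over the pairs `(u, y)` with `x < u + y ≤ x'`.
Differences at two points are used because the formula for a single distribution function would
contain a factor `1 / t` that is not integrable at zero. -/
theorem integral_fejer_mul_cdf_sub (μ : Measure ℝ) [IsProbabilityMeasure μ] {x x' : ℝ}
    (h : x ≤ x') :
    ∫ u, fejer u * (cdf μ (x' - u) - cdf μ (x - u)) = ∫ y, (∫ v in (x - y)..(x' - y), fejer v) ∂μ := by
  set f : ℝ → ℝ → ℝ := fun u y => (Set.Ioc (x - u) (x' - u)).indicator (fun _ => fejer u) y with hf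
  have h1 : ∀ u, fejer u * (cdf μ (x' - u) - cdf μ (x - u)) = ∫ y, f u y ∂μ := by
    intro u
    rw [hf]
    simp only
    rw [integral_indicator measurableSet_Ioc, setIntegral_const, smul_eq_mul, mul_comm]
    congr 1
    rw [cdf_eq_real, cdf_eq_real, ← measureReal_sdiff (Set.Iic_subset_Iic.2 (by linarith))
      measurableSet_Iic]
    congr 1
    ext y
    simp [and_comm]
  have hS : MeasurableSet {p : ℝ × ℝ | x - p.1 < p.2 ∧ p.2 ≤ x' - p.1} :=
    MeasurableSet.inter (s₁ := {p : ℝ × ℝ | x - p.1 < p.2}) (s₂ := {p : ℝ × ℝ | p.2 ≤ x' - p.1})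
      (measurableSet_lt (by fun_prop) (by fun_prop)) (measurableSet_le (by fun_prop) (by fun_prop))
  have hfu : Function.uncurry f = Set.indicator {p : ℝ × ℝ | x - p.1 < p.2 ∧ p.2 ≤ x' - p.1}
      (fun p => fejer p.1) := by
    ext ⟨u, y⟩
    simp [hf, Set.indicator]
  simp_rw [h1]
  rw [integral_integral_swap]
  · refine integral_congr_ae (Eventually.of_forall fun y => ?_)
    simp only
    rw [intervalIntegral.integral_of_le (by linarith), ← integral_indicator measurableSet_Ioc]
    refine integral_congr_ae (Eventually.of_forall fun u => ?_)
    simp only [hf, Set.indicator, Set.mem_Ioc]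
    have : (x - u < y ∧ y ≤ x' - u) ↔ (x - y < u ∧ u ≤ x' - y) := by
      constructor <;> rintro ⟨h1, h2⟩ <;> constructor <;> linarith
    simp only [this]
  · rw [hfu]
    exact (integrable_fejer.comp_fst μ).indicator hS

theorem integral_fejer_mul_cdf_sub_eq (μ : Measure ℝ) [IsProbabilityMeasure μ] {x x' : ℝ}
    (h : x ≤ x') :
    ((∫ u, fejer u * (cdf μ (x' - u) - cdf μ (x - u)) : ℝ) : ℂ) =
      ∫ t in (-1 : ℝ)..1, ((1 - |t| : ℝ) : ℂ) *
        ((Complex.exp (t * x' * Complex.I) - Complex.exp (t * x * Complex.I)) / (t * Complex.I)) *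
        charFun μ (-t) := by
  rw [integral_fejer_mul_cdf_sub μ h, ← integral_complex_ofReal]
  simp_rw [integral_fejer_eq]
  rw [← intervalIntegral_integral_swap]
  · refine intervalIntegral.integral_congr fun t _ => ?_
    rw [charFun_apply_real, ← integral_const_mul]
    refine integral_congr_ae (Eventually.of_forall fun y => ?_)
    have h1 : ∀ z : ℝ, Complex.exp (t * (z - y : ℝ) * Complex.I) =
        Complex.exp (t * z * Complex.I) * Complex.exp ((-t : ℝ) * y * Complex.I) := fun z => by
      rw [← Complex.exp_add]; congr 1; push_cast; ring
    simp only [h1]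
    ring
  · have : IsFiniteMeasure (volume.restrict (Set.uIoc (-1 : ℝ) 1)) := by
      rw [Set.uIoc_of_le (by norm_num)]; infer_instance
    refine Integrable.mono' (g := fun _ => |x' - x|) (integrable_const _) ?_ ?_
    · apply Measurable.aestronglyMeasurable
      simp only [Function.uncurry_def]
      fun_prop
    · have : ∀ᵐ p ∂((volume.restrict (Set.uIoc (-1 : ℝ) 1)).prod μ), p.1 ∈ Set.uIoc (-1 : ℝ) 1 :=
        Measure.quasiMeasurePreserving_fst.ae (ae_restrict_mem measurableSet_uIoc)
      filter_upwards [this] with p hp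
      simp only [Function.uncurry_def]
      rw [norm_mul, Complex.norm_real, Real.norm_eq_abs]
      have hp1 : |(1 - |p.1|)| ≤ 1 := by
        rw [Set.uIoc_of_le (by norm_num)] at hp
        have : |p.1| ≤ 1 := abs_le.2 ⟨hp.1.le, hp.2⟩
        rw [abs_le]; constructor <;> linarith [abs_nonneg p.1]
      have h2 := norm_exp_sub_exp_div_le (x - p.2) (x' - p.2) p.1
      rw [sub_sub_sub_cancel_right] at h2
      calc _ ≤ 1 * |x' - x| := by gcongr
        _ = _ := one_mul _

/-- The inversion formula is applied to the increments between `x` and `x'`, where the kernel is at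
most `2 / |t|` and the bound `|t| g(t)` cancels the singularity. Then `x'` tends to infinity, and
the contribution of `x'` vanishes by dominated convergence. -/
theorem abs_integral_fejer_mul_cdf_sub_le (μ ν : Measure ℝ) [IsProbabilityMeasure μ]
    [IsProbabilityMeasure ν] {g : ℝ → ℝ} (hg : IntervalIntegrable g volume (-1) 1)
    (h : ∀ t ∈ Set.Icc (-1 : ℝ) 1, ‖charFun μ t - charFun ν t‖ ≤ |t| * g t) (x : ℝ) :
    |∫ u, fejer u * (cdf μ (x - u) - cdf ν (x - u))| ≤ 2 * ∫ t in (-1 : ℝ)..1, g t := by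
  have hcdf : ∀ (μ : Measure ℝ) (z : ℝ), Integrable (fun u => fejer u * cdf μ (z - u)) := by
    intro μ z
    refine integrable_fejer.mul_bdd (c := 1) ?_ (Eventually.of_forall fun u => ?_)
    · exact ((monotone_cdf μ).measurable.comp (by fun_prop)).aestronglyMeasurable
    · rw [Real.norm_of_nonneg (cdf_nonneg μ _)]; exact cdf_le_one μ _
  have hcont : ∀ (μ : Measure ℝ) [IsProbabilityMeasure μ], Continuous fun t => charFun μ (-t) :=
    fun μ _ => continuous_charFun.comp continuous_neg
  have hk : ∀ (x x' : ℝ) (μ : Measure ℝ) [IsProbabilityMeasure μ], IntervalIntegrable (fun t : ℝ =>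
      ((1 - |t| : ℝ) : ℂ) *
        ((Complex.exp (t * x' * Complex.I) - Complex.exp (t * x * Complex.I)) / (t * Complex.I)) *
        charFun μ (-t)) volume (-1) 1 := by
    intro x x' μ _
    refine IntervalIntegrable.mul_continuousOn ?_ (hcont μ).continuousOn
    refine IntervalIntegrable.continuousOn_mul ?_ (by fun_prop)
    refine (intervalIntegrable_const (c := |x' - x|)).mono_fun' ?_
      (Eventually.of_forall fun t => norm_exp_sub_exp_div_le x x' t)
    apply Measurable.aestronglyMeasurable
    fun_prop
  have key : ∀ x' : ℝ, x ≤ x' → |(∫ u, fejer u * (cdf μ (x' - u) - cdf ν (x' - u))) -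
      ∫ u, fejer u * (cdf μ (x - u) - cdf ν (x - u))| ≤ 2 * ∫ t in (-1 : ℝ)..1, g t := by
    intro x' hx
    have e1 : (∫ u, fejer u * (cdf μ (x' - u) - cdf ν (x' - u))) -
        ∫ u, fejer u * (cdf μ (x - u) - cdf ν (x - u)) =
        (∫ u, fejer u * (cdf μ (x' - u) - cdf μ (x - u))) -
        ∫ u, fejer u * (cdf ν (x' - u) - cdf ν (x - u)) := by
      simp_rw [mul_sub]
      rw [integral_sub (hcdf _ _) (hcdf _ _), integral_sub (hcdf _ _) (hcdf _ _),
        integral_sub (hcdf _ _) (hcdf _ _), integral_sub (hcdf _ _) (hcdf _ _)]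
      ring
    rw [e1, ← Real.norm_eq_abs, ← Complex.norm_real, Complex.ofReal_sub,
      integral_fejer_mul_cdf_sub_eq μ hx, integral_fejer_mul_cdf_sub_eq ν hx,
      ← intervalIntegral.integral_sub (hk _ _ _) (hk _ _ _)]
    have e2 : 2 * ∫ t in (-1 : ℝ)..1, g t = ∫ t in (-1 : ℝ)..1, 2 * g (-t) := by
      rw [intervalIntegral.integral_const_mul, intervalIntegral.integral_comp_neg, neg_neg]
    rw [e2]
    refine intervalIntegral.norm_integral_le_of_norm_le (by norm_num) ?_ ?_
    · have hne : ∀ᵐ t : ℝ, t ≠ 0 := by simp [ae_iff]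
      filter_upwards [hne] with t ht0 ht
      have ht1 : |t| ≤ 1 := abs_le.2 ⟨ht.1.le, ht.2⟩
      have h3 := h (-t) ⟨by linarith [ht.2], by linarith [ht.1]⟩
      rw [abs_neg] at h3
      rw [← mul_sub, norm_mul, norm_mul, Complex.norm_real, Real.norm_eq_abs,
        abs_of_nonneg (by linarith)]
      have ht0' : 0 < |t| := abs_pos.2 ht0
      calc _ ≤ 1 * (2 / |t|) * (|t| * g (-t)) := by
            gcongr
            · linarith
            · exact norm_exp_sub_exp_div_le_two x x' t
        _ = 2 * g (-t) := by field_simp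
    · have := hg.comp_sub_left 0
      simp only [zero_sub, sub_neg_eq_add, zero_add] at this
      exact (this.symm).const_mul 2
  have hlim : Tendsto (fun x' => ∫ u, fejer u * (cdf μ (x' - u) - cdf ν (x' - u))) atTop (𝓝 0) := by
    have h0 : (0 : ℝ) = ∫ u, fejer u * (1 - 1) := by simp
    rw [h0]
    refine tendsto_integral_filter_of_dominated_convergence (fun u => fejer u * 1)
      (Eventually.of_forall fun z => ?_) (Eventually.of_forall fun z => Eventually.of_forall fun u => ?_)
      (by simpa using integrable_fejer) (Eventually.of_forall fun u => ?_)
    · simp_rw [mul_sub]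
      exact ((hcdf μ z).sub (hcdf ν z)).aestronglyMeasurable
    · rw [norm_mul, Real.norm_of_nonneg (fejer_nonneg u), Real.norm_eq_abs]
      refine mul_le_mul_of_nonneg_left ?_ (fejer_nonneg u)
      rw [abs_le]
      constructor <;> linarith [cdf_nonneg μ (z - u), cdf_le_one μ (z - u), cdf_nonneg ν (z - u),
        cdf_le_one ν (z - u)]
    · have ht : Tendsto (fun z : ℝ => z - u) atTop atTop := tendsto_atTop_add_const_right _ (-u) tendsto_id
      exact (((tendsto_cdf_atTop μ).comp ht).sub ((tendsto_cdf_atTop ν).comp ht)).const_mul _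
  have h1 := (hlim.sub_const (∫ u, fejer u * (cdf μ (x - u) - cdf ν (x - u)))).abs
  rw [zero_sub, abs_neg] at h1
  refine le_of_tendsto h1 ?_
  filter_upwards [eventually_ge_atTop x] with x' hx' using key x' hx'

/-- A function which does not decrease quickly is small if its smoothed version is small. -/
theorem exists_le_of_smoothed : ∃ K : ℝ, 0 ≤ K ∧ ∀ (D : ℝ → ℝ) (Δ m J : ℝ), Measurable D →
    (∀ x, |D x| ≤ Δ) → 0 ≤ m → 0 ≤ J → (∀ x y, x ≤ y → D x - m * (y - x) ≤ D y) →
    (∀ x, ∫ u, fejer u * D (x - u) ≤ J) → ∀ x, D x ≤ Δ / 3 + K * (J + m) := by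
  -- Three quarters of the mass of the kernel lie in the window. The window contributes at least
  -- `3/4` of the value in question and the complement at worst `-Δ/4`, so the value is bounded by
  -- `Δ/3` plus small terms; a factor below `1` allows the supremum `Δ` to be absorbed later.
  obtain ⟨A, hA, hA'⟩ := exists_integral_fejer_Icc
  have hc := integral_fejer_pos
  set c := ∫ u, fejer u with hcdef
  refine ⟨2 * A + 4 / (3 * c), by positivity, fun D Δ m J hD hΔ hm hJ hlow hJ' x => ?_⟩
  have hΔ0 : 0 ≤ Δ := (abs_nonneg _).trans (hΔ x)
  have hK : 2 * m * A + 4 * J / (3 * c) ≤ (2 * A + 4 / (3 * c)) * (J + m) := by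
    have e1 : 0 ≤ 2 * A * J := by positivity
    have e2 : 0 ≤ 4 / (3 * c) * m := by positivity
    have e3 : 4 * J / (3 * c) = 4 / (3 * c) * J := by ring
    rw [e3]
    nlinarith
  rcases le_or_gt (D x) (2 * m * A) with h | h
  · have : 0 ≤ 4 * J / (3 * c) := by positivity
    linarith
  -- The smoothing is centred at `x + A`, so that the window covers `[x, x + 2A]`, to the right of
  -- `x`, where `D` has dropped by at most `2 m A`.
  have hint : Integrable fun u => fejer u * D (x + A - u) :=
    integrable_fejer.mul_bdd (c := Δ) (hD.comp (by fun_prop)).aestronglyMeasurable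
      (Eventually.of_forall fun u => hΔ _)
  have hsplit := integral_add_compl (measurableSet_Icc (a := -A) (b := A)) hint
  have hsplit' := integral_add_compl (measurableSet_Icc (a := -A) (b := A)) integrable_fejer
  have hin : (D x - 2 * m * A) * ∫ u in Set.Icc (-A) A, fejer u ≤
      ∫ u in Set.Icc (-A) A, fejer u * D (x + A - u) := by
    rw [← integral_const_mul]
    refine setIntegral_mono_on (integrable_fejer.const_mul _).integrableOn hint.integrableOn
      measurableSet_Icc fun u hu => ?_
    rw [mul_comm]
    refine mul_le_mul_of_nonneg_left ?_ (fejer_nonneg u)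
    have h1 := hlow x (x + A - u) (by linarith [hu.2])
    have h2 : m * (x + A - u - x) ≤ m * (2 * A) := by gcongr; linarith [hu.1]
    linarith
  have hout : -Δ * ∫ u in (Set.Icc (-A) A)ᶜ, fejer u ≤
      ∫ u in (Set.Icc (-A) A)ᶜ, fejer u * D (x + A - u) := by
    rw [← integral_const_mul]
    refine setIntegral_mono_on (integrable_fejer.const_mul _).integrableOn hint.integrableOn
      measurableSet_Icc.compl fun u hu => ?_
    rw [mul_comm]
    refine mul_le_mul_of_nonneg_left ?_ (fejer_nonneg u)
    exact (abs_le.1 (hΔ _)).1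
  have h3 := hJ' (x + A)
  have h4 : (D x - 2 * m * A) * (3 / 4 * c) ≤ (D x - 2 * m * A) * ∫ u in Set.Icc (-A) A, fejer u :=
    mul_le_mul_of_nonneg_left hA' (by linarith)
  have h5 : ∫ u in (Set.Icc (-A) A)ᶜ, fejer u ≤ c / 4 := by linarith
  have h6 : Δ * ∫ u in (Set.Icc (-A) A)ᶜ, fejer u ≤ Δ * (c / 4) := by gcongr
  have h7 : (D x - 2 * m * A) * (3 / 4 * c) ≤ J + Δ * (c / 4) := by linarith
  have h8 : D x - 2 * m * A ≤ (J + Δ * (c / 4)) / (3 / 4 * c) := by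
    rw [le_div_iff₀ (by positivity)]; exact h7
  have h9 : (J + Δ * (c / 4)) / (3 / 4 * c) = 4 * J / (3 * c) + Δ / 3 := by field_simp
  linarith

/-- Esseen's smoothing inequality. -/
theorem exists_abs_cdf_sub_cdf_le : ∃ K : ℝ, 0 ≤ K ∧ ∀ (μ ν : Measure ℝ) [IsProbabilityMeasure μ]
    [IsProbabilityMeasure ν] (m : ℝ) (g : ℝ → ℝ), 0 ≤ m →
    (∀ x y, x ≤ y → cdf ν y - cdf ν x ≤ m * (y - x)) → IntervalIntegrable g volume (-1) 1 →
    (∀ t ∈ Set.Icc (-1 : ℝ) 1, ‖charFun μ t - charFun ν t‖ ≤ |t| * g t) →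
    ∀ x, |cdf μ x - cdf ν x| ≤ K * ((∫ t in (-1 : ℝ)..1, g t) + m) := by
  obtain ⟨K, hK, h⟩ := exists_le_of_smoothed
  refine ⟨3 * K, by positivity, fun μ ν _ _ m g hm hlip hg hchar => ?_⟩
  set I := ∫ t in (-1 : ℝ)..1, g t
  have hsm := abs_integral_fejer_mul_cdf_sub_le μ ν hg hchar
  have hI : 0 ≤ 2 * I := (abs_nonneg _).trans (hsm 0)
  set D : ℝ → ℝ := fun x => cdf μ x - cdf ν x with hD
  have hDm : Measurable D := (monotone_cdf μ).measurable.sub (monotone_cdf ν).measurable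
  have hbdd : BddAbove (Set.range fun x => |D x|) := by
    refine ⟨1, ?_⟩
    rintro _ ⟨x, rfl⟩
    simp only [hD]
    rw [abs_le]
    constructor <;> linarith [cdf_nonneg μ x, cdf_le_one μ x, cdf_nonneg ν x, cdf_le_one ν x]
  set Δ := ⨆ x, |D x|
  have hΔ : ∀ x, |D x| ≤ Δ := fun x => le_ciSup hbdd x
  have h1 : ∀ x, D x ≤ Δ / 3 + K * (2 * I + m) := by
    refine h D Δ m (2 * I) hDm hΔ hm hI (fun x y hxy => ?_) fun x => (le_abs_self _).trans (hsm x)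
    have := hlip x y hxy
    have := monotone_cdf μ hxy
    simp only [hD]
    linarith
  -- The reflected function `-D (-x)` satisfies the same hypotheses, as the kernel is even.
  have h2 : ∀ x, -D x ≤ Δ / 3 + K * (2 * I + m) := by
    intro x
    have := h (fun y => -D (-y)) Δ m (2 * I) (hDm.comp measurable_neg).neg
      (fun x => by rw [abs_neg]; exact hΔ _) hm hI (fun x y hxy => ?_) (fun x => ?_) (-x)
    · simpa using this
    · have := hlip (-y) (-x) (by linarith)
      have := monotone_cdf μ (show -y ≤ -x by linarith)
      simp only [hD]
      linarith
    · have e1 : ∫ u, fejer u * -D (-(x - u)) = -∫ u, fejer u * D (-x - u) := by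
        rw [← integral_neg_eq_self, ← integral_neg]
        congr 1
        ext u
        rw [fejer_neg]
        ring_nf
      rw [e1]
      exact (neg_le_abs _).trans (hsm (-x))
  have h3 : Δ ≤ Δ / 3 + K * (2 * I + m) := ciSup_le fun x => abs_le'.2 ⟨h1 x, h2 x⟩
  intro x
  have h4 := hΔ x
  have : 0 ≤ K * m := by positivity
  simp only [hD] at h4
  linarith

end Smoothing

/-! ### Sums along words and the decay of the twisted averages -/

section Words

open scoped BigOperators

variable {σ A : Type*}

/-- The sum of the increments along the path which starts in `s` and reads the word. -/
def wordSum (nx : σ → A → σ) (D : σ → A → ℝ) : σ → List A → ℝ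
  | _, [] => 0
  | s, a :: w => D s a + wordSum nx D (nx s a) w

variable {nx : σ → A → σ} {D : σ → A → ℝ}

theorem wordSum_append (s : σ) (w w' : List A) :
    wordSum nx D s (w ++ w') = wordSum nx D s w + wordSum nx D (w.foldl nx s) w' := by
  induction w generalizing s with
  | nil => simp [wordSum]
  | cons a w ih =>
    rw [List.cons_append, wordSum, wordSum, ih, List.foldl_cons, add_assoc]

/-- The concatenation of `m` copies of a word. -/
def wordPow (w : List A) : ℕ → List A
  | 0 => []
  | m + 1 => w ++ wordPow w m

theorem length_wordPow (w : List A) (m : ℕ) : (wordPow w m).length = m * w.length := by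
  induction m with
  | zero => simp [wordPow]
  | succ m ih => rw [wordPow, List.length_append, ih]; ring

theorem foldl_wordPow {s : σ} {w : List A} (h : w.foldl nx s = s) (m : ℕ) :
    (wordPow w m).foldl nx s = s := by
  induction m with
  | zero => rfl
  | succ m ih => rw [wordPow, List.foldl_append, h, ih]

theorem wordSum_wordPow {s : σ} {w : List A} (h : w.foldl nx s = s) (m : ℕ) :
    wordSum nx D s (wordPow w m) = m * wordSum nx D s w := by
  induction m with
  | zero => simp [wordPow, wordSum]
  | succ m ih => rw [wordPow, wordSum_append, h, ih]; push_cast; ring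

/-- If in an irreducible chain the sum of the increments along a path from `s` depends only on the
length and on the end of the path, then the increments are a constant plus a coboundary. -/
theorem exists_coboundary_of_wordSum_eq [Nonempty A] {K : Set σ} (hK : ∀ s ∈ K, ∀ a, nx s a ∈ K)
    (hr : ∀ s ∈ K, ∀ s' ∈ K, ∃ w : List A, w.foldl nx s = s') {s : σ} (hs : s ∈ K)
    (h : ∀ w w' : List A, w.length = w'.length → w.foldl nx s = w'.foldl nx s →
      wordSum nx D s w = wordSum nx D s w') :
    ∃ (α : ℝ) (β : σ → ℝ), ∀ s' ∈ K, ∀ a, D s' a = α + β (nx s' a) - β s' := by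
  obtain ⟨a₀⟩ := ‹Nonempty A›
  obtain ⟨v, hv⟩ := hr _ (hK s hs a₀) s hs
  -- A reference cycle at `s`; it is nonempty, so its mean increment `α` is defined.
  set c := a₀ :: v with hc
  have hcs : c.foldl nx s = s := hv
  choose! r hr' using fun s' (hs' : s' ∈ K) => hr s' hs' s hs
  set α := wordSum nx D s c / c.length with hα
  have hcl : (c.length : ℝ) ≠ 0 := by simp [hc]; positivity
  have key : ∀ w : List A, wordSum nx D s w = α * w.length +
      (α * (r (w.foldl nx s)).length - wordSum nx D (w.foldl nx s) (r (w.foldl nx s))) := by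
    intro w
    have hw : w.foldl nx s ∈ K := foldl_mem_of_closed hK w hs
    set u := w ++ r (w.foldl nx s) with hu
    have hus : u.foldl nx s = s := by rw [hu, List.foldl_append, hr' _ hw]
    -- These two closed paths have the same length, so every cycle `u` at `s` has the same mean
    -- increment as the reference cycle.
    have h1 := h (wordPow u c.length) (wordPow c u.length)
      (by rw [length_wordPow, length_wordPow, mul_comm]) (by rw [foldl_wordPow hus, foldl_wordPow hcs])
    rw [wordSum_wordPow hus, wordSum_wordPow hcs, hu, wordSum_append, List.length_append] at h1
    push_cast at h1
    rw [hα]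
    field_simp
    linarith
  refine ⟨α, fun s' => α * (r s').length - wordSum nx D s' (r s'), fun s' hs' a => ?_⟩
  obtain ⟨w, rfl⟩ := hr s hs s' hs'
  have h1 := key w
  have h2 := key (w ++ [a])
  rw [wordSum_append, List.foldl_append, List.length_append] at h2
  simp only [List.foldl_cons, List.foldl_nil, wordSum, List.length_singleton] at h2
  push_cast at h2
  linarith

variable [Fintype A]

/-- Otherwise `D` is a constant plus a coboundary of some `β`. Mean zero forces the constant to be
zero and `β` to be harmonic, hence constant; then `D = 0`, and the Poisson equation for `D²` gives
`b = 0`. -/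
theorem exists_wordSum_ne [Finite σ] [Nonempty A] {K : Set σ} (hK : ∀ s ∈ K, ∀ a, nx s a ∈ K)
    (hr : ∀ s ∈ K, ∀ s' ∈ K, ∃ w : List A, w.foldl nx s = s') {b : ℝ} (hb : b ≠ 0) {H₂ : σ → ℝ}
    (hD : ∀ s ∈ K, 𝔼 a, D s a = 0)
    (hD₂ : ∀ s ∈ K, 𝔼 a, D s a ^ 2 = b + H₂ s - 𝔼 a, H₂ (nx s a)) {s : σ} (hs : s ∈ K) :
    ∃ w w' : List A, w.length = w'.length ∧ w.foldl nx s = w'.foldl nx s ∧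
      wordSum nx D s w ≠ wordSum nx D s w' := by
  by_contra! hcon
  obtain ⟨α, β, h⟩ := exists_coboundary_of_wordSum_eq hK hr hs hcon
  have hα : α = 0 := by
    refine eq_zero_of_const_eq_sub ⟨s, hs⟩ hK (H := β) fun s hs => ?_
    have := hD s hs
    rw [Finset.expect_congr rfl fun a _ => h s hs a, Finset.expect_sub_distrib,
      Finset.expect_add_distrib, Finset.expect_const Finset.univ_nonempty,
      Finset.expect_const Finset.univ_nonempty] at this
    linarith
  have hβ : ∀ s ∈ K, β s = 𝔼 a, β (nx s a) := fun s hs => by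
    have := hD s hs
    rw [Finset.expect_congr rfl fun a _ => h s hs a, Finset.expect_sub_distrib,
      Finset.expect_add_distrib, Finset.expect_const Finset.univ_nonempty,
      Finset.expect_const Finset.univ_nonempty, hα] at this
    linarith
  have hD0 : ∀ s ∈ K, ∀ a, D s a = 0 := fun s hs a => by
    rw [h s hs a, hα, eq_of_harmonicOn hK hβ hr hs (hK s hs a)]
    ring
  refine hb (neg_eq_zero.1 (eq_zero_of_const_eq_sub ⟨s, hs⟩ hK (H := H₂) fun s hs => ?_))
  have := hD₂ s hs
  rw [Finset.expect_congr rfl fun a _ => by rw [hD0 s hs a]] at this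
  simp only [ne_eq, OfNat.ofNat_ne_zero, not_false_eq_true, zero_pow, Finset.expect_const_zero] at this
  linarith

theorem sum_ofFn_succ {M : Type*} [AddCommMonoid M] (k : ℕ) (f : List A → M) :
    ∑ w : Fin (k + 1) → A, f (List.ofFn w) = ∑ a, ∑ w : Fin k → A, f (a :: List.ofFn w) := by
  rw [← (Fin.consEquiv fun _ => A).sum_comp, Fintype.sum_prod_type]
  refine Finset.sum_congr rfl fun a _ => Finset.sum_congr rfl fun w _ => ?_
  rw [List.ofFn_succ]
  simp [Fin.consEquiv]

/-- The iterates of the skew averaging operator as averages over words. -/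
theorem skewAvg_pow_eq_sum {𝕜 : Type*} [RCLike 𝕜] (k : ℕ) (f : ℝ → σ → 𝕜) (x : ℝ) (s : σ) :
    (skewAvg 𝕜 nx D ^ k) f x s = ((Fintype.card A : 𝕜) ^ k)⁻¹ * ∑ w : Fin k → A,
      f (x + wordSum nx D s (List.ofFn w)) ((List.ofFn w).foldl nx s) := by
  induction k generalizing x s with
  | zero => simp [wordSum]
  | succ k ih =>
    rw [skewAvg_pow_succ, sum_ofFn_succ k (fun w => f (x + wordSum nx D s w) (w.foldl nx s)),
      Fintype.expect_eq_sum_div_card, div_eq_inv_mul, pow_succ, mul_inv_rev, mul_assoc]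
    congr 1
    rw [Finset.mul_sum]
    refine Finset.sum_congr rfl fun a _ => ?_
    rw [ih]
    simp only [wordSum, List.foldl_cons, add_assoc]

theorem twistAvg_pow_eq_sum (t : ℝ) (k : ℕ) (f : σ → ℂ) (s : σ) :
    (twistAvg nx D t ^ k) f s = ((Fintype.card A : ℂ) ^ k)⁻¹ * ∑ w : Fin k → A,
      Complex.exp (t * wordSum nx D s (List.ofFn w) * Complex.I) * f ((List.ofFn w).foldl nx s) := by
  have h := skewAvg_pow_exp (nx := nx) (D := D) t k f 0 s
  rw [skewAvg_pow_eq_sum] at h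
  simpa using h.symm

/-- The modulus is `2 cos ((x - y) / 2)`, and the cosine lies below a parabola on the relevant
range. -/
theorem norm_exp_add_exp_le {x y : ℝ} (h : |x - y| ≤ Real.pi) :
    ‖Complex.exp (x * Complex.I) + Complex.exp (y * Complex.I)‖ ≤
      2 - (x - y) ^ 2 / Real.pi ^ 2 := by
  have e1 : Complex.exp (x * Complex.I) + Complex.exp (y * Complex.I) =
      Complex.exp (((x + y) / 2 : ℝ) * Complex.I) * ((2 * Real.cos ((x - y) / 2) : ℝ) : ℂ) := by
    push_cast
    rw [Complex.cos, mul_div_cancel₀ _ (two_ne_zero (α := ℂ)), mul_add, ← Complex.exp_add,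
      ← Complex.exp_add]
    congr 2 <;> ring
  have hpi := Real.pi_pos
  have hz : |(x - y) / 2| ≤ Real.pi / 2 := by
    rw [abs_div, abs_two]; linarith
  rw [e1, norm_mul, Complex.norm_exp_ofReal_mul_I, one_mul, Complex.norm_real, Real.norm_eq_abs,
    abs_of_nonneg (by
      have := Real.cos_nonneg_of_mem_Icc (abs_le.1 hz)
      positivity)]
  have h3 := Real.cos_le_one_sub_mul_cos_sq (x := (x - y) / 2) (by linarith)
  have h4 : 2 * (1 - 2 / Real.pi ^ 2 * ((x - y) / 2) ^ 2) = 2 - (x - y) ^ 2 / Real.pi ^ 2 := by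
    field_simp
  linarith

/-- Two paths with the same end and different sums make the twisted averages contract. -/
theorem norm_twistAvg_pow_le_of_wordSum_ne [Nonempty A] {K : Set σ} (hK : ∀ s ∈ K, ∀ a, nx s a ∈ K)
    {s : σ} (hs : s ∈ K) {w w' : List A} (hl : w.length = w'.length)
    (he : w.foldl nx s = w'.foldl nx s) (hne : wordSum nx D s w ≠ wordSum nx D s w') :
    ∃ (n : ℕ) (R : ℝ), 0 < R ∧ ∀ t : ℝ, |t| * R ≤ 1 → ∀ (f : σ → ℂ) (m : ℝ),
      (∀ s ∈ K, ‖f s‖ ≤ m) → ‖(twistAvg nx D t ^ n) f s‖ ≤ (1 - t ^ 2 / R) * m := by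
  classical
  set n := w.length with hn
  set δ := wordSum nx D s w - wordSum nx D s w' with hδ
  have hδ0 : δ ≠ 0 := sub_ne_zero.2 hne
  set N := (Fintype.card A : ℝ) ^ n with hN
  have hN0 : 0 < N := by positivity
  have hpi := Real.pi_pos
  have hδ2 : 0 < δ ^ 2 := by positivity
  -- The first summand keeps `|t δ| ≤ 1`, where the bound for two exponentials applies; the second
  -- makes `t² / R` at most the gain `(t δ)² / π²` of the pair of words, distributed over all `N`
  -- words.
  refine ⟨n, |δ| + N * Real.pi ^ 2 / δ ^ 2, by positivity, fun t ht f m hf => ?_⟩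
  set R := |δ| + N * Real.pi ^ 2 / δ ^ 2 with hR
  have hR0 : 0 < R := by positivity
  have htδ : |t * δ| ≤ Real.pi := by
    rw [abs_mul]
    have : |t| * |δ| ≤ |t| * R := by
      gcongr
      rw [hR]
      have : 0 ≤ N * Real.pi ^ 2 / δ ^ 2 := by positivity
      linarith
    linarith [Real.pi_gt_three]
  have hm : 0 ≤ m := (norm_nonneg _).trans (hf s hs)
  set v : Fin n → A := fun i => w.get i with hv
  set v' : Fin n → A := fun i => w'.get (Fin.cast hl i) with hv'
  have hvw : List.ofFn v = w := List.ofFn_get w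
  have hvw' : List.ofFn v' = w' := by
    refine List.ext_getElem (by simp [← hl, hn]) fun i h1 h2 => by simp [hv']
  have hvne : v ≠ v' := fun h => hne (by rw [← hvw, ← hvw', h])
  set F : (Fin n → A) → ℂ := fun u => Complex.exp (t * wordSum nx D s (List.ofFn u) * Complex.I) *
    f ((List.ofFn u).foldl nx s) with hF
  have hFn : ∀ u, ‖F u‖ ≤ m := fun u => by
    rw [hF]
    simp only
    rw [norm_mul, norm_exp_mul_mul_I, one_mul]
    exact hf _ (foldl_mem_of_closed hK _ hs)
  have hpair : ‖F v + F v'‖ ≤ (2 - (t * δ) ^ 2 / Real.pi ^ 2) * m := by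
    have e1 : F v + F v' = (Complex.exp ((t * wordSum nx D s w : ℝ) * Complex.I) +
        Complex.exp ((t * wordSum nx D s w' : ℝ) * Complex.I)) * f (w.foldl nx s) := by
      simp only [hF, hvw, hvw', ← he]
      push_cast
      ring
    rw [e1, norm_mul]
    have h1 := norm_exp_add_exp_le (x := t * wordSum nx D s w) (y := t * wordSum nx D s w')
      (by rw [← mul_sub]; exact htδ)
    rw [← mul_sub] at h1
    exact mul_le_mul h1 (hf _ (foldl_mem_of_closed hK _ hs)) (norm_nonneg _)
      ((norm_nonneg _).trans h1)
  have hsum : ‖∑ u, F u‖ ≤ (N - (t * δ) ^ 2 / Real.pi ^ 2) * m := by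
    have hmem : v' ∈ Finset.univ.erase v := by simp [hvne.symm]
    rw [← Finset.add_sum_erase _ _ (Finset.mem_univ v), ← Finset.add_sum_erase _ _ hmem, ← add_assoc]
    refine (norm_add_le _ _).trans ((add_le_add hpair ((norm_sum_le _ _).trans
      (Finset.sum_le_card_nsmul _ _ m fun u _ => hFn u))).trans (le_of_eq ?_))
    rw [Finset.card_erase_of_mem hmem, Finset.card_erase_of_mem (Finset.mem_univ v),
      Finset.card_univ, nsmul_eq_mul]
    have hcard : 2 ≤ Fintype.card (Fin n → A) := by
      rw [← Finset.card_univ, ← Finset.card_pair hvne]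
      exact Finset.card_le_card (Finset.subset_univ _)
    have hcN : ((Fintype.card (Fin n → A) : ℕ) : ℝ) = N := by simp [hN]
    rw [Nat.sub_sub, Nat.cast_sub hcard, hcN]
    push_cast
    ring
  rw [twistAvg_pow_eq_sum, norm_mul, norm_inv, norm_pow, Complex.norm_natCast, ← hN,
    inv_mul_le_iff₀ hN0]
  refine hsum.trans ?_
  rw [← mul_assoc]
  gcongr
  have h1 : N * (t ^ 2 / R) ≤ (t * δ) ^ 2 / Real.pi ^ 2 := by
    rw [mul_div_assoc', div_le_div_iff₀ hR0 (by positivity)]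
    have h2 : N * Real.pi ^ 2 ≤ δ ^ 2 * R := by
      rw [hR, mul_add, mul_div_cancel₀ _ hδ2.ne']
      have : 0 ≤ δ ^ 2 * |δ| := by positivity
      linarith
    nlinarith [sq_nonneg t]
  linarith

/-- The decay of the twisted averages. -/
theorem exists_norm_twistAvg_pow_le_exp [Finite σ] [Nonempty A] {K : Set σ}
    (hK : ∀ s ∈ K, ∀ a, nx s a ∈ K)
    (hr : ∀ s ∈ K, ∀ s' ∈ K, ∃ w : List A, w.foldl nx s = s') {b : ℝ} (hb : 0 < b) {H₂ : σ → ℝ}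
    (hD : ∀ s ∈ K, 𝔼 a, D s a = 0)
    (hD₂ : ∀ s ∈ K, 𝔼 a, D s a ^ 2 = b + H₂ s - 𝔼 a, H₂ (nx s a)) :
    ∃ (t₀ c B : ℝ), 0 < t₀ ∧ 0 < c ∧ c ≤ b / 2 ∧ 1 ≤ B ∧ ∀ t : ℝ, |t| ≤ t₀ →
      ∀ (k : ℕ) (f : σ → ℂ) (m : ℝ), (∀ s ∈ K, ‖f s‖ ≤ m) →
      ∀ s ∈ K, ‖(twistAvg nx D t ^ k) f s‖ ≤ B * Real.exp (-(c * k * t ^ 2)) * m := by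
  have := Fintype.ofFinite σ
  have h : ∀ s ∈ K, ∃ (n : ℕ) (R : ℝ), 0 < R ∧ ∀ t : ℝ, |t| * R ≤ 1 → ∀ (f : σ → ℂ) (m : ℝ),
      (∀ s ∈ K, ‖f s‖ ≤ m) → ‖(twistAvg nx D t ^ n) f s‖ ≤ (1 - t ^ 2 / R) * m := fun s hs => by
    obtain ⟨w, w', hl, he, hne⟩ := exists_wordSum_ne hK hr hb.ne' hD hD₂ hs
    exact norm_twistAvg_pow_le_of_wordSum_ne hK hs hl he hne
  -- The values `0` and `1` outside `K` are placeholders; they only allow a choice for all states at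
  -- once.
  have h' : ∀ s, ∃ (n : ℕ) (R : ℝ), 0 < R ∧ (s ∈ K → ∀ t : ℝ, |t| * R ≤ 1 → ∀ (f : σ → ℂ) (m : ℝ),
      (∀ s ∈ K, ‖f s‖ ≤ m) → ‖(twistAvg nx D t ^ n) f s‖ ≤ (1 - t ^ 2 / R) * m) := fun s => by
    by_cases hs : s ∈ K
    · obtain ⟨n, R, hR, h⟩ := h s hs
      exact ⟨n, R, hR, fun _ => h⟩
    · exact ⟨0, 1, one_pos, fun h => absurd h hs⟩
  choose n R hR hnR using h'
  -- A block length valid for every state: the `n₀ - n s` surplus letters are spent first, where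
  -- averaging does not increase the norm.
  set n₀ := ∑ s, n s + 1 with hn₀
  set R₀ := ∑ s, R s + 1 with hR₀
  have hRs : ∀ s, R s ≤ R₀ := fun s => by
    have := Finset.single_le_sum (f := R) (fun s _ => (hR s).le) (Finset.mem_univ s)
    linarith
  have hns : ∀ s, n s ≤ n₀ := fun s => by
    have := Finset.single_le_sum (f := n) (fun s _ => Nat.zero_le _) (Finset.mem_univ s)
    omega
  have hR₀0 : 0 < R₀ := by
    have := Finset.sum_nonneg fun s (_ : s ∈ Finset.univ) => (hR s).le
    linarith
  have hn₀pos : 0 < n₀ := by omega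
  clear_value n₀ R₀
  have hstep : ∀ t : ℝ, |t| * R₀ ≤ 1 → ∀ (f : σ → ℂ) (m : ℝ), (∀ s ∈ K, ‖f s‖ ≤ m) →
      ∀ s ∈ K, ‖(twistAvg nx D t ^ n₀) f s‖ ≤ (1 - t ^ 2 / R₀) * m := by
    intro t ht f m hf s hs
    have hm : 0 ≤ m := (norm_nonneg _).trans (hf s hs)
    have h1 := hnR s hs t ((mul_le_mul_of_nonneg_left (hRs s) (abs_nonneg t)).trans ht)
      ((twistAvg nx D t ^ (n₀ - n s)) f) m (norm_twistAvg_pow_le hK t _ hf)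
    rw [← Module.End.mul_apply, ← pow_add, Nat.add_sub_cancel' (hns s)] at h1
    refine h1.trans ?_
    gcongr
    · exact hR s
    · exact hRs s
  have hpow : ∀ t : ℝ, |t| * R₀ ≤ 1 → ∀ (j : ℕ) (f : σ → ℂ) (m : ℝ), (∀ s ∈ K, ‖f s‖ ≤ m) →
      ∀ s ∈ K, ‖(twistAvg nx D t ^ (n₀ * j)) f s‖ ≤ (Real.exp (-(t ^ 2 / R₀))) ^ j * m := by
    intro t ht j
    induction j with
    | zero => intro f m hf s hs; simpa using hf s hs
    | succ j ih =>
      intro f m hf s hs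
      have hm : 0 ≤ m := (norm_nonneg _).trans (hf s hs)
      rw [mul_add, mul_one, pow_add, Module.End.mul_apply, pow_succ, mul_assoc]
      refine ih _ _ (fun s hs => (hstep t ht f m hf s hs).trans ?_) s hs
      gcongr
      exact Real.one_sub_le_exp_neg _
  have hn₀0 : (0 : ℝ) < n₀ := by exact_mod_cast hn₀pos
  -- A block of `n₀` letters gives the factor `exp (-t² / R₀)`, hence the rate `1 / (R₀ n₀)` per
  -- letter; the incomplete last block is paid for by the constant `B`. The minimum with `b / 2`
  -- ensures that the normal characteristic function decays at least as fast.
  refine ⟨1 / R₀, min (1 / (R₀ * n₀)) (b / 2), Real.exp (1 / R₀ * (1 / R₀) ^ 2), by positivity,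
    lt_min (by positivity) (by positivity), min_le_right _ _, Real.one_le_exp (by positivity),
    fun t ht k f m hf s hs => ?_⟩
  have hm : 0 ≤ m := (norm_nonneg _).trans (hf s hs)
  have ht' : |t| * R₀ ≤ 1 := by rwa [le_div_iff₀ hR₀0] at ht
  have h1 := hpow t ht' (k / n₀) ((twistAvg nx D t ^ (k % n₀)) f) m (norm_twistAvg_pow_le hK t (k % n₀) hf) s hs
  rw [← Module.End.mul_apply, ← pow_add, Nat.div_add_mod] at h1
  refine h1.trans ?_
  rw [← Real.exp_add, ← Real.exp_nat_mul]
  gcongr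
  have hk : (k : ℝ) ≤ n₀ * ((k / n₀ : ℕ) : ℝ) + n₀ := by
    have := Nat.lt_mul_div_succ k hn₀pos
    rw [mul_add, mul_one] at this
    exact_mod_cast this.le
  have ht2 : t ^ 2 ≤ (1 / R₀) ^ 2 := by rw [← sq_abs]; gcongr
  have h2 : min (1 / (R₀ * n₀)) (b / 2) * k * t ^ 2 ≤ 1 / (R₀ * n₀) * k * t ^ 2 := by
    gcongr
    exact min_le_left _ _
  have h3 : 1 / (R₀ * n₀) * k * t ^ 2 ≤ 1 / (R₀ * n₀) * (n₀ * ((k / n₀ : ℕ) : ℝ) + n₀) * t ^ 2 := by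
    gcongr
  have h4 : 1 / (R₀ * n₀) * (n₀ * ((k / n₀ : ℕ) : ℝ) + n₀) * t ^ 2 =
      ((k / n₀ : ℕ) : ℝ) * (t ^ 2 / R₀) + 1 / R₀ * t ^ 2 := by field_simp
  have h5 : 1 / R₀ * t ^ 2 ≤ 1 / R₀ * (1 / R₀) ^ 2 := by gcongr
  linarith

end Words

/-! ### Scaling, translation and Lipschitz bounds of the normal distribution function -/

section NormalCDF

theorem cdf_map_mul (μ : Measure ℝ) [IsProbabilityMeasure μ] {r : ℝ} (hr : 0 < r) (x : ℝ) :
    cdf (μ.map fun y => r * y) (r * x) = cdf μ x := by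
  have hm : Measurable fun y : ℝ => r * y := measurable_const_mul r
  have := Measure.isProbabilityMeasure_map (μ := μ) hm.aemeasurable
  rw [cdf_eq_real, cdf_eq_real, map_measureReal_apply hm measurableSet_Iic]
  congr 1
  ext y
  simp [mul_le_mul_iff_right₀ hr]

theorem cdf_map_add (μ : Measure ℝ) [IsProbabilityMeasure μ] (m x : ℝ) :
    cdf (μ.map fun y => m + y) (m + x) = cdf μ x := by
  have hm : Measurable fun y : ℝ => m + y := measurable_const_add m
  have := Measure.isProbabilityMeasure_map (μ := μ) hm.aemeasurable
  rw [cdf_eq_real, cdf_eq_real, map_measureReal_apply hm measurableSet_Iic]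
  congr 1
  ext y
  simp

theorem normalCDF_nonneg (m v x : ℝ) : 0 ≤ normalCDF m v x := cdf_nonneg _ _

theorem normalCDF_le_one (m v x : ℝ) : normalCDF m v x ≤ 1 := cdf_le_one _ _

theorem normalCDF_add (m v y x : ℝ) : normalCDF (m + y) v (x + y) = normalCDF m v x := by
  rw [normalCDF, normalCDF, ← gaussianReal_map_const_add, add_comm x, cdf_map_add]

theorem normalCDF_mul {m v r : ℝ} (hr : 0 < r) (x : ℝ) :
    normalCDF (r * m) (r ^ 2 * v) (r * x) = normalCDF m v x := by
  rw [normalCDF, normalCDF, ← cdf_map_mul (gaussianReal m v.toNNReal) hr, gaussianReal_map_const_mul]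
  congr 3
  rw [Real.toNNReal_mul (by positivity)]
  congr 1
  exact Real.toNNReal_of_nonneg _

/-- The density is at most `1 / √(2 π v)`; the factor `√(2 π)` is given away. -/
theorem normalCDF_sub_le (m : ℝ) {v : ℝ} (hv : 0 < v) {x y : ℝ} (hxy : x ≤ y) :
    normalCDF m v y - normalCDF m v x ≤ (√v)⁻¹ * (y - x) := by
  have hv' : v.toNNReal ≠ 0 := by simpa using hv
  have e : Set.Iic y \ Set.Iic x = Set.Ioc x y := by
    ext z; simp [and_comm]
  rw [normalCDF, normalCDF, cdf_eq_real, cdf_eq_real,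
    ← measureReal_sdiff (Set.Iic_subset_Iic.2 hxy) measurableSet_Iic, e,
    measureReal_def, gaussianReal_apply_eq_integral _ hv',
    ENNReal.toReal_ofReal (integral_nonneg fun _ => gaussianPDFReal_nonneg _ _ _)]
  have h : ∀ z ∈ Set.Ioc x y, ‖gaussianPDFReal m v.toNNReal z‖ ≤ (√v)⁻¹ := fun z _ => by
    rw [Real.norm_of_nonneg (gaussianPDFReal_nonneg _ _ _), gaussianPDFReal,
      Real.coe_toNNReal _ hv.le]
    have h1 : √v ≤ √(2 * Real.pi * v) := by
      apply Real.sqrt_le_sqrt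
      nlinarith [Real.pi_gt_three]
    have h2 : 0 < √v := Real.sqrt_pos.2 hv
    have h3 : Real.exp (-(z - m) ^ 2 / (2 * v)) ≤ 1 := by
      rw [Real.exp_le_one_iff, neg_div]
      have : 0 ≤ (z - m) ^ 2 / (2 * v) := by positivity
      linarith
    calc _ ≤ (√v)⁻¹ * 1 := by gcongr
      _ = _ := mul_one _
  have := norm_setIntegral_le_of_norm_le_const (μ := volume) (by simp) h
  rw [Real.volume_real_Ioc_of_le hxy] at this
  exact (Real.le_norm_self _).trans this

theorem monotone_normalCDF (m v : ℝ) : Monotone (normalCDF m v) := monotone_cdf _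

theorem abs_normalCDF_sub_le (m : ℝ) {v : ℝ} (hv : 0 < v) (x y : ℝ) :
    |normalCDF m v y - normalCDF m v x| ≤ (√v)⁻¹ * |y - x| := by
  rcases le_total x y with h | h
  · rw [abs_of_nonneg (sub_nonneg.2 h), abs_of_nonneg (sub_nonneg.2 (monotone_normalCDF m v h))]
    exact normalCDF_sub_le m hv h
  · rw [abs_sub_comm, abs_sub_comm y, abs_of_nonneg (sub_nonneg.2 h),
      abs_of_nonneg (sub_nonneg.2 (monotone_normalCDF m v h))]
    exact normalCDF_sub_le m hv h

end NormalCDF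

/-- Esseen's smoothing inequality with characteristic functions compared on `[-R, R]`. -/
theorem exists_abs_cdf_sub_cdf_le_of_Icc : ∃ K : ℝ, 0 ≤ K ∧ ∀ (μ ν : Measure ℝ)
    [IsProbabilityMeasure μ] [IsProbabilityMeasure ν] (m R : ℝ) (g : ℝ → ℝ), 0 ≤ m → 0 < R →
    (∀ x y, x ≤ y → cdf ν y - cdf ν x ≤ m * (y - x)) → Continuous g →
    (∀ t, |t| ≤ R → ‖charFun μ t - charFun ν t‖ ≤ |t| * g t) →
    ∀ x, |cdf μ x - cdf ν x| ≤ K * ((∫ t in (-R)..R, g t) + m / R) := by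
  obtain ⟨K, hK, h⟩ := exists_abs_cdf_sub_cdf_le
  refine ⟨K, hK, fun μ ν _ _ m R g hm hR hlip hg hchar x => ?_⟩
  have hme : Measurable fun y : ℝ => R * y := measurable_const_mul R
  have := Measure.isProbabilityMeasure_map (μ := μ) hme.aemeasurable
  have := Measure.isProbabilityMeasure_map (μ := ν) hme.aemeasurable
  have := h (μ.map fun y => R * y) (ν.map fun y => R * y) (m / R) (fun t => R * g (R * t))
    (by positivity) (fun x y hxy => ?_) ((by fun_prop : Continuous _).intervalIntegrable _ _)
    (fun t ht => ?_) (R * x)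
  · rw [cdf_map_mul μ hR, cdf_map_mul ν hR] at this
    refine this.trans_eq ?_
    rw [intervalIntegral.integral_const_mul, intervalIntegral.mul_integral_comp_mul_left]
    simp
  · have e : ∀ x, cdf (ν.map fun y => R * y) x = cdf ν (x / R) := fun x => by
      rw [← cdf_map_mul ν hR, mul_div_cancel₀ _ hR.ne']
    rw [e, e]
    refine (hlip (x / R) (y / R) (by gcongr)).trans_eq ?_
    ring
  · rw [charFun_map_mul, charFun_map_mul]
    refine (hchar (R * t) ?_).trans_eq ?_
    · rw [abs_mul, abs_of_pos hR]
      exact mul_le_of_le_one_right hR.le (abs_le.2 ht)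
    · rw [abs_mul, abs_of_pos hR]; ring

/-! ### The law of a uniformly chosen word -/

section EmpiricalLaw

variable {W : Type*} [Fintype W]

/-- The law of `X w` for `w` uniformly distributed in the finite type `W`. -/
def empiricalLaw (X : W → ℝ) : Measure ℝ :=
  ∑ w, ENNReal.ofReal (Fintype.card W : ℝ)⁻¹ • Measure.dirac (X w)

theorem isProbabilityMeasure_empiricalLaw [Nonempty W] (X : W → ℝ) :
    IsProbabilityMeasure (empiricalLaw X) := ⟨by
  have : (0 : ℝ) < Fintype.card W := by exact_mod_cast Fintype.card_pos
  simp only [empiricalLaw, Measure.finsetSum_apply, Measure.smul_apply, measure_univ, smul_eq_mul,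
    mul_one, Finset.sum_const, Finset.card_univ, nsmul_eq_mul]
  rw [← ENNReal.ofReal_natCast, ← ENNReal.ofReal_mul this.le, mul_inv_cancel₀ this.ne',
    ENNReal.ofReal_one]⟩

theorem charFun_empiricalLaw (X : W → ℝ) (t : ℝ) : charFun (empiricalLaw X) t =
    (Fintype.card W : ℂ)⁻¹ * ∑ w, Complex.exp (t * X w * Complex.I) := by
  rw [charFun_apply_real, empiricalLaw, integral_finsetSum_measure, Finset.mul_sum]
  · refine Finset.sum_congr rfl fun w _ => ?_
    rw [integral_smul_measure, integral_dirac, ENNReal.toReal_ofReal (by positivity)]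
    simp
  · intro w _
    refine Integrable.smul_measure ?_ ENNReal.ofReal_ne_top
    exact integrable_dirac (by simp)

theorem cdf_empiricalLaw [Nonempty W] (X : W → ℝ) (x : ℝ) : cdf (empiricalLaw X) x =
    (Fintype.card W : ℝ)⁻¹ * ∑ w, if X w ≤ x then 1 else 0 := by
  have := isProbabilityMeasure_empiricalLaw X
  rw [cdf_eq_real, measureReal_def, empiricalLaw, Measure.finsetSum_apply, ENNReal.toReal_sum,
    Finset.mul_sum]
  · refine Finset.sum_congr rfl fun w _ => ?_
    rw [Measure.smul_apply, Measure.dirac_apply' _ measurableSet_Iic, smul_eq_mul, ENNReal.toReal_mul,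
      ENNReal.toReal_ofReal (by positivity)]
    by_cases h : X w ≤ x <;> simp [h]
  · intro w _
    rw [Measure.smul_apply, Measure.dirac_apply' _ measurableSet_Iic, smul_eq_mul]
    refine ENNReal.mul_ne_top ENNReal.ofReal_ne_top ?_
    by_cases h : X w ≤ x <;> simp [h]

end EmpiricalLaw

theorem integral_abs_mul_exp_le {γ : ℝ} (hγ : 0 < γ) {R : ℝ} (hR : 0 ≤ R) :
    ∫ t in (-R)..R, |t| * Real.exp (-(γ * t ^ 2)) ≤ 1 / γ := by
  have hc : Continuous fun t : ℝ => |t| * Real.exp (-(γ * t ^ 2)) := by fun_prop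
  have h1 : ∫ t in (0 : ℝ)..R, |t| * Real.exp (-(γ * t ^ 2)) ≤ 1 / (2 * γ) := by
    have e : ∫ t in (0 : ℝ)..R, |t| * Real.exp (-(γ * t ^ 2)) =
        ∫ t in (0 : ℝ)..R, t * Real.exp (-(γ * t ^ 2)) := by
      refine intervalIntegral.integral_congr fun t ht => ?_
      rw [Set.uIcc_of_le hR] at ht
      simp only [abs_of_nonneg ht.1]
    rw [e, intervalIntegral.integral_eq_sub_of_hasDerivAt
      (f := fun t => -(1 / (2 * γ)) * Real.exp (-(γ * t ^ 2))) (fun t _ => ?_)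
      ((by fun_prop : Continuous _).intervalIntegrable _ _)]
    · have := Real.exp_pos (-(γ * R ^ 2))
      have : 0 ≤ 1 / (2 * γ) * Real.exp (-(γ * R ^ 2)) := by positivity
      simp only [zero_pow two_ne_zero, mul_zero, neg_zero, Real.exp_zero]
      linarith
    · have := ((((hasDerivAt_pow 2 t).const_mul γ).neg).exp).const_mul (-(1 / (2 * γ)))
      refine this.congr_deriv ?_
      simp only [Pi.neg_apply]
      field_simp
      simp
  have h2 : ∫ t in (-R)..0, |t| * Real.exp (-(γ * t ^ 2)) =
      ∫ t in (0 : ℝ)..R, |t| * Real.exp (-(γ * t ^ 2)) := by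
    have := intervalIntegral.integral_comp_neg (a := 0) (b := R)
      fun t : ℝ => |t| * Real.exp (-(γ * t ^ 2))
    rw [neg_zero] at this
    simpa using this.symm
  rw [← intervalIntegral.integral_add_adjacent_intervals (hc.intervalIntegrable (-R) 0)
    (hc.intervalIntegrable 0 R), h2]
  calc _ ≤ 1 / (2 * γ) + 1 / (2 * γ) := add_le_add h1 h1
    _ = 1 / γ := by field_simp; norm_num

/-! ### The Berry–Esseen bound for an irreducible chain -/

section BerryEsseen

open scoped BigOperators

variable {σ A : Type*} [Finite σ] [Fintype A] [Nonempty A] {nx : σ → A → σ} {D : σ → A → ℝ}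

theorem skewAvg_pow_indicator (k : ℕ) (z : ℝ) (s : σ) :
    (skewAvg ℝ nx D ^ k) (fun x _ => if x ≤ z then 1 else 0) 0 s =
      cdf (empiricalLaw fun w : Fin k → A => wordSum nx D s (List.ofFn w)) z := by
  rw [skewAvg_pow_eq_sum, cdf_empiricalLaw]
  simp

theorem twistAvg_pow_one_eq_charFun (k : ℕ) (t : ℝ) (s : σ) :
    (twistAvg nx D t ^ k) 1 s =
      charFun (empiricalLaw fun w : Fin k → A => wordSum nx D s (List.ofFn w)) t := by
  rw [twistAvg_pow_eq_sum, charFun_empiricalLaw]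
  simp

theorem exp_neg_sub_exp_neg_le {x y : ℝ} :
    Real.exp (-x) - Real.exp (-y) ≤ (y - x) * Real.exp (-x) := by
  have h2 := Real.one_sub_le_exp_neg (y - x)
  have h3 : Real.exp (-y) = Real.exp (-x) * Real.exp (-(y - x)) := by
    rw [← Real.exp_add]; congr 1; ring
  rw [h3]
  nlinarith [Real.exp_pos (-x)]

/-- The Berry–Esseen bound for the sums along the paths of a finite chain. -/
theorem exists_abs_skewAvg_pow_sub_normalCDF_le {K : Set σ} (hK : ∀ s ∈ K, ∀ a, nx s a ∈ K)
    (hr : ∀ s ∈ K, ∀ s' ∈ K, ∃ w : List A, w.foldl nx s = s') {b : ℝ} (hb : 0 < b) {H₂ : σ → ℝ}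
    (hD : ∀ s ∈ K, 𝔼 a, D s a = 0)
    (hD₂ : ∀ s ∈ K, 𝔼 a, D s a ^ 2 = b + H₂ s - 𝔼 a, H₂ (nx s a)) :
    ∃ B, 0 ≤ B ∧ ∀ l : ℝ, 1 ≤ l → ∀ k : ℕ, k ≤ l → ∀ s ∈ K, ∀ z : ℝ,
      |(skewAvg ℝ nx D ^ k) (fun x _ => if x ≤ z then 1 else 0) 0 s - normalCDF 0 (b * l) z| ≤
        B / √l * (1 + (l - k)) := by
  obtain ⟨t₀, c, B₁, ht₀, hc, hcb, hB₁, hL⟩ := exists_norm_twistAvg_pow_le_exp hK hr hb hD hD₂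
  obtain ⟨C, hC, hchar⟩ := exists_norm_twistAvg_pow_sub_le hb.le hD hD₂ hc.le hcb hB₁ hL
  obtain ⟨E, hE, hess⟩ := exists_abs_cdf_sub_cdf_le_of_Icc
  set B₂ := 4 / c * (C + b / 2 + C / √c) + (√b)⁻¹ / t₀ with hB₂
  have hB₂0 : 0 ≤ B₂ := by positivity
  refine ⟨2 + E * B₂, by positivity, fun l hl k hk s hs z => ?_⟩
  have hl0 : 0 < l := by linarith
  have hsl : 1 ≤ √l := Real.one_le_sqrt.2 hl
  have hsl0 : 0 < √l := by linarith
  have hll : √l * √l = l := Real.mul_self_sqrt hl0.le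
  have hkl : 0 ≤ l - k := by linarith
  rw [skewAvg_pow_indicator]
  set μ := empiricalLaw fun w : Fin k → A => wordSum nx D s (List.ofFn w) with hμ
  have := isProbabilityMeasure_empiricalLaw fun w : Fin k → A => wordSum nx D s (List.ofFn w)
  rw [← hμ] at this
  -- For `k < l / 2` the allowance `1 + (l - k)` makes the bound trivial; afterwards `k` is
  -- comparable to `l`.
  rcases lt_or_ge (k : ℝ) (l / 2) with hk2 | hk2
  · calc _ ≤ (1 : ℝ) := by
          rw [abs_le]
          constructor <;> linarith [cdf_nonneg μ z, cdf_le_one μ z, normalCDF_nonneg 0 (b * l) z,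
            normalCDF_le_one 0 (b * l) z]
      _ ≤ 2 / √l * (1 + (l - k)) := by
          rw [div_mul_eq_mul_div, le_div_iff₀ hsl0]
          nlinarith
      _ ≤ _ := by
          gcongr
          linarith [mul_nonneg hE hB₂0]
  · have hk0 : (0 : ℝ) < k := by linarith
    have hck : 0 < c * k := by positivity
    -- The difference of the characteristic functions will be at most `A₁ t² exp (-c k t² / 2)`. The
    -- last summand, of order `√l`, comes from `k |t|³`; after division by `|t|` the integral
    -- contributes a factor of order `1 / l`.
    set A₁ := C + b / 2 * (l - k) + C * (√l / √c) with hA₁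
    have hA₁0 : 0 ≤ A₁ := by positivity
    have key := hess μ (gaussianReal 0 (b * l).toNNReal) ((√(b * l))⁻¹) t₀
      (fun t => A₁ * (|t| * Real.exp (-(c * k / 2 * t ^ 2)))) (by positivity) ht₀
      (fun x y hxy => normalCDF_sub_le 0 (by positivity) hxy) (by fun_prop) (fun t ht => ?_) z
    · refine key.trans ?_
      rw [intervalIntegral.integral_const_mul]
      have h1 : ∫ t in (-t₀)..t₀, |t| * Real.exp (-(c * k / 2 * t ^ 2)) ≤ 4 / (c * l) := by
        refine (integral_abs_mul_exp_le (by positivity) ht₀.le).trans ?_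
        rw [div_le_div_iff₀ (by positivity) (by positivity)]
        nlinarith
      have h2 : A₁ ≤ (C + b / 2 + C / √c) * √l * (1 + (l - k)) := by
        have f1 : C * 1 ≤ C * (√l * (1 + (l - k))) := by
          gcongr; nlinarith
        have f2 : b / 2 * (l - k) ≤ b / 2 * (√l * (1 + (l - k))) := by
          gcongr; nlinarith
        have f3 : C * (√l / √c) * 1 ≤ C * (√l / √c) * (1 + (l - k)) := by
          gcongr; linarith
        calc A₁ ≤ C * (√l * (1 + (l - k))) + b / 2 * (√l * (1 + (l - k))) +
              C * (√l / √c) * (1 + (l - k)) := by rw [hA₁]; linarith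
          _ = _ := by ring
      have h3 : (√(b * l))⁻¹ / t₀ ≤ (√b)⁻¹ / t₀ / √l * (1 + (l - k)) := by
        rw [Real.sqrt_mul hb.le, mul_inv]
        calc _ = (√b)⁻¹ / t₀ / √l * 1 := by rw [mul_one]; field_simp
          _ ≤ _ := by gcongr; linarith
      calc _ ≤ E * (A₁ * (4 / (c * l)) + (√b)⁻¹ / t₀ / √l * (1 + (l - k))) := by
            gcongr
        _ ≤ E * ((C + b / 2 + C / √c) * √l * (1 + (l - k)) * (4 / (c * l)) +
            (√b)⁻¹ / t₀ / √l * (1 + (l - k))) := by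
            gcongr
        _ = E * B₂ / √l * (1 + (l - k)) := by
            have : 4 / (c * l) = 4 / c / √l / √l := by
              rw [div_div, div_div, hll]
            rw [this, hB₂]
            field_simp
        _ ≤ _ := by gcongr; linarith
    · rw [← twistAvg_pow_one_eq_charFun, charFun_gaussianReal, Real.coe_toNNReal _ (by positivity)]
      have e0 : Complex.exp (t * (0 : ℝ) * Complex.I - (b * l : ℝ) * t ^ 2 / 2) =
          Complex.exp (-(b * l * t ^ 2 / 2 : ℝ)) := by
        congr 1; push_cast; ring
      rw [e0]
      have h1 := hchar t ht k s hs
      have h2 : ‖Complex.exp (-(b * k * t ^ 2 / 2 : ℝ)) - Complex.exp (-(b * l * t ^ 2 / 2 : ℝ))‖ ≤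
          b / 2 * (l - k) * t ^ 2 * Real.exp (-(c * k * t ^ 2)) := by
        rw [← Complex.ofReal_neg, ← Complex.ofReal_neg, ← Complex.ofReal_exp, ← Complex.ofReal_exp,
          ← Complex.ofReal_sub, Complex.norm_real, Real.norm_eq_abs]
        have hle : b * k * t ^ 2 / 2 ≤ b * l * t ^ 2 / 2 := by gcongr
        rw [abs_of_nonneg (sub_nonneg.2 (Real.exp_le_exp.2 (by linarith)))]
        refine exp_neg_sub_exp_neg_le.trans ?_
        have f1 : c * k * t ^ 2 ≤ b * k * t ^ 2 / 2 := by
          have : c * (k * t ^ 2) ≤ b / 2 * (k * t ^ 2) := by gcongr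
          linarith
        calc _ = b / 2 * (l - k) * t ^ 2 * Real.exp (-(b * k * t ^ 2 / 2)) := by ring
          _ ≤ _ := by gcongr
      -- By `y ≤ exp (y² / 2)`, half of the Gaussian decay buys one factor `√k |t|`.
      have h3 : √(c * k) * |t| * Real.exp (-(c * k * t ^ 2)) ≤ Real.exp (-(c * k / 2 * t ^ 2)) := by
        have f1 : √(c * k) * |t| ≤ Real.exp (c * k / 2 * t ^ 2) := by
          have f2 : (√(c * k) * |t|) ^ 2 = c * k * t ^ 2 := by
            rw [mul_pow, Real.sq_sqrt hck.le, sq_abs]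
          have f3 := Real.add_one_le_exp (c * k / 2 * t ^ 2)
          nlinarith [sq_nonneg (√(c * k) * |t| - 1)]
        calc _ ≤ Real.exp (c * k / 2 * t ^ 2) * Real.exp (-(c * k * t ^ 2)) := by gcongr
          _ = _ := by rw [← Real.exp_add]; congr 1; ring
      have h4 : k * |t| * Real.exp (-(c * k * t ^ 2)) ≤
          √l / √c * Real.exp (-(c * k / 2 * t ^ 2)) := by
        have hsc : 0 < √c := Real.sqrt_pos.2 hc
        have hkk : √(k : ℝ) * √k = k := Real.mul_self_sqrt hk0.le
        calc _ = √k / √c * (√(c * k) * |t| * Real.exp (-(c * k * t ^ 2))) := by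
              rw [Real.sqrt_mul hc.le]
              nth_rewrite 1 [← hkk]
              field_simp
          _ ≤ _ := by gcongr
      have h5 : Real.exp (-(c * k * t ^ 2)) ≤ Real.exp (-(c * k / 2 * t ^ 2)) := by
        apply Real.exp_le_exp.2
        nlinarith [mul_nonneg hck.le (sq_nonneg t)]
      have ht2 : t ^ 2 = |t| * |t| := by rw [← sq_abs, sq]
      calc _ ≤ C * (t ^ 2 + k * |t| ^ 3) * Real.exp (-(c * k * t ^ 2)) +
            b / 2 * (l - k) * t ^ 2 * Real.exp (-(c * k * t ^ 2)) :=
            (norm_sub_le_norm_sub_add_norm_sub _ _ _).trans (add_le_add h1 h2)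
        _ = (C + b / 2 * (l - k)) * (|t| * |t|) * Real.exp (-(c * k * t ^ 2)) +
            C * (|t| * |t|) * (k * |t| * Real.exp (-(c * k * t ^ 2))) := by
            rw [ht2]; ring
        _ ≤ (C + b / 2 * (l - k)) * (|t| * |t|) * Real.exp (-(c * k / 2 * t ^ 2)) +
            C * (|t| * |t|) * (√l / √c * Real.exp (-(c * k / 2 * t ^ 2))) := by
            gcongr
        _ = _ := by rw [hA₁]; ring

end BerryEsseen

/-! ### Distribution functions of the values -/

namespace Transducer

open scoped BigOperators

variable {q d : ℕ} {S : Type*} {T : Transducer q d S} [NeZero q] [Fintype S]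

/-- The starting point, `g` and the corrector move the counter by at most `δ`, so the indicator lies
between those with thresholds shifted by `±δ`. The shifts cost `O(δ / √l)`, as the limiting normal
distribution function has slope `O(1 / √l)`. -/
theorem IsFinalComponent.exists_cdf_bound {C : Finset S} (hC : T.IsFinalComponent C)
    {a b : Finset S → ℝ} {H H₂ : S → ℝ} (hb : 0 < b C)
    (hH : ∀ s, 𝔼 ε, T.out s ε = T.harmonicExt a s + H s - 𝔼 ε, H (T.next s ε))
    (hH₂ : ∀ s, 𝔼 ε, T.centredOut (T.harmonicExt a) H s ε ^ 2 =
      T.harmonicExt b s + H₂ s - 𝔼 ε, H₂ (T.next s ε)) :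
    ∃ B, 0 ≤ B ∧ ∀ l : ℝ, 1 ≤ l → ∀ y : ℝ, ∀ s ∈ C, ∀ (k : ℕ) (g : S → ℝ) (G x : ℝ),
      k ≤ l → (∀ s, |g s| ≤ G) →
      |(skewAvg ℝ T.next T.out ^ k) (fun x s => if x + g s ≤ y then 1 else 0) x s -
        normalCDF 0 (b C * l) (y - a C * l)| ≤ B / √l * (1 + |x| + G + (l - k)) := by
  set D := T.centredOut (T.harmonicExt a) H with hD
  obtain ⟨B, hB, h⟩ := exists_abs_skewAvg_pow_sub_normalCDF_le (nx := T.next) (D := D)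
    (K := (C : Set S)) (H₂ := H₂) hC.closed hC.reach hb
    (fun s _ => expect_centredOut hH s) (fun s hs => by
      rw [hH₂ s, harmonicExt_of_mem (mem_finalComponents.2 hC) _ (by simpa using hs)])
  obtain ⟨CH, hCH, hHb⟩ := exists_abs_le H
  have hsb : 0 < √(b C) := Real.sqrt_pos.2 hb
  refine ⟨B + (√(b C))⁻¹ * (1 + 2 * CH + |a C|), by positivity, fun l hl y s hs k g G x hk hg => ?_⟩
  have hsl : 1 ≤ √l := Real.one_le_sqrt.2 hl
  have hsl0 : 0 < √l := by linarith
  have hG : 0 ≤ G := (abs_nonneg _).trans (hg s)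
  have hkl : 0 ≤ l - k := by linarith
  set F : ℝ → ℝ := fun z => (skewAvg ℝ T.next D ^ k) (fun x _ => if x ≤ z then 1 else 0) 0 s
    with hF
  set δ := |x| + G + 2 * CH with hδ
  have hδ0 : 0 ≤ δ := by positivity
  have hbd : ∀ s', |x + H s - H s' + g s'| ≤ δ := fun s' => by
    have h1 := abs_le.1 (hHb s)
    have h2 := abs_le.1 (hHb s')
    have h3 := abs_le.1 (hg s')
    have h4 := abs_le.1 (le_refl |x|)
    rw [abs_le]
    constructor <;> linarith
  have hc0 : (0 : ℝ) ≤ ((Fintype.card (Fin d → Fin q) : ℝ) ^ k)⁻¹ := by positivity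
  have hle : (skewAvg ℝ T.next T.out ^ k) (fun x s => if x + g s ≤ y then 1 else 0) x s ≤
      F (y - a C * k + δ) := by
    rw [skewAvg_pow_cohomologous T.next T.out hC.closed (out_eq_centredOut hC (a := a) (H := H)) k _ x
      (by simpa using hs), hF, skewAvg_pow_eq_sum]
    simp only [skewAvg_pow_eq_sum]
    refine mul_le_mul_of_nonneg_left (Finset.sum_le_sum fun w _ => ?_) hc0
    have := abs_le.1 (hbd ((List.ofFn w).foldl T.next s))
    split_ifs with h1 h2 <;> try norm_num
    exact h2 (by linarith)
  have hge : F (y - a C * k - δ) ≤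
      (skewAvg ℝ T.next T.out ^ k) (fun x s => if x + g s ≤ y then 1 else 0) x s := by
    rw [skewAvg_pow_cohomologous T.next T.out hC.closed (out_eq_centredOut hC (a := a) (H := H)) k _ x
      (by simpa using hs), hF, skewAvg_pow_eq_sum]
    simp only [skewAvg_pow_eq_sum]
    refine mul_le_mul_of_nonneg_left (Finset.sum_le_sum fun w _ => ?_) hc0
    have := abs_le.1 (hbd ((List.ofFn w).foldl T.next s))
    split_ifs with h1 h2 <;> try norm_num
    exact h2 (by linarith)
  have hΦ : ∀ z, |z| ≤ δ → |F (y - a C * k + z) - normalCDF 0 (b C * l) (y - a C * l)| ≤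
      (B + (√(b C))⁻¹ * (1 + 2 * CH + |a C|)) / √l * (1 + |x| + G + (l - k)) := fun z hz => by
    have h1 := h l hl k hk s (by simpa using hs) (y - a C * k + z)
    have h2 := abs_normalCDF_sub_le 0 (v := b C * l) (by positivity) (y - a C * l) (y - a C * k + z)
    have h3 : |y - a C * k + z - (y - a C * l)| ≤ δ + |a C| * (l - k) := by
      have e : y - a C * k + z - (y - a C * l) = z + a C * (l - k) := by ring
      rw [e]
      refine (abs_add_le _ _).trans (add_le_add hz ?_)
      rw [abs_mul, abs_of_nonneg hkl]
    rw [Real.sqrt_mul hb.le] at h2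
    calc _ ≤ B / √l * (1 + (l - k)) + (√(b C) * √l)⁻¹ * (δ + |a C| * (l - k)) :=
          (abs_sub_le _ _ _).trans (add_le_add h1 (h2.trans (by gcongr)))
      _ = (B * (1 + (l - k)) + (√(b C))⁻¹ * (|x| + G + 2 * CH + |a C| * (l - k))) / √l := by
          rw [hδ]; field_simp
      _ ≤ ((B + (√(b C))⁻¹ * (1 + 2 * CH + |a C|)) * (1 + |x| + G + (l - k))) / √l := by
          gcongr
          set L := 1 + |x| + G + (l - k) with hL
          have g0 := abs_nonneg x
          have g1 : B * (1 + (l - k)) ≤ B * L := by gcongr; linarith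
          have g2 : 2 * CH * 1 ≤ 2 * CH * L := by gcongr; linarith
          have g3 : |a C| * (l - k) ≤ |a C| * L := by gcongr; linarith
          have g4 : (√(b C))⁻¹ * (|x| + G + 2 * CH + |a C| * (l - k)) ≤
              (√(b C))⁻¹ * ((1 + 2 * CH + |a C|) * L) := by gcongr; linarith
          calc _ ≤ B * L + (√(b C))⁻¹ * ((1 + 2 * CH + |a C|) * L) := add_le_add g1 g4
            _ = _ := by ring
      _ = _ := by ring
  have h1 := (abs_le.1 (hΦ δ (abs_of_nonneg hδ0).le)).2
  have h2 := (abs_le.1 (hΦ (-δ) (by rw [abs_neg, abs_of_nonneg hδ0]))).1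
  rw [← sub_eq_add_neg] at h2
  rw [abs_le]
  constructor <;> linarith

/-- The distribution function of the values for uniformly distributed arguments. -/
theorem exists_cdf_value_bound (hq : 2 ≤ q) (hd : 1 ≤ d) {a b : Finset S → ℝ} {H H₂ : S → ℝ}
    (hb : ∀ C ∈ T.finalComponents, 0 < b C)
    (hH : ∀ s, 𝔼 ε, T.out s ε = T.harmonicExt a s + H s - 𝔼 ε, H (T.next s ε))
    (hH₂ : ∀ s, 𝔼 ε, T.centredOut (T.harmonicExt a) H s ε ^ 2 =
      T.harmonicExt b s + H₂ s - 𝔼 ε, H₂ (T.next s ε)) :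
    ∃ B, 0 ≤ B ∧ ∀ N : ℕ, q ≤ N → ∀ y : ℝ,
      |(unifBox d N).real {n | T.value n ≤ y} - ∑ C ∈ T.finalComponents, T.absorption C T.init *
          normalCDF 0 (b C * Real.logb q N) (y - a C * Real.logb q N)| ≤ B / √(Real.logb q N) := by
  obtain ⟨K, hK, htr⟩ := exists_transfer (𝕜 := ℝ) hq hd T
  obtain ⟨B, hB, h⟩ := exists_uniform_bound T.finalComponents (P := fun C B =>
    ∀ l : ℝ, 1 ≤ l → ∀ y : ℝ, ∀ s ∈ C, ∀ (k : ℕ) (g : S → ℝ) (G x : ℝ),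
      k ≤ l → (∀ s, |g s| ≤ G) →
      |(skewAvg ℝ T.next T.out ^ k) (fun x s => if x + g s ≤ y then 1 else 0) x s -
        normalCDF 0 (b C * l) (y - a C * l)| ≤ B / √l * (1 + |x| + G + (l - k)))
    (fun C B B' hBB' hP l hl y s hs k g G x hk hg => (hP l hl y s hs k g G x hk hg).trans (by
      have : 0 ≤ 1 + |x| + G + (l - k) := by
        have hG : 0 ≤ G := (abs_nonneg _).trans (hg s)
        have : 0 ≤ l - k := by linarith
        positivity
      gcongr))
    (fun C hC => (mem_finalComponents.1 hC).exists_cdf_bound (hb C hC) hH hH₂)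
  refine ⟨K * (B + 2), by positivity, fun N hN y => ?_⟩
  have hl := one_le_logb hq hN
  set l := Real.logb q N
  have hsl : 0 < √l := Real.sqrt_pos.2 (by linarith)
  rw [mul_div_assoc, unifBox_real]
  simp only [value_eq_valueFrom]
  refine htr N (by omega) (fun x => if x ≤ y then 1 else 0) _ ((B + 2) / √l) (by positivity)
    (two_le_div_sqrt_mul (by linarith) hl) (fun x => ?_) (fun C hC => ?_)
    fun C hC s hs k g G x hk hg => ?_
  · split_ifs <;> simp
  · rw [Real.norm_of_nonneg (normalCDF_nonneg _ _ _)]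
    exact normalCDF_le_one _ _ _
  · refine (h C hC l hl y s hs k g G x hk hg).trans ?_
    have : 0 ≤ 1 + |x| + G + (l - k) := by
      have hG : 0 ≤ G := (abs_nonneg _).trans (hg s)
      have : 0 ≤ l - k := by linarith
      positivity
    gcongr
    linarith

end Transducer

/-! ### The dominant eigenvalue of the twisted averages and its derivatives -/

section EigenvalueBranch

open scoped BigOperators

variable {σ A : Type*} [Fintype σ] [Fintype A] [Nonempty A] {nx : σ → A → σ} {D : σ → A → ℝ}

theorem re_expect (f : A → ℂ) : (𝔼 a, f a).re = 𝔼 a, (f a).re := by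
  rw [Fintype.expect_eq_sum_div_card, Fintype.expect_eq_sum_div_card, Complex.div_natCast_re,
    Complex.re_sum]

theorem im_expect (f : A → ℂ) : (𝔼 a, f a).im = 𝔼 a, (f a).im := by
  rw [Fintype.expect_eq_sum_div_card, Fintype.expect_eq_sum_div_card, Complex.div_natCast_im,
    Complex.im_sum]

/-- On an irreducible chain, only constants satisfy `P H - H = c`, and only for `c = 0`. -/
theorem eq_const_of_expect_sub_eq (hr : ∀ s s' : σ, ∃ w : List A, w.foldl nx s = s') [Nonempty σ]
    {H : σ → ℂ} {c : ℂ} (h : ∀ s, 𝔼 a, H (nx s a) - H s = c) : c = 0 ∧ ∀ s s', H s = H s' := by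
  have hre : ∀ s, 𝔼 a, (H (nx s a)).re - (H s).re = c.re := fun s => by
    rw [← re_expect, ← Complex.sub_re, h]
  have him : ∀ s, 𝔼 a, (H (nx s a)).im - (H s).im = c.im := fun s => by
    rw [← im_expect, ← Complex.sub_im, h]
  have h1 : -c.re = 0 := eq_zero_of_const_eq_sub (nx := nx) (K := Set.univ) Set.univ_nonempty
    (by simp) (H := fun s => (H s).re) fun s _ => by rw [← hre s]; ring
  have h2 : -c.im = 0 := eq_zero_of_const_eq_sub (nx := nx) (K := Set.univ) Set.univ_nonempty
    (by simp) (H := fun s => (H s).im) fun s _ => by rw [← him s]; ring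
  have hc : c = 0 := Complex.ext (neg_eq_zero.1 h1) (neg_eq_zero.1 h2)
  refine ⟨hc, fun s s' => Complex.ext ?_ ?_⟩
  · exact eq_of_harmonicOn (nx := nx) (K := Set.univ) (by simp) (y := fun s => (H s).re)
      (fun s _ => by have := hre s; rw [hc, Complex.zero_re] at this; linarith)
      (fun s _ s' _ => hr s s') trivial trivial
  · exact eq_of_harmonicOn (nx := nx) (K := Set.univ) (by simp) (y := fun s => (H s).im)
      (fun s _ => by have := him s; rw [hc, Complex.zero_im] at this; linarith)
      (fun s _ s' _ => hr s s') trivial trivial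

/-- The equations for an eigenvalue and a normalized eigenvector of the twisted averages. -/
def eigenEquation (nx : σ → A → σ) (D : σ → A → ℝ) (s₀ : σ) (p : ℝ × ℂ × (σ → ℂ)) : ℂ × (σ → ℂ) :=
  (p.2.2 s₀, fun s =>
    (Fintype.card A : ℂ)⁻¹ * ∑ a, Complex.exp ((p.1 : ℂ) * D s a * Complex.I) * p.2.2 (nx s a) -
      p.2.1 * p.2.2 s)

theorem eigenEquation_snd (s₀ : σ) (t : ℝ) (z : ℂ) (x : σ → ℂ) (s : σ) :
    (eigenEquation nx D s₀ (t, z, x)).2 s = twistAvg nx D t x s - z * x s := by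
  rw [twistAvg_apply, Fintype.expect_eq_sum_div_card, div_eq_inv_mul]
  rfl

theorem contDiff_eigenEquation (s₀ : σ) : ContDiff ℝ 2 (eigenEquation nx D s₀) := by
  have h1 : ContDiff ℝ 2 fun p : ℝ × ℂ × (σ → ℂ) => (p.1 : ℂ) :=
    Complex.ofRealCLM.contDiff.comp contDiff_fst
  have h2 : ∀ s, ContDiff ℝ 2 fun p : ℝ × ℂ × (σ → ℂ) => p.2.2 s := fun s => by fun_prop
  unfold eigenEquation
  refine (h2 s₀).prodMk (contDiff_pi.2 fun s => ContDiff.sub (contDiff_const.mul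
    (ContDiff.sum fun a _ => ContDiff.mul (ContDiff.cexp ?_) (h2 _))) (ContDiff.mul ?_ (h2 s)))
  · exact (h1.mul contDiff_const).mul contDiff_const
  · fun_prop

/-- In the directions `ζ` of the eigenvalue and `ξ` of the eigenvector the derivative is `(ξ s₀, P ξ
- ξ - ζ)`. If it vanishes, then `ζ = 0` and `ξ` is constant, hence zero because `ξ s₀ = 0`;
injectivity suffices in finite dimension. -/
theorem isInvertible_fderiv_eigenEquation (hr : ∀ s s' : σ, ∃ w : List A, w.foldl nx s = s')
    (s₀ : σ) : (fderiv ℝ (eigenEquation nx D s₀) (0, 1, 1) ∘L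
      .inr ℝ ℝ (ℂ × (σ → ℂ))).IsInvertible := by
  have : Nonempty σ := ⟨s₀⟩
  set L := fderiv ℝ (eigenEquation nx D s₀) (0, 1, 1) with hL
  have hfd : HasFDerivAt (eigenEquation nx D s₀) L (0, 1, 1) :=
    ((contDiff_eigenEquation s₀).differentiable (by norm_num) _).hasFDerivAt
  have hval : ∀ ζ ξ, L (0, ζ, ξ) = (ξ s₀, fun s => 𝔼 a, ξ (nx s a) - ξ s - ζ) := fun ζ ξ => by
    have hline : HasDerivAt (fun r : ℝ => ((0 : ℝ), (1 : ℂ) + r * ζ, (1 : σ → ℂ) + (r : ℂ) • ξ))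
        (0, ζ, ξ) 0 := by
      have h0 : HasDerivAt (fun r : ℝ => (r : ℂ)) 1 0 := Complex.ofRealCLM.hasDerivAt
      refine (hasDerivAt_const _ _).prodMk (HasDerivAt.prodMk ?_ ?_)
      · simpa using (h0.mul_const ζ).const_add 1
      · simpa using (h0.smul_const ξ).const_add 1
    have h1 := HasFDerivAt.comp_hasDerivAt (0 : ℝ) (by simpa using hfd) hline
    have h2 : HasDerivAt (eigenEquation nx D s₀ ∘
        fun r : ℝ => ((0 : ℝ), (1 : ℂ) + r * ζ, (1 : σ → ℂ) + (r : ℂ) • ξ))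
        (ξ s₀, fun s => 𝔼 a, ξ (nx s a) - ξ s - ζ) 0 := by
      have h0 : HasDerivAt (fun r : ℝ => (r : ℂ)) 1 0 := Complex.ofRealCLM.hasDerivAt
      refine HasDerivAt.prodMk ?_ (hasDerivAt_pi.2 fun s => ?_)
      · simpa using (h0.mul_const (ξ s₀)).const_add 1
      -- Along this line the equation is a quadratic polynomial in `r`, because `t = 0` removes the
      -- exponentials; its linear coefficient is the derivative.
      · have e : (fun r : ℝ => (eigenEquation nx D s₀ ((0 : ℝ), (1 : ℂ) + r * ζ,
            (1 : σ → ℂ) + (r : ℂ) • ξ)).2 s) =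
            fun r : ℝ => (r : ℂ) * (𝔼 a, ξ (nx s a) - ξ s - ζ) - (r : ℂ) * r * (ζ * ξ s) := by
          ext r
          rw [eigenEquation_snd, twistAvg_apply]
          simp only [Complex.ofReal_zero, zero_mul, Complex.exp_zero, one_mul, Pi.add_apply,
            Pi.one_apply, Pi.smul_apply, smul_eq_mul, Finset.expect_add_distrib, ← Finset.mul_expect,
            Fintype.expect_const]
          ring
        have := (h0.mul_const (𝔼 a, ξ (nx s a) - ξ s - ζ)).sub ((h0.mul h0).mul_const (ζ * ξ s))
        refine (HasDerivAt.congr_of_eventuallyEq ?_ (Eventually.of_forall fun r => congrFun e r))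
        exact this.congr_deriv (by simp)
    exact h1.unique h2
  have hinj : Function.Injective (L ∘L .inr ℝ ℝ (ℂ × (σ → ℂ))) := by
    rw [injective_iff_map_eq_zero]
    rintro ⟨ζ, ξ⟩ h0
    rw [ContinuousLinearMap.comp_apply, ContinuousLinearMap.inr_apply, hval] at h0
    have h1 : ξ s₀ = 0 := congrArg Prod.fst h0
    have h2 : ∀ s, 𝔼 a, ξ (nx s a) - ξ s = ζ := fun s =>
      sub_eq_zero.1 (congrFun (congrArg Prod.snd h0) s)
    obtain ⟨h3, h4⟩ := eq_const_of_expect_sub_eq hr h2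
    exact Prod.ext h3 (funext fun s => (h4 s s₀).trans h1)
  exact ⟨(LinearEquiv.ofInjectiveEndo (L ∘L .inr ℝ ℝ (ℂ × (σ → ℂ))).toLinearMap
    hinj).toContinuousLinearEquiv, by ext x <;> rfl⟩

theorem ContDiffAt.eventually_hasDerivAt {E : Type*} [NormedAddCommGroup E] [NormedSpace ℝ E]
    {f : ℝ → E} (hf : ContDiffAt ℝ 2 f 0) : (∀ᶠ t in 𝓝 (0 : ℝ), HasDerivAt f (deriv f t) t) ∧
      HasDerivAt (deriv f) (deriv (deriv f) 0) 0 := by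
  refine ⟨?_, ?_⟩
  · filter_upwards [hf.eventually (by simp)] with t ht
    exact (ht.differentiableAt (by norm_num)).hasDerivAt
  · have h := hf.fderiv_right (m := 1) (by norm_num)
    have : DifferentiableAt ℝ (deriv f) 0 := by
      have h2 := (h.differentiableAt (by norm_num)).clm_apply (differentiableAt_const (1 : ℝ))
      exact h2
    exact this.hasDerivAt

theorem hasDerivAt_exp_mul_I (x t : ℝ) : HasDerivAt (fun t : ℝ => Complex.exp (t * x * Complex.I))
    (x * Complex.I * Complex.exp (t * x * Complex.I)) t := by
  have h0 : HasDerivAt (fun r : ℝ => (r : ℂ)) 1 t := Complex.ofRealCLM.hasDerivAt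
  refine ((h0.mul_const (x : ℂ)).mul_const Complex.I).cexp.congr_deriv ?_
  ring

/-- The implicit function theorem at the eigenpair `(1, 1)` for `t = 0`; normalizing the eigenvector
at `s₀` makes the solution unique and the derivative invertible. -/
theorem exists_contDiffAt_eigenvalue (hr : ∀ s s' : σ, ∃ w : List A, w.foldl nx s = s') (s₀ : σ) :
    ∃ (κ : ℝ → ℂ) (v : σ → ℝ → ℂ), ContDiffAt ℝ 2 κ 0 ∧ (∀ s, ContDiffAt ℝ 2 (v s) 0) ∧ κ 0 = 1 ∧
      (∀ s, v s 0 = 1) ∧ (∀ᶠ t in 𝓝 (0 : ℝ), v s₀ t = 1) ∧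
      ∀ᶠ t in 𝓝 (0 : ℝ), ∀ s, twistAvg nx D t (fun s => v s t) s = κ t * v s t := by
  have hcd : ContDiffAt ℝ 2 (eigenEquation nx D s₀) (0, 1, 1) :=
    (contDiff_eigenEquation s₀).contDiffAt
  have hinv := isInvertible_fderiv_eigenEquation (D := D) hr s₀
  set ψ := hcd.implicitFunction two_ne_zero hinv with hψ
  have hψ0 : ψ 0 = (1, 1) := hcd.implicitFunction_apply_self two_ne_zero hinv
  have hψc : ContDiffAt ℝ 2 ψ 0 := hcd.contDiffAt_implicitFunction two_ne_zero hinv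
  have hψe : ∀ᶠ t in 𝓝 (0 : ℝ), eigenEquation nx D s₀ (t, ψ t) = eigenEquation nx D s₀ (0, 1, 1) :=
    hcd.eventually_apply_implicitFunction two_ne_zero hinv
  have h0 : eigenEquation nx D s₀ (0, 1, 1) = (1, 0) := by
    refine Prod.ext rfl (funext fun s => ?_)
    rw [eigenEquation_snd, twistAvg_apply]
    simp
  refine ⟨fun t => (ψ t).1, fun s t => (ψ t).2 s, hψc.fst, fun s => contDiffAt_pi.1 hψc.snd s,
    by simp [hψ0], fun s => by simp [hψ0], ?_, ?_⟩
  · filter_upwards [hψe] with t ht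
    rw [h0] at ht
    exact congrArg Prod.fst ht
  · filter_upwards [hψe] with t ht s
    rw [h0] at ht
    have := congrFun (congrArg Prod.snd ht) s
    rw [← Prod.mk.eta (p := ψ t), eigenEquation_snd] at this
    exact sub_eq_zero.1 this

/-- The first derivative of the eigenvalue equation at zero reads `P v' - v' = κ'`, since `D` has
mean zero. So `κ' = 0` and `v'` is constant, and it is zero by the normalization at `s₀`. With `v' =
0` the second derivative says that `P F - F = κ'' + b` for `F = v'' + H₂`, hence `κ'' = -b`. -/
theorem deriv_twistAvg_eigenvalue (hr : ∀ s s' : σ, ∃ w : List A, w.foldl nx s = s')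
    {b : ℝ} {H₂ : σ → ℝ} (hD : ∀ s, 𝔼 a, D s a = 0)
    (hD₂ : ∀ s, 𝔼 a, D s a ^ 2 = b + H₂ s - 𝔼 a, H₂ (nx s a)) {s₀ : σ} {κ : ℝ → ℂ} {v : σ → ℝ → ℂ}
    (hκc : ContDiffAt ℝ 2 κ 0) (hvc : ∀ s, ContDiffAt ℝ 2 (v s) 0) (hκ0 : κ 0 = 1)
    (hv0 : ∀ s, v s 0 = 1) (hvs₀ : ∀ᶠ t in 𝓝 (0 : ℝ), v s₀ t = 1)
    (heq : ∀ᶠ t in 𝓝 (0 : ℝ), ∀ s, twistAvg nx D t (fun s => v s t) s = κ t * v s t) :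
    deriv κ 0 = 0 ∧ deriv (deriv κ) 0 = -b := by
  have : Nonempty σ := ⟨s₀⟩
  obtain ⟨hκd, hκd₂⟩ := hκc.eventually_hasDerivAt
  have hvd := fun s => (hvc s).eventually_hasDerivAt
  have hderiv : ∀ s, ∀ᶠ t : ℝ in 𝓝 0,
      (Fintype.card A : ℂ)⁻¹ * ∑ a, (D s a * Complex.I * Complex.exp (t * D s a * Complex.I) *
        v (nx s a) t + Complex.exp (t * D s a * Complex.I) * deriv (v (nx s a)) t) =
      deriv κ t * v s t + κ t * deriv (v s) t := fun s => by
    filter_upwards [hκd, eventually_all.2 fun s => (hvd s).1, heq.eventually_nhds] with t h1 h2 h3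
    have e : (fun t : ℝ => (Fintype.card A : ℂ)⁻¹ *
        ∑ a, Complex.exp (t * D s a * Complex.I) * v (nx s a) t) =ᶠ[𝓝 t] fun t => κ t * v s t := by
      filter_upwards [h3] with t ht
      rw [← ht s, twistAvg_apply, Fintype.expect_eq_sum_div_card, div_eq_inv_mul]
    have f1 := (HasDerivAt.fun_sum (u := Finset.univ) fun a _ =>
      (hasDerivAt_exp_mul_I (D s a) t).mul (h2 (nx s a))).const_mul (Fintype.card A : ℂ)⁻¹
    exact (f1.congr_of_eventuallyEq e.symm).unique (h1.mul (h2 s))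
  have hfirst : ∀ s, 𝔼 a, deriv (v (nx s a)) 0 - deriv (v s) 0 = deriv κ 0 := fun s => by
    have := (hderiv s).self_of_nhds
    simp only [Complex.ofReal_zero, zero_mul, Complex.exp_zero, mul_one, hv0, one_mul, hκ0,
      Finset.sum_add_distrib, ← Finset.sum_mul] at this
    have h2 := hD s
    rw [Fintype.expect_eq_sum_div_card, div_eq_zero_iff,
      or_iff_left (by exact_mod_cast Fintype.card_ne_zero)] at h2
    have h3 : ∑ a, (D s a : ℂ) = 0 := by exact_mod_cast h2
    rw [h3, zero_mul, zero_add, ← div_eq_inv_mul, ← Fintype.expect_eq_sum_div_card] at this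
    rw [this]; ring
  obtain ⟨hκ1, hconst⟩ := eq_const_of_expect_sub_eq hr (H := fun s => deriv (v s) 0) hfirst
  have hv1 : ∀ s, deriv (v s) 0 = 0 := fun s => by
    rw [hconst s s₀, EventuallyEq.deriv_eq (f := fun _ => (1 : ℂ)) hvs₀, deriv_const]
  have hsecond : ∀ s, 𝔼 a, ((H₂ (nx s a) : ℂ) + deriv (deriv (v (nx s a))) 0) -
      ((H₂ s : ℂ) + deriv (deriv (v s)) 0) = deriv (deriv κ) 0 + b := fun s => by
    have f1 := (HasDerivAt.fun_sum (u := Finset.univ) fun a _ =>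
      (((hasDerivAt_exp_mul_I (D s a) 0).const_mul (D s a * Complex.I : ℂ)).mul
        (hvd (nx s a)).1.self_of_nhds).add ((hasDerivAt_exp_mul_I (D s a) 0).mul
          (hvd (nx s a)).2)).const_mul (Fintype.card A : ℂ)⁻¹
    have f2 := (hκd₂.mul (hvd s).1.self_of_nhds).add (hκd.self_of_nhds.mul (hvd s).2)
    have := (f1.congr_of_eventuallyEq (EventuallyEq.symm (hderiv s))).unique f2
    simp only [Complex.ofReal_zero, zero_mul, Complex.exp_zero, mul_one, hv0, one_mul, hκ0, hκ1,
      hv1, mul_zero, add_zero, zero_add, Finset.sum_add_distrib] at this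
    have h2 : ((𝔼 a, D s a ^ 2 : ℝ) : ℂ) = -((Fintype.card A : ℂ)⁻¹ *
        ∑ a, (D s a * Complex.I) * (D s a * Complex.I) : ℂ) := by
      rw [Fintype.expect_eq_sum_div_card, div_eq_inv_mul, ← mul_neg, ← Finset.sum_neg_distrib]
      push_cast
      congr 1
      refine Finset.sum_congr rfl fun a _ => ?_
      linear_combination (D s a : ℂ) ^ 2 * Complex.I_sq
    rw [hD₂ s] at h2
    have h4 : 𝔼 a, deriv (deriv (v (nx s a))) 0 =
        (Fintype.card A : ℂ)⁻¹ * ∑ a, deriv (deriv (v (nx s a))) 0 := by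
      rw [Fintype.expect_eq_sum_div_card, div_eq_inv_mul]
    push_cast at h2
    rw [Finset.expect_add_distrib, h4]
    rw [mul_add] at this
    linear_combination this - h2
  exact ⟨hκ1, eq_neg_of_add_eq_zero_left (eq_const_of_expect_sub_eq hr
    (H := fun s => (H₂ s : ℂ) + deriv (deriv (v s)) 0) hsecond).1⟩

/-- The dominant eigenvalue of the twisted averages of a centred irreducible chain. -/
theorem exists_twistAvg_eigenvalue (hr : ∀ s s' : σ, ∃ w : List A, w.foldl nx s = s')
    [Nonempty σ] {b : ℝ} {H₂ : σ → ℝ} (hD : ∀ s, 𝔼 a, D s a = 0)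
    (hD₂ : ∀ s, 𝔼 a, D s a ^ 2 = b + H₂ s - 𝔼 a, H₂ (nx s a)) :
    ∃ (κ : ℝ → ℂ) (v : ℝ → σ → ℂ), ContDiffAt ℝ 2 κ 0 ∧ κ 0 = 1 ∧ deriv κ 0 = 0 ∧
      deriv (deriv κ) 0 = -b ∧
      ∀ᶠ t in 𝓝 (0 : ℝ), v t ≠ 0 ∧ ∀ s, twistAvg nx D t (v t) s = κ t * v t s := by
  obtain ⟨s₀⟩ := ‹Nonempty σ›
  obtain ⟨κ, v, hκc, hvc, hκ0, hv0, hvs₀, heq⟩ := exists_contDiffAt_eigenvalue (D := D) hr s₀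
  obtain ⟨h1, h2⟩ := deriv_twistAvg_eigenvalue hr hD hD₂ hκc hvc hκ0 hv0 hvs₀ heq
  refine ⟨κ, fun t s => v s t, hκc, hκ0, h1, h2, ?_⟩
  filter_upwards [heq, hvs₀] with t h3 h4
  exact ⟨fun h => by simpa [h4] using congrFun h s₀, h3⟩

end EigenvalueBranch

/-! ### Identification of the constants with derivatives of the eigenvalues -/

namespace Transducer

open scoped BigOperators

variable {q d : ℕ} {S : Type*} {T : Transducer q d S} [NeZero q] [Fintype S]

/-- At a minimum of `H₂` on the component, `H₂ - P H₂` is at most zero, so `b C` is at least the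
mean square there. -/
theorem IsFinalComponent.nonneg_of_poisson {C : Finset S} (hC : T.IsFinalComponent C)
    {b : Finset S → ℝ} {D : S → (Fin d → Fin q) → ℝ} {H₂ : S → ℝ} (hH₂ : ∀ s, 𝔼 ε, D s ε ^ 2 =
      T.harmonicExt b s + H₂ s - 𝔼 ε, H₂ (T.next s ε)) : 0 ≤ b C := by
  obtain ⟨s, hs, hmin⟩ := C.exists_min_image H₂ hC.nonempty
  have h1 := Finset.le_expect (s := Finset.univ) Finset.univ_nonempty
    (f := fun ε => H₂ (T.next s ε)) (a := H₂ s) (fun ε _ => hmin _ (hC.2 s hs ε))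
  have h2 : 0 ≤ 𝔼 ε, D s ε ^ 2 := Finset.expect_nonneg fun ε _ => sq_nonneg _
  rw [hH₂ s, harmonicExt_of_mem (mem_finalComponents.2 hC) _ hs] at h2
  linarith

/-- The dominant eigenvalue of a final component, with its first two derivatives. -/
theorem IsFinalComponent.exists_eigenvalueBranch [DecidableEq S] {C : Finset S}
    (hC : T.IsFinalComponent C) {a b : Finset S → ℝ} {H H₂ : S → ℝ}
    (hH : ∀ s, 𝔼 ε, T.out s ε = T.harmonicExt a s + H s - 𝔼 ε, H (T.next s ε))
    (hH₂ : ∀ s, 𝔼 ε, T.centredOut (T.harmonicExt a) H s ε ^ 2 =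
      T.harmonicExt b s + H₂ s - 𝔼 ε, H₂ (T.next s ε)) :
    ∃ μ : ℝ → ℂ, T.IsEigenvalueBranch C μ ∧
      (a C : ℂ) = -Complex.I * ((q : ℂ) ^ d)⁻¹ * deriv μ 0 ∧
      (b C : ℂ) = ((deriv μ 0) ^ 2 - (q : ℂ) ^ d * iteratedDeriv 2 μ 0) / (q : ℂ) ^ (2 * d) := by
  set D := T.centredOut (T.harmonicExt a) H with hD
  have hC' := mem_finalComponents.2 hC
  set nx : {s // s ∈ C} → (Fin d → Fin q) → {s // s ∈ C} :=
    fun s ε => ⟨T.next s ε, hC.2 s s.2 ε⟩ with hnx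
  have hfold : ∀ (w : List (Fin d → Fin q)) (s : {s // s ∈ C}),
      ((w.foldl nx s : {s // s ∈ C}) : S) = w.foldl T.next s := fun w => by
    induction w with
    | nil => intro s; rfl
    | cons ε w ih => intro s; rw [List.foldl_cons, List.foldl_cons, ih]
  have : Nonempty {s // s ∈ C} := hC.nonempty.to_subtype
  obtain ⟨κ, v, hκc, hκ0, hκ1, hκ2, hev⟩ := exists_twistAvg_eigenvalue (nx := nx)
    (D := fun s ε => D s ε) (b := b C) (H₂ := fun s => H₂ s)
    (fun s s' => by
      obtain ⟨w, hw⟩ := hC.reach s (by simp) s' (by simp)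
      exact ⟨w, Subtype.ext (by rw [hfold]; exact hw)⟩)
    (fun s => expect_centredOut hH s) (fun s => by rw [hH₂ s, harmonicExt_of_mem hC' _ s.2])
  set Q : ℂ := (q : ℂ) ^ d with hQ
  have hQ0 : Q ≠ 0 := pow_ne_zero_complex
  -- This undoes the centring: the drift contributes a phase, and `q^d` converts averages over the
  -- letters into sums.
  set μ : ℝ → ℂ := fun t => Q * (Complex.exp (t * a C * Complex.I) * κ t) with hμ
  obtain ⟨hκd, hκd₂⟩ := hκc.eventually_hasDerivAt
  have hμd : ∀ᶠ t : ℝ in 𝓝 0, HasDerivAt μ (Q * (a C * Complex.I * Complex.exp (t * a C * Complex.I) *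
      κ t + Complex.exp (t * a C * Complex.I) * deriv κ t)) t := by
    filter_upwards [hκd] with t ht
    exact ((hasDerivAt_exp_mul_I (a C) t).mul ht).const_mul Q
  have hμ1 : deriv μ 0 = Q * (a C * Complex.I) := by
    rw [hμd.self_of_nhds.deriv]
    simp [hκ0, hκ1]
  have hμ2 : iteratedDeriv 2 μ 0 = Q * (-(a C : ℂ) ^ 2 - b C) := by
    rw [iteratedDeriv_succ, iteratedDeriv_one]
    have e : deriv μ =ᶠ[𝓝 0] fun t : ℝ => Q * (a C * Complex.I *
        Complex.exp (t * a C * Complex.I) * κ t + Complex.exp (t * a C * Complex.I) * deriv κ t) := by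
      filter_upwards [hμd] with t ht using ht.deriv
    have e₂ := ((((hasDerivAt_exp_mul_I (a C) 0).const_mul (a C * Complex.I : ℂ)).mul
      hκd.self_of_nhds).add ((hasDerivAt_exp_mul_I (a C) 0).mul hκd₂)).const_mul Q
    rw [(e₂.congr_of_eventuallyEq e).deriv]
    simp only [Complex.ofReal_zero, zero_mul, Complex.exp_zero, mul_one, one_mul, hκ0, hκ1, hκ2,
      mul_zero, add_zero, zero_add]
    linear_combination Q * (a C : ℂ) ^ 2 * Complex.I_sq
  refine ⟨μ, ⟨?_, by simp [hμ, hκ0, hQ], ?_⟩, ?_, ?_⟩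
  · refine contDiffAt_const.mul (ContDiffAt.mul (ContDiffAt.cexp ?_) hκc)
    have h1 : ContDiffAt ℝ 2 (fun t : ℝ => (t : ℂ)) 0 := Complex.ofRealCLM.contDiff.contDiffAt
    exact (h1.mul contDiffAt_const).mul contDiffAt_const
  · filter_upwards [hev] with t ht
    obtain ⟨hv0, hv⟩ := ht
    -- Outputs and centred outputs differ by the drift and a coboundary of `H`; multiplication by
    -- `exp (i t H)` conjugates the coboundary away.
    set x : {s // s ∈ C} → ℂ := fun s => Complex.exp (t * H s * Complex.I) * v t s with hx
    have hx0 : x ≠ 0 := fun h => hv0 (funext fun s => by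
      simpa [hx] using congrFun h s)
    rw [← Matrix.spectrum_toLin', ← Module.End.hasEigenvalue_iff_mem_spectrum]
    refine Module.End.hasEigenvalue_of_hasEigenvector (x := x) ⟨?_, hx0⟩
    rw [Module.End.mem_eigenspace_iff, Matrix.toLin'_apply]
    ext s
    have h1 := hv s
    have hcard : ((Fintype.card (Fin d → Fin q) : ℕ) : ℂ) = Q := by simp [hQ]
    rw [twistAvg_apply, Fintype.expect_eq_sum_div_card, hcard, div_eq_iff hQ0] at h1
    have h2 : ((T.transMatrix t).submatrix (Subtype.val : {s // s ∈ C} → S) Subtype.val).mulVec x s =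
        ∑ ε, Complex.exp (Complex.I * t * T.out s ε) * x (nx s ε) := by
      simp only [Matrix.mulVec, dotProduct, Matrix.submatrix_apply, transMatrix, Matrix.sum_apply,
        letterMatrix, Matrix.of_apply, Finset.sum_mul]
      rw [Finset.sum_comm]
      refine Finset.sum_congr rfl fun ε _ => ?_
      rw [Finset.sum_eq_single (nx s ε)]
      · simp [hnx]
      · intro s' _ hs'
        rw [if_neg (fun h => hs' (Subtype.ext h.symm)), zero_mul]
      · simp
    rw [h2, Pi.smul_apply, smul_eq_mul]
    have h3 : ∀ ε, Complex.exp (Complex.I * t * T.out s ε) * x (nx s ε) =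
        Complex.exp (t * a C * Complex.I) * Complex.exp (t * H s * Complex.I) *
          (Complex.exp (t * D s ε * Complex.I) * v t (nx s ε)) := fun ε => by
      rw [hx, out_eq_centredOut hC (a := a) (H := H) s (by simp) ε, ← mul_assoc, ← mul_assoc,
        ← Complex.exp_add, ← Complex.exp_add, ← Complex.exp_add]
      congr 2
      simp only [hnx]
      push_cast
      ring
    simp only [h3]
    rw [← Finset.mul_sum, h1]
    simp only [hx, hμ]
    ring
  · rw [hμ1]
    field_simp
    linear_combination (a C : ℂ) * Complex.I_sq
  · rw [hμ1, hμ2, mul_comm 2 d, pow_mul, ← hQ]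
    field_simp
    linear_combination -(a C : ℂ) ^ 2 * Complex.I_sq

end Transducer

/-! ### Convergence in distribution -/

namespace Transducer

open scoped BigOperators

theorem tendsto_logb_natCast {q : ℕ} (hq : 2 ≤ q) :
    Tendsto (fun N : ℕ => Real.logb q N) atTop atTop :=
  (Real.tendsto_logb_atTop (by exact_mod_cast (by omega : 1 < q))).comp tendsto_natCast_atTop_atTop

theorem isBigO_rpow_neg_mul_log_pow {ξ : ℝ} (hξ : 0 < ξ) (β : ℕ) :
    (fun N : ℕ => (N : ℝ) ^ (-ξ) * Real.log N ^ β) =O[atTop] fun _ => (1 : ℝ) := by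
  have h := ((isLittleO_log_rpow_rpow_atTop (β : ℝ) hξ).isBigO.comp_tendsto
    tendsto_natCast_atTop_atTop)
  refine ((Asymptotics.isBigO_refl (fun N : ℕ => (N : ℝ) ^ (-ξ)) atTop).mul h).congr' ?_ ?_
  · exact Eventually.of_forall fun N => by simp
  · filter_upwards [eventually_gt_atTop 0] with N hN
    have : (0 : ℝ) < N := by exact_mod_cast hN
    simp only [Function.comp]
    rw [← Real.rpow_add this, neg_add_cancel, Real.rpow_zero]

theorem isBigO_one_of_periodic {q : ℕ} {f g : ℕ → ℝ} {Ψ : ℝ → ℝ} (hc : Continuous Ψ) {p : ℝ}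
    (hp0 : p ≠ 0) (hp : Function.Periodic Ψ p) {ξ : ℝ} (hξ : 0 < ξ) {β : ℕ}
    (h : (fun N => f N - (g N + Ψ (Real.logb q N))) =O[atTop]
      fun N : ℕ => (N : ℝ) ^ (-ξ) * Real.log N ^ β) :
    (fun N => f N - g N) =O[atTop] fun _ => (1 : ℝ) := by
  obtain ⟨M, hM⟩ := exists_abs_le_of_periodic hc hp0 hp
  have h2 : (fun N : ℕ => Ψ (Real.logb q N)) =O[atTop] fun _ => (1 : ℝ) :=
    Asymptotics.IsBigO.of_bound M (Eventually.of_forall fun N => by simpa using hM _)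
  refine ((h.trans (isBigO_rpow_neg_mul_log_pow hξ β)).add h2).congr_left fun N => by ring

theorem exists_bound_of_isBigO_one {f : ℕ → ℝ} (h : f =O[atTop] fun _ => (1 : ℝ)) :
    ∃ M, 0 < M ∧ ∀ N, |f N| ≤ M := by
  obtain ⟨M, hM, hb⟩ := Asymptotics.bound_of_isBigO_nat_atTop h
  exact ⟨M, hM, fun N => by simpa using hb (x := N) one_ne_zero⟩

/-- Lévy's continuity theorem. The index is shifted by one because the distribution on the box of
side `0` need not be a probability measure. -/
theorem convergesInDistribution_of_tendsto_charFun {d : ℕ} {X : ℕ → (Fin d → ℕ) → ℝ} {ν : Measure ℝ}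
    [IsProbabilityMeasure ν] (h : ∀ t : ℝ, Tendsto (fun N : ℕ => ((N : ℂ) ^ d)⁻¹ *
      ∑ n ∈ box d N, Complex.exp (t * X N n * Complex.I)) atTop (𝓝 (charFun ν t))) :
    ConvergesInDistribution X ν := by
  have hm : ∀ N, Measurable (X N) := fun N => measurable_of_countable _
  have hP : ∀ N : ℕ, IsProbabilityMeasure ((unifBox d (N + 1)).map (X (N + 1))) := fun N => by
    have := isProbabilityMeasure_unifBox (d := d) N.succ_pos
    exact Measure.isProbabilityMeasure_map (hm _).aemeasurable
  let P : ℕ → ProbabilityMeasure ℝ := fun N => ⟨(unifBox d (N + 1)).map (X (N + 1)), hP N⟩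
  let P₀ : ProbabilityMeasure ℝ := ⟨ν, ‹_›⟩
  have hlim : Tendsto P atTop (𝓝 P₀) := by
    rw [ProbabilityMeasure.tendsto_iff_tendsto_charFun]
    intro t
    refine ((tendsto_add_atTop_iff_nat 1).2 (h t)).congr fun N => ?_
    change _ = charFun ((unifBox d (N + 1)).map (X (N + 1))) t
    rw [charFun_apply_real, integral_map (hm _).aemeasurable (by fun_prop), integral_unifBox,
      Complex.real_smul]
    push_cast
    rfl
  rw [ProbabilityMeasure.tendsto_iff_forall_integral_tendsto] at hlim
  intro f
  rw [← tendsto_add_atTop_iff_nat 1]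
  refine (hlim f).congr fun N => ?_
  exact integral_map (hm _).aemeasurable f.continuous.aestronglyMeasurable

theorem charFun_centredMixture {ι : Type*} (J : Finset ι) {lam b : ι → ℝ} (hl : ∀ j ∈ J, 0 ≤ lam j)
    (hb : ∀ j ∈ J, 0 ≤ b j) (t : ℝ) : charFun (centredMixture J lam b) t =
      ∑ j ∈ J, (lam j : ℂ) * Complex.exp (-(b j * t ^ 2 / 2 : ℝ)) := by
  rw [charFun_apply_real, centredMixture, integral_finsetSum_measure]
  · refine Finset.sum_congr rfl fun j hj => ?_
    rw [integral_smul_measure, ← charFun_apply_real, charFun_gaussianReal,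
      ENNReal.toReal_ofReal (hl j hj), Real.coe_toNNReal _ (hb j hj), Complex.real_smul]
    congr 2
    push_cast
    ring
  · intro j _
    refine Integrable.smul_measure ?_ ENNReal.ofReal_ne_top
    refine (integrable_const (1 : ℝ)).mono' (by fun_prop) (Eventually.of_forall fun x => ?_)
    exact (norm_exp_mul_mul_I t x).le

theorem isProbabilityMeasure_centredMixture {ι : Type*} (J : Finset ι) {lam b : ι → ℝ}
    (hl : ∀ j ∈ J, 0 ≤ lam j) (h1 : ∑ j ∈ J, lam j = 1) :
    IsProbabilityMeasure (centredMixture J lam b) := ⟨by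
  simp only [centredMixture, Measure.finsetSum_apply, Measure.smul_apply, measure_univ, smul_eq_mul,
    mul_one]
  rw [← ENNReal.ofReal_sum_of_nonneg hl, h1, ENNReal.ofReal_one]⟩

variable {q d : ℕ} {S : Type*} {T : Transducer q d S} [NeZero q] [Fintype S]

/-- With equal drifts, the centred and rescaled values have asymptotically the characteristic
function of a mixture of centred normal distributions. -/
theorem tendsto_charFun_centred (hq : 2 ≤ q) (hd : 1 ≤ d) {a b : Finset S → ℝ} {H H₂ : S → ℝ}
    (hb : ∀ C ∈ T.finalComponents, 0 ≤ b C)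
    (hH : ∀ s, 𝔼 ε, T.out s ε = T.harmonicExt a s + H s - 𝔼 ε, H (T.next s ε))
    (hH₂ : ∀ s, 𝔼 ε, T.centredOut (T.harmonicExt a) H s ε ^ 2 =
      T.harmonicExt b s + H₂ s - 𝔼 ε, H₂ (T.next s ε)) {α M : ℝ}
    (ha : ∀ C ∈ T.finalComponents, a C = α) (hM : ∀ N, |T.mean N - α * Real.logb q N| ≤ M)
    {r : ℕ → ℝ} {ρ : ℝ} (hρ : 0 < ρ)
    (hr : Tendsto (fun N : ℕ => r N / √(Real.logb q N)) atTop (𝓝 ρ)) (t : ℝ) :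
    Tendsto (fun N : ℕ => ((N : ℂ) ^ d)⁻¹ * ∑ n ∈ box d N,
      Complex.exp (t * ((T.value n - T.mean N) / r N : ℝ) * Complex.I)) atTop
      (𝓝 (∑ C ∈ T.finalComponents, (T.absorption C T.init : ℂ) *
        Complex.exp (-(b C * (t / ρ) ^ 2 / 2 : ℝ)))) := by
  -- The frequency in use is `t / r N`. As `r N / √(log_q N)` only tends to `ρ`, the factor `2`
  -- leaves room.
  obtain ⟨B, hB⟩ := exists_charFun_value_bound hq hd hb hH hH₂ (Θ := 2 * |t| / ρ) (by positivity)
  set l : ℕ → ℝ := fun N => Real.logb q N with hl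
  have hlt : Tendsto l atTop atTop := tendsto_logb_natCast hq
  have hsl : Tendsto (fun N => √(l N)) atTop atTop := Real.tendsto_sqrt_atTop.comp hlt
  set τ : ℕ → ℝ := fun N => t / r N with hτ
  have hτl : Tendsto (fun N => τ N * √(l N)) atTop (𝓝 (t / ρ)) := by
    refine (hr.inv₀ hρ.ne' |>.const_mul t).congr fun N => ?_
    rw [hτ, inv_div]; ring
  have hτ0 : Tendsto τ atTop (𝓝 0) := by
    have := hτl.mul hsl.inv_tendsto_atTop
    rw [mul_zero] at this
    refine this.congr' ?_
    filter_upwards [hsl.eventually_gt_atTop 0] with N hN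
    simp only [Pi.inv_apply]
    field_simp
  have hτl2 : Tendsto (fun N => l N * τ N ^ 2) atTop (𝓝 ((t / ρ) ^ 2)) := by
    refine (hτl.pow 2).congr' ?_
    filter_upwards [hlt.eventually_ge_atTop 0] with N hN
    rw [mul_pow, Real.sq_sqrt hN, mul_comm]
  have hτb : ∀ᶠ N in atTop, |τ N| ≤ 2 * |t| / ρ / √(l N) := by
    have h1 : ∀ᶠ N in atTop, ρ / 2 < r N / √(l N) := hr.eventually_const_lt (by linarith)
    filter_upwards [h1, hsl.eventually_gt_atTop 0] with N h1 h2
    rw [lt_div_iff₀ h2] at h1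
    have h3 : 0 < r N := lt_of_le_of_lt (by positivity) h1
    simp only [hτ]
    rw [abs_div, abs_of_pos h3, div_div, div_le_div_iff₀ h3 (by positivity)]
    nlinarith [abs_nonneg t]
  -- The mean differs from `α log_q N` by a bounded amount, which is invisible at frequencies
  -- tending to zero.
  have hmt : Tendsto (fun N => τ N * (α * l N - T.mean N)) atTop (𝓝 0) := by
    refine squeeze_zero_norm (a := fun N => |τ N| * M) (fun N => ?_) ?_
    · rw [norm_mul, Real.norm_eq_abs, Real.norm_eq_abs, abs_sub_comm]
      gcongr
      exact hM N
    · simpa using hτ0.abs.mul_const M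
  have hmain : Tendsto (fun N => ∑ C ∈ T.finalComponents, (T.absorption C T.init : ℂ) *
      (Complex.exp ((τ N * (α * l N - T.mean N) : ℝ) * Complex.I) *
        Complex.exp (-(b C * (l N * τ N ^ 2) / 2 : ℝ)))) atTop
      (𝓝 (∑ C ∈ T.finalComponents, (T.absorption C T.init : ℂ) *
        Complex.exp (-(b C * (t / ρ) ^ 2 / 2 : ℝ)))) := by
    refine tendsto_finsetSum _ fun C _ => Tendsto.const_mul _ ?_
    have c1 : Continuous fun x : ℝ => Complex.exp (x * Complex.I) := by fun_prop
    have c2 : Continuous fun x : ℝ => Complex.exp (-(b C * x / 2 : ℝ)) := by fun_prop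
    have := (c1.tendsto 0).comp hmt |>.mul ((c2.tendsto _).comp hτl2)
    simpa using this
  have hdiff : Tendsto (fun N : ℕ => ((N : ℂ) ^ d)⁻¹ * ∑ n ∈ box d N,
      Complex.exp (t * ((T.value n - T.mean N) / r N : ℝ) * Complex.I) -
      ∑ C ∈ T.finalComponents, (T.absorption C T.init : ℂ) *
      (Complex.exp ((τ N * (α * l N - T.mean N) : ℝ) * Complex.I) *
        Complex.exp (-(b C * (l N * τ N ^ 2) / 2 : ℝ)))) atTop (𝓝 0) := by
    refine squeeze_zero_norm' (a := fun N => B / √(l N)) ?_ ?_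
    · filter_upwards [hτb, eventually_ge_atTop q] with N h1 h2
      refine le_trans (le_of_eq ?_) (hB N h2 (τ N) h1)
      set E := Complex.exp (τ N * (-T.mean N : ℝ) * Complex.I) with hE
      have m1 : ∑ n ∈ box d N, Complex.exp (t * ((T.value n - T.mean N) / r N : ℝ) * Complex.I) =
          E * ∑ n ∈ box d N, Complex.exp (τ N * T.valueFrom T.init n * Complex.I) := by
        rw [Finset.mul_sum]
        refine Finset.sum_congr rfl fun n _ => ?_
        rw [hE, ← Complex.exp_add, value_eq_valueFrom]
        congr 1
        simp only [hτ]
        push_cast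
        ring
      have m2 : ∑ C ∈ T.finalComponents, (T.absorption C T.init : ℂ) *
          (Complex.exp ((τ N * (α * l N - T.mean N) : ℝ) * Complex.I) *
            Complex.exp (-(b C * (l N * τ N ^ 2) / 2 : ℝ))) =
          E * ∑ C ∈ T.finalComponents, (T.absorption C T.init : ℂ) *
            (Complex.exp (τ N * (a C * Real.logb q N : ℝ) * Complex.I) *
              Complex.exp (-(b C * Real.logb q N * τ N ^ 2 / 2 : ℝ))) := by
        rw [Finset.mul_sum]
        refine Finset.sum_congr rfl fun C hC => ?_
        rw [ha C hC, mul_left_comm E, hE]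
        simp only [← Complex.exp_add, hl]
        congr 2
        push_cast
        ring
      rw [m1, m2, mul_left_comm, ← mul_sub, norm_mul, hE, norm_exp_mul_mul_I, one_mul]
    · exact (tendsto_const_nhds (x := B)).div_atTop hsl
  simpa using hdiff.add hmain

end Transducer

/-! ### Rates of convergence after centring, and the order of the variance -/

namespace Transducer

open scoped BigOperators

theorem tendsto_sqrt_div_sqrt {f l : ℕ → ℝ} {v : ℝ} (hl : Tendsto l atTop atTop)
    (h : (fun N => f N - v * l N) =O[atTop] fun _ => (1 : ℝ)) :
    Tendsto (fun N => √(f N) / √(l N)) atTop (𝓝 √v) := by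
  obtain ⟨M, hM, hb⟩ := exists_bound_of_isBigO_one h
  have h1 : Tendsto (fun N => (f N - v * l N) / l N) atTop (𝓝 0) := by
    refine squeeze_zero_norm' (a := fun N => M / l N) ?_ (tendsto_const_nhds.div_atTop hl)
    filter_upwards [hl.eventually_gt_atTop 0] with N hN
    rw [norm_div, Real.norm_eq_abs, Real.norm_of_nonneg hN.le]
    gcongr
    exact hb N
  have h2 : Tendsto (fun N => f N / l N) atTop (𝓝 v) := by
    have := h1.add_const v
    rw [zero_add] at this
    refine this.congr' ?_
    filter_upwards [hl.eventually_gt_atTop 0] with N hN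
    field_simp
    ring
  refine ((Real.continuous_sqrt.tendsto v).comp h2).congr' ?_
  filter_upwards [hl.eventually_gt_atTop 0] with N hN
  exact Real.sqrt_div' _ hN.le

variable {q d : ℕ} {S : Type*} {T : Transducer q d S} [NeZero q] [Fintype S]

/-- The distribution function of the shifted and rescaled values. -/
theorem exists_cdf_shifted_bound (hq : 2 ≤ q) (hd : 1 ≤ d) {a b : Finset S → ℝ} {H H₂ : S → ℝ}
    (hb : ∀ C ∈ T.finalComponents, 0 < b C)
    (hH : ∀ s, 𝔼 ε, T.out s ε = T.harmonicExt a s + H s - 𝔼 ε, H (T.next s ε))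
    (hH₂ : ∀ s, 𝔼 ε, T.centredOut (T.harmonicExt a) H s ε ^ 2 =
      T.harmonicExt b s + H₂ s - 𝔼 ε, H₂ (T.next s ε)) :
    ∃ K : ℝ, 0 ≤ K ∧ ∀ N : ℕ, 2 ≤ N → ∀ x c : ℝ,
      |(unifBox d N).real {n | (T.value n - c) / √(Real.logb q N) ≤ x} -
        ∑ C ∈ T.finalComponents, T.absorption C T.init *
          normalCDF ((a C * Real.logb q N - c) / √(Real.logb q N)) (b C) x| ≤ K / √(Real.log N) := by
  obtain ⟨B, hB0, hB⟩ := exists_cdf_value_bound hq hd hb hH hH₂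
  have hq1 : (1 : ℝ) < q := by exact_mod_cast (by omega : 1 < q)
  have hlq : 0 < Real.log q := Real.log_pos hq1
  refine ⟨(B + 2) * √(Real.log q), by positivity, fun N hN x c => ?_⟩
  have hN1 : (1 : ℝ) < N := by exact_mod_cast (by omega : 1 < N)
  have hlN : 0 < Real.log N := Real.log_pos hN1
  have hsN : 0 < √(Real.log N) := Real.sqrt_pos.2 hlN
  have hl0 : 0 < Real.logb q N := Real.logb_pos hq1 hN1
  have hsl : 0 < √(Real.logb q N) := Real.sqrt_pos.2 hl0
  -- The previous bound starts at `N = q`; for `2 ≤ N < q` both quantities lie in `[0, 1]`, and the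
  -- constant is large enough.
  rcases lt_or_ge N q with hNq | hNq
  · have := isProbabilityMeasure_unifBox (d := d) (N := N) (by omega)
    have h1 : 0 ≤ ∑ C ∈ T.finalComponents, T.absorption C T.init *
        normalCDF ((a C * Real.logb q N - c) / √(Real.logb q N)) (b C) x :=
      Finset.sum_nonneg fun C hC => mul_nonneg (absorption_nonneg (mem_finalComponents.1 hC) _)
        (normalCDF_nonneg _ _ _)
    have h2 : ∑ C ∈ T.finalComponents, T.absorption C T.init *
        normalCDF ((a C * Real.logb q N - c) / √(Real.logb q N)) (b C) x ≤ 1 := by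
      rw [← T.sum_absorption T.init]
      exact Finset.sum_le_sum fun C hC => mul_le_of_le_one_right
        (absorption_nonneg (mem_finalComponents.1 hC) _) (normalCDF_le_one _ _ _)
    have h3 := measureReal_nonneg (μ := unifBox d N)
      (s := {n | (T.value n - c) / √(Real.logb q N) ≤ x})
    have h4 := measureReal_le_one (μ := unifBox d N)
      (s := {n | (T.value n - c) / √(Real.logb q N) ≤ x})
    calc _ ≤ (1 : ℝ) := by
          rw [abs_le]
          constructor <;> linarith
      _ ≤ (B + 2) * (√(Real.log q) / √(Real.log N)) := by
          have : 1 ≤ √(Real.log q) / √(Real.log N) := by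
            rw [one_le_div hsN]
            exact Real.sqrt_le_sqrt (Real.log_le_log (by linarith) (by exact_mod_cast hNq.le))
          nlinarith
      _ = _ := by ring
  · have h1 := hB N hNq (x * √(Real.logb q N) + c)
    have e1 : {n : Fin d → ℕ | (T.value n - c) / √(Real.logb q N) ≤ x} =
        {n | T.value n ≤ x * √(Real.logb q N) + c} := by
      ext n
      simp only [Set.mem_ofPred_eq]
      rw [div_le_iff₀ hsl, sub_le_iff_le_add]
    have e2 : ∀ C, normalCDF 0 (b C * Real.logb q N)
        (x * √(Real.logb q N) + c - a C * Real.logb q N) =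
        normalCDF ((a C * Real.logb q N - c) / √(Real.logb q N)) (b C) x := fun C => by
      rw [← normalCDF_mul hsl x, Real.sq_sqrt hl0.le, mul_div_cancel₀ _ hsl.ne', mul_comm (b C),
        ← normalCDF_add 0 _ (a C * Real.logb q N - c)]
      congr 1 <;> ring
    simp only [e2] at h1
    rw [e1]
    refine h1.trans ?_
    have e3 : √(Real.logb q N) = √(Real.log N) / √(Real.log q) := by
      rw [← Real.sqrt_div hlN.le]; rfl
    rw [e3, div_div_eq_mul_div]
    gcongr
    linarith

/-- Replacing `α log_q N` by the mean shifts the rescaled value by `O(log^(-1/2) N)`, and the normal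
distribution functions are Lipschitz continuous. -/
theorem exists_cdf_centred_bound (hq : 2 ≤ q) (hd : 1 ≤ d) {a b : Finset S → ℝ} {H H₂ : S → ℝ}
    (hb : ∀ C ∈ T.finalComponents, 0 < b C)
    (hH : ∀ s, 𝔼 ε, T.out s ε = T.harmonicExt a s + H s - 𝔼 ε, H (T.next s ε))
    (hH₂ : ∀ s, 𝔼 ε, T.centredOut (T.harmonicExt a) H s ε ^ 2 =
      T.harmonicExt b s + H₂ s - 𝔼 ε, H₂ (T.next s ε)) {α M : ℝ}
    (ha : ∀ C ∈ T.finalComponents, a C = α) (hM : ∀ N, |T.mean N - α * Real.logb q N| ≤ M) :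
    ∃ K : ℝ, ∀ N : ℕ, 2 ≤ N → ∀ x : ℝ,
      |(unifBox d N).real {n | (T.value n - T.mean N) / √(Real.logb q N) ≤ x} -
        ∑ C ∈ T.finalComponents, T.absorption C T.init * normalCDF 0 (b C) x| ≤
          K / √(Real.log N) := by
  obtain ⟨K, hK, h⟩ := exists_cdf_shifted_bound hq hd hb hH hH₂
  have hq1 : (1 : ℝ) < q := by exact_mod_cast (by omega : 1 < q)
  have hlq : 0 < Real.log q := Real.log_pos hq1
  refine ⟨K + ∑ C ∈ T.finalComponents, T.absorption C T.init * ((√(b C))⁻¹ * (M * √(Real.log q))),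
    fun N hN x => ?_⟩
  have hN1 : (1 : ℝ) < N := by exact_mod_cast (by omega : 1 < N)
  have hlN : 0 < Real.log N := Real.log_pos hN1
  have hsN : 0 < √(Real.log N) := Real.sqrt_pos.2 hlN
  have hsl : 0 < √(Real.logb q N) := Real.sqrt_pos.2 (Real.logb_pos hq1 hN1)
  have e3 : √(Real.logb q N) = √(Real.log N) / √(Real.log q) := by
    rw [← Real.sqrt_div hlN.le]; rfl
  rw [add_div, Finset.sum_div]
  refine (abs_sub_le _ _ _).trans (add_le_add (h N hN x (T.mean N)) ?_)
  rw [← Finset.sum_sub_distrib]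
  refine (Finset.abs_sum_le_sum_abs _ _).trans (Finset.sum_le_sum fun C hC => ?_)
  have h0 := absorption_nonneg (mem_finalComponents.1 hC) T.init
  rw [← mul_sub, abs_mul, abs_of_nonneg h0, mul_div_assoc]
  refine mul_le_mul_of_nonneg_left ?_ h0
  set z := (a C * Real.logb q N - T.mean N) / √(Real.logb q N) with hz
  have e4 : normalCDF z (b C) x = normalCDF 0 (b C) (x - z) := by
    rw [← normalCDF_add 0 (b C) z]
    simp
  have hz' : |z| ≤ M * √(Real.log q) / √(Real.log N) := by
    rw [hz, abs_div, abs_of_pos hsl, ha C hC, abs_sub_comm, e3, div_div_eq_mul_div]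
    gcongr
    exact hM N
  rw [e4, mul_div_assoc]
  refine (abs_normalCDF_sub_le 0 (hb C hC) _ _).trans ?_
  gcongr
  simpa using hz'

/-- Two opposite unit vectors with positive weights cancel in part, which makes the triangle
inequality strict. -/
theorem norm_sum_mul_lt_one {ι : Type*} {J : Finset ι} {lam : ι → ℝ} {u : ι → ℂ}
    (hl : ∀ j ∈ J, 0 < lam j) (h1 : ∑ j ∈ J, lam j = 1) (hu : ∀ j, ‖u j‖ = 1) {i j : ι} (hi : i ∈ J)
    (hj : j ∈ J) (hne : i ≠ j) (huij : u j = -u i) : ‖∑ j ∈ J, (lam j : ℂ) * u j‖ < 1 := by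
  classical
  have hj' : j ∈ J.erase i := Finset.mem_erase.2 ⟨hne.symm, hj⟩
  have hrest : ‖∑ k ∈ (J.erase i).erase j, (lam k : ℂ) * u k‖ ≤
      ∑ k ∈ (J.erase i).erase j, lam k := by
    refine (norm_sum_le _ _).trans (Finset.sum_le_sum fun k hk => ?_)
    rw [norm_mul, hu, mul_one, Complex.norm_real,
      Real.norm_of_nonneg (hl k (Finset.mem_of_mem_erase (Finset.mem_of_mem_erase hk))).le]
  rw [← Finset.add_sum_erase _ _ hi, ← Finset.add_sum_erase _ _ hj'] at h1 ⊢
  have h2 : ‖(lam i : ℂ) * u i + (lam j : ℂ) * u j‖ = |lam i - lam j| := by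
    rw [huij, mul_neg, ← sub_eq_add_neg, ← sub_mul, norm_mul, hu, mul_one, ← Complex.ofReal_sub,
      Complex.norm_real, Real.norm_eq_abs]
  rw [← add_assoc]
  refine (norm_add_le _ _).trans_lt ?_
  rw [h2]
  have h3 : |lam i - lam j| < lam i + lam j := by
    have := hl i hi
    have := hl j hj
    rw [abs_lt]
    constructor <;> linarith
  linarith

/-- The variance bounds the characteristic function from below. -/
theorem one_sub_le_norm_charFun {N : ℕ} (hN : 0 < N) (t : ℝ) : 1 - t ^ 2 / 2 * T.var N ≤
    ‖((N : ℂ) ^ d)⁻¹ * ∑ n ∈ box d N, Complex.exp (t * T.valueFrom T.init n * Complex.I)‖ := by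
  have hN0 : (0 : ℝ) < (N : ℝ) ^ d := by positivity
  set E := Complex.exp (t * (-T.mean N : ℝ) * Complex.I) with hE
  have e1 : ((E * (((N : ℂ) ^ d)⁻¹ *
      ∑ n ∈ box d N, Complex.exp (t * T.valueFrom T.init n * Complex.I))).re) =
      ((N : ℝ) ^ d)⁻¹ * ∑ n ∈ box d N, Real.cos (t * (T.valueFrom T.init n - T.mean N)) := by
    rw [mul_left_comm, Finset.mul_sum, ← Complex.ofReal_natCast, ← Complex.ofReal_pow,
      ← Complex.ofReal_inv, Complex.re_ofReal_mul, Complex.re_sum]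
    congr 1
    refine Finset.sum_congr rfl fun n _ => ?_
    rw [hE, ← Complex.exp_add, ← Complex.exp_ofReal_mul_I_re]
    congr 2
    push_cast
    ring
  calc 1 - t ^ 2 / 2 * T.var N = ((N : ℝ) ^ d)⁻¹ *
        ∑ n ∈ box d N, (1 - (t * (T.valueFrom T.init n - T.mean N)) ^ 2 / 2) := by
        rw [var_eq, Finset.sum_sub_distrib, Finset.sum_const, card_box, mul_sub, nsmul_eq_mul]
        push_cast
        rw [mul_one, inv_mul_cancel₀ hN0.ne', Finset.mul_sum, Finset.mul_sum, Finset.mul_sum]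
        congr 1
        refine Finset.sum_congr rfl fun n _ => ?_
        ring
    _ ≤ ((N : ℝ) ^ d)⁻¹ * ∑ n ∈ box d N, Real.cos (t * (T.valueFrom T.init n - T.mean N)) := by
        gcongr
        exact Real.one_sub_sq_div_two_le_cos
    _ ≤ _ := by
        rw [← e1]
        refine (Complex.re_le_norm _).trans ?_
        rw [norm_mul, hE, norm_exp_mul_mul_I, one_mul]

/-- With different drifts, the variance is of order `log ^ 2`. -/
theorem isTheta_var (hq : 2 ≤ q) (hd : 1 ≤ d) {a b : Finset S → ℝ} {H H₂ : S → ℝ}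
    (hpos : ∀ C ∈ T.finalComponents, 0 < T.absorption C T.init)
    (hb : ∀ C ∈ T.finalComponents, 0 ≤ b C)
    (hH : ∀ s, 𝔼 ε, T.out s ε = T.harmonicExt a s + H s - 𝔼 ε, H (T.next s ε))
    (hH₂ : ∀ s, 𝔼 ε, T.centredOut (T.harmonicExt a) H s ε ^ 2 =
      T.harmonicExt b s + H₂ s - 𝔼 ε, H₂ (T.next s ε)) {C C' : Finset S}
    (hC : C ∈ T.finalComponents) (hC' : C' ∈ T.finalComponents) (hne : a C ≠ a C') :
    (fun N : ℕ => T.var N) =Θ[atTop] fun N : ℕ => Real.log N ^ 2 := by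
  have hlog : Tendsto (fun N : ℕ => Real.log N) atTop atTop :=
    Real.tendsto_log_atTop.comp tendsto_natCast_atTop_atTop
  have hO := T.outBound_nonneg
  constructor
  · refine Asymptotics.IsBigO.of_bound ((8 * T.outBound) ^ 2) ?_
    filter_upwards [hlog.eventually_ge_atTop 1, eventually_gt_atTop 0] with N h1 hN
    have hN0 : (0 : ℝ) < (N : ℝ) ^ d := by positivity
    have h0 : 0 ≤ T.var N := variance_nonneg _ _
    rw [Real.norm_of_nonneg h0, Real.norm_of_nonneg (sq_nonneg _)]
    rw [var_eq_sub hN 0]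
    have h2 : ∑ n ∈ box d N, (T.valueFrom T.init n - 0) ^ 2 ≤
        ∑ n ∈ box d N, (8 * T.outBound * Real.log N) ^ 2 := by
      refine Finset.sum_le_sum fun n hn => sq_le_sq' ?_ ?_ <;>
      · obtain ⟨m, rfl⟩ : ∃ m, N = m + 1 := ⟨N - 1, by omega⟩
        have h3 := abs_le.1 (abs_valueFrom_le_log (T := T) hq T.init hn)
        push_cast at h1 ⊢
        have h4 : 4 * T.outBound * (1 + Real.log (m + 1)) ≤ 8 * T.outBound * Real.log (m + 1) := by
          nlinarith
        linarith [h3.1, h3.2]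
    rw [Finset.sum_const, card_box, nsmul_eq_mul] at h2
    push_cast at h2
    calc _ ≤ ((N : ℝ) ^ d)⁻¹ * ∑ n ∈ box d N, (T.valueFrom T.init n - 0) ^ 2 :=
          sub_le_self _ (sq_nonneg _)
      _ ≤ ((N : ℝ) ^ d)⁻¹ * ((N : ℝ) ^ d * (8 * T.outBound * Real.log N) ^ 2) := by gcongr
      _ = _ := by rw [inv_mul_cancel_left₀ hN0.ne']; ring
  -- At the frequency `θ / log_q N` the phases of the two components with different drifts are
  -- opposite, while the Gaussian factors tend to `1`. So the characteristic function stays away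
  -- from modulus `1`, and `one_sub_le_norm_charFun` bounds the variance from below.
  · set θ := Real.pi / (a C' - a C) with hθ
    have hne' : a C' - a C ≠ 0 := sub_ne_zero.2 hne.symm
    have hθ0 : θ ≠ 0 := div_ne_zero Real.pi_ne_zero hne'
    set l : ℕ → ℝ := fun N => Real.logb q N with hl
    have hlt : Tendsto l atTop atTop := tendsto_logb_natCast hq
    have hsl : Tendsto (fun N => √(l N)) atTop atTop := Real.tendsto_sqrt_atTop.comp hlt
    obtain ⟨B, hB⟩ := exists_charFun_value_bound hq hd hb hH hH₂ (Θ := |θ|) (abs_nonneg _)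
    set z := ∑ C ∈ T.finalComponents, (T.absorption C T.init : ℂ) *
      Complex.exp (θ * a C * Complex.I) with hz
    have hz1 : ‖z‖ < 1 := by
      refine norm_sum_mul_lt_one hpos (T.sum_absorption T.init)
        (fun C => norm_exp_mul_mul_I θ (a C)) hC hC' (fun h => hne (by rw [h])) ?_
      have e : (θ : ℂ) * a C' * Complex.I = θ * a C * Complex.I + Real.pi * Complex.I := by
        have : θ * a C' = θ * a C + Real.pi := by
          rw [hθ]; field_simp; ring
        have : (θ : ℂ) * a C' = θ * a C + Real.pi := by exact_mod_cast this
        rw [this]; ring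
      rw [e, Complex.exp_add, Complex.exp_pi_mul_I]
      ring
    have hmain : Tendsto (fun N => ‖∑ C ∈ T.finalComponents, (T.absorption C T.init : ℂ) *
        (Complex.exp (θ * a C * Complex.I) * Complex.exp (-(b C * θ ^ 2 / 2 * (l N)⁻¹ : ℝ)))‖ +
          B / √(l N)) atTop (𝓝 ‖z‖) := by
      have h1 : Tendsto (fun N => ∑ C ∈ T.finalComponents, (T.absorption C T.init : ℂ) *
          (Complex.exp (θ * a C * Complex.I) * Complex.exp (-(b C * θ ^ 2 / 2 * (l N)⁻¹ : ℝ))))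
          atTop (𝓝 z) := by
        refine tendsto_finsetSum _ fun C _ => Tendsto.const_mul _ ?_
        have c2 : Continuous fun x : ℝ => Complex.exp (θ * a C * Complex.I) *
          Complex.exp (-(b C * θ ^ 2 / 2 * x : ℝ)) := by fun_prop
        have h := (c2.tendsto 0).comp hlt.inv_tendsto_atTop
        simp only [mul_zero, Complex.ofReal_zero, neg_zero, Complex.exp_zero, mul_one] at h
        exact h
      simpa using h1.norm.add ((tendsto_const_nhds (x := B)).div_atTop hsl)
    have hsmall := hmain.eventually_le_const (u := (1 + ‖z‖) / 2) (by linarith)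
    have hlq : 0 < Real.log q := Real.log_pos (by exact_mod_cast (by omega : 1 < q))
    refine Asymptotics.IsBigO.of_bound ((Real.log q) ^ 2 * (θ ^ 2 / (1 - ‖z‖))) ?_
    filter_upwards [hsmall, eventually_ge_atTop q, hlt.eventually_ge_atTop 1] with N h1 hN hl1
    have hl0 : 0 < l N := by linarith
    have hsl1 : 1 ≤ √(l N) := Real.one_le_sqrt.2 hl1
    have h2 := hB N hN (θ / l N) (by
      rw [abs_div, abs_of_pos hl0]
      gcongr
      exact Real.sqrt_le_left (by linarith) |>.2 (by nlinarith))
    have h3 := one_sub_le_norm_charFun (T := T) (N := N) (by omega) (θ / l N)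
    have e2 : ∑ C ∈ T.finalComponents, (T.absorption C T.init : ℂ) *
        (Complex.exp ((θ / l N : ℝ) * (a C * Real.logb q N : ℝ) * Complex.I) *
          Complex.exp (-(b C * Real.logb q N * (θ / l N) ^ 2 / 2 : ℝ))) =
        ∑ C ∈ T.finalComponents, (T.absorption C T.init : ℂ) *
        (Complex.exp (θ * a C * Complex.I) * Complex.exp (-(b C * θ ^ 2 / 2 * (l N)⁻¹ : ℝ))) := by
      refine Finset.sum_congr rfl fun C _ => ?_
      have f1 : θ / l N * (a C * Real.logb q N) = θ * a C := by
        change θ / l N * (a C * l N) = _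
        field_simp
      have f2 : b C * Real.logb q N * (θ / l N) ^ 2 / 2 = b C * θ ^ 2 / 2 * (l N)⁻¹ := by
        change b C * l N * _ / 2 = _
        field_simp
      rw [← Complex.ofReal_mul, f1, f2, Complex.ofReal_mul]
    rw [e2] at h2
    have h4 := norm_le_norm_add_norm_sub' (((N : ℂ) ^ d)⁻¹ * ∑ n ∈ box d N,
      Complex.exp ((θ / l N : ℝ) * T.valueFrom T.init n * Complex.I))
      (∑ C ∈ T.finalComponents, (T.absorption C T.init : ℂ) *
        (Complex.exp (θ * a C * Complex.I) * Complex.exp (-(b C * θ ^ 2 / 2 * (l N)⁻¹ : ℝ))))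
    have h5 : (1 - ‖z‖) / 2 ≤ (θ / l N) ^ 2 / 2 * T.var N := by
      have : B / √(Real.logb q N) = B / √(l N) := rfl
      linarith
    have h0 : 0 ≤ T.var N := variance_nonneg _ _
    rw [Real.norm_of_nonneg h0, Real.norm_of_nonneg (sq_nonneg _)]
    have e3 : Real.log N = Real.log q * l N := by
      simp only [hl, Real.logb]
      field_simp
    rw [e3, mul_pow, mul_assoc]
    gcongr
    rw [div_mul_eq_mul_div, le_div_iff₀ (by linarith)]
    rw [div_pow] at h5
    have h6 : l N ^ 2 * (1 - ‖z‖) ≤ l N ^ 2 * (θ ^ 2 / l N ^ 2 * T.var N) := by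
      gcongr
      linarith
    refine h6.trans_eq ?_
    field_simp

end Transducer

end

/-! ### The main theorem -/

theorem theorem1 {q d : ℕ} [NeZero q] {S : Type*} [Fintype S] [DecidableEq S]
    (hq : 2 ≤ q) (hd : 1 ≤ d) (T : Transducer q d S) (hT : T.Accessible) :
    ∃ (μ : Finset S → ℝ → ℂ) (w : S → ℂ) (a b lam : Finset S → ℝ) (e v : ℝ) (Ψ₁ : ℝ → ℝ),
      -- the constants
      (∀ C ∈ T.finalComponents, T.IsEigenvalueBranch C (μ C)) ∧
      T.IsInitProjection w ∧
      (∀ C ∈ T.finalComponents,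
        (a C : ℂ) = -Complex.I * ((q : ℂ) ^ d)⁻¹ * deriv (μ C) 0 ∧
        (b C : ℂ) =
          ((deriv (μ C) 0) ^ 2 - (q : ℂ) ^ d * iteratedDeriv 2 (μ C) 0) / (q : ℂ) ^ (2 * d) ∧
        (lam C : ℂ) = ∑ s ∈ C, w s ∧
        0 ≤ b C ∧ 0 < lam C) ∧
      ∑ C ∈ T.finalComponents, lam C = 1 ∧
      e = ∑ C ∈ T.finalComponents, lam C * a C ∧
      v = ∑ C ∈ T.finalComponents, lam C * b C ∧
      (∃ ξ, T.IsErrorExponent ξ) ∧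
      -- the expected value
      Function.Periodic Ψ₁ (T.finalPeriod : ℝ) ∧
      (∀ α : NNReal, 0 < α → α < 1 → ∃ K : NNReal, HolderWith K α Ψ₁) ∧
      (∀ ξ, T.IsErrorExponent ξ →
        (fun N : ℕ => T.mean N - (e * Real.logb q N + Ψ₁ (Real.logb q N)))
          =O[atTop] fun N : ℕ => (N : ℝ) ^ (-ξ) * Real.log N) ∧
      -- approximation of the distribution function
      ((∀ C ∈ T.finalComponents, 0 < b C) →
        ∃ K : ℝ, ∀ N : ℕ, 2 ≤ N → ∀ x : ℝ,
          |(unifBox d N).real {n | T.value n / √(Real.logb q N) ≤ x} -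
            ∑ C ∈ T.finalComponents, lam C * normalCDF (a C * √(Real.logb q N)) (b C) x|
            ≤ K / √(Real.log N)) ∧
      -- all `a C` equal: variance and limiting distribution
      ((∀ C ∈ T.finalComponents, ∀ C' ∈ T.finalComponents, a C = a C') →
        (∃ Ψ₂ : ℝ → ℝ, Continuous Ψ₂ ∧ Function.Periodic Ψ₂ (T.finalPeriod : ℝ) ∧
          ∀ ξ, T.IsErrorExponent ξ →
            (fun N : ℕ => T.var N -
              (v * Real.logb q N - Ψ₁ (Real.logb q N) ^ 2 + Ψ₂ (Real.logb q N)))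
              =O[atTop] fun N : ℕ => (N : ℝ) ^ (-ξ) * Real.log N ^ 2) ∧
        ConvergesInDistribution (d := d)
          (fun N n => (T.value n - T.mean N) / √(Real.logb q N))
          (centredMixture T.finalComponents lam b) ∧
        ((∀ C ∈ T.finalComponents, 0 < b C) →
          ∃ K : ℝ, ∀ N : ℕ, 2 ≤ N → ∀ x : ℝ,
            |(unifBox d N).real {n | (T.value n - T.mean N) / √(Real.logb q N) ≤ x} -
              ∑ C ∈ T.finalComponents, lam C * normalCDF 0 (b C) x|
              ≤ K / √(Real.log N)) ∧
        (T.finalComponents.card = 1 → v ≠ 0 →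
          ConvergesInDistribution (d := d)
            (fun N n => (T.value n - T.mean N) / √(T.var N)) (gaussianReal 0 1))) ∧
      -- not all `a C` equal: variance
      ((¬ ∀ C ∈ T.finalComponents, ∀ C' ∈ T.finalComponents, a C = a C') →
        (fun N : ℕ => T.var N) =Θ[atTop] fun N : ℕ => Real.log N ^ 2) := by
  classical
  -- The first Poisson equation produces the drifts, the second, for the mean square of the centred
  -- output, the variances; both correctors are used throughout.
  obtain ⟨a, H, hH⟩ := T.exists_poisson fun s => Finset.univ.expect fun ε => T.out s ε
  obtain ⟨b, H₂, hH₂⟩ := T.exists_poisson fun s =>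
    Finset.univ.expect fun ε => T.centredOut (T.harmonicExt a) H s ε ^ 2
  have hb : ∀ C ∈ T.finalComponents, 0 ≤ b C := fun C hC =>
    (Transducer.mem_finalComponents.1 hC).nonneg_of_poisson hH₂
  have hpos : ∀ C ∈ T.finalComponents, 0 < T.absorption C T.init := fun C hC => by
    obtain ⟨s, hs⟩ := (Transducer.mem_finalComponents.1 hC).nonempty
    exact Transducer.absorption_pos_of_reach (Transducer.mem_finalComponents.1 hC) (hT s) hs
  have hμ : ∀ C ∈ T.finalComponents, ∃ μ : ℝ → ℂ, T.IsEigenvalueBranch C μ ∧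
      (a C : ℂ) = -Complex.I * ((q : ℂ) ^ d)⁻¹ * deriv μ 0 ∧
      (b C : ℂ) = ((deriv μ 0) ^ 2 - (q : ℂ) ^ d * iteratedDeriv 2 μ 0) / (q : ℂ) ^ (2 * d) :=
    fun C hC => (Transducer.mem_finalComponents.1 hC).exists_eigenvalueBranch hH hH₂
  choose! μ hμ using hμ
  obtain ⟨w, hw, hlam⟩ := T.exists_isInitProjection
  obtain ⟨ξ₀, hξ₀⟩ := T.exists_isErrorExponent hq
  obtain ⟨Ψ₁, hper, hhol, hmean⟩ :=
    Transducer.exists_mean_asymptotics hq hd (T.harmonicExt_harmonic a) hH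
  have hcont : Continuous Ψ₁ := by
    obtain ⟨K, hK⟩ := hhol (1 / 2) (by norm_num) (by
      rw [← NNReal.coe_lt_coe]; norm_num)
    exact hK.continuous (by norm_num)
  have hp0 : (T.finalPeriod : ℝ) ≠ 0 := by exact_mod_cast T.finalPeriod_pos.ne'
  have he : T.harmonicExt a T.init = ∑ C ∈ T.finalComponents, T.absorption C T.init * a C :=
    Finset.sum_congr rfl fun C _ => mul_comm _ _
  have hv : T.harmonicExt b T.init = ∑ C ∈ T.finalComponents, T.absorption C T.init * b C :=
    Finset.sum_congr rfl fun C _ => mul_comm _ _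
  refine ⟨μ, w, a, b, fun C => T.absorption C T.init, T.harmonicExt a T.init,
    T.harmonicExt b T.init, Ψ₁, fun C hC => (hμ C hC).1, hw, fun C hC =>
    ⟨(hμ C hC).2.1, (hμ C hC).2.2, hlam C hC, hb C hC, hpos C hC⟩, T.sum_absorption T.init, he, hv,
    ⟨ξ₀, hξ₀⟩, hper, hhol, hmean, fun hb' => ?_, fun ha => ?_, fun hne => ?_⟩
  · obtain ⟨K, -, hK⟩ := Transducer.exists_cdf_shifted_bound hq hd hb' hH hH₂
    refine ⟨K, fun N hN x => ?_⟩
    have h := hK N hN x 0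
    have e : ∀ C, a C * Real.logb q N / √(Real.logb q N) = a C * √(Real.logb q N) := fun C => by
      rw [mul_div_assoc, Real.div_sqrt]
    simpa only [sub_zero, e] using h
  · obtain ⟨α, hα⟩ : ∃ α, ∀ C ∈ T.finalComponents, a C = α := by
      -- With no final component any common value would do; disposing of this case formally avoids
      -- an appeal to existence.
      rcases T.finalComponents.eq_empty_or_nonempty with h0 | ⟨C₀, hC₀⟩
      · exact ⟨0, by simp [h0]⟩
      · exact ⟨a C₀, fun C hC => ha C hC C₀ hC₀⟩
    have hext : T.harmonicExt a = fun _ => α :=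
      funext fun s => Transducer.harmonicExt_of_const hα s
    obtain ⟨Ψ₂, hc₂, hp₂, hvar⟩ := Transducer.exists_var_asymptotics hq hd (a := α) (H := H)
      (w := T.harmonicExt b) (H₂ := H₂) (fun s => by rw [hH s, hext]) (T.harmonicExt_harmonic b)
      (fun s => by rw [← hext, hH₂ s]) hcont hper (fun ξ hξ => by
        have := hmean ξ hξ
        rwa [hext] at this)
    obtain ⟨M, -, hM⟩ := Transducer.exists_bound_of_isBigO_one
      (Transducer.isBigO_one_of_periodic (f := T.mean) (g := fun N => α * Real.logb q N) (β := 1)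
        hcont hp0 hper hξ₀.1 (by
          have := hmean ξ₀ hξ₀
          rw [hext] at this
          simpa using this))
    refine ⟨⟨Ψ₂, hc₂, hp₂, hvar⟩, ?_, fun hb' =>
      Transducer.exists_cdf_centred_bound hq hd hb' hH hH₂ hα hM, fun hcard hv0 => ?_⟩
    · have := Transducer.isProbabilityMeasure_centredMixture
        (b := b) T.finalComponents (fun C hC => (hpos C hC).le) (T.sum_absorption T.init)
      refine Transducer.convergesInDistribution_of_tendsto_charFun fun t => ?_
      rw [Transducer.charFun_centredMixture _ (fun C hC => (hpos C hC).le) hb]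
      have := Transducer.tendsto_charFun_centred hq hd hb hH hH₂ hα hM (ρ := 1)
        (r := fun N => √(Real.logb q N)) one_pos ?_ t
      · simpa only [div_one] using this
      · refine tendsto_const_nhds.congr' ?_
        filter_upwards [(Transducer.tendsto_logb_natCast hq).eventually_gt_atTop 0] with N hN
        exact (div_self (Real.sqrt_pos.2 hN).ne').symm
    · obtain ⟨C₀, hC₀⟩ := Finset.card_eq_one.1 hcard
      have hmem : C₀ ∈ T.finalComponents := by rw [hC₀]; exact Finset.mem_singleton_self _
      have h1 : T.absorption C₀ T.init = 1 := by
        have := T.sum_absorption T.init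
        rwa [hC₀, Finset.sum_singleton] at this
      have hvb : T.harmonicExt b T.init = b C₀ := by
        rw [hv, hC₀, Finset.sum_singleton, h1, one_mul]
      rw [hvb] at hv0
      have hbpos : 0 < b C₀ := lt_of_le_of_ne (hb C₀ hmem) hv0.symm
      refine Transducer.convergesInDistribution_of_tendsto_charFun fun t => ?_
      -- The variance is `b C₀ log_q N` up to a bounded term, so norming by its root instead of
      -- `√(log_q N)` rescales the limit to variance `1`.
      have hr : Filter.Tendsto (fun N : ℕ => √(T.var N) / √(Real.logb q N)) Filter.atTop
          (nhds √(b C₀)) := by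
        refine Transducer.tendsto_sqrt_div_sqrt (Transducer.tendsto_logb_natCast hq)
          (Transducer.isBigO_one_of_periodic (q := q) (Ψ := fun x => Ψ₂ x - Ψ₁ x ^ 2) (β := 2)
            (by fun_prop) hp0 (fun x => by simp only [hp₂ x, hper x]) hξ₀.1 ?_)
        refine (hvar ξ₀ hξ₀).congr_left fun N => ?_
        rw [hvb]
        ring
      have := Transducer.tendsto_charFun_centred hq hd hb hH hH₂ hα hM (Real.sqrt_pos.2 hbpos) hr t
      have e : (t / √(b C₀)) ^ 2 = t ^ 2 / b C₀ := by rw [div_pow, Real.sq_sqrt hbpos.le]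
      rw [hC₀, Finset.sum_singleton, h1, e, mul_div_cancel₀ _ hbpos.ne'] at this
      rw [charFun_gaussianReal]
      convert this using 2
      simp
  · push Not at hne
    obtain ⟨C, hC, C', hC', h⟩ := hne
    exact Transducer.isTheta_var hq hd hpos hb hH hH₂ hC hC' h
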